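/- **Conventions.** Let $\mathbb H=\{z:\operatorname{Im}z>0\}$. For a meromorphic $Q$ on a domain $D$ and $\theta\in[0,\pi)$, a *$\theta$-trajectory arc* of $Q(z)dz^2$ is a curve $\sigma:(a,b)\to D$ avoiding zeros and poles of $Q$ with $\arg[Q(\sigma(t))\dot\sigma(t)^2]=2\theta$ for all $t$. A *Kühnau quadratic differential* on $\mathbb H$ is $Q(z)dz^2$ with $Q$ meromorphic on $\mathbb H$, such that for some finite set $S\subset\mathbb R$ the function $Q$ extends continuously to $\mathbb R\setminus S$, each component of $\mathbb R\setminus S$ is a $\theta$-trajectory arc for some $\theta\in[0,\pi)$, and $Q$ has no essential singularity at the points of $S\cup\{\infty\}$, i.e. in $\mathbb H$ we have $Q(z)=O(|z-s|^{-m})$ as $z\to s\in S$ and $Q(z)=O(|z|^m)$ as $z\to\infty$, for some $m$. *Boundary degree.* Let $f$ map $\mathbb H$ conformally onto $D$, and let $f(c)$, $c\in\mathbb R$, denote the prime end of $D$ corresponding to $c$. Suppose that the boundary arcs of $D$ corresponding to small intervals $(c-\varepsilon,c)$ and $(c,c+\varepsilon)$ are a $\theta_1$- and a $\theta_2$-trajectory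 arc of $Q$ ($Q$ being extended continuously from $D$ to these arcs; $\theta_1,\theta_2\in[0,\pi)$), and that the number $J$ of $\theta_2$-trajectories of $Q$ inside $D$ that end at the prime end $f(c)$ is finite (a trajectory both of whose ends tend to it is counted twice). Then $$\deg_{D,Q}(f(c))=\begin{cases}2J&\text{if }\theta_1=\theta_2,\\ 2\left[\Theta/\pi+J-1\right]&\text{if }\theta_1\ne\theta_2,\end{cases}$$ where $\Theta\in(0,\pi)$ is congruent to $\theta_1-\theta_2$ modulo $\pi$. For $D=\mathbb H$ take $f(z)=z$. **Statement.** Let $Q(z)dz^2$ be a Kühnau quadratic differential on $\mathbb H$ and let $\xi_0\in\mathbb R$ satisfy $\deg_{\mathbb H,Q}(\xi_0)=N\in\{0,1,2,\dots\}$. Then one can write $$Q(w)=R\,(w-\xi_0)^N\prod_{j=1}^n(w-a_j)^{\alpha_j}\qquad(w\in\mathbb H)\tag{1}$$ with $R\neq0$, pairwise distinct $a_j\in\mathbb C\setminus\{\xi_0\}$ and $\alpha_j\in\mathbb R\setminus\{0\}$. Fix any such representation. Let $\phi\in[0,\pi)$, $T>0$, and let $\gamma:[0,T]\to\overline{\mathbb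 H}$ be a simple curve with $\gamma(0)=\xi_0$, such that $\gamma(0,T)\subset\mathbb H$ is a $\phi$-trajectory arc of $Q(w)dw^2$ and $\zeta=\gamma(T)\in\mathbb H$ is an ordinary point of $Q(w)dw^2$ (neither zero nor pole). Let $f$ map $\mathbb H$ conformally onto $\mathbb H\setminus\gamma(0,T]$ with $f(z)\to\infty$ as $z\to\infty$. Extend $f$ to $\mathbb R$ by its boundary values and to the lower half-plane by $f(\bar z)=\overline{f(z)}$. Then $\xi_0$ has exactly two preimages $c^-<c^+$ under $f$, both real; $\zeta$ has exactly one preimage $\xi$, which is real; each $a_j$ has exactly one preimage $A_j\in\mathbb C$; the degrees $$\mu^\pm=\deg_{\mathbb H\setminus\gamma(0,T],\,Q}(f(c^\pm))$$ are defined; and for some constant $R'\neq0$, $$Q(f(z))f'(z)^2=R'(z-\xi)^2(z-c^-)^{\mu^-}(z-c^+)^{\mu^+}\prod_{j=1}^n(z-A_j)^{\alpha_j}\qquad(z\in\mathbb H).$$ (Powers are principal branches; at poles the two sides of either identity are both understood as $\infty$.) -/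

import Mathlib

open Filter Topology Set

/-- The open upper half-plane, as a subset of `ℂ`. -/
abbrev upperHalf : Set ℂ := {z : ℂ | 0 < z.im}

/-- `z ∈ ℂ` has argument `2θ`; in particular `z ≠ 0`. -/
def HasArgTwice (θ : ℝ) (z : ℂ) : Prop :=
  ∃ r : ℝ, 0 < r ∧ z = (r : ℂ) * Complex.exp (2 * (θ : ℂ) * Complex.I)

/-- The curve `σ : (a, b) → D` is a `θ`-trajectory arc of `Q(z)dz²`:
`arg [Q(σ(t)) σ'(t)²] = 2θ` for all `t ∈ (a, b)`.
(With the convention that `Q` has the value `0` at its poles, such an arc meets neither zeros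
nor poles of `Q`.) -/
def IsTrajectoryArc (D : Set ℂ) (Q : ℂ → ℂ) (θ : ℝ) (σ : ℝ → ℂ) (a b : ℝ) : Prop :=
  ∀ t ∈ Ioo a b, σ t ∈ D ∧ ∃ v : ℂ, HasDerivAt σ v t ∧ HasArgTwice θ (Q (σ t) * v ^ 2)

/-- Let `f` map the upper half-plane conformally onto `D`, let `Q(w)dw²` be a quadratic
differential on `D`, and let `I ⊆ ℝ` be open. The set of prime ends of `D` that correspond
to `I` is a `θ`-trajectory arc in the boundary of `D`:
`f` has boundary values `Γ(x)`, `x ∈ I`, the function `Q`, approached from the side of `D` in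
question, has boundary values `q(x)`, and `arg [q(x) Γ'(x)²] = 2θ` for all `x ∈ I`.
For `D` the upper half-plane take `f = id`, so that `Γ(x) = x`. -/
def IsBoundaryArc (Q f : ℂ → ℂ) (θ : ℝ) (I : Set ℝ) : Prop :=
  ∃ (Γ : ℝ → ℂ) (q : ℝ → ℂ), ∀ x ∈ I,
    Tendsto f (𝓝[upperHalf] (x : ℂ)) (𝓝 (Γ x)) ∧
    Tendsto (fun z => Q (f z)) (𝓝[upperHalf] (x : ℂ)) (𝓝 (q x)) ∧
    ∃ v : ℂ, HasDerivAt Γ v x ∧ HasArgTwice θ (q x * v ^ 2)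

/-- Quadratic differentials `Q(z)dz²` on the upper half-plane of Kühnau's type.

* `Q` is meromorphic in the upper half-plane (as usual, with the value `0` at the poles);
* the boundary is, apart from `∞` and a finite set `S ⊆ ℝ` of corners, the union of finitely many
  open arcs to which `Q` extends continuously and on which `arg [Q(x)dx²]` is constant;
* `Q` has no essential singularity at the corners and at `∞`, that is, it grows at most like
  a power there. -/
structure IsKuhnau (Q : ℂ → ℂ) : Prop where
  meromorphic : MeromorphicNFOn Q upperHalf
  boundary : ∃ S : Finset ℝ,
    (∀ I : Set ℝ, IsOpen I → I.OrdConnected → Disjoint I (S : Set ℝ) →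
      ∃ θ ∈ Ico 0 Real.pi, IsBoundaryArc Q id θ I) ∧
    (∀ s ∈ S, ∃ m : ℕ,
      Q =O[𝓝[upperHalf] (s : ℂ)] fun z => ((z - (s : ℂ)) ^ m)⁻¹) ∧
    ∃ m : ℕ, Q =O[Bornology.cobounded ℂ ⊓ 𝓟 upperHalf] fun z => z ^ m

/-- The prime end of `D` that corresponds to `c ∈ ℝ` under the conformal map `f` of the upper
half-plane onto `D`, as the filter of its neighbourhoods in `D`. -/
noncomputable def primeEnd (f : ℂ → ℂ) (c : ℝ) : Filter ℂ :=
  map f (𝓝[upperHalf] (c : ℂ))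

/-- The `θ`-trajectories of `Q(w)dw²` inside `D = f (upperHalf)` that end at the prime end of `D`
corresponding to `c`. Each end of a trajectory is represented by the filter generated by the
final pieces `σ (0, ε)`, `ε > 0`, of a trajectory arc `σ` that tends to the prime end at time `0`;
so arcs count as one iff they agree near the prime end up to reparametrization. -/
def trajectoryEnds (Q f : ℂ → ℂ) (c θ : ℝ) : Set (Filter ℂ) :=
  {F | ∃ σ : ℝ → ℂ, IsTrajectoryArc (f '' upperHalf) Q θ σ 0 1 ∧
    Tendsto σ (𝓝[>] 0) (primeEnd f c) ∧ F = map σ (𝓝[>] 0)}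

/-- `μ` is the degree, in `D = f (upperHalf)` and with respect to `Q(w)dw²`, of the prime end of `D`
that corresponds to `c`. If the boundary arc that precedes the prime end is a `θ₁`-trajectory arc
and the one that follows it (in the positive orientation, `D` to the left) is a `θ₂`-trajectory arc,
and if `J` is the (finite) number of `θ₂`-trajectories inside `D` ending at the prime end, then
the degree is `2J` if `θ₁ = θ₂` and `2(Θ/π + J - 1)` otherwise, where `Θ ∈ (0, π)` is the
difference `θ₁ - θ₂` modulo `π`. -/
def HasBoundaryDegree (Q f : ℂ → ℂ) (c μ : ℝ) : Prop :=
  ∃ θ₁ ∈ Ico 0 Real.pi, ∃ θ₂ ∈ Ico 0 Real.pi,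
    (∃ ε > 0, IsBoundaryArc Q f θ₁ (Ioo (c - ε) c) ∧ IsBoundaryArc Q f θ₂ (Ioo c (c + ε))) ∧
    (trajectoryEnds Q f c θ₂).Finite ∧
    ((θ₁ = θ₂ ∧ μ = 2 * ((trajectoryEnds Q f c θ₂).ncard : ℝ)) ∨
     (θ₁ ≠ θ₂ ∧ μ = 2 * (Int.fract ((θ₁ - θ₂) / Real.pi) +
        ((trajectoryEnds Q f c θ₂).ncard : ℝ) - 1)))

/-- `Q(w) = R (w - ξ₀)^N ∏ (w - aⱼ)^αⱼ` in the upper half-plane, with distinct points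
`aⱼ ≠ ξ₀` of `ℂ`, nonzero real exponents `αⱼ`, and `R ≠ 0` (principal branches;
at the poles both sides have the value `0`). -/
def IsFactorization (Q : ℂ → ℂ) (ξ₀ : ℝ) (N : ℕ) (n : ℕ) (a : Fin n → ℂ) (α : Fin n → ℝ)
    (R : ℂ) : Prop :=
  Function.Injective a ∧ (∀ j, a j ≠ (ξ₀ : ℂ)) ∧ (∀ j, α j ≠ 0) ∧ R ≠ 0 ∧
  ∀ w ∈ upperHalf, Q w = R * (w - (ξ₀ : ℂ)) ^ N * ∏ j, (w - a j) ^ (α j : ℂ)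

/-- The conformal map `f` of the upper half-plane, extended to `ℝ` by its boundary values and to
the lower half-plane by reflection, takes the value `w` at `z`. -/
def IsPreimage (f : ℂ → ℂ) (z w : ℂ) : Prop :=
  (0 < z.im ∧ f z = w) ∨
  (z.im = 0 ∧ Tendsto f (𝓝[upperHalf] z) (𝓝 w)) ∨
  (z.im < 0 ∧ f (starRingEnd ℂ z) = starRingEnd ℂ w)

/-!
The identity for `Q(f(z))f'(z)²` holds because its two sides are products of powers with the same
exponents everywhere. The exponents of the left side have to be determined on the boundary, where
`Q` behaves like a constant multiple of `(z - x)^m` up to a factor that is analytic at `x` and real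
on the real axis (`HasBoundaryExponent`). Four facts carry the proof.

*A Kühnau quadratic differential is a product of powers* (`IsKuhnau.isPowerProduct`). On the arcs of
`ℝ ∖ S` the direction of the boundary values is constant. Powers with suitable exponents at the
corners cancel its jumps (`exists_boundary_pos`), and integer powers remove the poles. What remains
has real boundary values and grows at most like a power, so it is a polynomial, by reflection
(`exists_polynomial_of_boundary_real`). For any such representation, reality of the logarithmic
derivative on an interval of the axis and the independence of partial fractions show that the
exponents at conjugate points agree (`IsKuhnau.isReflectionSymmetric`); this gives the exponents at
all points of the axis.

*The degree of a prime end is the exponent there.* If the exponent `m` exceeds `-2`, there is a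
coordinate `ω`, real on the axis, in which the differential is a constant multiple of `ω^m dω²`
(`exists_normal_form`, `IsModelCoordinate`). The power `ω^((m+2)/2)` makes its trajectories straight,
so that the trajectories ending at the point are rays in the coordinate `ω`
(`IsModelCoordinate.exists_ray_of_trajectory`), and these can be counted
(`exists_trajectoryEnds_eq_image`, `HasBoundaryExponent.hasBoundaryDegree`). If `m ≤ -2`, infinitely
many trajectories end at the point, and there is no degree
(`HasBoundaryExponent.infinite_trajectoryEnds`).

*The map of a slit half-plane is explicit near each boundary point, up to a real coordinate.* If `ψ`
maps a half-disc into the image domain and its diameter to the boundary, then `f⁻¹ ∘ ψ` has real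
boundary values, extends by reflection, and is a local coordinate (`exists_isBoundaryChart`); so
`f = ψ ∘ χ` with `χ` real on the axis. For `ψ` one takes a translation at points of the axis; the
inverse of a trajectory coordinate, in which the slit is straight, at the two sides of the slit; the
same composed with `u ↦ u²` at the tip; and maps onto the two sectors between the slit and the axis
at the starting point. The exponents of `Q(f(z))f'(z)²` result: `α` at a real preimage of a point of
exponent `α`, `0` on the sides of the slit, `2` at the preimage of the tip, and numbers greater
than `-2` at the preimages of the starting point, which are the degrees `μ±`. Moreover each boundary
value is taken at the centres of its charts only, and `∞` is treated in the same way, so that no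
point of the axis is left out (`IsSlitMap.exists_boundary_correspondence`).

*A quotient with the same exponents is constant.* The quotient of the two sides extends to a
zero-free function in the upper half-plane with exponent `0` at all points of the axis. Its
logarithmic derivative is then real on the axis; since `f` has a finite nonzero derivative at `∞`
(`IsSlitMap.tendsto_deriv_infty`), it is a polynomial that tends to `0` at `∞`, and vanishes
(`IsTameUnit.eq_const`, `IsSlitMap.exists_eq_const_mul`).
-/

/-! ### Holomorphic functions near the real axis -/

/-- **Painlevé's theorem** for the real axis: a continuous function that is holomorphic off the
real axis is holomorphic. -/
theorem differentiableOn_of_continuousOn_of_differentiableOn_off_real {U : Set ℂ} (hU : IsOpen U)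
    {F : ℂ → ℂ} (hc : ContinuousOn F U) (hd : DifferentiableOn ℂ F (U \ {z | z.im = 0})) :
    DifferentiableOn ℂ F U := by
  rw [← Complex.isConservativeOn_and_continuousOn_iff_isDifferentiableOn hU]
  refine ⟨?_, hc⟩
  have key : ∀ z w : ℂ, Complex.Rectangle z w ⊆ U → (0 : ℝ) ∉ Ioo (min z.im w.im) (max z.im w.im) →
      Complex.wedgeIntegral z w F = - Complex.wedgeIntegral w z F := by
    intro z w hzw h0
    rw [← add_eq_zero_iff_eq_neg, Complex.wedgeIntegral_add_wedgeIntegral_eq]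
    apply Complex.integral_boundary_rect_eq_zero_of_continuousOn_of_differentiableOn
    · exact hc.mono hzw
    · refine hd.mono ?_
      intro x hx
      rw [Complex.mem_reProdIm] at hx
      refine ⟨hzw ?_, ?_⟩
      · rw [Complex.Rectangle, Complex.mem_reProdIm]
        exact ⟨Ioo_subset_Icc_self hx.1, Ioo_subset_Icc_self hx.2⟩
      · intro h
        have h' : x.im = 0 := h
        rw [h'] at hx
        exact h0 hx.2
  intro z w hzw
  by_cases h0 : (0 : ℝ) ∈ Ioo (min z.im w.im) (max z.im w.im)
  · have hsub1 : Complex.Rectangle z (w.re : ℂ) ⊆ Complex.Rectangle z w := by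
      intro x hx
      simp only [Complex.Rectangle, Complex.mem_reProdIm, Complex.ofReal_re, Complex.ofReal_im,
        mem_uIcc] at hx ⊢
      refine ⟨hx.1, ?_⟩
      simp only [mem_Ioo, min_lt_iff, lt_max_iff] at h0
      grind
    have hsub2 : Complex.Rectangle (z.re : ℂ) w ⊆ Complex.Rectangle z w := by
      intro x hx
      simp only [Complex.Rectangle, Complex.mem_reProdIm, Complex.ofReal_re, Complex.ofReal_im,
        mem_uIcc] at hx ⊢
      refine ⟨hx.1, ?_⟩
      simp only [mem_Ioo, min_lt_iff, lt_max_iff] at h0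
      grind
    have h1 := key z (w.re : ℂ) (hsub1.trans hzw) (by
      simp only [Complex.ofReal_im, mem_Ioo, min_lt_iff, lt_max_iff]; grind)
    have h2 := key (z.re : ℂ) w (hsub2.trans hzw) (by
      simp only [Complex.ofReal_im, mem_Ioo, min_lt_iff, lt_max_iff]; grind)
    rw [← add_eq_zero_iff_eq_neg, Complex.wedgeIntegral_add_wedgeIntegral_eq] at h1 h2 ⊢
    have hvert : ∀ a : ℝ, a ∈ uIcc z.re w.re → ∀ p ∈ uIcc z.im w.im, ∀ q ∈ uIcc z.im w.im,
        IntervalIntegrable (fun y : ℝ => F (a + y * Complex.I)) MeasureTheory.volume p q := by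
      intro a ha p hp q hq
      apply ContinuousOn.intervalIntegrable
      refine hc.comp (by fun_prop) ?_
      intro y hy
      apply hzw
      rw [Complex.Rectangle, Complex.mem_reProdIm]
      refine ⟨by simpa using ha, ?_⟩
      simpa using (uIcc_subset_uIcc hp hq) hy
    have h0' : (0 : ℝ) ∈ uIcc z.im w.im := by
      rw [uIcc]; exact Ioo_subset_Icc_self h0
    have e1 := intervalIntegral.integral_add_adjacent_intervals
      (hvert w.re right_mem_uIcc _ left_mem_uIcc _ h0')
      (hvert w.re right_mem_uIcc _ h0' _ right_mem_uIcc)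
    have e2 := intervalIntegral.integral_add_adjacent_intervals
      (hvert z.re left_mem_uIcc _ left_mem_uIcc _ h0')
      (hvert z.re left_mem_uIcc _ h0' _ right_mem_uIcc)
    rw [← e1, ← e2]
    simp only [Complex.ofReal_re, Complex.ofReal_im, smul_eq_mul] at h1 h2 ⊢
    linear_combination h1 + h2
  · exact key z w hzw h0

/-- On a domain star-shaped about `0`, the differential equation `z k' + β k = β h` has a holomorphic
solution, given by an average of `h` over the segment from `0` to `z`. For `β = 1` the function
`z k` is a primitive of `h`. -/
theorem exists_solution_euler_equation {U : Set ℂ} (hU : IsOpen U)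
    (hstar : ∀ z ∈ U, ∀ s ∈ Icc (0 : ℝ) 1, (s : ℂ) * z ∈ U) {h : ℂ → ℂ}
    (hh : DifferentiableOn ℂ h U) {β : ℝ} (hβ : 0 < β) :
    ∃ k : ℂ → ℂ, DifferentiableOn ℂ k U ∧ (∀ z ∈ U, z * deriv k z + β * k z = β * h z) ∧
      ∀ z, (∀ s ∈ Icc (0 : ℝ) 1, (h (s * z)).im = 0) → (k z).im = 0 := by
  set p : ℝ := 1 / β with hp
  have hp0 : 0 < p := by positivity
  have hpow : ∀ t ∈ Icc (0 : ℝ) 1, t ^ p ∈ Icc (0 : ℝ) 1 := fun t ht =>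
    ⟨Real.rpow_nonneg ht.1 p, Real.rpow_le_one ht.1 ht.2 hp0.le⟩
  have hpc : Continuous fun t : ℝ => t ^ p := Real.continuous_rpow_const hp0.le
  have hpc' : Continuous fun t : ℝ => ((t ^ p : ℝ) : ℂ) := Complex.continuous_ofReal.comp hpc
  have hd : ContinuousOn (deriv h) U := (hh.deriv hU).continuousOn
  have h01 : uIcc (0 : ℝ) 1 = Icc 0 1 := uIcc_of_le zero_le_one
  have cont1 : ∀ z ∈ U, ContinuousOn (fun t : ℝ => h ((t ^ p : ℝ) * z)) (Icc 0 1) := fun z hz =>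
    hh.continuousOn.comp (by fun_prop) fun t ht => hstar z hz _ (hpow t ht)
  have cont2 : ∀ z ∈ U, ContinuousOn
      (fun t : ℝ => ((t ^ p : ℝ) : ℂ) * deriv h ((t ^ p : ℝ) * z)) (Icc 0 1) := fun z hz =>
    hpc'.continuousOn.mul <| hd.comp (by fun_prop) fun t ht => hstar z hz _ (hpow t ht)
  have hder : ∀ z ∈ U, HasDerivAt (fun w => ∫ t in (0 : ℝ)..1, h ((t ^ p : ℝ) * w))
      (∫ t in (0 : ℝ)..1, ((t ^ p : ℝ) : ℂ) * deriv h ((t ^ p : ℝ) * z)) z := by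
    intro z hz
    obtain ⟨ε, hε, hball⟩ := Metric.nhds_basis_closedBall.mem_iff.1 (hU.mem_nhds hz)
    have hcomp : IsCompact (Icc (0 : ℝ) 1 ×ˢ Metric.closedBall z ε) :=
      isCompact_Icc.prod (isCompact_closedBall z ε)
    have hcont : ContinuousOn
        (fun q : ℝ × ℂ => ((q.1 ^ p : ℝ) : ℂ) * deriv h ((q.1 ^ p : ℝ) * q.2))
        (Icc (0 : ℝ) 1 ×ˢ Metric.closedBall z ε) := by
      have c1 : Continuous fun q : ℝ × ℂ => ((q.1 ^ p : ℝ) : ℂ) := hpc'.comp continuous_fst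
      refine c1.continuousOn.mul (hd.comp (c1.mul continuous_snd).continuousOn ?_)
      rintro ⟨t, w⟩ ⟨ht, hw⟩
      exact hstar w (hball hw) _ (hpow t ht)
    obtain ⟨C, hC⟩ := hcomp.exists_bound_of_continuousOn hcont
    refine (intervalIntegral.hasDerivAt_integral_of_dominated_loc_of_deriv_le
      (F' := fun w t => ((t ^ p : ℝ) : ℂ) * deriv h ((t ^ p : ℝ) * w)) (bound := fun _ => C)
      (Metric.closedBall_mem_nhds z hε) ?_ ?_ ?_ ?_ ?_ ?_).2
    · filter_upwards [hU.mem_nhds hz] with w hw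
      rw [uIoc_of_le zero_le_one]
      exact ((cont1 w hw).mono Ioc_subset_Icc_self).aestronglyMeasurable measurableSet_Ioc
    · exact ContinuousOn.intervalIntegrable (by rw [h01]; exact cont1 z hz)
    · rw [uIoc_of_le zero_le_one]
      exact ((cont2 z hz).mono Ioc_subset_Icc_self).aestronglyMeasurable measurableSet_Ioc
    · refine Eventually.of_forall fun t ht w hw => ?_
      rw [uIoc_of_le zero_le_one] at ht
      exact hC (t, w) ⟨Ioc_subset_Icc_self ht, hw⟩
    · simp
    · refine Eventually.of_forall fun t ht w hw => ?_
      rw [uIoc_of_le zero_le_one] at ht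
      have hmem := hstar w (hball hw) _ (hpow t (Ioc_subset_Icc_self ht))
      have h1 := (hh.differentiableAt (hU.mem_nhds hmem)).hasDerivAt
      have h2 : HasDerivAt (fun w : ℂ => ((t ^ p : ℝ) : ℂ) * w) ((t ^ p : ℝ) : ℂ) w := by
        simpa using (hasDerivAt_id w).const_mul ((t ^ p : ℝ) : ℂ)
      have h3 := h1.comp w h2
      rw [mul_comm] at h3
      exact h3
  refine ⟨fun w => ∫ t in (0 : ℝ)..1, h ((t ^ p : ℝ) * w),
    fun z hz => (hder z hz).differentiableAt.differentiableWithinAt, ?_, ?_⟩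
  · intro z hz
    rw [(hder z hz).deriv]
    have int1 : IntervalIntegrable (fun t : ℝ => h ((t ^ p : ℝ) * z)) MeasureTheory.volume 0 1 :=
      ContinuousOn.intervalIntegrable (by rw [h01]; exact cont1 z hz)
    have int2 : IntervalIntegrable
        (fun t : ℝ => ((t ^ p : ℝ) : ℂ) * deriv h ((t ^ p : ℝ) * z)) MeasureTheory.volume 0 1 :=
      ContinuousOn.intervalIntegrable (by rw [h01]; exact cont2 z hz)
    have ftc := intervalIntegral.integral_eq_sub_of_hasDerivAt_of_le zero_le_one
      (f := fun t : ℝ => (t : ℂ) * h ((t ^ p : ℝ) * z))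
      (f' := fun t : ℝ => h ((t ^ p : ℝ) * z) +
        (p * z) * (((t ^ p : ℝ) : ℂ) * deriv h ((t ^ p : ℝ) * z)))
      (Complex.continuous_ofReal.continuousOn.mul (cont1 z hz)) ?_
      (int1.add (int2.const_mul _))
    · rw [intervalIntegral.integral_add int1 (int2.const_mul _),
        intervalIntegral.integral_const_mul] at ftc
      simp only [Complex.ofReal_one, Real.one_rpow, one_mul, Complex.ofReal_zero, zero_mul,
        sub_zero] at ftc
      rw [← ftc, hp]
      push_cast
      have : (β : ℂ) ≠ 0 := by exact_mod_cast hβ.ne'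
      field_simp
      ring
    · intro t ht
      have hmem := hstar z hz _ (hpow t (Ioo_subset_Icc_self ht))
      have h1 := (hh.differentiableAt (hU.mem_nhds hmem)).hasDerivAt
      have h2 : HasDerivAt (fun t : ℝ => ((t ^ p : ℝ) : ℂ) * z)
          (((p * t ^ (p - 1) : ℝ) : ℂ) * z) t :=
        ((Real.hasDerivAt_rpow_const (Or.inl ht.1.ne')).ofReal_comp).mul_const z
      have h3 := (Complex.ofRealCLM.hasDerivAt (x := t)).mul (h1.comp t h2)
      refine HasDerivAt.congr_deriv h3 ?_
      have ht' : (t : ℂ) * ((t ^ (p - 1) : ℝ) : ℂ) = ((t ^ p : ℝ) : ℂ) := by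
        rw [← Complex.ofReal_mul, ← Real.rpow_one_add' ht.1.le (by simpa using hp0.ne')]
        simp
      simp only [Complex.ofRealCLM_apply, Complex.ofReal_one, one_mul, Function.comp_apply]
      rw [← ht']
      push_cast
      ring
  · intro z hz
    have : ∀ t ∈ uIcc (0 : ℝ) 1, h ((t ^ p : ℝ) * z) = (((h ((t ^ p : ℝ) * z)).re : ℝ) : ℂ) := by
      intro t ht
      rw [h01] at ht
      exact Complex.ext (by simp) (by simpa using hz _ (hpow t ht))
    show (∫ t in (0 : ℝ)..1, h ((t ^ p : ℝ) * z)).im = 0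
    rw [intervalIntegral.integral_congr this, intervalIntegral.integral_ofReal]
    simp

/-- A holomorphic function on a convex open set has a primitive. -/
theorem exists_primitive_of_convex {U : Set ℂ} (hU : IsOpen U) (hc : Convex ℝ U) {h : ℂ → ℂ}
    (hh : DifferentiableOn ℂ h U) : ∃ P : ℂ → ℂ, ∀ z ∈ U, HasDerivAt P (h z) z := by
  rcases U.eq_empty_or_nonempty with rfl | ⟨z₀, hz₀⟩
  · exact ⟨0, by simp⟩
  have hV : IsOpen ((fun z => z₀ + z) ⁻¹' U) := hU.preimage (by fun_prop)
  obtain ⟨k, hk, hk', -⟩ := exists_solution_euler_equation hV (h := fun z => h (z₀ + z)) (β := 1)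
    (fun z hz s hs => by
      have := hc hz₀ hz (sub_nonneg.2 hs.2) hs.1 (by ring)
      simp only [mem_preimage, Complex.real_smul] at this ⊢
      convert this using 1
      push_cast
      ring)
    (hh.comp (by fun_prop) fun z hz => hz) one_pos
  refine ⟨fun z => (z - z₀) * k (z - z₀), fun z hz => ?_⟩
  have hz' : z - z₀ ∈ (fun z => z₀ + z) ⁻¹' U := by simpa using hz
  have h1 : HasDerivAt k (deriv k (z - z₀)) (z - z₀) :=
    (hk.differentiableAt (hV.mem_nhds hz')).hasDerivAt
  have h2 : HasDerivAt (fun z : ℂ => z - z₀) 1 z := (hasDerivAt_id z).sub_const z₀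
  have h3 := h2.mul (h1.comp z h2)
  refine HasDerivAt.congr_deriv h3 ?_
  have := hk' _ hz'
  simp only [Complex.ofReal_one, one_mul, add_sub_cancel] at this
  simp only [Function.comp_apply]
  linear_combination this

/-! ### Reflection in the real axis -/

theorem isOpen_upperHalf : IsOpen upperHalf := isOpen_lt continuous_const Complex.continuous_im

theorem convex_upperHalf : Convex ℝ upperHalf := convex_halfSpace_im_gt 0

theorem closure_upperHalf : closure upperHalf = {z : ℂ | 0 ≤ z.im} := Complex.closure_setOfPred_lt_im 0

instance neBot_nhdsWithin_upperHalf (x : ℝ) : (𝓝[upperHalf] (x : ℂ)).NeBot := by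
  rw [← mem_closure_iff_nhdsWithin_neBot, closure_upperHalf]
  simp

/-- **Schwarz reflection** for a function that is continuous up to the real axis. -/
theorem exists_reflection_of_continuousOn {U : Set ℂ} (hU : IsOpen U)
    (hsymm : ∀ z ∈ U, (starRingEnd ℂ) z ∈ U) {P : ℂ → ℂ}
    (hc : ContinuousOn P (U ∩ {z | 0 ≤ z.im})) (hd : DifferentiableOn ℂ P (U ∩ upperHalf))
    (hreal : ∀ x : ℝ, (x : ℂ) ∈ U → (P x).im = 0) :
    ∃ S : ℂ → ℂ, DifferentiableOn ℂ S U ∧ EqOn S P (U ∩ {z | 0 ≤ z.im}) ∧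
      ∀ z ∈ U, z.im < 0 → S z = (starRingEnd ℂ) (P ((starRingEnd ℂ) z)) := by
  classical
  set S : ℂ → ℂ := fun z => if 0 ≤ z.im then P z else (starRingEnd ℂ) (P ((starRingEnd ℂ) z))
    with hS
  refine ⟨S, ?_, fun z hz => if_pos hz.2, fun z _ hz => if_neg (not_le.2 hz)⟩
  apply differentiableOn_of_continuousOn_of_differentiableOn_off_real hU
  · apply ContinuousOn.if
    · rintro z ⟨hz, hz'⟩
      rw [show {a : ℂ | 0 ≤ a.im} = {a : ℂ | (0 : ℝ) ≤ a.im} from rfl,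
        Complex.frontier_setOfPred_le_im] at hz'
      have hz0 : z.im = 0 := hz'
      have hzr : z = (z.re : ℂ) := Complex.ext rfl (by simpa using hz0)
      rw [hzr, Complex.conj_ofReal]
      exact (Complex.conj_eq_iff_im.2 (hreal _ (hzr ▸ hz))).symm
    · rw [IsClosed.closure_eq (isClosed_le continuous_const Complex.continuous_im)]
      exact hc
    · refine Complex.continuous_conj.comp_continuousOn
        (hc.comp Complex.continuous_conj.continuousOn ?_)
      rintro z ⟨hz, hz'⟩
      refine ⟨hsymm z hz, ?_⟩
      simp only [not_le, Complex.closure_setOfPred_im_lt] at hz'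
      have : z.im ≤ 0 := hz'
      simpa using this
  · rintro z ⟨hz, hz0⟩
    have hz0 : z.im ≠ 0 := hz0
    apply DifferentiableAt.differentiableWithinAt
    rcases lt_or_gt_of_ne hz0 with h | h
    · have hmem : (starRingEnd ℂ) z ∈ U ∩ upperHalf := ⟨hsymm z hz, by simpa using h⟩
      have h1 : DifferentiableAt ℂ P ((starRingEnd ℂ) z) :=
        hd.differentiableAt ((hU.inter isOpen_upperHalf).mem_nhds hmem)
      have h2 : DifferentiableAt ℂ ((starRingEnd ℂ) ∘ P ∘ (starRingEnd ℂ)) z :=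
        differentiableAt_conj_conj_iff.2 h1
      refine h2.congr_of_eventuallyEq ?_
      filter_upwards [(isOpen_lt Complex.continuous_im continuous_const).mem_nhds h] with w hw
      exact if_neg (not_le.2 hw)
    · have h1 : DifferentiableAt ℂ P z :=
        hd.differentiableAt ((hU.inter isOpen_upperHalf).mem_nhds ⟨hz, h⟩)
      refine h1.congr_of_eventuallyEq ?_
      filter_upwards [isOpen_upperHalf.mem_nhds h] with w hw
      exact if_pos (le_of_lt hw)

/-- **Schwarz reflection** for a bounded holomorphic function on a half-disc of which only the
imaginary part is known to tend to `0` at the real diameter. A primitive is Lipschitz continuous,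
hence extends to the diameter, where its imaginary part is constant; so the primitive can be
reflected. -/
theorem exists_reflection_of_tendsto_im {r : ℝ} {F : ℂ → ℂ}
    (hF : DifferentiableOn ℂ F (Metric.ball 0 r ∩ upperHalf)) {M : ℝ}
    (hM : ∀ z ∈ Metric.ball 0 r ∩ upperHalf, ‖F z‖ ≤ M)
    (him : ∀ x : ℝ, |x| < r → Tendsto (fun z => (F z).im) (𝓝[upperHalf] (x : ℂ)) (𝓝 0)) :
    ∃ S : ℂ → ℂ, DifferentiableOn ℂ S (Metric.ball 0 r) ∧
      EqOn S F (Metric.ball 0 r ∩ upperHalf) ∧ ∀ x : ℝ, |x| < r → (S x).im = 0 := by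
  set B : Set ℂ := Metric.ball 0 r ∩ upperHalf with hB
  have hBo : IsOpen B := Metric.isOpen_ball.inter isOpen_upperHalf
  have hBc : Convex ℝ B := (convex_ball 0 r).inter convex_upperHalf
  obtain ⟨P, hP⟩ := exists_primitive_of_convex hBo hBc hF
  have hlip : LipschitzOnWith M.toNNReal P B :=
    hBc.lipschitzOnWith_of_nnnorm_hasDerivWithin_le (fun z hz => (hP z hz).hasDerivWithinAt)
      fun z hz => by
        rw [← NNReal.coe_le_coe, coe_nnnorm]
        exact (hM z hz).trans (Real.le_coe_toNNReal M)
  obtain ⟨P', hP'lip, hP'⟩ := hlip.extend_finite_dimension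
  have hP'c : Continuous P' := hP'lip.continuous
  -- the points `x + iε` of the half-disc above a point `x` of the diameter
  have hmemB : ∀ x : ℝ, |x| < r → ∀ᶠ ε : ℝ in 𝓝[>] 0, ∀ t : ℝ, |t| ≤ |x| →
      (t + ε * Complex.I : ℂ) ∈ B := by
    intro x hx
    filter_upwards [Ioo_mem_nhdsGT (sub_pos.2 hx)] with ε hε t ht
    refine ⟨?_, by simpa using hε.1⟩
    rw [mem_ball_zero_iff]
    calc ‖(t + ε * Complex.I : ℂ)‖ ≤ ‖(t : ℂ)‖ + ‖(ε * Complex.I : ℂ)‖ := norm_add_le _ _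
      _ = |t| + ε := by simp [abs_of_pos hε.1]
      _ < r := by linarith [hε.2]
  have hvert : ∀ x : ℝ, Tendsto (fun ε : ℝ => (x + ε * Complex.I : ℂ)) (𝓝[>] 0)
      (𝓝[upperHalf] (x : ℂ)) := by
    intro x
    apply tendsto_nhdsWithin_of_tendsto_nhds_of_eventually_within
    · have : Continuous fun ε : ℝ => (x + ε * Complex.I : ℂ) := by fun_prop
      simpa using (this.tendsto 0).mono_left nhdsWithin_le_nhds
    · filter_upwards [self_mem_nhdsWithin] with ε hε
      simpa using hε
  have hconst : ∀ x : ℝ, |x| < r → (P' x).im = (P' 0).im := by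
    intro x hx
    have hle : ∀ t ∈ uIoc 0 x, |t| ≤ |x| := fun t ht => by
      have := abs_sub_left_of_mem_uIcc (uIoc_subset_uIcc ht)
      simpa using this
    have hle' : ∀ t ∈ uIcc 0 x, |t| ≤ |x| := fun t ht => by
      have := abs_sub_left_of_mem_uIcc ht
      simpa using this
    have hint : ∀ᶠ ε : ℝ in 𝓝[>] 0, ∫ t in (0 : ℝ)..x, (F (t + ε * Complex.I)).im =
        (P' (x + ε * Complex.I)).im - (P' ((0 : ℝ) + ε * Complex.I)).im := by
      filter_upwards [hmemB x hx] with ε hε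
      rw [← hP' (hε x le_rfl), ← hP' (hε 0 (by simp))]
      apply intervalIntegral.integral_eq_sub_of_hasDerivAt
        (f := fun t : ℝ => (P (t + ε * Complex.I)).im)
      · intro t ht
        have h1 : HasDerivAt (fun t : ℝ => (t + ε * Complex.I : ℂ)) 1 t :=
          (Complex.ofRealCLM.hasDerivAt (x := t)).add_const _
        have h2 : HasDerivAt (fun t : ℝ => P (t + ε * Complex.I)) (F (t + ε * Complex.I)) t := by
          have h2 := (hP _ (hε t (hle' t ht))).comp t h1
          rw [mul_one] at h2
          exact h2
        exact Complex.imCLM.hasFDerivAt.comp_hasDerivAt t h2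
      · apply ContinuousOn.intervalIntegrable
        refine Complex.continuous_im.comp_continuousOn (hF.continuousOn.comp (by fun_prop) ?_)
        exact fun t ht => hε t (hle' t ht)
    have hlim : Tendsto (fun ε : ℝ => ∫ t in (0 : ℝ)..x, (F (t + ε * Complex.I)).im) (𝓝[>] 0)
        (𝓝 (∫ t in (0 : ℝ)..x, (0 : ℝ))) := by
      apply intervalIntegral.tendsto_integral_filter_of_dominated_convergence (fun _ => M)
      · filter_upwards [hmemB x hx] with ε hε
        refine ContinuousOn.aestronglyMeasurable ?_ measurableSet_uIoc
        refine Complex.continuous_im.comp_continuousOn (hF.continuousOn.comp (by fun_prop) ?_)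
        exact fun t ht => hε t (hle t ht)
      · filter_upwards [hmemB x hx] with ε hε
        refine Eventually.of_forall fun t ht => ?_
        exact (Complex.abs_im_le_norm _).trans (hM _ (hε t (hle t ht)))
      · simp
      · refine Eventually.of_forall fun t ht => ?_
        exact (him t ((hle t ht).trans_lt hx)).comp (hvert t)
    have hlim' : Tendsto (fun ε : ℝ => ∫ t in (0 : ℝ)..x, (F (t + ε * Complex.I)).im) (𝓝[>] 0)
        (𝓝 ((P' x).im - (P' (0 : ℝ)).im)) := by
      refine Tendsto.congr' (EventuallyEq.symm hint) ?_
      have h1 := ((Complex.continuous_im.comp hP'c).tendsto (x : ℂ)).comp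
        ((hvert x).mono_right nhdsWithin_le_nhds)
      have h2 := ((Complex.continuous_im.comp hP'c).tendsto ((0 : ℝ) : ℂ)).comp
        ((hvert 0).mono_right nhdsWithin_le_nhds)
      exact h1.sub h2
    have := tendsto_nhds_unique hlim hlim'
    simp only [intervalIntegral.integral_zero, Complex.ofReal_zero] at this
    linarith
  obtain ⟨S, hS, hS', -⟩ := exists_reflection_of_continuousOn (U := Metric.ball 0 r)
    (P := fun z => P' z - ((P' 0).im : ℂ) * Complex.I) Metric.isOpen_ball
    (fun z hz => by simpa using hz) (hP'c.sub continuous_const).continuousOn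
    (fun z hz => by
      have h1 : HasDerivAt P' (F z) z :=
        (hP z hz).congr_of_eventuallyEq (hP'.symm.eventuallyEq_of_mem (hBo.mem_nhds hz))
      exact (h1.differentiableAt.sub_const _).differentiableWithinAt)
    (fun x hx => by
      have : |x| < r := by simpa using hx
      simp [hconst x this])
  refine ⟨deriv S, hS.deriv Metric.isOpen_ball, ?_, ?_⟩
  · intro z hz
    have h1 : HasDerivAt P' (F z) z :=
      (hP z hz).congr_of_eventuallyEq (hP'.symm.eventuallyEq_of_mem (hBo.mem_nhds hz))
    have h2 : HasDerivAt S (F z) z := by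
      refine (h1.sub_const (((P' 0).im : ℂ) * Complex.I)).congr_of_eventuallyEq ?_
      filter_upwards [hBo.mem_nhds hz] with w hw
      exact hS' ⟨hw.1, le_of_lt (show 0 < w.im from hw.2)⟩
    exact h2.deriv
  · intro x hx
    have hxm : (x : ℂ) ∈ Metric.ball (0 : ℂ) r := by simpa using hx
    have h1 : HasDerivAt S (deriv S x) (x : ℂ) :=
      (hS.differentiableAt (Metric.isOpen_ball.mem_nhds hxm)).hasDerivAt
    have h2 : HasDerivAt (fun t : ℝ => (S t).im) (deriv S x).im x :=
      Complex.imCLM.hasFDerivAt.comp_hasDerivAt x h1.comp_ofReal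
    have h3 : (fun t : ℝ => (S t).im) =ᶠ[𝓝 x] fun _ => 0 := by
      have : ∀ᶠ t : ℝ in 𝓝 x, |t| < r := (continuous_abs.tendsto x).eventually_lt_const hx
      filter_upwards [this] with t ht
      have htm : (t : ℂ) ∈ Metric.ball (0 : ℂ) r := by simpa using ht
      rw [hS' ⟨htm, by simp⟩]
      simp [hconst t ht]
    exact (h2.congr_of_eventuallyEq h3.symm).unique (hasDerivAt_const x (0 : ℝ))

/-! ### Functions that are real on the real axis -/

/-- `k` is analytic at the real point `x` and takes real values at the real points near `x`. -/
structure IsRealAnalyticAt (k : ℂ → ℂ) (x : ℝ) : Prop where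
  analytic : AnalyticAt ℂ k x
  real : ∀ᶠ y : ℝ in 𝓝 x, (k y).im = 0

theorem tendsto_ofReal_nhds (x : ℝ) : Tendsto (fun y : ℝ => (y : ℂ)) (𝓝 x) (𝓝 (x : ℂ)) :=
  Complex.continuous_ofReal.tendsto x

namespace IsRealAnalyticAt

variable {k l : ℂ → ℂ} {x : ℝ}

theorem im_eq_zero (hk : IsRealAnalyticAt k x) : (k x).im = 0 := hk.real.self_of_nhds

theorem ofReal_re (hk : IsRealAnalyticAt k x) : ((k x).re : ℂ) = k x :=
  Complex.ext (by simp) (by simp [hk.im_eq_zero])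

theorem const (c : ℝ) : IsRealAnalyticAt (fun _ => (c : ℂ)) x :=
  ⟨analyticAt_const, by simp⟩

theorem id : IsRealAnalyticAt (fun z => z) x := ⟨analyticAt_id, by simp⟩

theorem add (hk : IsRealAnalyticAt k x) (hl : IsRealAnalyticAt l x) :
    IsRealAnalyticAt (fun z => k z + l z) x := by
  refine ⟨hk.analytic.add hl.analytic, ?_⟩
  filter_upwards [hk.real, hl.real] with y h1 h2
  simp [h1, h2]

theorem mul (hk : IsRealAnalyticAt k x) (hl : IsRealAnalyticAt l x) :
    IsRealAnalyticAt (fun z => k z * l z) x := by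
  refine ⟨hk.analytic.mul hl.analytic, ?_⟩
  filter_upwards [hk.real, hl.real] with y h1 h2
  simp [h1, h2]

theorem sub (hk : IsRealAnalyticAt k x) (hl : IsRealAnalyticAt l x) :
    IsRealAnalyticAt (fun z => k z - l z) x := by
  refine ⟨hk.analytic.sub hl.analytic, ?_⟩
  filter_upwards [hk.real, hl.real] with y h1 h2
  simp [h1, h2]

theorem pow (hk : IsRealAnalyticAt k x) (n : ℕ) : IsRealAnalyticAt (fun z => k z ^ n) x := by
  refine ⟨hk.analytic.pow n, ?_⟩
  filter_upwards [hk.real] with y h1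
  rw [show k y = ((k y).re : ℂ) from Complex.ext (by simp) (by simp [h1]), ← Complex.ofReal_pow,
    Complex.ofReal_im]

theorem inv (hk : IsRealAnalyticAt k x) (h0 : k x ≠ 0) :
    IsRealAnalyticAt (fun z => (k z)⁻¹) x := by
  refine ⟨hk.analytic.inv h0, ?_⟩
  filter_upwards [hk.real] with y h1
  simp [h1]

theorem div (hk : IsRealAnalyticAt k x) (hl : IsRealAnalyticAt l x) (h0 : l x ≠ 0) :
    IsRealAnalyticAt (fun z => k z / l z) x := by
  simpa only [div_eq_mul_inv] using hk.mul (hl.inv h0)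

theorem comp {χ : ℂ → ℂ} {y : ℝ} (hk : IsRealAnalyticAt k y) (hχ : IsRealAnalyticAt χ x)
    (hy : χ x = y) : IsRealAnalyticAt (fun z => k (χ z)) x := by
  refine ⟨(hy ▸ hk.analytic : AnalyticAt ℂ k (χ x)).comp hχ.analytic, ?_⟩
  have h1 : Tendsto (fun t : ℝ => (χ t).re) (𝓝 x) (𝓝 y) := by
    have := (Complex.continuous_re.tendsto _).comp
      (hχ.analytic.continuousAt.tendsto.comp (tendsto_ofReal_nhds x))
    rw [hy] at this
    exact this
  filter_upwards [hχ.real, h1.eventually hk.real] with t ht ht'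
  rwa [show χ t = ((χ t).re : ℂ) from Complex.ext (by simp) (by simp [ht])]

/-- The derivative of a function that is real on the real axis is real on the real axis. -/
theorem deriv (hk : IsRealAnalyticAt k x) : IsRealAnalyticAt (deriv k) x := by
  refine ⟨hk.analytic.deriv, ?_⟩
  filter_upwards [hk.real.eventually_nhds,
    (tendsto_ofReal_nhds x).eventually hk.analytic.eventually_analyticAt] with y hy hya
  have h2 : HasDerivAt (fun t : ℝ => (k t).im) (_root_.deriv k y).im y :=
    Complex.imCLM.hasFDerivAt.comp_hasDerivAt y hya.differentiableAt.hasDerivAt.comp_ofReal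
  exact (h2.congr_of_eventuallyEq (f := fun t : ℝ => (k t).im) (f₁ := fun _ => (0 : ℝ))
    (by filter_upwards [hy] with t ht using ht.symm)).unique (hasDerivAt_const y (0 : ℝ))

theorem cpow (hk : IsRealAnalyticAt k x) (hpos : 0 < (k x).re) (α : ℝ) :
    IsRealAnalyticAt (fun z => k z ^ (α : ℂ)) x := by
  refine ⟨hk.analytic.cpow analyticAt_const (Or.inl hpos), ?_⟩
  have h1 : Tendsto (fun t : ℝ => (k t).re) (𝓝 x) (𝓝 (k x).re) :=
    (Complex.continuous_re.tendsto _).comp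
      (hk.analytic.continuousAt.tendsto.comp (tendsto_ofReal_nhds x))
  filter_upwards [hk.real, h1.eventually_const_lt hpos] with t ht ht'
  rw [show k t = ((k t).re : ℂ) from Complex.ext (by simp) (by simp [ht]),
    ← Complex.ofReal_cpow ht'.le, Complex.ofReal_im]

/-- Near a real point where the derivative is positive, the half-planes are preserved. -/
theorem eventually_im_pos (hk : IsRealAnalyticAt k x) (hpos : 0 < (_root_.deriv k x).re) :
    ∀ᶠ z in 𝓝 (x : ℂ), (0 < z.im → 0 < (k z).im) ∧ (z.im < 0 → (k z).im < 0) := by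
  set a := (_root_.deriv k x).re with ha
  have ha' : _root_.deriv k x = a := (hk.deriv.ofReal_re).symm
  have hs : HasStrictDerivAt k (a : ℂ) x := ha' ▸ hk.analytic.hasStrictDerivAt
  have ho := hs.isLittleO.def (half_pos hpos)
  have ht : Tendsto (fun z : ℂ => (z, (z.re : ℂ))) (𝓝 (x : ℂ)) (𝓝 ((x : ℂ), (x : ℂ))) := by
    have : Continuous fun z : ℂ => (z, (z.re : ℂ)) := by fun_prop
    simpa using this.tendsto (x : ℂ)
  have hre : Tendsto (fun z : ℂ => z.re) (𝓝 (x : ℂ)) (𝓝 x) := by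
    simpa using Complex.continuous_re.tendsto (x : ℂ)
  filter_upwards [ht.eventually ho, hre.eventually hk.real] with z hz hr
  have h1 := (Complex.abs_im_le_norm _).trans hz
  have h2 : ‖z - (z.re : ℂ)‖ = |z.im| := by
    rw [show z - (z.re : ℂ) = (z.im : ℂ) * Complex.I from by
      apply Complex.ext <;> simp]
    simp
  simp only [h2, Complex.sub_im, hr, ContinuousLinearMap.toSpanSingleton_apply, smul_eq_mul, Complex.mul_im,
    Complex.ofReal_im, Complex.ofReal_re, Complex.sub_re, sub_self, mul_zero, sub_zero] at h1
  rw [abs_le] at h1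
  constructor
  · intro h
    rw [abs_of_pos h] at h1
    nlinarith [mul_pos hpos h]
  · intro h
    rw [abs_of_neg h] at h1
    nlinarith [mul_neg_of_pos_of_neg hpos h]

/-- A function that is real on the real axis and maps the upper half-plane near a real point into
itself has a positive derivative there: a zero of order `n ≥ 2` of `k - k x` would map the
half-plane near `x` onto a full neighbourhood of `k x`. -/
theorem deriv_pos (hk : IsRealAnalyticAt k x)
    (him : ∀ᶠ z in 𝓝[upperHalf] (x : ℂ), 0 < (k z).im) : 0 < (_root_.deriv k x).re := by
  have han : AnalyticAt ℂ (fun z => k z - k x) x := hk.analytic.sub analyticAt_const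
  have hne : analyticOrderAt (fun z => k z - k x) (x : ℂ) ≠ ⊤ := by
    rw [Ne, analyticOrderAt_eq_top]
    intro h0
    obtain ⟨z, hz, hz'⟩ := ((h0.filter_mono nhdsWithin_le_nhds).and him).exists
    have : k z = k x := sub_eq_zero.1 hz
    rw [this, hk.im_eq_zero] at hz'
    exact lt_irrefl _ hz'
  obtain ⟨h, hh, hh0, hkh⟩ := (han.analyticOrderAt_ne_top).1 hne
  set n := analyticOrderNatAt (fun z => k z - k x) (x : ℂ) with hn
  have hn0 : n ≠ 0 := by
    intro h0
    have := hkh.self_of_nhds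
    simp [h0] at this
    exact hh0 this.symm
  have hhr : (h x).im = 0 := by
    have h1 : Tendsto (fun y : ℝ => (h y).im) (𝓝[≠] x) (𝓝 (h x).im) :=
      ((Complex.continuous_im.tendsto _).comp
        (hh.continuousAt.tendsto.comp (tendsto_ofReal_nhds x))).mono_left nhdsWithin_le_nhds
    have h2 : (fun y : ℝ => (h y).im) =ᶠ[𝓝[≠] x] fun _ => 0 := by
      filter_upwards [self_mem_nhdsWithin,
        ((tendsto_ofReal_nhds x).eventually hkh).filter_mono nhdsWithin_le_nhds,
        hk.real.filter_mono nhdsWithin_le_nhds] with y hy hy1 hy2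
      have hyx : ((y : ℂ) - x) ^ n ≠ 0 := by
        apply pow_ne_zero
        rw [sub_ne_zero]
        exact_mod_cast hy
      have h3 : h y = ((((k y).re - (k x).re) / (y - x) ^ n : ℝ) : ℂ) := by
        push_cast
        rw [hk.ofReal_re, eq_div_iff hyx, show ((k y).re : ℂ) = k y from
          Complex.ext (by simp) (by simp [hy2]), hy1, smul_eq_mul, mul_comm]
      rw [h3, Complex.ofReal_im]
    exact tendsto_nhds_unique h1 (tendsto_const_nhds.congr' h2.symm)
  -- along the ray with angle `η` the imaginary part of `k` is positive; for `η = π/(2n)` and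
  -- `η = 3π/(2n)`, both in `(0, π)` if `n ≥ 2`, the sines of `nη` have opposite signs
  have key : ∀ η ∈ Ioo 0 Real.pi, 0 ≤ Real.sin (n * η) * (h x).re := by
    intro η hη
    have hray : Tendsto (fun ρ : ℝ => (x : ℂ) + ρ * Complex.exp (η * Complex.I)) (𝓝[>] 0)
        (𝓝[upperHalf] (x : ℂ)) := by
      apply tendsto_nhdsWithin_of_tendsto_nhds_of_eventually_within
      · have : Continuous fun ρ : ℝ => (x : ℂ) + ρ * Complex.exp (η * Complex.I) := by fun_prop
        simpa using (this.tendsto 0).mono_left nhdsWithin_le_nhds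
      · filter_upwards [self_mem_nhdsWithin] with ρ hρ
        have hρ : 0 < ρ := hρ
        simp only [Complex.add_im, Complex.ofReal_im, Complex.mul_im,
          Complex.ofReal_re, Complex.exp_ofReal_mul_I_im, zero_mul, add_zero, zero_add]
        exact mul_pos hρ (Real.sin_pos_of_pos_of_lt_pi hη.1 hη.2)
    have hlim : Tendsto (fun ρ : ℝ => (Complex.exp (n * η * Complex.I) *
        h ((x : ℂ) + ρ * Complex.exp (η * Complex.I))).im) (𝓝[>] 0)
        (𝓝 (Complex.exp (n * η * Complex.I) * h x).im) :=
      (Complex.continuous_im.tendsto _).comp (tendsto_const_nhds.mul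
        (hh.continuousAt.tendsto.comp (hray.mono_right nhdsWithin_le_nhds)))
    have hval : (Complex.exp (n * η * Complex.I) * h x).im = Real.sin (n * η) * (h x).re := by
      have : (n * η * Complex.I : ℂ) = ((n * η : ℝ) : ℂ) * Complex.I := by push_cast; ring
      rw [this, Complex.mul_im, Complex.exp_ofReal_mul_I_im, hhr]
      ring
    rw [← hval]
    refine ge_of_tendsto hlim ?_
    filter_upwards [self_mem_nhdsWithin, hray.eventually him,
      hray.eventually (hkh.filter_mono nhdsWithin_le_nhds)] with ρ hρ h1 h2
    have hρ : 0 < ρ := hρ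
    rw [add_sub_cancel_left, smul_eq_mul, mul_pow, ← Complex.exp_nat_mul, ← mul_assoc,
      ← Complex.ofReal_pow, mul_assoc] at h2
    have h3 := congrArg Complex.im h2
    rw [Complex.sub_im, hk.im_eq_zero, sub_zero, Complex.im_ofReal_mul] at h3
    rw [h3] at h1
    exact (pos_of_mul_pos_right h1 (by positivity)).le
  have hre : (h x).re ≠ 0 := fun h0 => hh0 (Complex.ext h0 hhr)
  have hnpos : (0 : ℝ) < n := by exact_mod_cast Nat.pos_of_ne_zero hn0
  have hpi := Real.pi_pos
  have hge : 0 ≤ (h x).re := by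
    have := key (Real.pi / (2 * n)) ⟨by positivity, by
      rw [div_lt_iff₀ (by positivity)]
      have : (1 : ℝ) ≤ n := by exact_mod_cast Nat.one_le_iff_ne_zero.2 hn0
      nlinarith⟩
    rwa [show (n : ℝ) * (Real.pi / (2 * n)) = Real.pi / 2 by field_simp, Real.sin_pi_div_two,
      one_mul] at this
  have hn1 : n = 1 := by
    by_contra hn1
    have h2 : (2 : ℝ) ≤ n := by
      exact_mod_cast (by omega : 2 ≤ n)
    have := key (3 * Real.pi / (2 * n)) ⟨by positivity, by
      rw [div_lt_iff₀ (by positivity)]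
      nlinarith⟩
    rw [show (n : ℝ) * (3 * Real.pi / (2 * n)) = Real.pi / 2 + Real.pi by field_simp; ring,
      Real.sin_add_pi, Real.sin_pi_div_two] at this
    exact hre (le_antisymm (by linarith) hge)
  have hder : HasDerivAt (fun z => k z - k x) (h x) x := by
    have h1 : HasDerivAt (fun z : ℂ => (z - x) * h z) (1 * h x + ((x : ℂ) - x) * _root_.deriv h x)
        x := ((hasDerivAt_id (x : ℂ)).sub_const (x : ℂ)).mul hh.differentiableAt.hasDerivAt
    rw [one_mul, sub_self, zero_mul, add_zero] at h1
    refine h1.congr_of_eventuallyEq ?_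
    filter_upwards [hkh] with z hz
    rw [hz, hn1, pow_one, smul_eq_mul]
  have : HasDerivAt k (h x) x := by simpa using hder.add_const (k x)
  rw [this.deriv]
  exact lt_of_le_of_ne hge hre.symm

end IsRealAnalyticAt

/-- The local inverse of a function that is real on the real axis with positive derivative. -/
theorem exists_local_inverse_of_isRealAnalyticAt {G : ℂ → ℂ} {u : ℝ} (hG : IsRealAnalyticAt G u)
    (hpos : 0 < (deriv G u).re) :
    ∃ χ : ℂ → ℂ, IsRealAnalyticAt χ (G u).re ∧ χ (G u).re = u ∧ 0 < (deriv χ (G u).re).re ∧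
      (∀ᶠ z in 𝓝 (((G u).re : ℝ) : ℂ), G (χ z) = z) ∧ ∀ᶠ v in 𝓝 (u : ℂ), χ (G v) = v := by
  have hd : deriv G u ≠ 0 := fun h => by rw [h] at hpos; simp at hpos
  set χ := hG.analytic.hasStrictDerivAt.localInverse _ _ _ hd with hχ
  have hχa : AnalyticAt ℂ χ (G u) := hG.analytic.analyticAt_localInverse hd
  have hleft : ∀ᶠ v in 𝓝 (u : ℂ), χ (G v) = v := HasStrictDerivAt.eventually_left_inverse _ _
  have hright : ∀ᶠ z in 𝓝 (G u), G (χ z) = z := HasStrictDerivAt.eventually_right_inverse _ _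
  have h0 : χ (G u) = u := hleft.self_of_nhds
  have hder : HasStrictDerivAt χ (deriv G u)⁻¹ (G u) := HasStrictDerivAt.to_localInverse _ _
  rw [hG.ofReal_re]
  refine ⟨χ, ⟨by rwa [hG.ofReal_re], ?_⟩, h0, ?_, hright, hleft⟩
  · have ht : Tendsto (fun y : ℝ => (y : ℂ)) (𝓝 (G u).re) (𝓝 (G u)) := by
      have := tendsto_ofReal_nhds (G u).re
      rwa [hG.ofReal_re] at this
    have hχt : Tendsto χ (𝓝 (G u)) (𝓝 (u : ℂ)) := by
      have := hχa.continuousAt.tendsto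
      rwa [h0] at this
    filter_upwards [ht.eventually hright,
      (hχt.comp ht).eventually (hG.eventually_im_pos hpos)] with y h1 h2
    simp only [Function.comp_apply] at h2
    rw [h1, Complex.ofReal_im] at h2
    rcases lt_trichotomy (χ y).im 0 with h | h | h
    · exact absurd (h2.2 h) (lt_irrefl _)
    · exact h
    · exact absurd (h2.1 h) (lt_irrefl _)
  · rw [hder.hasDerivAt.deriv]
    rw [Complex.inv_re]
    exact div_pos hpos (Complex.normSq_pos.2 hd)

/-- Boundary behaviour of a conformal map at a free boundary arc. If a bounded holomorphic map `G`
of a half-disc into the upper half-plane leaves every compact set at the diameter, then it extends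
analytically across the diameter, with positive derivative; `χ` is the local inverse of the
extension at the image of `0`. -/
theorem exists_boundary_chart {r : ℝ} (hr : 0 < r) {G : ℂ → ℂ}
    (hG : DifferentiableOn ℂ G (Metric.ball 0 r ∩ upperHalf))
    (hmaps : MapsTo G (Metric.ball 0 r ∩ upperHalf) upperHalf) {M : ℝ}
    (hM : ∀ z ∈ Metric.ball 0 r ∩ upperHalf, ‖G z‖ ≤ M)
    (hleave : ∀ x : ℝ, |x| < r → ∀ K ⊆ upperHalf, IsCompact K →
      ∀ᶠ u in 𝓝[upperHalf] (x : ℂ), G u ∉ K) :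
    ∃ (x₀ : ℝ) (χ : ℂ → ℂ), IsRealAnalyticAt χ x₀ ∧ χ x₀ = 0 ∧ 0 < (deriv χ x₀).re ∧
      Tendsto G (𝓝[upperHalf] 0) (𝓝 (x₀ : ℂ)) ∧
      ∀ᶠ z in 𝓝[upperHalf] (x₀ : ℂ), χ z ∈ Metric.ball 0 r ∩ upperHalf ∧ G (χ z) = z := by
  have hBev : ∀ x : ℝ, |x| < r →
      ∀ᶠ u in 𝓝[upperHalf] (x : ℂ), u ∈ Metric.ball (0 : ℂ) r ∩ upperHalf := by
    intro x hx
    have hxm : (x : ℂ) ∈ Metric.ball (0 : ℂ) r := by simpa using hx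
    filter_upwards [self_mem_nhdsWithin,
      mem_nhdsWithin_of_mem_nhds (Metric.isOpen_ball.mem_nhds hxm)] with u h1 h2
    exact ⟨h2, h1⟩
  have him : ∀ x : ℝ, |x| < r → Tendsto (fun z => (G z).im) (𝓝[upperHalf] (x : ℂ)) (𝓝 0) := by
    intro x hx
    rw [tendsto_order]
    constructor
    · intro a ha
      filter_upwards [hBev x hx] with u hu
      exact ha.trans (show 0 < (G u).im from hmaps hu)
    · intro ε hε
      have hK : IsCompact (Metric.closedBall (0 : ℂ) M ∩ {z | ε ≤ z.im}) :=
        (isCompact_closedBall 0 M).inter_right (isClosed_le continuous_const Complex.continuous_im)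
      filter_upwards [hBev x hx, hleave x hx _ (fun z hz => lt_of_lt_of_le hε hz.2) hK]
        with u hu hu'
      by_contra hcon
      exact hu' ⟨by simpa using hM u hu, not_lt.1 hcon⟩
  obtain ⟨S, hS, hSG, hSr⟩ := exists_reflection_of_tendsto_im hG hM him
  have hS0 : IsRealAnalyticAt S 0 := by
    refine ⟨hS.analyticAt (Metric.isOpen_ball.mem_nhds (by simpa using hr)), ?_⟩
    have : ∀ᶠ t : ℝ in 𝓝 0, |t| < r :=
      (continuous_abs.tendsto (0 : ℝ)).eventually_lt_const (by simpa using hr)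
    filter_upwards [this] with t ht using hSr t ht
  have hBev0 := hBev 0 (by simpa using hr)
  have hpos : 0 < (deriv S ((0 : ℝ) : ℂ)).re := by
    apply hS0.deriv_pos
    filter_upwards [hBev0] with u hu
    rw [hSG hu]
    exact hmaps hu
  obtain ⟨χ, hχ, hχ0, hχpos, hχr, -⟩ := exists_local_inverse_of_isRealAnalyticAt hS0 hpos
  refine ⟨_, χ, hχ, by simpa using hχ0, hχpos, ?_, ?_⟩
  · have h1 : Tendsto S (𝓝[upperHalf] ((0 : ℝ) : ℂ)) (𝓝 (((S (0 : ℝ)).re : ℝ) : ℂ)) := by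
      rw [hS0.ofReal_re]
      exact hS0.analytic.continuousAt.tendsto.mono_left nhdsWithin_le_nhds
    rw [Complex.ofReal_zero] at h1 hBev0
    exact h1.congr' (by filter_upwards [hBev0] with u hu using hSG hu)
  · have hχt : Tendsto χ (𝓝 (((S (0 : ℝ)).re : ℝ) : ℂ)) (𝓝 0) := by
      have := hχ.analytic.continuousAt.tendsto
      rwa [hχ0, Complex.ofReal_zero] at this
    filter_upwards [self_mem_nhdsWithin, mem_nhdsWithin_of_mem_nhds hχr,
      mem_nhdsWithin_of_mem_nhds (hχ.eventually_im_pos hχpos),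
      mem_nhdsWithin_of_mem_nhds (hχt.eventually (Metric.isOpen_ball.mem_nhds
        (Metric.mem_ball_self hr)))] with z h1 h2 h3 h4
    have h5 : χ z ∈ Metric.ball 0 r ∩ upperHalf := ⟨h4, h3.1 h1⟩
    exact ⟨h5, by rw [← hSG h5, h2]⟩

/-! ### Injective holomorphic functions -/

/-- An injective holomorphic function has no critical points: at a critical point it would be the
`n`-th power of a local coordinate, `n ≥ 2`. -/
theorem deriv_ne_zero_of_injOn {U : Set ℂ} (hU : IsOpen U) {f : ℂ → ℂ}
    (hf : DifferentiableOn ℂ f U) (hinj : InjOn f U) {z₀ : ℂ} (hz₀ : z₀ ∈ U) :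
    deriv f z₀ ≠ 0 := by
  intro hd0
  have hfa : AnalyticAt ℂ f z₀ := hf.analyticAt (hU.mem_nhds hz₀)
  have han : AnalyticAt ℂ (fun z => f z - f z₀) z₀ := hfa.sub analyticAt_const
  have hne : analyticOrderAt (fun z => f z - f z₀) z₀ ≠ ⊤ := by
    rw [Ne, analyticOrderAt_eq_top]
    intro h0
    have h1 : ∀ᶠ z in 𝓝[≠] z₀, f z - f z₀ = 0 ∧ z ∈ U ∧ z ≠ z₀ := by
      filter_upwards [h0.filter_mono nhdsWithin_le_nhds,
        mem_nhdsWithin_of_mem_nhds (hU.mem_nhds hz₀), self_mem_nhdsWithin] with z h1 h2 h3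
      exact ⟨h1, h2, h3⟩
    obtain ⟨z, h1, h2, h3⟩ := h1.exists
    exact h3 (hinj h2 hz₀ (sub_eq_zero.1 h1))
  obtain ⟨h, hh, hh0, hkh⟩ := (han.analyticOrderAt_ne_top).1 hne
  set n := analyticOrderNatAt (fun z => f z - f z₀) z₀ with hn
  have hn0 : n ≠ 0 := by
    intro h0
    have := hkh.self_of_nhds
    simp [h0] at this
    exact hh0 this.symm
  have hn1 : n ≠ 1 := by
    intro h1
    have h2 : HasDerivAt (fun z : ℂ => (z - z₀) * h z) (1 * h z₀ + (z₀ - z₀) * deriv h z₀)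
        z₀ := ((hasDerivAt_id z₀).sub_const z₀).mul hh.differentiableAt.hasDerivAt
    rw [one_mul, sub_self, zero_mul, add_zero] at h2
    have h3 : HasDerivAt (fun z => f z - f z₀) (h z₀) z₀ := by
      refine h2.congr_of_eventuallyEq ?_
      filter_upwards [hkh] with z hz
      rw [hz, h1, pow_one, smul_eq_mul]
    have h4 : HasDerivAt (fun z => f z - f z₀) 0 z₀ := by
      rw [← hd0]
      exact hfa.differentiableAt.hasDerivAt.sub_const _
    exact hh0 (h3.unique h4)
  obtain ⟨c, hc⟩ := IsAlgClosed.exists_pow_nat_eq (h z₀) (Nat.pos_of_ne_zero hn0)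
  have hc0 : c ≠ 0 := by
    rintro rfl
    rw [zero_pow hn0] at hc
    exact hh0 hc.symm
  -- the local coordinate of which `f - f z₀` is the `n`-th power
  set ψ : ℂ → ℂ := fun z => (z - z₀) * (c * (h z / h z₀) ^ ((n : ℂ)⁻¹)) with hψ
  have hla : AnalyticAt ℂ (fun z => c * (h z / h z₀) ^ ((n : ℂ)⁻¹)) z₀ := by
    refine analyticAt_const.mul ((hh.div analyticAt_const hh0).cpow analyticAt_const ?_)
    simp [hh0]
  have hψa : AnalyticAt ℂ ψ z₀ := (analyticAt_id.sub analyticAt_const).mul hla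
  have hψn : ∀ᶠ z in 𝓝 z₀, f z - f z₀ = ψ z ^ n := by
    filter_upwards [hkh] with z hz
    rw [hz, hψ]
    simp only [smul_eq_mul, mul_pow]
    rw [hc, Complex.cpow_nat_inv_pow _ hn0, mul_div_cancel₀ _ hh0]
  have hψd : deriv ψ z₀ = c := by
    have h2 : HasDerivAt ψ (1 * (c * (h z₀ / h z₀) ^ ((n : ℂ)⁻¹)) + (z₀ - z₀) * _) z₀ :=
      ((hasDerivAt_id z₀).sub_const z₀).mul hla.differentiableAt.hasDerivAt
    rw [h2.deriv]
    simp [hh0]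
  have hψd0 : deriv ψ z₀ ≠ 0 := by rwa [hψd]
  set ρ := hψa.hasStrictDerivAt.localInverse _ _ _ hψd0 with hρ
  have hψ0 : ψ z₀ = 0 := by simp [hψ]
  have hright : ∀ᶠ v in 𝓝 (ψ z₀), ψ (ρ v) = v := HasStrictDerivAt.eventually_right_inverse _ _
  have hρt : Tendsto ρ (𝓝 (ψ z₀)) (𝓝 z₀) := by
    have h1 : ContinuousAt ρ (ψ z₀) := (hψa.analyticAt_localInverse hψd0).continuousAt
    have h2 : ρ (ψ z₀) = z₀ :=
      (HasStrictDerivAt.eventually_left_inverse hψa.hasStrictDerivAt hψd0).self_of_nhds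
    have := h1.tendsto
    rwa [h2] at this
  have hgood : ∀ᶠ v in 𝓝 (ψ z₀), ψ (ρ v) = v ∧ ρ v ∈ U ∧ f (ρ v) - f z₀ = ψ (ρ v) ^ n := by
    filter_upwards [hright, hρt.eventually (hU.mem_nhds hz₀), hρt.eventually hψn] with v h1 h2 h3
    exact ⟨h1, h2, h3⟩
  rw [hψ0] at hgood
  set e : ℂ := Complex.exp (2 * Real.pi * Complex.I / n) with he
  have hprim : IsPrimitiveRoot e n := Complex.isPrimitiveRoot_exp n hn0
  have ht1 : Tendsto (fun δ : ℂ => δ * e) (𝓝 0) (𝓝 0) := by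
    have : Continuous fun δ : ℂ => δ * e := by fun_prop
    simpa using this.tendsto 0
  have hev : ∀ᶠ δ in 𝓝[≠] (0 : ℂ), ((ψ (ρ δ) = δ ∧ ρ δ ∈ U ∧ f (ρ δ) - f z₀ = ψ (ρ δ) ^ n) ∧
      (ψ (ρ (δ * e)) = δ * e ∧ ρ (δ * e) ∈ U ∧ f (ρ (δ * e)) - f z₀ = ψ (ρ (δ * e)) ^ n)) ∧
      δ ≠ 0 := by
    filter_upwards [hgood.filter_mono nhdsWithin_le_nhds,
      (ht1.eventually hgood).filter_mono nhdsWithin_le_nhds, self_mem_nhdsWithin] with δ h1 h2 h3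
    exact ⟨⟨h1, h2⟩, h3⟩
  obtain ⟨δ, ⟨⟨h1, h2, h3⟩, ⟨h4, h5, h6⟩⟩, h7⟩ := hev.exists
  have heq : f (ρ δ) = f (ρ (δ * e)) := by
    rw [h1] at h3
    rw [h4, mul_pow, hprim.pow_eq_one, mul_one, ← h3] at h6
    exact (sub_left_inj.1 h6).symm
  have h8 := hinj h2 h5 heq
  have h9 : δ = δ * e := by rw [← h4, ← h8, h1]
  have h10 : e = 1 := by
    have : δ * e = δ * 1 := by rw [mul_one]; exact h9.symm
    exact mul_left_cancel₀ h7 this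
  exact hn1 (hprim.unique (h10 ▸ IsPrimitiveRoot.one))

/-- The inverse of an injective holomorphic function is holomorphic. -/
theorem hasDerivAt_invFunOn {U : Set ℂ} (hU : IsOpen U) {f : ℂ → ℂ}
    (hf : DifferentiableOn ℂ f U) (hinj : InjOn f U) {z : ℂ} (hz : z ∈ U) :
    HasDerivAt (Function.invFunOn f U) (deriv f z)⁻¹ (f z) := by
  have hfa : AnalyticAt ℂ f z := hf.analyticAt (hU.mem_nhds hz)
  have hd := deriv_ne_zero_of_injOn hU hf hinj hz
  have := hfa.hasStrictDerivAt.to_local_left_inverse hd (g := Function.invFunOn f U) (by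
    filter_upwards [hU.mem_nhds hz] with w hw
    exact hinj.leftInvOn_invFunOn hw)
  exact this.hasDerivAt

/-- An analytic function is locally the square of the derivative of an analytic function, away from
its zeros. -/
theorem exists_analyticAt_deriv_sq_eq {q : ℂ → ℂ} {w : ℂ} (hq : AnalyticAt ℂ q w) (h0 : q w ≠ 0) :
    ∃ Φ : ℂ → ℂ, AnalyticAt ℂ Φ w ∧ Φ w = 0 ∧ deriv Φ w ≠ 0 ∧
      ∀ᶠ z in 𝓝 w, deriv Φ z ^ 2 = q z := by
  obtain ⟨c, hc⟩ := IsAlgClosed.exists_pow_nat_eq (q w) two_pos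
  have hc0 : c ≠ 0 := by
    rintro rfl
    exact h0 (by rw [← hc]; simp)
  set s : ℂ → ℂ := fun z => c * (q z / q w) ^ ((2 : ℂ)⁻¹) with hs
  have hsa : AnalyticAt ℂ s w := by
    refine analyticAt_const.mul ((hq.div analyticAt_const h0).cpow analyticAt_const ?_)
    simp [h0]
  have hs2 : ∀ z, s z ^ 2 = q z := by
    intro z
    simp only [hs, mul_pow]
    have := Complex.cpow_nat_inv_pow (q z / q w) two_ne_zero
    rw [Nat.cast_ofNat] at this
    rw [hc, this, mul_div_cancel₀ _ h0]
  obtain ⟨ε, hε, hball⟩ := Metric.eventually_nhds_iff_ball.1 hsa.eventually_analyticAt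
  have hsd : DifferentiableOn ℂ s (Metric.ball w ε) := fun z hz =>
    (hball z hz).differentiableAt.differentiableWithinAt
  obtain ⟨Φ, hΦ0, hΦ⟩ := hsd.isExactOn_ball.with_val_at w 0
  have hΦd : DifferentiableOn ℂ Φ (Metric.ball w ε) := fun z hz =>
    (hΦ z hz).differentiableAt.differentiableWithinAt
  refine ⟨Φ, hΦd.analyticAt (Metric.ball_mem_nhds w hε), hΦ0, ?_, ?_⟩
  · rw [(hΦ w (Metric.mem_ball_self hε)).deriv]
    intro h
    have := hs2 w
    rw [h] at this
    exact h0 (by rw [← this]; simp)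
  · filter_upwards [Metric.ball_mem_nhds w hε] with z hz
    rw [(hΦ z hz).deriv, hs2]

/-! ### Quadratic differentials at a boundary point -/

theorem mul_cpow_of_re_pos {a b : ℂ} (ha : 0 < a.re) (hb : 0 < b.re) (α : ℂ) :
    (a * b) ^ α = a ^ α * b ^ α := by
  have h1 := abs_lt.1 (Complex.abs_arg_lt_pi_div_two_iff.2 (Or.inl ha))
  have h2 := abs_lt.1 (Complex.abs_arg_lt_pi_div_two_iff.2 (Or.inl hb))
  have ha0 : a ≠ 0 := fun h => by simp [h] at ha
  have hb0 : b ≠ 0 := fun h => by simp [h] at hb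
  rw [Complex.cpow_def_of_ne_zero ha0, Complex.cpow_def_of_ne_zero hb0,
    Complex.cpow_def_of_ne_zero (mul_ne_zero ha0 hb0),
    Complex.log_mul ha0 hb0 ⟨by linarith, by linarith⟩, add_mul, Complex.exp_add]

theorem re_neg_I_mul (z : ℂ) : (-Complex.I * z).re = z.im := by simp

/-- The function `q` behaves at the real point `x`, seen from the upper half-plane, like a constant
multiple of `(z - x)^m`, up to a factor that is analytic at `x` and real on the real axis. The power
is normalized so as to be analytic across the real axis to both sides of `x`. -/
def HasBoundaryExponent (q : ℂ → ℂ) (x m : ℝ) : Prop :=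
  ∃ C : ℂ, C ≠ 0 ∧ ∃ k : ℂ → ℂ, IsRealAnalyticAt k x ∧ k x ≠ 0 ∧
    ∀ᶠ z in 𝓝[upperHalf] (x : ℂ), q z = C * ((-Complex.I * (z - x)) ^ (m : ℂ) * k z)

namespace HasBoundaryExponent

variable {q p : ℂ → ℂ} {x m n : ℝ}

theorem congr (hq : HasBoundaryExponent q x m) (h : q =ᶠ[𝓝[upperHalf] (x : ℂ)] p) :
    HasBoundaryExponent p x m := by
  obtain ⟨C, hC, k, hk, hk0, hqk⟩ := hq
  refine ⟨C, hC, k, hk, hk0, ?_⟩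
  filter_upwards [hqk, h] with z h1 h2
  rw [← h2, h1]

theorem of_isRealAnalyticAt {k : ℂ → ℂ} (hk : IsRealAnalyticAt k x) (h0 : k x ≠ 0) :
    HasBoundaryExponent k x 0 :=
  ⟨1, one_ne_zero, k, hk, h0, by simp⟩

theorem const {C : ℂ} (hC : C ≠ 0) : HasBoundaryExponent (fun _ => C) x 0 :=
  ⟨C, hC, fun _ => ((1 : ℝ) : ℂ), IsRealAnalyticAt.const 1, by simp, by simp⟩

theorem mul (hq : HasBoundaryExponent q x m) (hp : HasBoundaryExponent p x n) :
    HasBoundaryExponent (fun z => q z * p z) x (m + n) := by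
  obtain ⟨C, hC, k, hk, hk0, hqk⟩ := hq
  obtain ⟨D, hD, l, hl, hl0, hpl⟩ := hp
  refine ⟨C * D, mul_ne_zero hC hD, fun z => k z * l z, hk.mul hl, mul_ne_zero hk0 hl0, ?_⟩
  filter_upwards [hqk, hpl, self_mem_nhdsWithin] with z h1 h2 h3
  have h3 : 0 < z.im := h3
  have h4 : -Complex.I * (z - x) ≠ 0 := fun h => by
    have := re_neg_I_mul (z - x)
    rw [h] at this
    simp at this
    exact h3.ne this
  rw [h1, h2]
  push_cast
  rw [Complex.cpow_add _ _ h4]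
  ring

theorem inv (hq : HasBoundaryExponent q x m) : HasBoundaryExponent (fun z => (q z)⁻¹) x (-m) := by
  obtain ⟨C, hC, k, hk, hk0, hqk⟩ := hq
  refine ⟨C⁻¹, inv_ne_zero hC, fun z => (k z)⁻¹, hk.inv hk0, inv_ne_zero hk0, ?_⟩
  filter_upwards [hqk] with z h1
  rw [h1, mul_inv, mul_inv, Complex.ofReal_neg, Complex.cpow_neg]

theorem div (hq : HasBoundaryExponent q x m) (hp : HasBoundaryExponent p x n) :
    HasBoundaryExponent (fun z => q z / p z) x (m - n) := by
  simpa only [div_eq_mul_inv, sub_eq_add_neg] using hq.mul hp.inv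

theorem finset_prod {ι : Type*} (s : Finset ι) {q : ι → ℂ → ℂ} {m : ι → ℝ}
    (hq : ∀ i ∈ s, HasBoundaryExponent (q i) x (m i)) :
    HasBoundaryExponent (fun z => ∏ i ∈ s, q i z) x (∑ i ∈ s, m i) := by
  classical
  induction s using Finset.induction_on with
  | empty => simpa using const (x := x) one_ne_zero
  | insert a s ha ih =>
    simp only [Finset.prod_insert ha, Finset.sum_insert ha]
    exact (hq a (Finset.mem_insert_self a s)).mul
      (ih fun i hi => hq i (Finset.mem_insert_of_mem hi))

/-- The analytic factor may be normalized to have the value `1` at the point. -/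
theorem normalize (hq : HasBoundaryExponent q x m) :
    ∃ C : ℂ, C ≠ 0 ∧ ∃ k : ℂ → ℂ, IsRealAnalyticAt k x ∧ k x = 1 ∧
      ∀ᶠ z in 𝓝[upperHalf] (x : ℂ), q z = C * ((-Complex.I * (z - x)) ^ (m : ℂ) * k z) := by
  obtain ⟨C, hC, k, hk, hk0, hqk⟩ := hq
  refine ⟨C * k x, mul_ne_zero hC hk0, fun z => k z / (((k x).re : ℝ) : ℂ),
    hk.div (IsRealAnalyticAt.const _) (by rwa [hk.ofReal_re]),
    by rw [hk.ofReal_re]; exact div_self hk0, ?_⟩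
  filter_upwards [hqk] with z h1
  rw [h1, hk.ofReal_re]
  field_simp

end HasBoundaryExponent

/-- **Normal form of a quadratic differential** at a boundary point, for exponents `m > -2`: in a
suitable coordinate `ω` that is real on the real axis, it is a constant multiple of `ω^m dω²`. -/
theorem exists_normal_form {x m : ℝ} (hm : -2 < m) {k : ℂ → ℂ} (hk : IsRealAnalyticAt k x)
    (hk1 : k x = 1) :
    ∃ ω : ℂ → ℂ, IsRealAnalyticAt ω x ∧ ω x = 0 ∧ deriv ω x = 1 ∧
      ∀ᶠ z in 𝓝[upperHalf] (x : ℂ), (-Complex.I * ω z) ^ (m : ℂ) * deriv ω z ^ 2 =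
        (-Complex.I * (z - x)) ^ (m : ℂ) * k z := by
  set β : ℝ := (m + 2) / 2 with hβ
  have hβ0 : 0 < β := by rw [hβ]; linarith
  have hβc : (β : ℂ) ≠ 0 := by exact_mod_cast hβ0.ne'
  have hs : IsRealAnalyticAt (fun z => k z ^ ((1 / 2 : ℝ) : ℂ)) x := hk.cpow (by simp [hk1]) _
  obtain ⟨ε, hε, hball⟩ := Metric.eventually_nhds_iff_ball.1 hs.analytic.eventually_analyticAt
  obtain ⟨δ, hδ, hballr⟩ := Metric.eventually_nhds_iff_ball.1 hs.real
  obtain ⟨κ, hκd, hκ, hκr⟩ := exists_solution_euler_equation (U := Metric.ball 0 ε)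
    Metric.isOpen_ball (h := fun ζ => k (x + ζ) ^ ((1 / 2 : ℝ) : ℂ)) (β := β)
    (fun z hz s hs => by
      rw [mem_ball_zero_iff] at hz ⊢
      rw [norm_mul, Complex.norm_real, Real.norm_of_nonneg hs.1]
      exact (mul_le_of_le_one_left (norm_nonneg z) hs.2).trans_lt hz)
    (fun z hz => by
      have h1 := (hball (x + z) (by simpa using hz)).differentiableAt
      exact (h1.comp z (by fun_prop)).differentiableWithinAt) hβ0
  have h0mem : (0 : ℂ) ∈ Metric.ball (0 : ℂ) ε := Metric.mem_ball_self hε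
  have hκ0 : κ 0 = 1 := by
    have := hκ 0 h0mem
    simp only [zero_mul, zero_add, add_zero, hk1, Complex.one_cpow, mul_one] at this
    exact mul_left_cancel₀ hβc (by rw [this, mul_one])
  have hκa : IsRealAnalyticAt κ 0 := by
    refine ⟨by simpa using hκd.analyticAt (Metric.isOpen_ball.mem_nhds h0mem), ?_⟩
    filter_upwards [Metric.ball_mem_nhds (0 : ℝ) hδ] with y hy
    refine hκr _ fun s hs => ?_
    have h1 : x + s * y ∈ Metric.ball x δ := by
      rw [Metric.mem_ball, dist_eq_norm, sub_zero] at hy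
      rw [Metric.mem_ball, dist_eq_norm, add_sub_cancel_left, norm_mul, Real.norm_of_nonneg hs.1]
      exact (mul_le_of_le_one_left (norm_nonneg y) hs.2).trans_lt hy
    have := hballr _ h1
    push_cast at this ⊢
    exact this
  have hsub : IsRealAnalyticAt (fun z : ℂ => z - x) x :=
    IsRealAnalyticAt.id.sub (IsRealAnalyticAt.const x)
  have hκx : IsRealAnalyticAt (fun z => κ (z - x)) x := hκa.comp hsub (by simp)
  have hP : IsRealAnalyticAt (fun z => κ (z - x) ^ ((1 / β : ℝ) : ℂ)) x :=
    hκx.cpow (by simp [hκ0]) _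
  refine ⟨fun z => (z - x) * κ (z - x) ^ ((1 / β : ℝ) : ℂ), hsub.mul hP, by simp, ?_, ?_⟩
  · have h1 : HasDerivAt (fun z : ℂ => (z - x) * κ (z - x) ^ ((1 / β : ℝ) : ℂ)) _ (x : ℂ) :=
      ((hasDerivAt_id (x : ℂ)).sub_const (x : ℂ)).mul hP.analytic.differentiableAt.hasDerivAt
    rw [h1.deriv]
    simp [hκ0]
  · have hsubt : Tendsto (fun z : ℂ => z - x) (𝓝 (x : ℂ)) (𝓝 0) := by
      have : Continuous fun z : ℂ => z - x := by fun_prop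
      simpa using this.tendsto (x : ℂ)
    have hκt : Tendsto (fun z : ℂ => κ (z - x)) (𝓝 (x : ℂ)) (𝓝 1) := by
      have := hκx.analytic.continuousAt.tendsto
      simpa [hκ0] using this
    have hlog : Tendsto (fun z : ℂ => Complex.log (κ (z - x))) (𝓝 (x : ℂ)) (𝓝 0) := by
      have h1 : ContinuousAt Complex.log 1 := continuousAt_clog (by simp)
      have := h1.tendsto.comp hκt
      rw [Complex.log_one] at this
      exact this
    have hlogβ : Tendsto (fun z : ℂ => (Complex.log (κ (z - x)) * ((1 / β : ℝ) : ℂ)).im)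
        (𝓝 (x : ℂ)) (𝓝 0) := by
      have := (Complex.continuous_im.tendsto _).comp (hlog.mul_const ((1 / β : ℝ) : ℂ))
      rw [zero_mul, Complex.zero_im] at this
      exact this
    have hPt : Tendsto (fun z : ℂ => (κ (z - x) ^ ((1 / β : ℝ) : ℂ)).re) (𝓝 (x : ℂ)) (𝓝 1) := by
      have := (Complex.continuous_re.tendsto _).comp hP.analytic.continuousAt.tendsto
      simpa [hκ0, Function.comp_def] using this
    have hκre : Tendsto (fun z : ℂ => (κ (z - x)).re) (𝓝 (x : ℂ)) (𝓝 1) := by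
      exact (Complex.continuous_re.tendsto _).comp hκt
    have hpi := Real.pi_pos
    filter_upwards [self_mem_nhdsWithin,
      mem_nhdsWithin_of_mem_nhds (hsubt.eventually (Metric.isOpen_ball.mem_nhds h0mem)),
      mem_nhdsWithin_of_mem_nhds (hlogβ.eventually (Ioo_mem_nhds (neg_lt_zero.2 hpi) hpi)),
      mem_nhdsWithin_of_mem_nhds (hPt.eventually_const_lt (zero_lt_one)),
      mem_nhdsWithin_of_mem_nhds (hκre.eventually_const_lt zero_lt_one)] with z hz hzb hzl hzP hzκ
    have hz : 0 < z.im := hz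
    have hκne : κ (z - x) ≠ 0 := fun h => by rw [h] at hzκ; simp at hzκ
    have hd : HasDerivAt (fun z : ℂ => κ (z - x)) (deriv κ (z - x)) z :=
      ((hκd.differentiableAt (Metric.isOpen_ball.mem_nhds hzb)).hasDerivAt).comp_sub_const z x
    have hdP : HasDerivAt (fun z : ℂ => κ (z - x) ^ ((1 / β : ℝ) : ℂ))
        (((1 / β : ℝ) : ℂ) * κ (z - x) ^ (((1 / β : ℝ) : ℂ) - 1) * deriv κ (z - x)) z :=
      hd.cpow_const (Or.inl hzκ)
    have hdω : HasDerivAt (fun z : ℂ => (z - x) * κ (z - x) ^ ((1 / β : ℝ) : ℂ)) _ z :=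
      ((hasDerivAt_id z).sub_const (x : ℂ)).mul hdP
    rw [hdω.deriv]
    have hsq : (k z ^ ((1 / 2 : ℝ) : ℂ)) ^ 2 = k z := by
      rw [← Complex.cpow_nat_mul]
      simp
    have heq := hκ _ hzb
    simp only [add_sub_cancel] at heq
    rw [show -Complex.I * ((z - x) * κ (z - x) ^ ((1 / β : ℝ) : ℂ)) =
      (-Complex.I * (z - x)) * κ (z - x) ^ ((1 / β : ℝ) : ℂ) by ring,
      mul_cpow_of_re_pos (by rw [re_neg_I_mul]; simpa using hz) hzP,
      ← Complex.cpow_mul _ hzl.1 hzl.2.le, Complex.cpow_sub _ _ hκne, Complex.cpow_one]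
    set A := κ (z - x) with hA
    have hexp : A ^ (((1 / β : ℝ) : ℂ) * (m : ℂ)) * (A ^ ((1 / β : ℝ) : ℂ)) ^ 2 = A ^ 2 := by
      rw [← Complex.cpow_nat_mul, ← Complex.cpow_add _ _ hκne, ← Complex.cpow_natCast]
      congr 1
      have hm' : (m : ℂ) = 2 * β - 2 := by rw [hβ]; push_cast; ring
      rw [hm']
      push_cast
      field_simp
      ring
    have h2 : (id z - (x : ℂ)) = z - x := rfl
    rw [h2, one_mul]
    have h3 : A ^ ((1 / β : ℝ) : ℂ) + (z - x) * (((1 / β : ℝ) : ℂ) *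
        (A ^ ((1 / β : ℝ) : ℂ) / A) * deriv κ (z - x)) =
        A ^ ((1 / β : ℝ) : ℂ) * k z ^ ((1 / 2 : ℝ) : ℂ) / A := by
      have h4 : k z ^ ((1 / 2 : ℝ) : ℂ) = ((z - x) * deriv κ (z - x) + β * A) / β := by
        rw [heq]; field_simp
      rw [h4]
      push_cast
      field_simp
      ring
    rw [h3, div_pow, mul_pow, hsq]
    rw [mul_div_assoc', div_eq_iff (pow_ne_zero 2 hκne)]
    linear_combination ((-Complex.I * (z - x)) ^ (m : ℂ) * k z) * hexp

/-! ### Trajectories near a boundary point -/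

/-- If the square of the derivative of a curve is positive, the curve is horizontal, and it is
traversed in one direction. -/
theorem im_eq_zero_and_re_sign_of_sq_pos {y v : ℝ → ℂ} {a b : ℝ}
    (hy : ∀ t ∈ Ioo a b, HasDerivAt y (v t) t) (hv : ∀ t ∈ Ioo a b, ∃ r : ℝ, 0 < r ∧ v t ^ 2 = r) :
    (∀ t ∈ Ioo a b, (v t).im = 0) ∧
      ((∀ t ∈ Ioo a b, (v t).re < 0) ∨ ∀ t ∈ Ioo a b, 0 < (v t).re) := by
  have h0 : ∀ t ∈ Ioo a b, (v t).im = 0 ∧ (v t).re ≠ 0 := by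
    intro t ht
    obtain ⟨r, hr, hvr⟩ := hv t ht
    have h1 := congrArg Complex.re hvr
    have h2 := congrArg Complex.im hvr
    simp only [sq, Complex.mul_re, Complex.mul_im, Complex.ofReal_re, Complex.ofReal_im] at h1 h2
    have hre : (v t).re ≠ 0 := fun h => by rw [h] at h1; nlinarith [sq_nonneg (v t).im]
    refine ⟨?_, hre⟩
    have : (v t).re * (v t).im = 0 := by linarith
    exact (mul_eq_zero.1 this).resolve_left hre
  refine ⟨fun t ht => (h0 t ht).1, ?_⟩
  apply hasDerivWithinAt_forall_lt_or_forall_gt_of_forall_ne (f := fun t => (y t).re)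
    (convex_Ioo a b)
  · intro t ht
    exact (Complex.reCLM.hasFDerivAt.comp_hasDerivAt t (hy t ht)).hasDerivWithinAt
  · exact fun t ht => (h0 t ht).2

theorem im_eq_of_sq_pos {y v : ℝ → ℂ} {a b : ℝ}
    (hy : ∀ t ∈ Ioo a b, HasDerivAt y (v t) t) (hv : ∀ t ∈ Ioo a b, ∃ r : ℝ, 0 < r ∧ v t ^ 2 = r)
    {s t : ℝ} (hs : s ∈ Ioo a b) (ht : t ∈ Ioo a b) : (y s).im = (y t).im := by
  have h := (convex_Ioo a b).norm_image_sub_le_of_norm_hasDerivWithin_le (f := fun t => (y t).im)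
    (f' := fun t => (v t).im) (C := 0)
    (fun t ht => (Complex.imCLM.hasFDerivAt.comp_hasDerivAt t (hy t ht)).hasDerivWithinAt)
    (fun t ht => by rw [(im_eq_zero_and_re_sign_of_sq_pos hy hv).1 t ht, norm_zero]) ht hs
  rw [zero_mul] at h
  exact sub_eq_zero.1 (norm_le_zero_iff.1 h)

theorem strictMonoOn_or_strictAntiOn_re_of_sq_pos {y v : ℝ → ℂ} {a b : ℝ}
    (hy : ∀ t ∈ Ioo a b, HasDerivAt y (v t) t) (hv : ∀ t ∈ Ioo a b, ∃ r : ℝ, 0 < r ∧ v t ^ 2 = r) :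
    StrictMonoOn (fun t => (y t).re) (Ioo a b) ∨ StrictAntiOn (fun t => (y t).re) (Ioo a b) := by
  have hd : ∀ t ∈ Ioo a b, HasDerivAt (fun t => (y t).re) (v t).re t := fun t ht =>
    Complex.reCLM.hasFDerivAt.comp_hasDerivAt t (hy t ht)
  have hc : ContinuousOn (fun t => (y t).re) (Ioo a b) := fun t ht =>
    (hd t ht).continuousAt.continuousWithinAt
  rcases (im_eq_zero_and_re_sign_of_sq_pos hy hv).2 with h | h
  · right
    refine strictAntiOn_of_deriv_neg (convex_Ioo a b) hc fun t ht => ?_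
    rw [interior_Ioo] at ht
    rw [(hd t ht).deriv]
    exact h t ht
  · left
    refine strictMonoOn_of_deriv_pos (convex_Ioo a b) hc fun t ht => ?_
    rw [interior_Ioo] at ht
    rw [(hd t ht).deriv]
    exact h t ht

/-- A horizontal curve that starts at `0` stays on one of the two real half-lines. -/
theorem real_and_ne_zero_of_sq_pos {y v : ℝ → ℂ} {b : ℝ}
    (hy : ∀ t ∈ Ioo 0 b, HasDerivAt y (v t) t) (hv : ∀ t ∈ Ioo 0 b, ∃ r : ℝ, 0 < r ∧ v t ^ 2 = r)
    (hlim : Tendsto y (𝓝[>] 0) (𝓝 0)) {t : ℝ} (ht : t ∈ Ioo 0 b) : (y t).im = 0 ∧ y t ≠ 0 := by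
  have hb : 0 < b := ht.1.trans ht.2
  have hev : ∀ᶠ s : ℝ in 𝓝[>] 0, s ∈ Ioo 0 b := Ioo_mem_nhdsGT hb
  have him : (y t).im = 0 := by
    have h1 : Tendsto (fun s => (y s).im) (𝓝[>] 0) (𝓝 0) := by
      have := (Complex.continuous_im.tendsto _).comp hlim
      rwa [Complex.zero_im] at this
    refine tendsto_nhds_unique (tendsto_const_nhds.congr' ?_) h1
    filter_upwards [hev] with s hs using im_eq_of_sq_pos hy hv ht hs
  refine ⟨him, fun h0 => ?_⟩
  have hre : Tendsto (fun s => (y s).re) (𝓝[>] 0) (𝓝 0) := by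
    have := (Complex.continuous_re.tendsto _).comp hlim
    rwa [Complex.zero_re] at this
  -- the value at `t / 2` separates the value at `t` from the limit at `0`
  have ht2 : t / 2 ∈ Ioo 0 b := ⟨by linarith [ht.1], by linarith [ht.1, ht.2]⟩
  have hev2 : ∀ᶠ s : ℝ in 𝓝[>] 0, s ∈ Ioo 0 (t / 2) := Ioo_mem_nhdsGT ht2.1
  rcases strictMonoOn_or_strictAntiOn_re_of_sq_pos hy hv with h | h
  · have h1 : (y (t / 2)).re < 0 := by
      have := h ht2 ht (by linarith [ht.1])
      simpa [h0] using this
    have h2 : (0 : ℝ) ≤ (y (t / 2)).re := by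
      refine le_of_tendsto hre ?_
      filter_upwards [hev2] with s hs
      exact (h ⟨hs.1, hs.2.trans ht2.2⟩ ht2 hs.2).le
    linarith
  · have h1 : 0 < (y (t / 2)).re := by
      have := h ht2 ht (by linarith [ht.1])
      simpa [h0] using this
    have h2 : (y (t / 2)).re ≤ 0 := by
      refine ge_of_tendsto hre ?_
      filter_upwards [hev2] with s hs
      exact (h ⟨hs.1, hs.2.trans ht2.2⟩ ht2 hs.2).le
    linarith

/-- A continuous positive function that tends to `0` at `0` does not change the germ of `(0, ∞)`
at `0`. -/
theorem map_nhdsGT_zero_eq {ρ : ℝ → ℝ} {ε : ℝ} (hε : 0 < ε) (hc : ContinuousOn ρ (Ioo 0 ε))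
    (hpos : ∀ t ∈ Ioo 0 ε, 0 < ρ t) (hlim : Tendsto ρ (𝓝[>] 0) (𝓝 0)) :
    map ρ (𝓝[>] 0) = 𝓝[>] 0 := by
  have hev : ∀ᶠ s : ℝ in 𝓝[>] 0, s ∈ Ioo 0 ε := Ioo_mem_nhdsGT hε
  apply le_antisymm
  · refine tendsto_nhdsWithin_of_tendsto_nhds_of_eventually_within _ hlim ?_
    filter_upwards [hev] with s hs using hpos s hs
  · intro S hS
    rw [mem_map, mem_nhdsGT_iff_exists_Ioo_subset] at hS
    obtain ⟨δ, hδ, hsub⟩ := hS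
    have hδ : 0 < δ := hδ
    set t := min δ ε / 2 with ht
    have hmin : 0 < min δ ε := lt_min hδ hε
    have ht0 : 0 < t := by rw [ht]; linarith
    have htδ : t < δ := by rw [ht]; linarith [min_le_left δ ε]
    have htε : t < ε := by rw [ht]; linarith [min_le_right δ ε]
    filter_upwards [Ioo_mem_nhdsGT (hpos t ⟨ht0, htε⟩)] with r hr
    obtain ⟨s, hs1, hs2⟩ := ((hlim.eventually_lt_const hr.1).and (Ioo_mem_nhdsGT ht0)).exists
    have hsub2 : Icc s t ⊆ Ioo 0 ε := fun u hu => ⟨hs2.1.trans_le hu.1, hu.2.trans_lt htε⟩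
    obtain ⟨u, hu, rfl⟩ := intermediate_value_Icc hs2.2.le (hc.mono hsub2) ⟨hs1.le, hr.2.le⟩
    exact hsub ⟨hs2.1.trans_le hu.1, hu.2.trans_lt htδ⟩

/-- `ω` is a local coordinate at the real point `c`, real on the real axis, in which the quadratic
differential `q(z)dz²` is `-ρ e^{2iψ} (-iω)^m dω²`. -/
structure IsModelCoordinate (q ω : ℂ → ℂ) (c m ρ ψ : ℝ) : Prop where
  analytic : IsRealAnalyticAt ω c
  map_zero : ω c = 0
  deriv_eq : deriv ω c = 1
  pos : 0 < ρ
  eq : ∀ᶠ z in 𝓝[upperHalf] (c : ℂ), q z =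
    -(ρ * Complex.exp (2 * ψ * Complex.I)) * ((-Complex.I * ω z) ^ (m : ℂ) * deriv ω z ^ 2)

theorem HasBoundaryExponent.exists_isModelCoordinate {q : ℂ → ℂ} {c m : ℝ}
    (hq : HasBoundaryExponent q c m) (hm : -2 < m) :
    ∃ (ω : ℂ → ℂ) (ρ ψ : ℝ), IsModelCoordinate q ω c m ρ ψ := by
  obtain ⟨C, hC, k, hk, hk1, hqk⟩ := hq.normalize
  obtain ⟨ω, hω, hω0, hω1, hωk⟩ := exists_normal_form hm hk hk1
  refine ⟨ω, ‖C‖, (-C).arg / 2, hω, hω0, hω1, norm_pos_iff.2 hC, ?_⟩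
  filter_upwards [hqk, hωk] with z h1 h2
  rw [h1, h2]
  congr 1
  have := Complex.norm_mul_exp_arg_mul_I (-C)
  rw [norm_neg] at this
  push_cast
  rw [mul_div_cancel₀ _ (two_ne_zero' ℂ), this, neg_neg]

namespace IsModelCoordinate

variable {q ω : ℂ → ℂ} {c m ρ ψ : ℝ}

theorem eventually_im_pos (h : IsModelCoordinate q ω c m ρ ψ) :
    ∀ᶠ z in 𝓝[upperHalf] (c : ℂ), 0 < (ω z).im := by
  filter_upwards [self_mem_nhdsWithin,
    mem_nhdsWithin_of_mem_nhds (h.analytic.eventually_im_pos (by simp [h.deriv_eq]))] with z h1 h2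
  exact h2.1 h1

theorem tendsto_zero (h : IsModelCoordinate q ω c m ρ ψ) :
    Tendsto ω (𝓝 (c : ℂ)) (𝓝 0) := by
  have := h.analytic.analytic.continuousAt.tendsto
  rwa [h.map_zero] at this

/-- A model coordinate has an inverse that is real on the real axis, and in the inverse coordinate
the quadratic differential is exactly a constant multiple of `(-iu)^m du²`. -/
theorem exists_inverse (h : IsModelCoordinate q ω c m ρ ψ) :
    ∃ Ψ : ℂ → ℂ, IsRealAnalyticAt Ψ 0 ∧ Ψ 0 = c ∧ 0 < (deriv Ψ 0).re ∧
      (∀ᶠ u in 𝓝 (0 : ℂ), ω (Ψ u) = u) ∧ (∀ᶠ z in 𝓝 (c : ℂ), Ψ (ω z) = z) ∧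
      ∀ᶠ u in 𝓝[upperHalf] (0 : ℂ), Ψ u ∈ upperHalf ∧ DifferentiableAt ℂ Ψ u ∧
        q (Ψ u) * deriv Ψ u ^ 2 =
          -(ρ * Complex.exp (2 * ψ * Complex.I)) * (-Complex.I * u) ^ (m : ℂ) := by
  obtain ⟨Ψ, hΨ, hΨ0, hΨd, hr, hl⟩ :=
    exists_local_inverse_of_isRealAnalyticAt h.analytic (by simp [h.deriv_eq])
  simp only [h.map_zero, Complex.zero_re, Complex.ofReal_zero] at hΨ hΨ0 hΨd hr
  refine ⟨Ψ, hΨ, hΨ0, hΨd, hr, hl, ?_⟩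
  have hΨt : Tendsto Ψ (𝓝 0) (𝓝 (c : ℂ)) := by
    have := hΨ.analytic.continuousAt.tendsto
    rwa [Complex.ofReal_zero, hΨ0] at this
  have him := hΨ.eventually_im_pos (by simpa using hΨd)
  rw [Complex.ofReal_zero] at him
  have hH : ∀ᶠ u in 𝓝[upperHalf] (0 : ℂ), Ψ u ∈ upperHalf := by
    filter_upwards [self_mem_nhdsWithin, mem_nhdsWithin_of_mem_nhds him] with u h1 h2
    exact h2.1 h1
  have hΨt' : Tendsto Ψ (𝓝[upperHalf] 0) (𝓝[upperHalf] (c : ℂ)) :=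
    tendsto_nhdsWithin_of_tendsto_nhds_of_eventually_within _
      (hΨt.mono_left nhdsWithin_le_nhds) hH
  have ha := hΨ.analytic.eventually_analyticAt
  rw [Complex.ofReal_zero] at ha
  filter_upwards [hH, hΨt'.eventually h.eq, mem_nhdsWithin_of_mem_nhds ha,
    mem_nhdsWithin_of_mem_nhds hr.eventually_nhds,
    mem_nhdsWithin_of_mem_nhds (hΨt.eventually h.analytic.analytic.eventually_analyticAt)]
    with u h1 h2 h3 h4 h5
  refine ⟨h1, h3.differentiableAt, ?_⟩
  have hd : deriv ω (Ψ u) * deriv Ψ u = 1 := by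
    have h6 : HasDerivAt (fun u => ω (Ψ u)) (deriv ω (Ψ u) * deriv Ψ u) u :=
      h5.differentiableAt.hasDerivAt.comp u h3.differentiableAt.hasDerivAt
    exact (h6.congr_of_eventuallyEq (f₁ := fun u => u)
      (by filter_upwards [h4] with v hv using hv.symm)).unique (hasDerivAt_id u)
  rw [h2, h4.self_of_nhds]
  linear_combination (-(ρ * Complex.exp (2 * ψ * Complex.I)) * (-Complex.I * u) ^ (m : ℂ)) *
    (deriv ω (Ψ u) * deriv Ψ u + 1) * hd

/-- A trajectory that ends at a boundary point of exponent `m > -2` is, near its end, a ray in the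
model coordinate: the power `(-iω)^((m+2)/2)` maps it into a straight line, and its direction can
take only countably many values. -/
theorem exists_ray_of_trajectory (h : IsModelCoordinate q ω c m ρ ψ) (hm : -2 < m)
    {z : ℝ → ℂ} {θ ε : ℝ} (hε : 0 < ε)
    (hz : ∀ t ∈ Ioo 0 ε, z t ∈ upperHalf ∧
      ∃ v : ℂ, HasDerivAt z v t ∧ HasArgTwice θ (q (z t) * v ^ 2))
    (hlim : Tendsto z (𝓝[>] 0) (𝓝 (c : ℂ))) :
    ∃ n : ℤ, |θ - ψ + n * Real.pi| < Real.pi / 2 * ((m + 2) / 2) ∧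
      ∀ᶠ t in 𝓝[>] 0, 0 < (ω (z t)).im ∧ ω (z t) = Complex.I * (‖ω (z t)‖ *
        Complex.exp (((θ - ψ + n * Real.pi) / ((m + 2) / 2) : ℝ) * Complex.I)) := by
  set β : ℝ := (m + 2) / 2 with hβ
  have hβ0 : 0 < β := by rw [hβ]; linarith
  have hzH : ∀ᶠ t in 𝓝[>] (0 : ℝ), z t ∈ upperHalf := by
    filter_upwards [Ioo_mem_nhdsGT hε] with t ht using (hz t ht).1
  have hlim' : Tendsto z (𝓝[>] 0) (𝓝[upperHalf] (c : ℂ)) :=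
    tendsto_nhdsWithin_of_tendsto_nhds_of_eventually_within _ hlim hzH
  have hev : ∀ᶠ t in 𝓝[>] (0 : ℝ), t < ε ∧ 0 < (ω (z t)).im ∧ AnalyticAt ℂ ω (z t) ∧
      q (z t) = -(ρ * Complex.exp (2 * ψ * Complex.I)) *
        ((-Complex.I * ω (z t)) ^ (m : ℂ) * deriv ω (z t) ^ 2) := by
    filter_upwards [Ioo_mem_nhdsGT hε, hlim'.eventually h.eventually_im_pos,
      hlim.eventually h.analytic.analytic.eventually_analyticAt, hlim'.eventually h.eq]
      with t h1 h2 h3 h4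
    exact ⟨h1.2, h2, h3, h4⟩
  obtain ⟨b, hb, hsub⟩ := mem_nhdsGT_iff_exists_Ioo_subset.1 hev
  have hb : 0 < b := hb
  have hre : ∀ t ∈ Ioo 0 b, 0 < (-Complex.I * ω (z t)).re := fun t ht => by
    rw [re_neg_I_mul]
    exact (hsub ht).2.1
  have hzt : ∀ t ∈ Ioo 0 b, t ∈ Ioo 0 ε := fun t ht => ⟨ht.1, (hsub ht).1⟩
  choose! v hv using fun t ht => (hz t (hzt t ht)).2
  -- the image of the trajectory under the rotated power of the coordinate
  set E : ℂ := Complex.exp (-((θ - ψ : ℝ) * Complex.I)) with hE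
  set y : ℝ → ℂ := fun t => E * (-Complex.I * ω (z t)) ^ (β : ℂ) with hy
  have hyd : ∀ t ∈ Ioo 0 b, HasDerivAt y (E * (β * (-Complex.I * ω (z t)) ^ ((β : ℂ) - 1) *
      (-Complex.I * (deriv ω (z t) * v t)))) t := by
    intro t ht
    have h1 : HasDerivAt (fun t => ω (z t)) (deriv ω (z t) * v t) t :=
      (hsub ht).2.2.1.differentiableAt.hasDerivAt.comp t (hv t ht).1
    have h2 : HasDerivAt (fun t => -Complex.I * ω (z t)) (-Complex.I * (deriv ω (z t) * v t)) t :=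
      h1.const_mul _
    have h3 : HasDerivAt (fun w : ℂ => w ^ (β : ℂ))
        ((β : ℂ) * (-Complex.I * ω (z t)) ^ ((β : ℂ) - 1)) (-Complex.I * ω (z t)) :=
      (hasDerivAt_id _).cpow_const (Or.inl (hre t ht)) |>.congr_deriv (by simp)
    exact (h3.comp t h2).const_mul E
  have hysq : ∀ t ∈ Ioo 0 b, ∃ r : ℝ, 0 < r ∧ (E * (β * (-Complex.I * ω (z t)) ^ ((β : ℂ) - 1) *
      (-Complex.I * (deriv ω (z t) * v t)))) ^ 2 = r := by
    intro t ht
    obtain ⟨r, hr, hqr⟩ := (hv t ht).2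
    refine ⟨β ^ 2 * r / ρ, by have := h.pos; positivity, ?_⟩
    rw [(hsub ht).2.2.2] at hqr
    have hpow : ((-Complex.I * ω (z t)) ^ ((β : ℂ) - 1)) ^ 2 = (-Complex.I * ω (z t)) ^ (m : ℂ) := by
      rw [← Complex.cpow_nat_mul]
      congr 1
      rw [hβ]
      push_cast
      ring
    have hEE : E ^ 2 * Complex.exp (2 * θ * Complex.I) = Complex.exp (2 * ψ * Complex.I) := by
      rw [hE, ← Complex.exp_nat_mul, ← Complex.exp_add]
      congr 1
      push_cast
      ring
    have hρ : (ρ : ℂ) ≠ 0 := by exact_mod_cast h.pos.ne'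
    have he : Complex.exp (2 * ψ * Complex.I) ≠ 0 := Complex.exp_ne_zero _
    have hX : (-Complex.I * ω (z t)) ^ (m : ℂ) * deriv ω (z t) ^ 2 * v t ^ 2 * ρ * E ^ 2 = -r := by
      have := congrArg (fun x => -(E ^ 2) * x) hqr
      apply mul_left_cancel₀ he
      linear_combination this - r * hEE
    push_cast
    rw [eq_div_iff hρ]
    calc _ = (β : ℂ) ^ 2 * Complex.I ^ 2 * (((-Complex.I * ω (z t)) ^ ((β : ℂ) - 1)) ^ 2 *
          deriv ω (z t) ^ 2 * v t ^ 2 * ρ * E ^ 2) := by ring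
      _ = _ := by
          rw [hpow, hX, Complex.I_sq]
          ring
  have hω0 : Tendsto (fun t => ω (z t)) (𝓝[>] 0) (𝓝 0) := h.tendsto_zero.comp hlim
  have hnorm : ∀ t, ‖y t‖ = ‖ω (z t)‖ ^ β := by
    intro t
    rw [hy]
    simp only [norm_mul, Complex.norm_cpow_real, norm_neg, Complex.norm_I, one_mul]
    rw [hE, ← neg_mul, ← Complex.ofReal_neg, Complex.norm_exp_ofReal_mul_I, one_mul]
  have hy0 : Tendsto y (𝓝[>] 0) (𝓝 0) := by
    rw [tendsto_zero_iff_norm_tendsto_zero]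
    simp only [hnorm]
    have h1 := (tendsto_zero_iff_norm_tendsto_zero.1 hω0).rpow_const (p := β) (Or.inr hβ0.le)
    rwa [Real.zero_rpow hβ0.ne'] at h1
  -- the argument of `-iω` along the trajectory
  have harg : ∀ t ∈ Ioo 0 b, ∃ n : ℤ,
      (-Complex.I * ω (z t)).arg = (θ - ψ + n * Real.pi) / β := by
    intro t ht
    have him := (real_and_ne_zero_of_sq_pos hyd hysq hy0 ht).1
    have hne : -Complex.I * ω (z t) ≠ 0 := fun h0 => by
      have := hre t ht
      rw [h0] at this
      simp at this
    set A := (-Complex.I * ω (z t)).arg with hA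
    have hyt : y t = ((‖ω (z t)‖ ^ β : ℝ) : ℂ) *
        Complex.exp ((β * A - (θ - ψ) : ℝ) * Complex.I) := by
      have hω : 0 < ‖ω (z t)‖ := norm_pos_iff.2 fun h0 => hne (by rw [h0, mul_zero])
      have hnormu : ‖-Complex.I * ω (z t)‖ = ‖ω (z t)‖ := by simp
      rw [hy]
      simp only
      rw [Complex.cpow_def_of_ne_zero hne, Complex.log, hnormu, ← hA, hE, ← Complex.exp_add,
        Real.rpow_def_of_pos hω, Complex.ofReal_exp, ← Complex.exp_add]
      congr 1
      push_cast
      ring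
    rw [hyt, Complex.im_ofReal_mul, Complex.exp_ofReal_mul_I_im] at him
    have hpos : (‖ω (z t)‖ ^ β : ℝ) ≠ 0 := by
      have : 0 < ‖ω (z t)‖ := norm_pos_iff.2 fun h0 => hne (by rw [h0, mul_zero])
      positivity
    obtain ⟨n, hn⟩ := Real.sin_eq_zero_iff.1 ((mul_eq_zero.1 him).resolve_left hpos)
    refine ⟨n, ?_⟩
    rw [hn]
    field_simp
    ring
  have hcont : ContinuousOn (fun t => (-Complex.I * ω (z t)).arg) (Ioo 0 b) := by
    intro t ht
    have h1 : ContinuousAt (fun t => -Complex.I * ω (z t)) t :=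
      continuousAt_const.mul ((hsub ht).2.2.1.continuousAt.comp (hv t ht).1.continuousAt)
    have h2 : ContinuousAt Complex.arg ((fun t => -Complex.I * ω (z t)) t) :=
      Complex.continuousAt_arg (Or.inl (hre t ht))
    exact (ContinuousAt.comp (f := fun t => -Complex.I * ω (z t)) h2 h1).continuousWithinAt
  -- a continuous function with countably many values on an interval is constant
  have hsubs : ((fun t => (-Complex.I * ω (z t)).arg) '' Ioo 0 b).Subsingleton := by
    have hcount : (range fun n : ℤ => (θ - ψ + n * Real.pi) / β).Countable := countable_range _
    refine hcount.isTotallyDisconnected _ ?_ (isPreconnected_Ioo.image _ hcont)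
    rintro _ ⟨t, ht, rfl⟩
    obtain ⟨n, hn⟩ := harg t ht
    exact ⟨n, hn.symm⟩
  have hmid : b / 2 ∈ Ioo 0 b := ⟨by linarith, by linarith⟩
  obtain ⟨n, hn⟩ := harg _ hmid
  have hall : ∀ t ∈ Ioo 0 b, (-Complex.I * ω (z t)).arg = (θ - ψ + n * Real.pi) / β := fun t ht =>
    (hsubs (mem_image_of_mem _ ht) (mem_image_of_mem _ hmid)).trans hn
  refine ⟨n, ?_, ?_⟩
  · have := Complex.abs_arg_lt_pi_div_two_iff.2 (Or.inl (hre _ hmid))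
    rwa [hn, abs_div, abs_of_pos hβ0, div_lt_iff₀ hβ0] at this
  · filter_upwards [Ioo_mem_nhdsGT hb] with t ht
    refine ⟨(hsub ht).2.1, ?_⟩
    have h1 := Complex.norm_mul_exp_arg_mul_I (-Complex.I * ω (z t))
    rw [hall t ht, show ‖-Complex.I * ω (z t)‖ = ‖ω (z t)‖ by simp] at h1
    rw [h1]
    linear_combination ω (z t) * Complex.I_sq

end IsModelCoordinate

/-! ### Trajectories ending at a prime end -/

theorem IsRealAnalyticAt.eventually_re_lt {k : ℂ → ℂ} {x : ℝ} (hk : IsRealAnalyticAt k x)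
    (hpos : 0 < (_root_.deriv k x).re) :
    (∀ᶠ y : ℝ in 𝓝[>] x, (k x).re < (k y).re) ∧ ∀ᶠ y : ℝ in 𝓝[<] x, (k y).re < (k x).re := by
  have hd : HasDerivAt (fun t : ℝ => (k t).re) (_root_.deriv k x).re x :=
    Complex.reCLM.hasFDerivAt.comp_hasDerivAt x hk.analytic.differentiableAt.hasDerivAt.comp_ofReal
  have hs := (hasDerivAt_iff_tendsto_slope.1 hd).eventually_const_lt hpos
  constructor
  · have h1 := hs.filter_mono (nhdsWithin_mono x (fun y (hy : x < y) => ne_of_gt hy))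
    filter_upwards [h1, self_mem_nhdsWithin] with y hy hxy
    rw [slope_def_field, lt_div_iff₀ (sub_pos.2 hxy)] at hy
    linarith
  · have h1 := hs.filter_mono (nhdsWithin_mono x (fun y (hy : y < x) => ne_of_lt hy))
    filter_upwards [h1, self_mem_nhdsWithin] with y hy hxy
    have hxy : y < x := hxy
    rw [slope_def_field, ← neg_div_neg_eq, lt_div_iff₀ (by linarith)] at hy
    linarith

namespace IsModelCoordinate

variable {q ω : ℂ → ℂ} {c m ρ ψ : ℝ}

theorem im_ray_pos {τ t : ℝ} (hτ : |τ| < Real.pi / 2) (ht : 0 < t) :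
    0 < (Complex.I * (t * Complex.exp (τ * Complex.I))).im := by
  rw [Complex.I_mul_im, Complex.re_ofReal_mul, Complex.exp_ofReal_mul_I_re]
  exact mul_pos ht (Real.cos_pos_of_mem_Ioo (abs_lt.1 hτ))

theorem tendsto_ray {τ : ℝ} (hτ : |τ| < Real.pi / 2) :
    Tendsto (fun t : ℝ => Complex.I * (t * Complex.exp (τ * Complex.I))) (𝓝[>] 0)
      (𝓝[upperHalf] 0) := by
  apply tendsto_nhdsWithin_of_tendsto_nhds_of_eventually_within
  · have : Continuous fun t : ℝ => Complex.I * (t * Complex.exp (τ * Complex.I)) := by fun_prop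
    simpa using (this.tendsto 0).mono_left nhdsWithin_le_nhds
  · filter_upwards [self_mem_nhdsWithin] with t ht using im_ray_pos hτ ht

/-- The rays in a model coordinate that occur in `exists_ray_of_trajectory` are trajectories. -/
theorem eventually_hasArgTwice_ray {Ψ : ℂ → ℂ} (hρ : 0 < ρ) (hm : -2 < m)
    (hΨ : ∀ᶠ u in 𝓝[upperHalf] (0 : ℂ), Ψ u ∈ upperHalf ∧ DifferentiableAt ℂ Ψ u ∧
        q (Ψ u) * deriv Ψ u ^ 2 =
          -(ρ * Complex.exp (2 * ψ * Complex.I)) * (-Complex.I * u) ^ (m : ℂ))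
    {θ : ℝ} {n : ℤ} (hn : |θ - ψ + n * Real.pi| < Real.pi / 2 * ((m + 2) / 2)) :
    ∀ᶠ t : ℝ in 𝓝[>] 0, Ψ (Complex.I * (t * Complex.exp
        (((θ - ψ + n * Real.pi) / ((m + 2) / 2) : ℝ) * Complex.I))) ∈ upperHalf ∧
      ∃ v : ℂ, HasDerivAt (fun t : ℝ => Ψ (Complex.I * (t * Complex.exp
        (((θ - ψ + n * Real.pi) / ((m + 2) / 2) : ℝ) * Complex.I)))) v t ∧
      HasArgTwice θ (q (Ψ (Complex.I * (t * Complex.exp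
        (((θ - ψ + n * Real.pi) / ((m + 2) / 2) : ℝ) * Complex.I)))) * v ^ 2) := by
  set β : ℝ := (m + 2) / 2 with hβ
  have hβ0 : 0 < β := by rw [hβ]; linarith
  set τ : ℝ := (θ - ψ + n * Real.pi) / β with hτ
  have hτ' : |τ| < Real.pi / 2 := by
    rw [hτ, abs_div, abs_of_pos hβ0, div_lt_iff₀ hβ0]
    exact hn
  filter_upwards [self_mem_nhdsWithin, (tendsto_ray hτ').eventually hΨ] with t ht hu
  have ht : 0 < t := ht
  obtain ⟨h1, h2, h3⟩ := hu
  refine ⟨h1, deriv Ψ (Complex.I * (t * Complex.exp (τ * Complex.I))) *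
    (Complex.I * Complex.exp (τ * Complex.I)), ?_, ?_⟩
  · have h4 : HasDerivAt (fun t : ℝ => Complex.I * (t * Complex.exp (τ * Complex.I)))
        (Complex.I * Complex.exp (τ * Complex.I)) t := by
      have := ((Complex.ofRealCLM.hasDerivAt (x := t)).mul_const
        (Complex.exp (τ * Complex.I))).const_mul Complex.I
      simpa using this
    exact h2.hasDerivAt.comp t h4
  · refine ⟨ρ * t ^ m, by positivity, ?_⟩
    have h5 : -Complex.I * (Complex.I * (t * Complex.exp (τ * Complex.I))) =
        t * Complex.exp (τ * Complex.I) := by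
      linear_combination (-(t * Complex.exp (τ * Complex.I))) * Complex.I_sq
    have htc : (t : ℂ) ≠ 0 := by exact_mod_cast ht.ne'
    have h6 : ((t : ℂ) * Complex.exp (τ * Complex.I)) ^ (m : ℂ) =
        ((t ^ m : ℝ) : ℂ) * Complex.exp (m * τ * Complex.I) := by
      have hpi := Real.pi_pos
      have hlog : Complex.log (Complex.exp (τ * Complex.I)) = τ * Complex.I :=
        Complex.log_exp (by simp; linarith [(abs_lt.1 hτ').1]) (by
          simp; linarith [(abs_lt.1 hτ').2])
      rw [Complex.cpow_def_of_ne_zero (mul_ne_zero htc (Complex.exp_ne_zero _)),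
        Complex.log_ofReal_mul ht (Complex.exp_ne_zero _), hlog, Real.rpow_def_of_pos ht,
        Complex.ofReal_exp, ← Complex.exp_add]
      congr 1
      push_cast
      ring
    rw [h5, h6] at h3
    have h7 : Complex.exp (2 * ψ * Complex.I) * Complex.exp (m * τ * Complex.I) *
        Complex.exp (τ * Complex.I) ^ 2 = Complex.exp (2 * θ * Complex.I) := by
      rw [← Complex.exp_nat_mul, ← Complex.exp_add, ← Complex.exp_add]
      have h8 : 2 * ψ * Complex.I + m * τ * Complex.I + (2 : ℕ) * (τ * Complex.I) =
          2 * θ * Complex.I + n * (2 * Real.pi * Complex.I) := by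
        have h9 : β * τ = θ - ψ + n * Real.pi := by rw [hτ]; field_simp
        have h10 : (m + 2) * τ = 2 * (θ - ψ + n * Real.pi) := by rw [← h9, hβ]; ring
        have h11 : ((m : ℂ) + 2) * τ = 2 * (θ - ψ + n * Real.pi) := by exact_mod_cast h10
        push_cast
        linear_combination Complex.I * h11
      rw [h8, Complex.exp_add, Complex.exp_int_mul_two_pi_mul_I, mul_one]
    push_cast
    rw [← h7]
    linear_combination (Complex.I * Complex.exp (τ * Complex.I)) ^ 2 * h3 -
      ρ * Complex.exp (2 * ψ * Complex.I) * ((t ^ m : ℝ) : ℂ) * Complex.exp (m * τ * Complex.I) *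
        Complex.exp (τ * Complex.I) ^ 2 * Complex.I_sq

end IsModelCoordinate

/-- The germ at `0` of the positive half-line is invariant under rescaling. -/
theorem map_mul_left_nhdsGT_zero {δ : ℝ} (hδ : 0 < δ) :
    map (fun t : ℝ => δ * t) (𝓝[>] 0) = 𝓝[>] 0 := by
  apply map_nhdsGT_zero_eq one_pos (by fun_prop) (fun t ht => mul_pos hδ ht.1)
  have : Continuous fun t : ℝ => δ * t := by fun_prop
  simpa using (this.tendsto 0).mono_left nhdsWithin_le_nhds

/-- The trajectories that end at a prime end of exponent `m > -2` correspond to the rays in a model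
coordinate. -/
theorem exists_trajectoryEnds_eq_image {Q f ω : ℂ → ℂ} {c m ρ ψ : ℝ}
    (hf : DifferentiableOn ℂ f upperHalf) (hinj : InjOn f upperHalf)
    (h : IsModelCoordinate (fun z => Q (f z) * deriv f z ^ 2) ω c m ρ ψ) (hm : -2 < m) (θ : ℝ) :
    ∃ e : ℤ → Filter ℂ,
      InjOn e {n : ℤ | |θ - ψ + n * Real.pi| < Real.pi / 2 * ((m + 2) / 2)} ∧
      trajectoryEnds Q f c θ =
        e '' {n : ℤ | |θ - ψ + n * Real.pi| < Real.pi / 2 * ((m + 2) / 2)} := by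
  obtain ⟨Ψ, hΨ, hΨ0, hΨd, hr, hl, hΨH⟩ := h.exists_inverse
  have hβ0 : 0 < (m + 2) / 2 := by linarith
  set g := Function.invFunOn f upperHalf with hg
  have hgf : ∀ z ∈ upperHalf, g (f z) = z := fun z hz => hinj.leftInvOn_invFunOn hz
  set ray : ℤ → ℝ → ℂ := fun n t => Ψ (Complex.I * (t * Complex.exp
        (((θ - ψ + n * Real.pi) / ((m + 2) / 2) : ℝ) * Complex.I))) with hray
  have hτ : ∀ n : ℤ, |θ - ψ + n * Real.pi| < Real.pi / 2 * ((m + 2) / 2) →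
      |(θ - ψ + n * Real.pi) / ((m + 2) / 2)| < Real.pi / 2 := by
    intro n hn
    rwa [abs_div, abs_of_pos hβ0, div_lt_iff₀ hβ0]
  have hΨt : Tendsto Ψ (𝓝[upperHalf] 0) (𝓝[upperHalf] (c : ℂ)) := by
    apply tendsto_nhdsWithin_of_tendsto_nhds_of_eventually_within
    · have := hΨ.analytic.continuousAt.tendsto
      rw [Complex.ofReal_zero, hΨ0] at this
      exact this.mono_left nhdsWithin_le_nhds
    · exact hΨH.mono fun u hu => hu.1
  have hrayt : ∀ n : ℤ, |θ - ψ + n * Real.pi| < Real.pi / 2 * ((m + 2) / 2) →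
      Tendsto (ray n) (𝓝[>] 0) (𝓝[upperHalf] (c : ℂ)) := fun n hn =>
    hΨt.comp (IsModelCoordinate.tendsto_ray (hτ n hn))
  refine ⟨fun n => map (fun t => f (ray n t)) (𝓝[>] 0), ?_, ?_⟩
  · -- the direction of a ray can be recovered from its germ
    have hdir : ∀ n : ℤ, |θ - ψ + n * Real.pi| < Real.pi / 2 * ((m + 2) / 2) →
        ∀ᶠ w in map (fun t => f (ray n t)) (𝓝[>] 0),
          (-Complex.I * ω (g w)).arg = (θ - ψ + n * Real.pi) / ((m + 2) / 2) := by
      intro n hn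
      rw [eventually_map]
      filter_upwards [self_mem_nhdsWithin, (hrayt n hn).eventually self_mem_nhdsWithin,
        ((IsModelCoordinate.tendsto_ray (hτ n hn)).mono_right nhdsWithin_le_nhds).eventually hr]
        with t h0 h1 h2
      have h0 : 0 < t := h0
      rw [hgf _ h1, hray]
      simp only
      rw [h2, show -Complex.I * (Complex.I * ((t : ℂ) * Complex.exp
        (((θ - ψ + n * Real.pi) / ((m + 2) / 2) : ℝ) * Complex.I))) = (t : ℂ) * Complex.exp
        (((θ - ψ + n * Real.pi) / ((m + 2) / 2) : ℝ) * Complex.I) by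
          rw [← mul_assoc, neg_mul, Complex.I_mul_I, neg_neg, one_mul],
        Complex.arg_real_mul _ h0, Complex.arg_exp_mul_I, toIocMod_eq_self]
      have := abs_lt.1 (hτ n hn)
      have hpi := Real.pi_pos
      exact ⟨by linarith [this.1], by linarith [this.2]⟩
    intro n hn n' hn' heq
    have heq : map (fun t => f (ray n t)) (𝓝[>] 0) = map (fun t => f (ray n' t)) (𝓝[>] 0) := heq
    have h1 := hdir n hn
    have h2 := hdir n' hn'
    rw [← heq] at h2
    obtain ⟨w, h3, h4⟩ := (h1.and h2).exists
    rw [h3, div_left_inj' hβ0.ne', add_right_inj, mul_left_inj' Real.pi_ne_zero] at h4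
    exact_mod_cast h4
  · apply Subset.antisymm
    · rintro F ⟨σ, hσ, hσt, rfl⟩
      have hmem : ∀ t ∈ Ioo (0 : ℝ) 1, g (σ t) ∈ upperHalf ∧ f (g (σ t)) = σ t := by
        intro t ht
        obtain ⟨z, hz, hzσ⟩ := (hσ t ht).1
        rw [← hzσ, hgf z hz]
        exact ⟨hz, rfl⟩
      have hgσ : Tendsto (fun t => g (σ t)) (𝓝[>] 0) (𝓝 (c : ℂ)) := by
        have h1 : Tendsto g (primeEnd f c) (𝓝 (c : ℂ)) := by
          rw [primeEnd, tendsto_map'_iff]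
          refine Tendsto.congr' ?_ (tendsto_id.mono_left nhdsWithin_le_nhds)
          filter_upwards [self_mem_nhdsWithin] with z hz using (hgf z hz).symm
        exact h1.comp hσt
      obtain ⟨n, hn, hev⟩ := h.exists_ray_of_trajectory hm (θ := θ) one_pos (fun t ht => by
        obtain ⟨h1, h2⟩ := hmem t ht
        refine ⟨h1, ?_⟩
        obtain ⟨v, hv, hQ⟩ := (hσ t ht).2
        have h3 := hasDerivAt_invFunOn isOpen_upperHalf hf hinj h1
        have h4 := deriv_ne_zero_of_injOn isOpen_upperHalf hf hinj h1
        rw [h2] at h3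
        refine ⟨(deriv f (g (σ t)))⁻¹ * v, h3.comp t hv, ?_⟩
        convert hQ using 1
        rw [h2]
        field_simp) hgσ
      refine ⟨n, hn, ?_⟩
      have hωt : Tendsto (fun t => ‖ω (g (σ t))‖) (𝓝[>] 0) (𝓝 0) := by
        have := (h.tendsto_zero.comp hgσ).norm
        rw [norm_zero] at this
        exact this
      have hprop : ∀ᶠ t in 𝓝[>] (0 : ℝ), t ∈ Ioo (0 : ℝ) 1 ∧ AnalyticAt ℂ ω (g (σ t)) ∧
          0 < (ω (g (σ t))).im := by
        filter_upwards [Ioo_mem_nhdsGT one_pos, hev,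
          hgσ.eventually h.analytic.analytic.eventually_analyticAt] with t h1 h2 h3
        exact ⟨h1, h3, h2.1⟩
      obtain ⟨b, hb, hsub⟩ := mem_nhdsGT_iff_exists_Ioo_subset.1 hprop
      have hmap : map (fun t => ‖ω (g (σ t))‖) (𝓝[>] 0) = 𝓝[>] 0 := by
        refine map_nhdsGT_zero_eq hb ?_ ?_ hωt
        · intro t ht
          have h1 := (hsub ht).1
          have h2 := hasDerivAt_invFunOn isOpen_upperHalf hf hinj (hmem t h1).1
          rw [(hmem t h1).2] at h2
          obtain ⟨v, hv, -⟩ := (hσ t h1).2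
          have h3 : ContinuousAt (fun t => ω (g (σ t))) t :=
            ContinuousAt.comp (f := fun t => g (σ t)) (hsub ht).2.1.continuousAt
              (ContinuousAt.comp (f := σ) h2.continuousAt hv.continuousAt)
          exact h3.norm.continuousWithinAt
        · intro t ht
          rw [norm_pos_iff]
          intro h0
          have := (hsub ht).2.2
          rw [h0] at this
          simp at this
      show map (fun t => f (ray n t)) (𝓝[>] 0) = map σ (𝓝[>] 0)
      conv_lhs => rw [← hmap]
      rw [map_map]
      apply Filter.map_congr
      filter_upwards [hev, Ioo_mem_nhdsGT one_pos, hgσ.eventually hl] with t h1 h2 h3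
      simp only [Function.comp, hray]
      rw [← h1.2, h3, (hmem t h2).2]
    · rintro _ ⟨n, hn, rfl⟩
      have hn : |θ - ψ + n * Real.pi| < Real.pi / 2 * ((m + 2) / 2) := hn
      obtain ⟨δ, hδ, hsub⟩ := mem_nhdsGT_iff_exists_Ioo_subset.1
        (IsModelCoordinate.eventually_hasArgTwice_ray
          (q := fun z => Q (f z) * deriv f z ^ 2) h.pos hm hΨH hn)
      have hδ : 0 < δ := hδ
      refine ⟨fun t => f (ray n (δ * t)), ?_, ?_, ?_⟩
      · intro t ht
        obtain ⟨h1, v, hv, hQ⟩ := hsub (show δ * t ∈ Ioo 0 δ from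
          ⟨mul_pos hδ ht.1, mul_lt_of_lt_one_right hδ ht.2⟩)
        refine ⟨mem_image_of_mem f h1, deriv f (ray n (δ * t)) * (δ * v), ?_, ?_⟩
        · have h2 : HasDerivAt (fun t : ℝ => δ * t) δ t := by
            simpa using (hasDerivAt_id t).const_mul δ
          have h3 : HasDerivAt (fun t => ray n (δ * t)) (δ • v) t := hv.scomp t h2
          rw [Complex.real_smul] at h3
          exact (hf.differentiableAt (isOpen_upperHalf.mem_nhds h1)).hasDerivAt.comp t h3
        · obtain ⟨r, hr0, hQr⟩ := hQ
          refine ⟨δ ^ 2 * r, by positivity, ?_⟩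
          push_cast
          linear_combination (δ : ℂ) ^ 2 * hQr
      · have h1 : Tendsto (fun t : ℝ => δ * t) (𝓝[>] 0) (𝓝[>] 0) :=
          (map_mul_left_nhdsGT_zero hδ).le
        have h2 := (hrayt n hn).comp h1
        exact tendsto_map.comp h2
      · show map (fun t => f (ray n t)) (𝓝[>] 0) = _
        conv_lhs => rw [← map_mul_left_nhdsGT_zero hδ]
        rw [map_map]
        rfl

/-- A criterion for a boundary interval to be a trajectory arc. -/
theorem isBoundaryArc_of_tendsto {Q f : ℂ → ℂ} {θ : ℝ} {I : Set ℝ}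
    (hreg : ∀ x ∈ I, (∃ F : ℂ → ℂ, AnalyticAt ℂ F x ∧ f =ᶠ[𝓝[upperHalf] (x : ℂ)] F) ∧
      (∃ w, Tendsto (fun z => Q (f z)) (𝓝[upperHalf] (x : ℂ)) (𝓝 w)) ∧
      ∃ w, Tendsto (fun z => Q (f z) * deriv f z ^ 2) (𝓝[upperHalf] (x : ℂ)) (𝓝 w) ∧
        HasArgTwice θ w) :
    IsBoundaryArc Q f θ I := by
  refine ⟨fun x => limUnder (𝓝[upperHalf] (x : ℂ)) f,
    fun x => limUnder (𝓝[upperHalf] (x : ℂ)) fun z => Q (f z), fun x hx => ?_⟩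
  obtain ⟨⟨F, hF, hfF⟩, ⟨w, hw⟩, ⟨w', hw', harg⟩⟩ := hreg x hx
  have hΓ : ∀ y : ℝ, AnalyticAt ℂ F y → f =ᶠ[𝓝[upperHalf] (y : ℂ)] F →
      limUnder (𝓝[upperHalf] (y : ℂ)) f = F y := fun y h1 h2 =>
    Tendsto.limUnder_eq
      ((h1.continuousAt.tendsto.mono_left nhdsWithin_le_nhds).congr' h2.symm)
  have hfF' : ∀ᶠ y in 𝓝 (x : ℂ), f =ᶠ[𝓝[upperHalf] y] F := by
    have hfF0 : ∀ᶠ z in 𝓝[upperHalf] (x : ℂ), f z = F z := hfF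
    rw [eventually_nhdsWithin_iff] at hfF0
    filter_upwards [hfF0.eventually_nhds] with y hy
    exact eventually_nhdsWithin_iff.2 hy
  refine ⟨?_, ?_, deriv F x, ?_, ?_⟩
  · exact tendsto_nhds_limUnder ⟨F x,
      (hF.continuousAt.tendsto.mono_left nhdsWithin_le_nhds).congr' hfF.symm⟩
  · exact tendsto_nhds_limUnder ⟨w, hw⟩
  · refine (hF.differentiableAt.hasDerivAt.comp_ofReal).congr_of_eventuallyEq ?_
    filter_upwards [(tendsto_ofReal_nhds x).eventually hfF',
      (tendsto_ofReal_nhds x).eventually hF.eventually_analyticAt] with y h1 h2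
    exact hΓ y h2 h1
  · have h1 : Tendsto (fun z => Q (f z) * deriv f z ^ 2) (𝓝[upperHalf] (x : ℂ))
        (𝓝 (w * deriv F x ^ 2)) := by
      refine hw.mul (Tendsto.pow ?_ 2)
      refine (hF.deriv.continuousAt.tendsto.mono_left nhdsWithin_le_nhds).congr' ?_
      filter_upwards [mem_nhdsWithin_of_mem_nhds hfF', self_mem_nhdsWithin] with z h2 h3
      rw [isOpen_upperHalf.nhdsWithin_eq h3] at h2
      exact h2.deriv_eq.symm
    show HasArgTwice θ (limUnder (𝓝[upperHalf] (x : ℂ)) (fun z => Q (f z)) * deriv F x ^ 2)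
    rw [hw.limUnder_eq, tendsto_nhds_unique h1 hw']
    exact harg

/-! ### The degree of a prime end -/

namespace HasArgTwice

theorem mul_of_pos {θ r : ℝ} {z : ℂ} (h : HasArgTwice θ z) (hr : 0 < r) :
    HasArgTwice θ (z * r) := by
  obtain ⟨s, hs, rfl⟩ := h
  exact ⟨s * r, mul_pos hs hr, by push_cast; ring⟩

theorem of_mul_pos {θ r : ℝ} {z : ℂ} (h : HasArgTwice θ (z * r)) (hr : 0 < r) :
    HasArgTwice θ z := by
  have := h.mul_of_pos (inv_pos.2 hr)
  have hrc : (r : ℂ) ≠ 0 := by exact_mod_cast hr.ne'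
  rwa [Complex.ofReal_inv, mul_inv_cancel_right₀ hrc] at this

/-- The direction modulo `π` is determined. -/
theorem eq {θ θ' : ℝ} {z : ℂ} (h : HasArgTwice θ z) (h' : HasArgTwice θ' z)
    (hθ : θ ∈ Ico 0 Real.pi) (hθ' : θ' ∈ Ico 0 Real.pi) : θ = θ' := by
  obtain ⟨r, hr, rfl⟩ := h
  obtain ⟨s, hs, heq⟩ := h'
  have hn := congrArg norm heq
  have e1 : ∀ a : ℝ, (2 : ℂ) * a * Complex.I = ((2 * a : ℝ) : ℂ) * Complex.I := fun a => by
    push_cast; ring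
  rw [e1, e1] at heq hn
  rw [norm_mul, norm_mul, Complex.norm_exp_ofReal_mul_I, Complex.norm_exp_ofReal_mul_I,
    Complex.norm_of_nonneg hr.le, Complex.norm_of_nonneg hs.le, mul_one, mul_one] at hn
  subst hn
  have hrc : (r : ℂ) ≠ 0 := by exact_mod_cast hr.ne'
  obtain ⟨n, hn⟩ := Complex.exp_eq_exp_iff_exists_int.1 (mul_left_cancel₀ hrc heq)
  have h2 : ((2 * θ : ℝ) : ℂ) = ((2 * θ' + n * (2 * Real.pi) : ℝ) : ℂ) := by
    apply mul_right_cancel₀ Complex.I_ne_zero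
    rw [hn]
    push_cast
    ring
  have h3 : 2 * θ = 2 * θ' + n * (2 * Real.pi) := by exact_mod_cast h2
  have hpi := Real.pi_pos
  have h4 : n = 0 := by
    have h5 : (n : ℝ) < 1 := by
      by_contra h6
      nlinarith [hθ.2, hθ'.1, not_lt.1 h6]
    have h6 : (-1 : ℝ) < n := by
      by_contra h6
      nlinarith [hθ'.2, hθ.1, not_lt.1 h6]
    have h7 : n < 1 := by exact_mod_cast h5
    have h8 : -1 < n := by exact_mod_cast h6
    omega
  rw [h4] at h3
  simp at h3
  exact h3

theorem add_int_mul_pi {θ : ℝ} {z : ℂ} (h : HasArgTwice θ z) (l : ℤ) :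
    HasArgTwice (θ + l * Real.pi) z := by
  obtain ⟨r, hr, rfl⟩ := h
  refine ⟨r, hr, ?_⟩
  rw [show 2 * ((θ + l * Real.pi : ℝ) : ℂ) * Complex.I = 2 * θ * Complex.I +
    l * (2 * Real.pi * Complex.I) by push_cast; ring, Complex.exp_add,
    Complex.exp_int_mul_two_pi_mul_I, mul_one]

/-- The direction determines the phase. -/
theorem exp_eq {θ : ℝ} {z : ℂ} (h : HasArgTwice θ z) :
    Complex.exp (2 * (θ : ℂ) * Complex.I) = z / ‖z‖ := by
  obtain ⟨r, hr, rfl⟩ := h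
  have hrc : (r : ℂ) ≠ 0 := by exact_mod_cast hr.ne'
  rw [show (2 : ℂ) * θ * Complex.I = ((2 * θ : ℝ) : ℂ) * Complex.I by push_cast; ring, norm_mul,
    Complex.norm_exp_ofReal_mul_I, Complex.norm_of_nonneg hr.le, mul_one,
    mul_div_cancel_left₀ _ hrc]

theorem mul {θ θ' : ℝ} {z w : ℂ} (h : HasArgTwice θ z) (h' : HasArgTwice θ' w) :
    HasArgTwice (θ + θ') (z * w) := by
  obtain ⟨r, hr, rfl⟩ := h
  obtain ⟨s, hs, rfl⟩ := h'
  refine ⟨r * s, mul_pos hr hs, ?_⟩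
  rw [show (2 : ℂ) * ((θ + θ' : ℝ) : ℂ) * Complex.I = 2 * θ * Complex.I + 2 * θ' * Complex.I by
    push_cast; ring, Complex.exp_add]
  push_cast
  ring

theorem finset_prod {ι : Type*} (s : Finset ι) {θ : ι → ℝ} {z : ι → ℂ}
    (h : ∀ i ∈ s, HasArgTwice (θ i) (z i)) : HasArgTwice (∑ i ∈ s, θ i) (∏ i ∈ s, z i) := by
  classical
  induction s using Finset.induction_on with
  | empty => exact ⟨1, one_pos, by simp⟩
  | insert a s ha ih =>
    rw [Finset.sum_insert ha, Finset.prod_insert ha]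
    exact (h a (Finset.mem_insert_self a s)).mul
      (ih fun i hi => h i (Finset.mem_insert_of_mem hi))

end HasArgTwice

theorem IsBoundaryArc.mono {Q f : ℂ → ℂ} {θ : ℝ} {I J : Set ℝ} (h : IsBoundaryArc Q f θ I)
    (hJ : J ⊆ I) : IsBoundaryArc Q f θ J := by
  obtain ⟨Γ, q, hΓ⟩ := h
  exact ⟨Γ, q, fun x hx => hΓ x (hJ hx)⟩

theorem IsBoundaryArc.eq {Q f : ℂ → ℂ} {θ θ' : ℝ} {I : Set ℝ} (h : IsBoundaryArc Q f θ I)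
    (h' : IsBoundaryArc Q f θ' I) (hI : IsOpen I) (hne : I.Nonempty)
    (hθ : θ ∈ Ico 0 Real.pi) (hθ' : θ' ∈ Ico 0 Real.pi) : θ = θ' := by
  obtain ⟨Γ, q, hΓ⟩ := h
  obtain ⟨Γ', q', hΓ'⟩ := h'
  obtain ⟨x, hx⟩ := hne
  obtain ⟨-, h2, v, hv, h3⟩ := hΓ x hx
  obtain ⟨-, h2', v', hv', h3'⟩ := hΓ' x hx
  have hv'' : HasDerivAt Γ v' x := by
    refine hv'.congr_of_eventuallyEq ?_
    filter_upwards [hI.mem_nhds hx] with y hy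
    exact tendsto_nhds_unique (hΓ y hy).1 (hΓ' y hy).1
  rw [← tendsto_nhds_unique h2 h2', ← hv.unique hv''] at h3'
  exact h3.eq h3' hθ hθ'

theorem IsBoundaryArc.exists_tendsto {Q : ℂ → ℂ} {θ : ℝ} {I : Set ℝ} (h : IsBoundaryArc Q id θ I)
    (hI : IsOpen I) {x : ℝ} (hx : x ∈ I) :
    ∃ w, Tendsto Q (𝓝[upperHalf] (x : ℂ)) (𝓝 w) ∧ HasArgTwice θ w := by
  obtain ⟨Γ, q, hΓ⟩ := h
  obtain ⟨-, hq, v, hv, harg⟩ := hΓ x hx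
  have hv1 : HasDerivAt Γ 1 x := by
    refine (Complex.ofRealCLM.hasDerivAt (x := x)).congr_of_eventuallyEq ?_ |>.congr_deriv (by simp)
    filter_upwards [hI.mem_nhds hx] with y hy
    exact tendsto_nhds_unique (hΓ y hy).1 (tendsto_id.mono_left nhdsWithin_le_nhds)
  rw [hv.unique hv1, one_pow, mul_one] at harg
  exact ⟨q x, hq, harg⟩

/-- The degree is well defined: adjacent arcs determine the angles, as these lie in `[0, π)`. -/
theorem HasBoundaryDegree.unique {Q f : ℂ → ℂ} {c μ μ' : ℝ} (h : HasBoundaryDegree Q f c μ)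
    (h' : HasBoundaryDegree Q f c μ') : μ = μ' := by
  obtain ⟨θ₁, hθ₁, θ₂, hθ₂, ⟨ε, hε, hl, hr⟩, -, hd⟩ := h
  obtain ⟨θ₁', hθ₁', θ₂', hθ₂', ⟨ε', hε', hl', hr'⟩, -, hd'⟩ := h'
  have hm : 0 < min ε ε' := lt_min hε hε'
  have h1 : θ₁ = θ₁' := (hl.mono (J := Ioo (c - min ε ε') c)
      (Ioo_subset_Ioo_left (by linarith [min_le_left ε ε']))).eq
    (hl'.mono (Ioo_subset_Ioo_left (by linarith [min_le_right ε ε']))) isOpen_Ioo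
    (nonempty_Ioo.2 (by linarith)) hθ₁ hθ₁'
  have h2 : θ₂ = θ₂' := (hr.mono (J := Ioo c (c + min ε ε'))
      (Ioo_subset_Ioo_right (by linarith [min_le_left ε ε']))).eq
    (hr'.mono (Ioo_subset_Ioo_right (by linarith [min_le_right ε ε']))) isOpen_Ioo
    (nonempty_Ioo.2 (by linarith)) hθ₂ hθ₂'
  subst h1 h2
  rcases hd with ⟨h3, h4⟩ | ⟨h3, h4⟩ <;> rcases hd' with ⟨h5, h6⟩ | ⟨h5, h6⟩
  · rw [h4, h6]
  · exact absurd h3 h5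
  · exact absurd h5 h3
  · rw [h4, h6]

namespace IsModelCoordinate

variable {q ω : ℂ → ℂ} {c m ρ ψ : ℝ}

/-- The boundary direction of the quadratic differential at a real point whose model coordinate
is `s` (for `τ = -π/2`) or `-s` (for `τ = π/2`). -/
theorem tendsto_hasArgTwice (hρ : 0 < ρ) {x s τ : ℝ} (hτ : τ = Real.pi / 2 ∨ τ = -(Real.pi / 2))
    (hs : 0 < s) (hx : ω x = Complex.I * (s * Complex.exp (τ * Complex.I)))
    (ha : AnalyticAt ℂ ω x) (hr : (deriv ω x).im = 0) (hr0 : 0 < (deriv ω x).re)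
    (hcut : ∀ᶠ z in 𝓝[upperHalf] (x : ℂ), q z =
      -(ρ * Complex.exp (2 * ψ * Complex.I)) * ((-Complex.I * ω z) ^ (m : ℂ) * deriv ω z ^ 2)) :
    ∃ w, Tendsto q (𝓝[upperHalf] (x : ℂ)) (𝓝 w) ∧ HasArgTwice (ψ + (m + 2) / 2 * τ) w := by
  have hpi := Real.pi_pos
  have h1 : -Complex.I * ω x = s * Complex.exp (τ * Complex.I) := by
    rw [hx]
    linear_combination (-(s * Complex.exp (τ * Complex.I))) * Complex.I_sq
  have hsc : (s : ℂ) ≠ 0 := by exact_mod_cast hs.ne'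
  have harg : (-Complex.I * ω x).arg = τ := by
    rw [h1, Complex.arg_real_mul _ hs, Complex.arg_exp_mul_I, toIocMod_eq_self]
    rcases hτ with rfl | rfl <;> constructor <;> linarith
  have hmem : -Complex.I * ω x ∈ Complex.slitPlane := by
    rw [Complex.mem_slitPlane_iff_arg, harg]
    refine ⟨by rcases hτ with rfl | rfl <;> linarith, ?_⟩
    rw [h1]
    exact mul_ne_zero hsc (Complex.exp_ne_zero _)
  have hcont : ContinuousAt (fun z => -(ρ * Complex.exp (2 * ψ * Complex.I)) *
      ((-Complex.I * ω z) ^ (m : ℂ) * deriv ω z ^ 2)) x := by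
    refine continuousAt_const.mul (ContinuousAt.mul ?_ (ha.deriv.continuousAt.pow 2))
    exact (continuousAt_const.mul ha.continuousAt).cpow continuousAt_const hmem
  refine ⟨_, (hcont.tendsto.mono_left nhdsWithin_le_nhds).congr'
    (hcut.mono fun z hz => hz.symm), ?_⟩
  have hd : deriv ω x = ((deriv ω x).re : ℂ) := Complex.ext (by simp) (by simp [hr])
  refine ⟨ρ * s ^ m * (deriv ω x).re ^ 2, by positivity, ?_⟩
  have h6 : (-Complex.I * ω x) ^ (m : ℂ) =
      ((s ^ m : ℝ) : ℂ) * Complex.exp (m * τ * Complex.I) := by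
    rw [Complex.cpow_def_of_ne_zero (Complex.slitPlane_ne_zero hmem), Complex.log, harg, h1,
      norm_mul, Complex.norm_exp_ofReal_mul_I, mul_one, Complex.norm_of_nonneg hs.le,
      Real.rpow_def_of_pos hs, Complex.ofReal_exp, ← Complex.exp_add]
    congr 1
    push_cast
    ring
  have h7 : Complex.exp (2 * τ * Complex.I) = -1 := by
    rcases hτ with rfl | rfl
    · rw [← Complex.exp_pi_mul_I]
      congr 1
      push_cast
      ring
    · rw [← Complex.exp_neg_pi_mul_I]
      congr 1
      push_cast
      ring
  have h8 : Complex.exp (2 * ((ψ + (m + 2) / 2 * τ : ℝ) : ℂ) * Complex.I) =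
      Complex.exp (2 * ψ * Complex.I) * Complex.exp (m * τ * Complex.I) *
        Complex.exp (2 * τ * Complex.I) := by
    rw [← Complex.exp_add, ← Complex.exp_add]
    congr 1
    push_cast
    ring
  rw [h6, h8, h7]
  conv_lhs => rw [hd]
  push_cast
  ring

/-- The boundary directions on both sides of the point. -/
theorem eventually_tendsto_hasArgTwice (h : IsModelCoordinate q ω c m ρ ψ) :
    (∀ᶠ x : ℝ in 𝓝[>] c, ∃ w, Tendsto q (𝓝[upperHalf] (x : ℂ)) (𝓝 w) ∧
      HasArgTwice (ψ + (m + 2) / 2 * -(Real.pi / 2)) w) ∧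
    ∀ᶠ x : ℝ in 𝓝[<] c, ∃ w, Tendsto q (𝓝[upperHalf] (x : ℂ)) (𝓝 w) ∧
      HasArgTwice (ψ + (m + 2) / 2 * (Real.pi / 2)) w := by
  have hc := tendsto_ofReal_nhds c
  have hcut : ∀ᶠ x : ℝ in 𝓝 c, ∀ᶠ z in 𝓝[upperHalf] (x : ℂ), q z =
      -(ρ * Complex.exp (2 * ψ * Complex.I)) * ((-Complex.I * ω z) ^ (m : ℂ) * deriv ω z ^ 2) := by
    have h1 := h.eq
    rw [eventually_nhdsWithin_iff] at h1
    filter_upwards [hc.eventually h1.eventually_nhds] with x hx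
    exact eventually_nhdsWithin_iff.2 hx
  have hpos : 0 < (deriv ω c).re := by simp [h.deriv_eq]
  have hd0 : ∀ᶠ x : ℝ in 𝓝 c, 0 < (deriv ω x).re :=
    ((Complex.continuous_re.tendsto _).comp
      (h.analytic.deriv.analytic.continuousAt.tendsto.comp hc)).eventually_const_lt hpos
  have hall := ((hcut.and hd0).and (h.analytic.real.and h.analytic.deriv.real)).and
    (hc.eventually h.analytic.analytic.eventually_analyticAt)
  obtain ⟨hgt, hlt⟩ := h.analytic.eventually_re_lt hpos
  rw [h.map_zero, Complex.zero_re] at hgt hlt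
  constructor
  · filter_upwards [hgt, hall.filter_mono nhdsWithin_le_nhds] with x hx hx'
    obtain ⟨⟨⟨h1, h2⟩, h3, h4⟩, h5⟩ := hx'
    refine tendsto_hasArgTwice h.pos (Or.inr rfl) hx ?_ h5 h4 h2 h1
    rw [Complex.ofReal_neg, neg_mul, Complex.exp_neg]
    push_cast
    rw [Complex.exp_pi_div_two_mul_I, Complex.inv_I]
    apply Complex.ext <;> simp [h3]
  · filter_upwards [hlt, hall.filter_mono nhdsWithin_le_nhds] with x hx hx'
    obtain ⟨⟨⟨h1, h2⟩, h3, h4⟩, h5⟩ := hx'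
    refine tendsto_hasArgTwice h.pos (Or.inl rfl) (neg_pos.2 hx) ?_ h5 h4 h2 h1
    push_cast
    rw [Complex.exp_pi_div_two_mul_I]
    apply Complex.ext <;> simp [h3]

end IsModelCoordinate

theorem exists_int_add_mul_pi_mem_Ico (x : ℝ) : ∃ l : ℤ, x + l * Real.pi ∈ Ico 0 Real.pi := by
  have hpi := Real.pi_pos
  refine ⟨-⌊x / Real.pi⌋, ?_⟩
  have h1 := Int.floor_le (x / Real.pi)
  have h2 := Int.lt_floor_add_one (x / Real.pi)
  rw [le_div_iff₀ hpi] at h1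
  rw [div_lt_iff₀ hpi] at h2
  push_cast
  constructor <;> nlinarith

/-- **The degree of a prime end is the exponent of the quadratic differential there**, transplanted
to the upper half-plane, provided that the exponent exceeds `-2`. -/
theorem HasBoundaryExponent.hasBoundaryDegree {Q f : ℂ → ℂ} {c m : ℝ}
    (hf : DifferentiableOn ℂ f upperHalf) (hinj : InjOn f upperHalf)
    (hq : HasBoundaryExponent (fun z => Q (f z) * deriv f z ^ 2) c m) (hm : -2 < m)
    (hreg : ∀ᶠ x : ℝ in 𝓝[≠] c,
      (∃ F : ℂ → ℂ, AnalyticAt ℂ F x ∧ f =ᶠ[𝓝[upperHalf] (x : ℂ)] F) ∧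
      ∃ w, Tendsto (fun z => Q (f z)) (𝓝[upperHalf] (x : ℂ)) (𝓝 w)) :
    HasBoundaryDegree Q f c m := by
  obtain ⟨ω, ρ, ψ, h⟩ := hq.exists_isModelCoordinate hm
  have hpi := Real.pi_pos
  set β : ℝ := (m + 2) / 2 with hβ
  have hβ0 : 0 < β := by rw [hβ]; linarith
  obtain ⟨l₁, hl₁⟩ := exists_int_add_mul_pi_mem_Ico (ψ + β * (Real.pi / 2))
  obtain ⟨l₂, hl₂⟩ := exists_int_add_mul_pi_mem_Ico (ψ + β * -(Real.pi / 2))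
  obtain ⟨hgt, hlt⟩ := h.eventually_tendsto_hasArgTwice
  set θ₁ := ψ + β * (Real.pi / 2) + l₁ * Real.pi with hθ₁
  set θ₂ := ψ + β * -(Real.pi / 2) + l₂ * Real.pi with hθ₂
  obtain ⟨e, he, hends⟩ := exists_trajectoryEnds_eq_image hf hinj h hm θ₂
  -- the number of trajectories
  have hset : {n : ℤ | |θ₂ - ψ + n * Real.pi| < Real.pi / 2 * β} =
      (Finset.Ioo (-l₂) (⌈β⌉ - l₂) : Finset ℤ) := by
    ext n
    rw [mem_ofPred_eq, Finset.coe_Ioo, mem_Ioo, abs_lt, lt_sub_iff_add_lt, Int.lt_ceil,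
      neg_lt_iff_pos_add, hθ₂]
    push_cast
    constructor
    · rintro ⟨h1, h2⟩
      constructor
      · have : (0 : ℝ) < n + l₂ := by
          by_contra h3
          nlinarith [not_lt.1 h3]
        have : (0 : ℤ) < n + l₂ := by exact_mod_cast this
        linarith
      · by_contra h3
        nlinarith [not_lt.1 h3]
    · rintro ⟨h1, h2⟩
      have h1 : (0 : ℝ) < l₂ + n := by exact_mod_cast (by linarith : 0 < l₂ + n)
      constructor <;> nlinarith
  rw [← hβ, hset] at he
  rw [← hβ, hset] at hends
  have hcard : ((trajectoryEnds Q f c θ₂).ncard : ℝ) = ⌈β⌉ - 1 := by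
    rw [hends, he.ncard_image, ncard_coe_finset, Int.card_Ioo]
    have h1 : 0 < ⌈β⌉ := Int.ceil_pos.2 hβ0
    have h2 : (((⌈β⌉ - l₂ - -l₂ - 1).toNat : ℤ)) = ⌈β⌉ - 1 := by
      rw [Int.toNat_of_nonneg (by linarith)]
      ring
    exact_mod_cast h2
  have hfin : (trajectoryEnds Q f c θ₂).Finite := by
    rw [hends]
    exact (Finset.finite_toSet _).image e
  refine ⟨θ₁, hl₁, θ₂, hl₂, ?_, hfin, ?_⟩
  · have hreg1 := hreg.filter_mono (nhdsWithin_mono c (fun y (hy : c < y) => ne_of_gt hy))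
    have hreg2 := hreg.filter_mono (nhdsWithin_mono c (fun y (hy : y < c) => ne_of_lt hy))
    obtain ⟨b, hb, hsub⟩ := mem_nhdsGT_iff_exists_Ioo_subset.1 (hgt.and hreg1)
    obtain ⟨a, ha, hsub'⟩ := mem_nhdsLT_iff_exists_Ioo_subset.1 (hlt.and hreg2)
    have hb : c < b := hb
    have ha : a < c := ha
    refine ⟨min (b - c) (c - a), lt_min (by linarith) (by linarith), ?_, ?_⟩
    · refine isBoundaryArc_of_tendsto fun x hx => ?_
      obtain ⟨⟨w, h1, h2⟩, h3, h4⟩ := hsub' (show x ∈ Ioo a c from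
        ⟨by linarith [hx.1, min_le_right (b - c) (c - a)], hx.2⟩)
      exact ⟨h3, h4, w, h1, h2.add_int_mul_pi l₁⟩
    · refine isBoundaryArc_of_tendsto fun x hx => ?_
      obtain ⟨⟨w, h1, h2⟩, h3, h4⟩ := hsub (show x ∈ Ioo c b from
        ⟨hx.1, by linarith [hx.2, min_le_left (b - c) (c - a)]⟩)
      exact ⟨h3, h4, w, h1, h2.add_int_mul_pi l₂⟩
  · have hdiff : θ₁ - θ₂ = (β + (l₁ - l₂ : ℤ)) * Real.pi := by
      rw [hθ₁, hθ₂]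
      push_cast
      ring
    -- modulo `π` the angle `θ₁ - θ₂` is `βπ`, so `Θ/π` is the fractional part of `β`, and the arcs
    -- have the same angle iff `β` is an integer
    rw [hcard]
    by_cases heq : θ₁ = θ₂
    · refine Or.inl ⟨heq, ?_⟩
      rw [heq, sub_self] at hdiff
      have h1 : β = ((l₂ - l₁ : ℤ) : ℝ) := by
        have := (mul_eq_zero.1 hdiff.symm).resolve_right hpi.ne'
        push_cast at this ⊢
        linarith
      rw [h1, Int.ceil_intCast, ← h1, hβ]
      ring
    · refine Or.inr ⟨heq, ?_⟩
      rw [hdiff, mul_div_cancel_right₀ _ hpi.ne', Int.fract_add_intCast]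
      have hne : Int.fract β ≠ 0 := by
        intro h0
        have h1 := Int.floor_add_fract β
        rw [h0, add_zero] at h1
        apply heq
        have h2 : ((⌊β⌋ + (l₁ - l₂) : ℤ) : ℝ) = β + (l₁ - l₂ : ℤ) := by
          push_cast
          rw [h1]
        rw [← h2] at hdiff
        have h3 : ⌊β⌋ + (l₁ - l₂) = 0 := by
          have h5 : ((⌊β⌋ + (l₁ - l₂) : ℤ) : ℝ) < 1 := by
            by_contra h6
            nlinarith [hl₁.2, hl₂.1, not_lt.1 h6]
          have h6 : (-1 : ℝ) < ((⌊β⌋ + (l₁ - l₂) : ℤ) : ℝ) := by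
            by_contra h6
            nlinarith [hl₂.2, hl₁.1, not_lt.1 h6]
          have h7 : ⌊β⌋ + (l₁ - l₂) < 1 := by exact_mod_cast h5
          have h8 : -1 < ⌊β⌋ + (l₁ - l₂) := by exact_mod_cast h6
          omega
        rw [h3] at hdiff
        push_cast at hdiff
        linarith
      have h1 : (⌈β⌉ : ℝ) = ⌊β⌋ + 1 := by
        have : ⌈β⌉ = ⌊β⌋ + 1 := by
          apply le_antisymm (Int.ceil_le_floor_add_one β)
          rw [Int.add_one_le_iff, Int.lt_ceil]
          have := Int.floor_add_fract β
          have h0 := (Int.fract_nonneg β).lt_of_ne' hne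
          linarith
        exact_mod_cast this
      rw [h1]
      have := Int.floor_add_fract β
      linarith

/-! ### Boundary points of exponent at most -2 -/

/-- The right half-strip `{V | R < Re V, |Im V| < δ}`. -/
def halfStrip (R δ : ℝ) : Set ℂ := {V | R < V.re ∧ |V.im| < δ}

theorem halfStrip_mono {R R' δ : ℝ} (h : R ≤ R') : halfStrip R' δ ⊆ halfStrip R δ :=
  fun _ hV => ⟨h.trans_lt hV.1, hV.2⟩

theorem isOpen_halfStrip (R δ : ℝ) : IsOpen (halfStrip R δ) :=
  (isOpen_lt continuous_const Complex.continuous_re).inter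
    (isOpen_lt (Complex.continuous_im.abs) continuous_const)

theorem convex_halfStrip (R δ : ℝ) : Convex ℝ (halfStrip R δ) := by
  have h1 : Convex ℝ {V : ℂ | R < V.re} := convex_halfSpace_re_gt R
  have h2 : Convex ℝ {V : ℂ | V.im < δ} := convex_halfSpace_im_lt δ
  have h3 : Convex ℝ {V : ℂ | -δ < V.im} := convex_halfSpace_im_gt (-δ)
  convert h1.inter (h3.inter h2) using 1
  ext V
  simp [halfStrip, abs_lt]

/-- Suppose that in the coordinate `V`, ranging over the lower part of a half-strip, the quadratic
differential is nearly constant: `A κ(V)² dV²` with `κ` close to `1` and real on the real axis,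
where `A` has the argument `2θ`. Then there are infinitely many `θ`-trajectories that run to `∞`
in the half-strip, one at each small negative height of the coordinate `∫ κ dV`. -/
theorem infinite_trajectoryEnds_of_halfStrip {q z κ : ℂ → ℂ} {c θ R δ : ℝ} {A : ℂ} (hδ : 0 < δ)
    (hz : DifferentiableOn ℂ z (halfStrip R δ)) (hinj : InjOn z (halfStrip R δ))
    (him : ∀ V ∈ halfStrip R δ, V.im < 0 → 0 < (z V).im)
    (hlim : Tendsto z (comap Complex.re atTop ⊓ 𝓟 (halfStrip R δ)) (𝓝 (c : ℂ)))
    (hκ : DifferentiableOn ℂ κ (halfStrip R δ)) (hκ1 : ∀ V ∈ halfStrip R δ, ‖κ V - 1‖ ≤ 1 / 4)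
    (hκr : ∀ x : ℝ, R < x → (κ x).im = 0) (hA : HasArgTwice θ A)
    (hq : ∀ V ∈ halfStrip R δ, V.im < 0 → q (z V) * deriv z V ^ 2 = A * κ V ^ 2) :
    (trajectoryEnds q id c θ).Infinite := by
  set U := halfStrip R δ with hU
  have hUo : IsOpen U := isOpen_halfStrip R δ
  have hUc : Convex ℝ U := convex_halfStrip R δ
  have hmemR : ∀ x : ℝ, R < x → (x : ℂ) ∈ U := fun x hx => ⟨by simpa using hx, by simpa using hδ⟩
  obtain ⟨P, hP⟩ := exists_primitive_of_convex hUo hUc hκ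
  set x₁ : ℝ := R + δ with hx₁
  have hx₁R : R < x₁ := by rw [hx₁]; linarith
  set Φ : ℂ → ℂ := fun V => P V - P x₁ with hΦ
  have hΦd : ∀ V ∈ U, HasDerivAt Φ (κ V) V := fun V hV => (hP V hV).sub_const _
  have hΦ1 : Φ x₁ = 0 := by simp [hΦ]
  have hnear : ∀ V ∈ U, ∀ W ∈ U, ‖Φ V - Φ W - (V - W)‖ ≤ 1 / 4 * ‖V - W‖ := by
    intro V hV W hW
    have := hUc.norm_image_sub_le_of_norm_hasDerivWithin_le (f := fun V => Φ V - V)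
      (f' := fun V => κ V - 1)
      (fun x hx => ((hΦd x hx).sub (hasDerivAt_id x)).hasDerivWithinAt) hκ1 hW hV
    rwa [show Φ V - V - (Φ W - W) = Φ V - Φ W - (V - W) by ring] at this
  have hΦinj : InjOn Φ U := by
    intro V hV W hW h
    have h1 := hnear V hV W hW
    rw [h, sub_self, zero_sub, norm_neg] at h1
    exact sub_eq_zero.1 (norm_eq_zero.1 (le_antisymm (by linarith) (norm_nonneg _)))
  have hΦdiff : DifferentiableOn ℂ Φ U := fun V hV =>
    (hΦd V hV).differentiableAt.differentiableWithinAt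
  -- on the real axis the new coordinate is real
  have hreal : ∀ x : ℝ, R < x → (Φ x).im = 0 := by
    intro x hx
    have h1 : ∀ t ∈ Ioi R, HasDerivWithinAt (fun t : ℝ => (Φ t).im) (κ t).im (Ioi R) t :=
      fun t ht => (Complex.imCLM.hasFDerivAt.comp_hasDerivAt t
        (hΦd t (hmemR t ht)).comp_ofReal).hasDerivWithinAt
    have := (convex_Ioi R).norm_image_sub_le_of_norm_hasDerivWithin_le (C := 0) h1
      (fun t ht => by rw [hκr t ht, norm_zero]) (mem_Ioi.2 hx₁R) (mem_Ioi.2 hx)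
    rw [hΦ1, zero_mul] at this
    simpa using this
  have hsign : ∀ V ∈ U, (Φ V).im < 0 → V.im < 0 := by
    intro V hV hneg
    have h1 := hnear V hV V.re (hmemR _ hV.1)
    have h2 := (Complex.abs_im_le_norm _).trans h1
    have h3 : V - (V.re : ℂ) = V.im * Complex.I := by
      apply Complex.ext <;> simp
    rw [h3] at h2
    simp only [Complex.sub_im, hreal _ hV.1, Complex.mul_im, Complex.ofReal_re, Complex.I_im,
      mul_one, Complex.ofReal_im, Complex.I_re, mul_zero, add_zero, sub_zero, norm_mul,
      Complex.norm_real, Complex.norm_I, Real.norm_eq_abs] at h2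
    by_contra h4
    have h4 := not_lt.1 h4
    rw [abs_of_nonneg h4] at h2
    linarith [(abs_le.1 h2).1]
  -- every point `s + i h` with `s ≥ 0` and small `|h|` is a value of the new coordinate
  have hsurj : ∀ s h : ℝ, 0 ≤ s → |h| ≤ 3 / 8 * δ → ∃ V ∈ U, Φ V = s + h * Complex.I := by
    intro s h hs hh
    have hgrow : ∀ x : ℝ, x₁ ≤ x → 3 / 4 * (x - x₁) ≤ (Φ x).re := by
      intro x hx
      have h1 := hnear x (hmemR x (hx₁R.trans_le hx)) x₁ (hmemR x₁ hx₁R)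
      have h2 := (Complex.abs_re_le_norm _).trans h1
      rw [hΦ1, ← Complex.ofReal_sub, Complex.norm_real, Real.norm_of_nonneg (sub_nonneg.2 hx)] at h2
      simp only [Complex.sub_re, sub_zero, Complex.ofReal_re] at h2
      linarith [(abs_le.1 h2).1]
    have hcont : ContinuousOn (fun x : ℝ => (Φ x).re) (Icc x₁ (x₁ + 2 * s)) := by
      intro x hx
      exact ((Complex.continuous_re.continuousAt.comp
        (hΦd x (hmemR x (hx₁R.trans_le hx.1))).continuousAt).comp
          Complex.continuous_ofReal.continuousAt).continuousWithinAt
    have h1 := intermediate_value_Icc (by linarith : x₁ ≤ x₁ + 2 * s) hcont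
    have h2 := hgrow (x₁ + 2 * s) (by linarith)
    obtain ⟨x, hx, hxs⟩ := h1 (show s ∈ _ from
      ⟨by simp only [hΦ1, Complex.zero_re]; exact hs, by linarith⟩)
    have hx' : R + δ ≤ x := hx.1
    have hball : Metric.closedBall (x : ℂ) (δ / 2) ⊆ U := by
      intro V hV
      rw [mem_closedBall_iff_norm] at hV
      have h3 := abs_le.1 ((Complex.abs_re_le_norm _).trans hV)
      have h4 := (Complex.abs_im_le_norm _).trans hV
      simp only [Complex.sub_re, Complex.sub_im, Complex.ofReal_re, Complex.ofReal_im,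
        sub_zero] at h3 h4
      exact ⟨by linarith [h3.1], by linarith⟩
    have happ : ApproximatesLinearOn Φ (ContinuousLinearMap.id ℂ ℂ) U (1 / 4) := by
      intro V hV W hW
      simpa using hnear V hV W hW
    obtain ⟨V, hV, hVeq⟩ := happ.surjOn_closedBall_of_nonlinearRightInverse
      (⟨id, 1, by simp, by simp⟩ : (ContinuousLinearMap.id ℂ ℂ).NonlinearRightInverse)
      (half_pos hδ).le hball (show (s : ℂ) + h * Complex.I ∈ _ by
        have hΦx : Φ x = s := Complex.ext (by simpa using hxs)
          (by simpa using hreal x (by linarith))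
        rw [mem_closedBall_iff_norm, hΦx, add_sub_cancel_left]
        simp only [norm_mul, Complex.norm_real, Complex.norm_I, mul_one, Real.norm_eq_abs]
        norm_num
        linarith)
    exact ⟨V, hball hV, hVeq⟩
  set g := Function.invFunOn Φ U with hg
  have hgmem : ∀ s h : ℝ, 0 ≤ s → |h| ≤ 3 / 8 * δ →
      g (s + h * Complex.I) ∈ U ∧ Φ (g (s + h * Complex.I)) = s + h * Complex.I := by
    intro s h hs hh
    obtain ⟨V, hV, hVeq⟩ := hsurj s h hs hh
    rw [← hVeq]
    exact ⟨Function.invFunOn_mem ⟨V, hV, rfl⟩, Function.invFunOn_eq ⟨V, hV, rfl⟩⟩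
  have hgre : ∀ h : ℝ, |h| ≤ 3 / 8 * δ →
      Tendsto (fun s : ℝ => g (s + h * Complex.I)) atTop (comap Complex.re atTop ⊓ 𝓟 U) := by
    intro h hh
    refine tendsto_inf.2 ⟨tendsto_comap_iff.2 (tendsto_atTop.2 fun b => ?_), ?_⟩
    · filter_upwards [eventually_ge_atTop (0 : ℝ),
        eventually_gt_atTop (5 / 4 * (|b - R| + 2 * δ + |R - x₁|))] with s h0 hs
      obtain ⟨h1, h2⟩ := hgmem s h h0 hh
      by_contra hb
      have hb : (g (s + h * Complex.I)).re < b := not_le.1 hb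
      set V := g (s + h * Complex.I) with hV
      have h3 := hnear V h1 x₁ (hmemR x₁ hx₁R)
      rw [hΦ1, sub_zero, h2] at h3
      have h4 : ‖V - x₁‖ ≤ |b - R| + δ + |R - x₁| := by
        have h5 : ‖V - x₁‖ ≤ |(V - x₁).re| + |(V - x₁).im| := Complex.norm_le_abs_re_add_abs_im _
        simp only [Complex.sub_re, Complex.sub_im, Complex.ofReal_re, Complex.ofReal_im,
          sub_zero] at h5
        have h6 : |V.re - x₁| ≤ |V.re - R| + |R - x₁| := abs_sub_le _ _ _
        have h7 : |V.re - R| ≤ |b - R| := by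
          have : R < V.re := h1.1
          rw [abs_of_pos (by linarith), abs_of_pos (by linarith)]
          linarith
        have : |V.im| < δ := h1.2
        linarith
      have h5 : (s : ℝ) ≤ ‖(s : ℂ) + h * Complex.I‖ := by
        have := (le_abs_self _).trans (Complex.abs_re_le_norm ((s : ℂ) + h * Complex.I))
        simpa using this
      have h6 : ‖(s : ℂ) + h * Complex.I‖ ≤ ‖(s : ℂ) + h * Complex.I - (V - x₁)‖ + ‖V - x₁‖ := by
        simpa using norm_add_le ((s : ℂ) + h * Complex.I - (V - x₁)) (V - x₁)
      linarith
    · rw [tendsto_principal]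
      filter_upwards [eventually_ge_atTop (0 : ℝ)] with s h0 using (hgmem s h h0 hh).1
  have htop : Tendsto (fun t : ℝ => t⁻¹) (𝓝[>] 0) atTop := tendsto_inv_nhdsGT_zero
  -- the horizontal line at height `h`, parametrized by `1/t` so that it ends at `t = 0`
  set σ : ℝ → ℝ → ℂ := fun h t => z (g ((t⁻¹ : ℝ) + h * Complex.I)) with hσ
  have hne : (Ioo (-(3 / 8 * δ)) 0).Infinite := Ioo_infinite (by linarith)
  have habs : ∀ h ∈ Ioo (-(3 / 8 * δ)) 0, |h| ≤ 3 / 8 * δ := fun h hh => by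
    rw [abs_of_neg hh.2]; linarith [hh.1]
  refine infinite_of_injOn_mapsTo (f := fun h => map (σ h) (𝓝[>] 0)) ?_ ?_ hne
  · intro h hh h' hh' heq
    have heq : map (σ h) (𝓝[>] 0) = map (σ h') (𝓝[>] 0) := heq
    have h1 : ∀ k ∈ Ioo (-(3 / 8 * δ)) 0, ∀ᶠ w in map (σ k) (𝓝[>] 0),
        ∃ t : ℝ, 0 < t ∧ w = σ k t := by
      intro k hk
      rw [eventually_map]
      filter_upwards [self_mem_nhdsWithin] with t ht using ⟨t, ht, rfl⟩
    have h2 := h1 h hh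
    rw [heq] at h2
    obtain ⟨w, ⟨t, ht, hw⟩, t', ht', hw'⟩ := (h2.and (h1 h' hh')).exists
    obtain ⟨h3, h4⟩ := hgmem t⁻¹ h (inv_pos.2 ht).le (habs h hh)
    obtain ⟨h5, h6⟩ := hgmem t'⁻¹ h' (inv_pos.2 ht').le (habs h' hh')
    have h7 := hinj h3 h5 (hw.symm.trans hw')
    rw [h7, h6] at h4
    have := congrArg Complex.im h4
    simpa using this.symm
  · intro h hh
    have hVim : ∀ t : ℝ, 0 < t → (g ((t⁻¹ : ℝ) + h * Complex.I)).im < 0 := by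
      intro t ht
      obtain ⟨h3, h4⟩ := hgmem t⁻¹ h (inv_pos.2 ht).le (habs h hh)
      refine hsign _ h3 ?_
      rw [h4]
      simpa using hh.2
    refine ⟨σ h, ?_, ?_, rfl⟩
    · intro t ht
      have ht0 := ht.1
      obtain ⟨h3, h4⟩ := hgmem t⁻¹ h (inv_pos.2 ht0).le (habs h hh)
      set V := g ((t⁻¹ : ℝ) + h * Complex.I) with hV
      have hκ0 : κ V ≠ 0 := by
        intro h0
        have := hκ1 V h3
        rw [h0] at this
        norm_num at this
      refine ⟨by rw [image_id]; exact him V h3 (hVim t ht0),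
        deriv z V * ((κ V)⁻¹ * ((-(t ^ 2)⁻¹ : ℝ) : ℂ)), ?_, ?_⟩
      · have h5 := hasDerivAt_invFunOn hUo hΦdiff hΦinj h3
        rw [(hΦd V h3).deriv, h4] at h5
        have h6 : HasDerivAt (fun t : ℝ => ((t⁻¹ : ℝ) : ℂ) + h * Complex.I)
            ((-(t ^ 2)⁻¹ : ℝ) : ℂ) t := ((hasDerivAt_inv ht0.ne').ofReal_comp).add_const _
        have h7 : HasDerivAt (fun t : ℝ => g ((t⁻¹ : ℝ) + h * Complex.I)) _ t :=
          HasDerivAt.comp t (h₂ := g) h5 h6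
        exact (hz.differentiableAt (hUo.mem_nhds h3)).hasDerivAt.comp t h7
      · have h7 := (hA.mul_of_pos (show 0 < ((t ^ 2)⁻¹) ^ 2 by positivity))
        convert h7 using 1
        calc q (z V) * (deriv z V * ((κ V)⁻¹ * ((-(t ^ 2)⁻¹ : ℝ) : ℂ))) ^ 2
            = (q (z V) * deriv z V ^ 2) * ((κ V)⁻¹ * ((-(t ^ 2)⁻¹ : ℝ) : ℂ)) ^ 2 := by ring
          _ = A * κ V ^ 2 * ((κ V)⁻¹ * ((-(t ^ 2)⁻¹ : ℝ) : ℂ)) ^ 2 := by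
              rw [hq V h3 (hVim t ht0)]
          _ = _ := by
              push_cast
              field_simp
    · rw [primeEnd, map_id]
      apply tendsto_nhdsWithin_of_tendsto_nhds_of_eventually_within
      · exact hlim.comp ((hgre h (habs h hh)).comp htop)
      · filter_upwards [self_mem_nhdsWithin] with t ht
        exact him _ (hgmem t⁻¹ h (inv_pos.2 ht).le (habs h hh)).1 (hVim t ht)

theorem neg_I_mul_cpow {u : ℂ} (hu : 0 < u.re) (m : ℂ) :
    (-Complex.I * u) ^ m = (-Complex.I) ^ m * u ^ m := by
  have hu0 : u ≠ 0 := fun h => by simp [h] at hu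
  have hI : -Complex.I ≠ 0 := neg_ne_zero.2 Complex.I_ne_zero
  have h1 := abs_lt.1 (Complex.abs_arg_lt_pi_div_two_iff.2 (Or.inl hu))
  have hpi := Real.pi_pos
  rw [Complex.cpow_def_of_ne_zero (mul_ne_zero hI hu0), Complex.cpow_def_of_ne_zero hI,
    Complex.cpow_def_of_ne_zero hu0, Complex.log_mul hI hu0, add_mul, Complex.exp_add]
  rw [Complex.arg_neg_I]
  constructor <;> linarith

/-- The boundary direction at the right of a boundary point, in terms of the leading coefficient. -/
theorem HasBoundaryExponent.hasArgTwice_of_isBoundaryArc {Q k : ℂ → ℂ} {c m θ ε : ℝ} {C : ℂ}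
    (hk : IsRealAnalyticAt k c) (hk1 : k c = 1)
    (hQ : ∀ᶠ z in 𝓝[upperHalf] (c : ℂ), Q z = C * ((-Complex.I * (z - c)) ^ (m : ℂ) * k z))
    (hε : 0 < ε) (harc : IsBoundaryArc Q id θ (Ioo c (c + ε))) :
    HasArgTwice θ (C * (-Complex.I) ^ (m : ℂ)) := by
  have hc := tendsto_ofReal_nhds c
  rw [eventually_nhdsWithin_iff] at hQ
  have hkpos : ∀ᶠ x : ℝ in 𝓝 c, 0 < (k x).re :=
    ((Complex.continuous_re.tendsto _).comp (hk.analytic.continuousAt.tendsto.comp hc)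
      ).eventually_const_lt (by simp [hk1])
  obtain ⟨x, ⟨⟨⟨h1, h2⟩, h3⟩, h4⟩, hx⟩ :=
    ((((((hc.eventually hQ.eventually_nhds).and hkpos).and hk.real).and
      (hc.eventually hk.analytic.eventually_analyticAt)).filter_mono nhdsWithin_le_nhds).and
        (Ioo_mem_nhdsGT (show c < c + ε by linarith))).exists
  obtain ⟨q, hq, harg⟩ := harc.exists_tendsto isOpen_Ioo hx
  have hxc : 0 < x - c := sub_pos.2 hx.1
  have hxcc : ((x : ℂ) - c) = ((x - c : ℝ) : ℂ) := by push_cast; ring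
  have hslit : -Complex.I * ((x : ℂ) - c) ∈ Complex.slitPlane := by
    rw [hxcc, Complex.mem_slitPlane_iff]
    right
    simpa [sub_eq_zero, eq_comm] using hx.1.ne'
  have hcont : ContinuousAt (fun z : ℂ => C * ((-Complex.I * (z - c)) ^ (m : ℂ) * k z)) x := by
    refine continuousAt_const.mul (ContinuousAt.mul ?_ h4.continuousAt)
    exact (continuousAt_const.mul (continuousAt_id.sub continuousAt_const)).cpow
      continuousAt_const hslit
  have hlim : Tendsto Q (𝓝[upperHalf] (x : ℂ))
      (𝓝 (C * ((-Complex.I * ((x : ℂ) - c)) ^ (m : ℂ) * k x))) :=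
    (hcont.tendsto.mono_left nhdsWithin_le_nhds).congr'
      ((eventually_nhdsWithin_iff.2 h1).mono fun z hz => hz.symm)
  rw [tendsto_nhds_unique hq hlim, neg_I_mul_cpow (by rw [hxcc]; simpa using hxc), hxcc,
    ← Complex.ofReal_cpow hxc.le] at harg
  refine HasArgTwice.of_mul_pos (r := (x - c) ^ m * (k x).re) ?_ (by positivity)
  convert harg using 1
  rw [show k x = ((k x).re : ℂ) from Complex.ext (by simp) (by simp [h3])]
  push_cast
  simp only [Complex.ofReal_re]
  ring

/-- The existence of infinitely many trajectories at a boundary point of exponent `m`, in a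
coordinate `V` with `z - c = exp (-ℓ(V))` in which `(z - c)^m dz²` is constant. -/
theorem infinite_trajectoryEnds_of_log_coordinate {Q ℓ : ℂ → ℂ} {c m θ ε R δ B : ℝ} (hδ : 0 < δ)
    (hQ : HasBoundaryExponent Q c m) (hε : 0 < ε) (harc : IsBoundaryArc Q id θ (Ioo c (c + ε)))
    (hB : 0 < B) (hℓ : DifferentiableOn ℂ ℓ (halfStrip R δ)) (hinj : InjOn ℓ (halfStrip R δ))
    (him : ∀ V ∈ halfStrip R δ, |(ℓ V).im| < Real.pi / 2 ∧ (V.im < 0 → (ℓ V).im < 0) ∧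
      (V.im = 0 → (ℓ V).im = 0))
    (hlim : Tendsto (fun V => (ℓ V).re) (comap Complex.re atTop ⊓ 𝓟 (halfStrip R δ)) atTop)
    (heq : ∀ V ∈ halfStrip R δ, Complex.exp (-((m + 2) * ℓ V)) * deriv ℓ V ^ 2 = B) :
    (trajectoryEnds Q id c θ).Infinite := by
  obtain ⟨C, hC, k, hk, hk1, hqk⟩ := hQ.normalize
  have hA := HasBoundaryExponent.hasArgTwice_of_isBoundaryArc hk hk1 hqk hε harc
  have hs : IsRealAnalyticAt (fun z => k z ^ ((1 / 2 : ℝ) : ℂ)) c := hk.cpow (by simp [hk1]) _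
  have hs1 : Tendsto (fun z => k z ^ ((1 / 2 : ℝ) : ℂ)) (𝓝 (c : ℂ)) (𝓝 1) := by
    have := hs.analytic.continuousAt.tendsto
    simp only [hk1, Complex.one_cpow] at this
    exact this
  have hball := hs.analytic.eventually_analyticAt.and
    ((hs1.eventually (Metric.closedBall_mem_nhds (1 : ℂ) (by norm_num : (0 : ℝ) < 1 / 4))).and
      (eventually_nhdsWithin_iff.1 hqk))
  obtain ⟨η, hη, hball⟩ := Metric.eventually_nhds_iff_ball.1 hball
  obtain ⟨η', hη', hballr⟩ := Metric.eventually_nhds_iff_ball.1 hs.real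
  set η₀ := min η η' with hη₀
  have hη₀0 : 0 < η₀ := lt_min hη hη'
  -- far to the right, `z - c = exp (-ℓ)` is small
  have hfar : ∀ᶠ V in comap Complex.re atTop ⊓ 𝓟 (halfStrip R δ), -Real.log η₀ < (ℓ V).re :=
    hlim.eventually_gt_atTop _
  obtain ⟨R', hR'⟩ : ∃ R' : ℝ, ∀ V ∈ halfStrip R δ, R' ≤ V.re → -Real.log η₀ < (ℓ V).re := by
    rw [eventually_inf_principal, eventually_comap] at hfar
    obtain ⟨R', hR'⟩ := eventually_atTop.1 hfar
    exact ⟨R', fun V hV h => hR' V.re h V rfl hV⟩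
  set R₁ := max R R' with hR₁
  have hsub : halfStrip R₁ δ ⊆ halfStrip R δ := halfStrip_mono (le_max_left _ _)
  have hnorm : ∀ V ∈ halfStrip R₁ δ, ‖Complex.exp (-ℓ V)‖ < η₀ := by
    intro V hV
    rw [Complex.norm_exp, ← Real.lt_log_iff_exp_lt hη₀0, Complex.neg_re]
    linarith [hR' V (hsub hV) ((le_max_right R R').trans hV.1.le)]
  have hmem : ∀ V ∈ halfStrip R₁ δ, (c : ℂ) + Complex.exp (-ℓ V) ∈ Metric.ball (c : ℂ) η := by
    intro V hV
    rw [mem_ball_iff_norm, add_sub_cancel_left]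
    exact (hnorm V hV).trans_le (min_le_left _ _)
  have hpi := Real.pi_pos
  have hlog : ∀ V ∈ halfStrip R δ, Complex.log (Complex.exp (-ℓ V)) = -ℓ V := by
    intro V hV
    have := abs_lt.1 (him V hV).1
    apply Complex.log_exp <;> rw [Complex.neg_im] <;> linarith
  have hexpre : ∀ V ∈ halfStrip R δ, 0 < (Complex.exp (-ℓ V)).re := by
    intro V hV
    rw [Complex.exp_re]
    have := abs_lt.1 (him V hV).1
    exact mul_pos (Real.exp_pos _) (Real.cos_pos_of_mem_Ioo
      (by rw [Complex.neg_im]; constructor <;> linarith))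
  have hexpim : ∀ V ∈ halfStrip R δ, V.im < 0 → 0 < (Complex.exp (-ℓ V)).im := by
    intro V hV hneg
    rw [Complex.exp_im]
    have h1 := abs_lt.1 (him V hV).1
    have h2 := (him V hV).2.1 hneg
    exact mul_pos (Real.exp_pos _) (Real.sin_pos_of_pos_of_lt_pi
      (by rw [Complex.neg_im]; linarith) (by rw [Complex.neg_im]; linarith))
  have hder : ∀ V ∈ halfStrip R δ, HasDerivAt (fun V => (c : ℂ) + Complex.exp (-ℓ V))
      (Complex.exp (-ℓ V) * -deriv ℓ V) V := fun V hV =>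
    ((hℓ.differentiableAt ((isOpen_halfStrip R δ).mem_nhds hV)).hasDerivAt.neg.cexp).const_add _
  refine infinite_trajectoryEnds_of_halfStrip (z := fun V => (c : ℂ) + Complex.exp (-ℓ V))
    (κ := fun V => k (c + Complex.exp (-ℓ V)) ^ ((1 / 2 : ℝ) : ℂ)) (R := R₁)
    (A := C * (-Complex.I) ^ (m : ℂ) * B) hδ ?_ ?_ ?_ ?_ ?_ ?_ ?_ (hA.mul_of_pos hB) ?_
  · exact fun V hV => (hder V (hsub hV)).differentiableAt.differentiableWithinAt
  · intro V hV W hW h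
    have h1 := congrArg Complex.log (add_left_cancel h)
    rw [hlog V (hsub hV), hlog W (hsub hW)] at h1
    exact hinj (hsub hV) (hsub hW) (neg_injective h1)
  · intro V hV hneg
    simpa using hexpim V (hsub hV) hneg
  · have h1 : Tendsto (fun V => (c : ℂ) + Complex.exp (-ℓ V))
        (comap Complex.re atTop ⊓ 𝓟 (halfStrip R δ)) (𝓝 ((c : ℂ) + 0)) := by
      refine tendsto_const_nhds.add (Complex.tendsto_exp_comap_re_atBot.comp ?_)
      rw [tendsto_comap_iff]
      simpa [Function.comp_def] using tendsto_neg_atTop_atBot.comp hlim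
    rw [add_zero] at h1
    exact h1.mono_left (inf_le_inf_left _ (principal_mono.2 hsub))
  · intro V hV
    exact (DifferentiableAt.comp V (g := fun z => k z ^ ((1 / 2 : ℝ) : ℂ))
      (f := fun V => (c : ℂ) + Complex.exp (-ℓ V)) (hball _ (hmem V hV)).1.differentiableAt
      (hder V (hsub hV)).differentiableAt).differentiableWithinAt
  · intro V hV
    exact mem_closedBall_iff_norm.1 (hball _ (hmem V hV)).2.1
  · intro x hx
    have hx' : (x : ℂ) ∈ halfStrip R₁ δ := ⟨by simpa using hx, by simpa using hδ⟩
    have h1 := (him x (hsub hx')).2.2 (Complex.ofReal_im x)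
    have h2 : Complex.exp (-ℓ x) = ((Real.exp (-(ℓ x).re) : ℝ) : ℂ) := by
      rw [Complex.ofReal_exp, Complex.ofReal_neg]
      congr 2
      exact Complex.ext (by simp) (by simp [h1])
    have h3 := hnorm x hx'
    rw [h2, Complex.norm_real] at h3
    have h4 := hballr (c + Real.exp (-(ℓ x).re)) (by
      rw [mem_ball_iff_norm, add_sub_cancel_left]
      exact h3.trans_le (min_le_right _ _))
    simp only [h2]
    exact_mod_cast h4
  · intro V hV hneg
    have h1 := (hball _ (hmem V hV)).2.2 (by simpa using hexpim V (hsub hV) hneg)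
    rw [h1, (hder V (hsub hV)).deriv, add_sub_cancel_left, neg_I_mul_cpow (hexpre V (hsub hV)),
      Complex.cpow_def_of_ne_zero (Complex.exp_ne_zero _) (m : ℂ), hlog V (hsub hV),
      ← Complex.cpow_nat_mul, ← heq V (hsub hV)]
    have h2 : Complex.exp (-ℓ V * m) * Complex.exp (-ℓ V) ^ 2 =
        Complex.exp (-((m + 2) * ℓ V)) := by
      rw [← Complex.exp_nat_mul, ← Complex.exp_add]
      congr 1
      push_cast
      ring
    rw [← h2]
    have h3 : ((2 : ℕ) : ℂ) * ((1 / 2 : ℝ) : ℂ) = 1 := by norm_num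
    rw [h3, Complex.cpow_one]
    ring

/-- Infinitely many trajectories end at a boundary point of exponent `m ≤ -2`. -/
theorem HasBoundaryExponent.infinite_trajectoryEnds {Q : ℂ → ℂ} {c m θ ε : ℝ}
    (hQ : HasBoundaryExponent Q c m) (hm : m ≤ -2) (hε : 0 < ε)
    (harc : IsBoundaryArc Q id θ (Ioo c (c + ε))) : (trajectoryEnds Q id c θ).Infinite := by
  have hpi := Real.pi_pos
  -- the coordinate is `V = -log (z - c)` for `m = -2`, and `V = (z - c)^(-p)` for `m < -2`
  rcases hm.eq_or_lt with rfl | hm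
  · refine infinite_trajectoryEnds_of_log_coordinate (ℓ := id) (R := 0) (δ := 1) (B := 1) one_pos hQ
      hε harc one_pos differentiableOn_id (injOn_id _) ?_ ?_ ?_
    · intro V hV
      exact ⟨hV.2.trans (by linarith [Real.pi_gt_three]), id, id⟩
    · exact tendsto_comap.mono_left inf_le_left
    · intro V hV
      simp
  · set p : ℝ := -(m + 2) / 2 with hp
    have hp0 : 0 < p := by rw [hp]; linarith
    -- a half-strip in which the argument is small
    obtain ⟨η, hη, hball⟩ := Metric.eventually_nhds_iff_ball.1
      ((Complex.continuousAt_arg (by simp : (1 : ℂ) ∈ Complex.slitPlane)).eventually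
        (Metric.ball_mem_nhds (Complex.arg 1) (show 0 < Real.pi / 2 * p by positivity)))
    have hη' : 0 < η⁻¹ := inv_pos.2 hη
    have hVre : ∀ V ∈ halfStrip η⁻¹ 1, 0 < V.re := fun V hV => hη'.trans hV.1
    have hV0 : ∀ V ∈ halfStrip η⁻¹ 1, V ≠ 0 := fun V hV h => by
      have := hVre V hV
      simp [h] at this
    have harg : ∀ V ∈ halfStrip η⁻¹ 1, |V.arg| < Real.pi / 2 * p := by
      intro V hV
      have h0 := hVre V hV
      have h1 := hball (((V.re)⁻¹ : ℝ) * V) (by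
        have h2 : (((V.re)⁻¹ : ℝ) * V : ℂ) - 1 = ((V.im / V.re : ℝ) : ℂ) * Complex.I := by
          apply Complex.ext
          · simp [h0.ne']
          · simp
            ring
        rw [mem_ball_iff_norm, h2, norm_mul, Complex.norm_I, mul_one, Complex.norm_real,
          Real.norm_eq_abs, abs_div, abs_of_pos h0, div_lt_iff₀ h0]
        have h3 : 1 < η * V.re := by
          have := mul_lt_mul_of_pos_left hV.1 hη
          rwa [mul_inv_cancel₀ hη.ne'] at this
        exact hV.2.trans h3)
      rw [Complex.arg_real_mul _ (inv_pos.2 h0), Complex.arg_one, Real.dist_eq, sub_zero] at h1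
      exact h1
    have hpc : (p : ℂ) ≠ 0 := by exact_mod_cast hp0.ne'
    have hℓim : ∀ V : ℂ, (Complex.log V / p).im = V.arg / p := by
      intro V
      rw [Complex.div_ofReal_im, Complex.log_im]
    have hℓre : ∀ V : ℂ, (Complex.log V / p).re = Real.log ‖V‖ / p := by
      intro V
      rw [Complex.div_ofReal_re, Complex.log_re]
    have hder : ∀ V ∈ halfStrip η⁻¹ 1, HasDerivAt (fun V => Complex.log V / p) (V⁻¹ / p) V :=
      fun V hV => (Complex.hasDerivAt_log (Or.inl (hVre V hV))).div_const _
    refine infinite_trajectoryEnds_of_log_coordinate (ℓ := fun V => Complex.log V / p) (R := η⁻¹)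
      (δ := 1) (B := 1 / p ^ 2) one_pos hQ hε harc (by positivity) ?_ ?_ ?_ ?_ ?_
    · exact fun V hV => (hder V hV).differentiableAt.differentiableWithinAt
    · intro V hV W hW h
      have h1 : Complex.log V = Complex.log W := (div_left_inj' hpc).1 h
      rw [← Complex.exp_log (hV0 V hV), h1, Complex.exp_log (hV0 W hW)]
    · intro V hV
      simp only [hℓim]
      refine ⟨?_, fun h => div_neg_of_neg_of_pos (Complex.arg_neg_iff.2 h) hp0, fun h => ?_⟩
      · rw [abs_div, abs_of_pos hp0, div_lt_iff₀ hp0]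
        exact harg V hV
      · rw [Complex.arg_eq_zero_iff.2 ⟨(hVre V hV).le, h⟩, zero_div]
    · simp only [hℓre]
      refine Tendsto.atTop_div_const hp0 (Real.tendsto_log_atTop.comp ?_)
      exact tendsto_atTop_mono (fun V => Complex.re_le_norm V)
        (tendsto_comap.mono_left inf_le_left)
    · intro V hV
      rw [(hder V hV).deriv, show -(((m : ℂ) + 2) * (Complex.log V / p)) =
        (2 : ℕ) * Complex.log V by
          rw [hp]
          have : ((m : ℂ) + 2) ≠ 0 := by
            have : m + 2 ≠ 0 := by linarith
            exact_mod_cast this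
          push_cast
          field_simp, Complex.exp_nat_mul, Complex.exp_log (hV0 V hV)]
      have := hV0 V hV
      push_cast
      field_simp

/-! ### Symmetric products of powers -/

/-- Partial fractions with distinct poles are linearly independent on every infinite set. -/
theorem eq_zero_of_sum_div_sub_eq_zero {B : Finset ℂ} {d : ℂ → ℂ} {T : Set ℂ} (hT : T.Infinite)
    (hTB : ∀ x ∈ T, x ∉ B) (h : ∀ x ∈ T, ∑ b ∈ B, d b / (x - b) = 0) : ∀ b ∈ B, d b = 0 := by
  classical
  set p : Polynomial ℂ := ∑ b ∈ B, Polynomial.C (d b) *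
    ∏ b' ∈ B.erase b, (Polynomial.X - Polynomial.C b') with hp
  have heval : ∀ x, p.eval x = ∑ b ∈ B, d b * ∏ b' ∈ B.erase b, (x - b') := by
    intro x
    simp [hp, Polynomial.eval_finsetSum, Polynomial.eval_prod]
  have hp0 : p = 0 := by
    refine Polynomial.eq_zero_of_infinite_isRoot p (hT.mono fun x hx => ?_)
    show p.eval x = 0
    rw [heval, ← mul_zero (∏ b ∈ B, (x - b)), ← h x hx, Finset.mul_sum]
    refine Finset.sum_congr rfl fun b hb => ?_
    have hxb : x - b ≠ 0 := sub_ne_zero.2 fun h0 => hTB x hx (h0 ▸ hb)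
    rw [← Finset.mul_prod_erase B _ hb]
    field_simp
  intro b hb
  have h1 := heval b
  rw [hp0, Polynomial.eval_zero, Finset.sum_eq_single_of_mem b hb] at h1
  · refine (mul_eq_zero.1 h1.symm).resolve_right (Finset.prod_ne_zero_iff.2 fun b' hb' => ?_)
    exact sub_ne_zero.2 (Finset.ne_of_mem_erase hb').symm
  · intro b' _ hne
    rw [Finset.prod_eq_zero (i := b) (Finset.mem_erase.2 ⟨hne.symm, hb⟩) (sub_self b), mul_zero]

section PowerProduct

variable {ι : Type*} {a : ι → ℂ} {α : ι → ℝ}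

/-- The points `a i` with exponents `α i` are symmetric with respect to the real axis, and the
exponents at the nonreal points are integers. -/
structure IsReflectionSymmetric (a : ι → ℂ) (α : ι → ℝ) : Prop where
  injective : Function.Injective a
  exists_conj : ∀ i, ∃ k, a k = (starRingEnd ℂ) (a i) ∧ α k = α i
  exists_int : ∀ i, (a i).im ≠ 0 → ∃ p : ℤ, α i = p

theorem IsReflectionSymmetric.exists_perm (h : IsReflectionSymmetric a α) :
    ∃ τ : Equiv.Perm ι, ∀ i, a (τ i) = (starRingEnd ℂ) (a i) ∧ α (τ i) = α i := by
  choose τ hτ using h.exists_conj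
  have hinv : Function.Involutive τ := fun i => h.injective (by
    rw [(hτ (τ i)).1, (hτ i).1, Complex.conj_conj])
  exact ⟨hinv.toPerm, hτ⟩

variable [Fintype ι]

/-- The principal power differs from the one in `HasBoundaryExponent` by a constant factor in the
upper half-plane. -/
theorem hasBoundaryExponent_cpow_sub {x b α : ℝ} :
    HasBoundaryExponent (fun z : ℂ => (z - b) ^ (α : ℂ)) x (if (b : ℂ) = x then α else 0) := by
  have hI : Complex.I ≠ 0 := Complex.I_ne_zero
  have hIα : Complex.I ^ (α : ℂ) ≠ 0 := by
    rw [Complex.cpow_def_of_ne_zero hI]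
    exact Complex.exp_ne_zero _
  split_ifs with hb
  · have hb : b = x := by exact_mod_cast hb
    subst hb
    refine ⟨Complex.I ^ (α : ℂ), hIα, fun _ => ((1 : ℝ) : ℂ), IsRealAnalyticAt.const 1, by simp, ?_⟩
    filter_upwards [self_mem_nhdsWithin] with z hz
    have hz : 0 < z.im := hz
    have h1 : 0 < (-Complex.I * (z - b)).re := by rw [re_neg_I_mul]; simpa using hz
    have h2 := abs_lt.1 (Complex.abs_arg_lt_pi_div_two_iff.2 (Or.inl h1))
    have h0 : -Complex.I * (z - b) ≠ 0 := fun h => by rw [h] at h1; simp at h1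
    have h3 : z - b = Complex.I * (-Complex.I * (z - b)) := by
      linear_combination (z - b) * Complex.I_sq
    conv_lhs => rw [h3]
    rw [Complex.cpow_def_of_ne_zero (mul_ne_zero hI h0), Complex.cpow_def_of_ne_zero hI,
      Complex.cpow_def_of_ne_zero h0, Complex.log_mul hI h0, add_mul, Complex.exp_add]
    · push_cast
      ring
    · rw [Complex.arg_I]
      have := Real.pi_pos
      constructor <;> linarith
  · have hb : b ≠ x := fun h => hb (by rw [h])
    have hsub : IsRealAnalyticAt (fun z : ℂ => z - b) x :=
      IsRealAnalyticAt.id.sub (IsRealAnalyticAt.const b)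
    rcases lt_or_gt_of_ne hb with h | h
    · have hre : 0 < ((x : ℂ) - b).re := by simpa using h
      refine HasBoundaryExponent.of_isRealAnalyticAt (hsub.cpow hre α) ?_
      rw [Complex.cpow_def_of_ne_zero (fun h0 => by rw [h0] at hre; simp at hre)]
      exact Complex.exp_ne_zero _
    · have hsub' : IsRealAnalyticAt (fun z : ℂ => b - z) x :=
        (IsRealAnalyticAt.const b).sub IsRealAnalyticAt.id
      have hre : 0 < ((b : ℂ) - x).re := by simpa using h
      have hk := HasBoundaryExponent.of_isRealAnalyticAt (hsub'.cpow hre α) (by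
        rw [Complex.cpow_def_of_ne_zero (fun h0 => by rw [h0] at hre; simp at hre)]
        exact Complex.exp_ne_zero _)
      have hk' := (HasBoundaryExponent.const (x := x)
        (Complex.exp_ne_zero (Real.pi * Complex.I * α))).mul hk
      rw [add_zero] at hk'
      refine hk'.congr ?_
      have hre' : ∀ᶠ z : ℂ in 𝓝 (x : ℂ), 0 < (b - z).re :=
        (Complex.continuous_re.continuousAt.comp hsub'.analytic.continuousAt).eventually_const_lt hre
      filter_upwards [self_mem_nhdsWithin, mem_nhdsWithin_of_mem_nhds hre'] with z hz hz'
      have hz : 0 < z.im := hz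
      have h0 : (b : ℂ) - z ≠ 0 := fun h0 => by rw [h0] at hz'; simp at hz'
      have h3 : z - (b : ℂ) = -1 * (b - z) := by ring
      have h4 : (b - z : ℂ).arg < 0 := Complex.arg_neg_iff.2 (by simpa using hz)
      rw [h3, Complex.cpow_def_of_ne_zero (mul_ne_zero (by norm_num) h0),
        Complex.cpow_def_of_ne_zero h0, Complex.log_mul (by norm_num) h0, Complex.log_neg_one,
        add_mul, Complex.exp_add]
      rw [Complex.arg_neg_one]
      have := Real.pi_pos
      have := Complex.neg_pi_lt_arg (b - z : ℂ)
      constructor <;> linarith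

/-- A symmetric product of powers has at a real point the exponent that the product shows. -/
theorem IsReflectionSymmetric.hasBoundaryExponent (h : IsReflectionSymmetric a α) (x : ℝ) :
    HasBoundaryExponent (fun z => ∏ i, (z - a i) ^ (α i : ℂ)) x
      (∑ i, if a i = x then α i else 0) := by
  classical
  have hreal : HasBoundaryExponent
      (fun z => ∏ i ∈ Finset.univ.filter fun i => (a i).im = 0, (z - a i) ^ (α i : ℂ)) x
      (∑ i ∈ Finset.univ.filter fun i => (a i).im = 0, if a i = x then α i else 0) := by
    refine HasBoundaryExponent.finset_prod _ fun i hi => ?_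
    have h1 : a i = ((a i).re : ℂ) := Complex.ext (by simp) (by simpa using hi)
    rw [h1]
    exact hasBoundaryExponent_cpow_sub
  -- the nonreal factors form conjugate pairs with integer exponents
  have hnon : HasBoundaryExponent
      (fun z => ∏ i ∈ Finset.univ.filter fun i => ¬ (a i).im = 0, (z - a i) ^ (α i : ℂ)) x 0 := by
    choose! p hp using h.exists_int
    obtain ⟨τ, hτ⟩ := h.exists_perm
    have hne : ∀ y : ℝ, ∀ i, (a i).im ≠ 0 → (y : ℂ) - a i ≠ 0 := fun y i hi h0 => hi (by
      rw [← sub_eq_zero.1 h0, Complex.ofReal_im])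
    have hcpow : ∀ i, (a i).im ≠ 0 → ∀ w : ℂ, w ^ (α i : ℂ) = w ^ (p i) := fun i hi w => by
      rw [hp i hi, Complex.ofReal_intCast, Complex.cpow_intCast]
    refine HasBoundaryExponent.of_isRealAnalyticAt ⟨?_, Eventually.of_forall fun y => ?_⟩ ?_
    · refine Finset.analyticAt_fun_prod _ fun i hi => ?_
      have hi : (a i).im ≠ 0 := by simpa using hi
      simp only [hcpow i hi]
      exact (analyticAt_id.sub analyticAt_const).zpow (hne x i hi)
    · rw [← Complex.conj_eq_iff_im, map_prod]
      refine Finset.prod_equiv τ (fun i => ?_) fun i hi => ?_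
      · simp [(hτ i).1]
      · have hi : (a i).im ≠ 0 := by simpa using hi
        have hi' : (a (τ i)).im ≠ 0 := by simpa [(hτ i).1] using hi
        have hpp : p (τ i) = p i := by
          have := (hτ i).2
          rw [hp _ hi, hp _ hi'] at this
          exact_mod_cast this
        rw [hcpow i hi, hcpow _ hi', hpp, (hτ i).1, map_zpow₀, map_sub, Complex.conj_ofReal]
    · refine Finset.prod_ne_zero_iff.2 fun i hi => ?_
      have hi : (a i).im ≠ 0 := by simpa using hi
      rw [hcpow i hi]
      exact zpow_ne_zero _ (hne x i hi)
  have := hreal.mul hnon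
  simp only [Finset.prod_filter_mul_prod_filter_not] at this
  convert this using 1
  rw [add_zero, Finset.sum_filter]
  refine Finset.sum_congr rfl fun i _ => ?_
  split_ifs with h1 h2 h2 <;> first | rfl | (exfalso; apply h2; rw [h1, Complex.ofReal_im])

theorem eq_zero_of_tendsto_rpow {y L : ℝ} (hL : 0 < L)
    (h : Tendsto (fun t : ℝ => t ^ y) (𝓝[>] 0) (𝓝 L)) : y = 0 := by
  have hpos : ∀ {y L : ℝ}, 0 < L → Tendsto (fun t : ℝ => t ^ y) (𝓝[>] 0) (𝓝 L) → ¬ 0 < y := by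
    intro y L hL h hy
    have h1 : Tendsto (fun t : ℝ => t ^ y) (𝓝[>] 0) (𝓝 0) := by
      have := (Real.continuousAt_rpow_const 0 y (Or.inr hy.le)).tendsto
      rw [Real.zero_rpow hy.ne'] at this
      exact this.mono_left nhdsWithin_le_nhds
    exact hL.ne' (tendsto_nhds_unique h h1)
  have h1 := hpos hL h
  have h2 : ¬ 0 < -y := hpos (inv_pos.2 hL) ((h.inv₀ hL.ne').congr' (by
    filter_upwards [self_mem_nhdsWithin] with t ht
    exact (Real.rpow_neg (le_of_lt ht) y).symm))
  linarith

theorem eventually_ne_of_finite (a : ι → ℂ) (w : ℂ) : ∀ᶠ z in 𝓝[≠] w, ∀ i, z ≠ a i := by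
  rw [eventually_all]
  intro i
  by_cases h : w = a i
  · subst h
    exact self_mem_nhdsWithin
  · exact mem_nhdsWithin_of_mem_nhds (isOpen_ne.mem_nhds h)

theorem prod_cpow_ne_zero {z : ℂ} (hz : ∀ i, z ≠ a i) : ∏ i, (z - a i) ^ (α i : ℂ) ≠ 0 := by
  refine Finset.prod_ne_zero_iff.2 fun i _ => ?_
  rw [Complex.cpow_def_of_ne_zero (sub_ne_zero.2 (hz i))]
  exact Complex.exp_ne_zero _

/-- The exponent of a meromorphic product of powers at one of its points is an integer, as the
growth at this point shows. -/
theorem exists_int_of_meromorphicAt {Q : ℂ → ℂ} {R : ℂ} (hinj : Function.Injective a) (hR : R ≠ 0)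
    {i₀ : ι} (hmer : MeromorphicAt Q (a i₀))
    (hQ : ∀ᶠ w in 𝓝[≠] (a i₀), Q w = R * ∏ i, (w - a i) ^ (α i : ℂ)) : ∃ p : ℤ, α i₀ = p := by
  classical
  have hne : meromorphicOrderAt Q (a i₀) ≠ ⊤ := by
    rw [meromorphicOrderAt_ne_top_iff_eventually_ne_zero hmer]
    filter_upwards [hQ, eventually_ne_of_finite a (a i₀)] with w h1 h2
    rw [h1]
    exact mul_ne_zero hR (prod_cpow_ne_zero h2)
  obtain ⟨g, hg, hg0, hgQ⟩ := (meromorphicOrderAt_ne_top_iff hmer).1 hne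
  set p := (meromorphicOrderAt Q (a i₀)).untop₀ with hp
  refine ⟨p, ?_⟩
  set w₀ := a i₀ with hw₀
  set hfun : ℂ → ℝ := fun w => ‖R‖ * ∏ i ∈ Finset.univ.erase i₀, ‖w - a i‖ ^ (α i) with hhfun
  have hcont : ContinuousAt hfun w₀ := by
    refine continuousAt_const.mul (tendsto_finsetProd _ fun i hi => ?_)
    refine ContinuousAt.rpow_const (by fun_prop) (Or.inl ?_)
    exact norm_ne_zero_iff.2 (sub_ne_zero.2 (hinj.ne (Finset.ne_of_mem_erase hi).symm))
  have hpos : 0 < hfun w₀ := by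
    refine mul_pos (norm_pos_iff.2 hR) (Finset.prod_pos fun i hi => ?_)
    exact Real.rpow_pos_of_pos (norm_pos_iff.2
      (sub_ne_zero.2 (hinj.ne (Finset.ne_of_mem_erase hi).symm))) _
  have hpath : Tendsto (fun t : ℝ => w₀ + t) (𝓝[>] 0) (𝓝[≠] w₀) := by
    apply tendsto_nhdsWithin_of_tendsto_nhds_of_eventually_within
    · have : Continuous fun t : ℝ => w₀ + t := by fun_prop
      simpa using (this.tendsto 0).mono_left nhdsWithin_le_nhds
    · filter_upwards [self_mem_nhdsWithin] with t ht
      have ht : 0 < t := ht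
      simpa using ht.ne'
  have hlim : Tendsto (fun t : ℝ => t ^ ((p : ℝ) - α i₀)) (𝓝[>] 0) (𝓝 (hfun w₀ / ‖g w₀‖)) := by
    have h1 : Tendsto (fun w => hfun w / ‖g w‖) (𝓝[≠] w₀) (𝓝 (hfun w₀ / ‖g w₀‖)) :=
      ((hcont.div hg.continuousAt.norm (norm_ne_zero_iff.2 hg0)).tendsto).mono_left
        nhdsWithin_le_nhds
    refine (h1.comp hpath).congr' ?_
    have hgne : ∀ᶠ w in 𝓝[≠] w₀, g w ≠ 0 :=
      (hg.continuousAt.eventually_ne hg0).filter_mono nhdsWithin_le_nhds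
    filter_upwards [self_mem_nhdsWithin, hpath.eventually hQ, hpath.eventually hgQ,
      hpath.eventually hgne] with t ht h2 h3 h4
    have ht : 0 < t := ht
    have h5 : t ^ (α i₀) * hfun (w₀ + t) = t ^ (p : ℝ) * ‖g (w₀ + t)‖ := by
      have h6 := congrArg norm (h2.symm.trans h3)
      rw [← Finset.mul_prod_erase Finset.univ _ (Finset.mem_univ i₀)] at h6
      simp only [← hw₀, add_sub_cancel_left, norm_mul, norm_prod, Complex.norm_cpow_real,
        norm_smul, norm_zpow, Complex.norm_real, Real.norm_of_nonneg ht.le] at h6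
      rw [Real.rpow_intCast, ← h6, hhfun]
      ring
    have h6 : 0 < ‖g (w₀ + t)‖ := norm_pos_iff.2 h4
    have h7 : 0 < t ^ (α i₀) := Real.rpow_pos_of_pos ht _
    simp only [Function.comp]
    rw [Real.rpow_sub ht, div_eq_div_iff h6.ne' h7.ne', ← h5]
    ring
  have := eq_zero_of_tendsto_rpow (div_pos hpos (norm_pos_iff.2 hg0)) hlim
  linarith

theorem logDeriv_prod_cpow {x : ℂ} (hx : ∀ i, x - a i ∈ Complex.slitPlane) :
    logDeriv (fun w => ∏ i, (w - a i) ^ (α i : ℂ)) x = ∑ i, (α i : ℂ) / (x - a i) := by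
  have hd : ∀ i, HasDerivAt (fun w : ℂ => (w - a i) ^ (α i : ℂ))
      ((α i : ℂ) * (x - a i) ^ ((α i : ℂ) - 1) * 1) x := fun i =>
    ((hasDerivAt_id x).sub_const (a i)).cpow_const (hx i)
  have h0 : ∀ i, (x - a i) ^ (α i : ℂ) ≠ 0 := fun i => by
    rw [Complex.cpow_def_of_ne_zero (Complex.slitPlane_ne_zero (hx i))]
    exact Complex.exp_ne_zero _
  rw [logDeriv_prod (fun i _ => h0 i) (fun i _ => (hd i).differentiableAt)]
  refine Finset.sum_congr rfl fun i _ => ?_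
  rw [logDeriv_apply, (hd i).deriv, Complex.cpow_sub _ _ (Complex.slitPlane_ne_zero (hx i)),
    Complex.cpow_one]
  have := h0 i
  have := Complex.slitPlane_ne_zero (hx i)
  field_simp

/-- If a product of powers is a quadratic differential of Kühnau's type, then it is symmetric: its
logarithmic derivative is real on an interval of the real axis, and partial fractions are
independent. -/
theorem IsKuhnau.isReflectionSymmetric {Q : ℂ → ℂ} (hQ : IsKuhnau Q) {R : ℂ}
    (hinj : Function.Injective a) (hα : ∀ i, (a i).im ≠ 0 → α i ≠ 0) (hR : R ≠ 0)
    (hfac : ∀ w ∈ upperHalf, Q w = R * ∏ i, (w - a i) ^ (α i : ℂ)) :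
    IsReflectionSymmetric a α := by
  classical
  obtain ⟨S, hS, -, -⟩ := hQ.boundary
  -- an interval to the right of all special points
  obtain ⟨M, hM⟩ : ∃ M : ℝ, (∀ i, (a i).re < M) ∧ ∀ s ∈ S, s < M := by
    obtain ⟨M₁, hM₁⟩ := (finite_range fun i => (a i).re).bddAbove
    obtain ⟨M₂, hM₂⟩ := S.bddAbove
    refine ⟨max M₁ M₂ + 1, fun i => ?_, fun s hs => ?_⟩
    · linarith [hM₁ (mem_range_self i), le_max_left M₁ M₂]
    · linarith [hM₂ hs, le_max_right M₁ M₂]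
  obtain ⟨θ, -, harc⟩ := hS (Ioi M) isOpen_Ioi ordConnected_Ioi
    (disjoint_left.2 fun x hx hxS => (hM.2 x hxS).not_gt hx)
  have hslit : ∀ x : ℝ, M < x → ∀ i, (x : ℂ) - a i ∈ Complex.slitPlane := fun x hx i =>
    Or.inl (by simpa using (hM.1 i).trans hx)
  set F : ℂ → ℂ := fun w => R * ∏ i, (w - a i) ^ (α i : ℂ) with hF
  have hFa : ∀ x : ℝ, M < x → AnalyticAt ℂ F x := fun x hx =>
    analyticAt_const.mul (Finset.analyticAt_fun_prod _ fun i _ =>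
      (analyticAt_id.sub analyticAt_const).cpow analyticAt_const (hslit x hx i))
  have hFarg : ∀ x : ℝ, M < x → HasArgTwice θ (F x) := by
    intro x hx
    obtain ⟨q, h1, h2⟩ := harc.exists_tendsto isOpen_Ioi hx
    have h3 : Tendsto Q (𝓝[upperHalf] (x : ℂ)) (𝓝 (F x)) :=
      ((hFa x hx).continuousAt.tendsto.mono_left nhdsWithin_le_nhds).congr' (by
        filter_upwards [self_mem_nhdsWithin] with z hz using (hfac z hz).symm)
    rwa [tendsto_nhds_unique h1 h3] at h2
  set E : ℂ := Complex.exp (-(2 * θ * Complex.I)) with hE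
  -- after a rotation the product is real on the interval, hence so is its logarithmic derivative
  have hkr : ∀ x : ℝ, M < x → IsRealAnalyticAt (fun w => E * F w) x := by
    intro x hx
    refine ⟨analyticAt_const.mul (hFa x hx), ?_⟩
    filter_upwards [isOpen_Ioi.mem_nhds hx] with y hy
    obtain ⟨r, -, hr⟩ := hFarg y hy
    rw [hr, hE, mul_left_comm, ← Complex.exp_add, neg_add_cancel, Complex.exp_zero, mul_one,
      Complex.ofReal_im]
  have hF0 : ∀ x : ℝ, M < x → F x ≠ 0 := fun x hx h0 => by
    obtain ⟨r, hr, hr'⟩ := hFarg x hx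
    rw [h0] at hr'
    have : (r : ℂ) ≠ 0 := by exact_mod_cast hr.ne'
    exact mul_ne_zero this (Complex.exp_ne_zero _) hr'.symm
  have hE0 : E ≠ 0 := Complex.exp_ne_zero _
  have hsum : ∀ x : ℝ, M < x → (∑ i, (α i : ℂ) / (x - a i)).im = 0 := by
    intro x hx
    have h1 := ((hkr x hx).deriv.div (hkr x hx) (mul_ne_zero hE0 (hF0 x hx))).im_eq_zero
    rwa [← logDeriv_apply, logDeriv_const_mul _ _ hE0, logDeriv_const_mul _ _ hR,
      logDeriv_prod_cpow (hslit x hx)] at h1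
  -- the coefficient of `1/(x - b)` is `e b`; conjugation replaces `e b` by `e (conj b)`
  set B : Finset ℂ := Finset.univ.image a ∪ Finset.univ.image fun i => (starRingEnd ℂ) (a i) with hB
  set e : ℂ → ℂ := fun b => ∑ i, if a i = b then (α i : ℂ) else 0 with he
  have he1 : ∀ x : ℂ, ∑ b ∈ B, e b / (x - b) = ∑ i, (α i : ℂ) / (x - a i) := by
    intro x
    simp only [he, Finset.sum_div]
    rw [Finset.sum_comm]
    refine Finset.sum_congr rfl fun i _ => ?_
    rw [Finset.sum_eq_single_of_mem (a i) (Finset.mem_union_left _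
      (Finset.mem_image_of_mem _ (Finset.mem_univ i)))]
    · simp
    · intro b _ hb
      simp [hb.symm]
  have he2 : ∀ x : ℂ, ∑ b ∈ B, e ((starRingEnd ℂ) b) / (x - b) =
      ∑ i, (α i : ℂ) / (x - (starRingEnd ℂ) (a i)) := by
    intro x
    simp only [he, Finset.sum_div]
    rw [Finset.sum_comm]
    refine Finset.sum_congr rfl fun i _ => ?_
    rw [Finset.sum_eq_single_of_mem ((starRingEnd ℂ) (a i)) (Finset.mem_union_right _
      (Finset.mem_image_of_mem (fun i => (starRingEnd ℂ) (a i)) (Finset.mem_univ i)))]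
    · simp
    · intro b _ hb
      have : a i ≠ (starRingEnd ℂ) b := fun h => hb (by rw [h, Complex.conj_conj])
      simp [this]
  have hind := eq_zero_of_sum_div_sub_eq_zero (B := B) (d := fun b => e b - e ((starRingEnd ℂ) b))
    (T := (fun x : ℝ => (x : ℂ)) '' Ioi M)
    ((Ioi_infinite M).image Complex.ofReal_injective.injOn) (by
      rintro _ ⟨x, hx, rfl⟩ hxB
      have hx : M < x := hx
      rcases Finset.mem_union.1 hxB with h | h
      · obtain ⟨i, -, hi⟩ := Finset.mem_image.1 h
        have := hM.1 i
        rw [hi, Complex.ofReal_re] at this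
        linarith
      · obtain ⟨i, -, hi⟩ := Finset.mem_image.1 h
        have := hM.1 i
        rw [← Complex.conj_re, hi, Complex.ofReal_re] at this
        linarith) (by
      rintro _ ⟨x, hx, rfl⟩
      simp only [sub_div, Finset.sum_sub_distrib]
      rw [he1, he2, sub_eq_zero, ← Complex.conj_eq_iff_im.2 (hsum x hx), map_sum]
      refine Finset.sum_congr rfl fun i _ => ?_
      rw [map_div₀, map_sub, Complex.conj_ofReal, Complex.conj_ofReal])
  have hei : ∀ i, e (a i) = α i := by
    intro i
    simp only [he]
    rw [Finset.sum_eq_single_of_mem i (Finset.mem_univ i)]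
    · simp
    · intro k _ hk
      simp [hinj.ne hk]
  have hconj : ∀ i, ∃ k, a k = (starRingEnd ℂ) (a i) ∧ α k = α i := by
    intro i
    by_cases hi : (a i).im = 0
    · exact ⟨i, (Complex.conj_eq_iff_im.2 hi).symm, rfl⟩
    · have h1 := hind (a i) (Finset.mem_union_left _
        (Finset.mem_image_of_mem _ (Finset.mem_univ i)))
      have h2 : e ((starRingEnd ℂ) (a i)) = α i := by
        rw [← hei i]
        exact (sub_eq_zero.1 h1).symm
      have h3 : e ((starRingEnd ℂ) (a i)) ≠ 0 := by
        rw [h2]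
        exact_mod_cast hα i hi
      obtain ⟨k, -, hk⟩ := Finset.exists_ne_zero_of_sum_ne_zero h3
      have hk' : a k = (starRingEnd ℂ) (a i) := by
        by_contra h4
        exact hk (if_neg h4)
      refine ⟨k, hk', ?_⟩
      rw [← hk', hei k] at h2
      exact_mod_cast h2
  have hintU : ∀ i, 0 < (a i).im → ∃ p : ℤ, α i = p := by
    intro i hi
    have hev : ∀ᶠ w in 𝓝 (a i), w ∈ upperHalf := isOpen_upperHalf.mem_nhds hi
    exact exists_int_of_meromorphicAt hinj hR (hQ.meromorphic hi).meromorphicAt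
      ((hev.filter_mono nhdsWithin_le_nhds).mono hfac)
  refine ⟨hinj, hconj, fun i hi => ?_⟩
  rcases lt_or_gt_of_ne hi with h | h
  · obtain ⟨k, hk, hk'⟩ := hconj i
    rw [← hk']
    exact hintU k (by rw [hk]; simpa using h)
  · exact hintU i h

end PowerProduct

/-! ### Growth and boundary values of Kühnau quadratic differentials -/

/-- An entire function of polynomial growth is a polynomial. -/
theorem exists_polynomial_of_growth (L : ℕ) : ∀ {f : ℂ → ℂ}, Differentiable ℂ f → ∀ K : ℝ,
    (∀ z, ‖f z‖ ≤ K * (1 + ‖z‖) ^ L) → ∃ p : Polynomial ℂ, ∀ z, f z = p.eval z := by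
  induction L with
  | zero =>
    intro f hf K hK
    refine ⟨Polynomial.C (f 0), fun z => ?_⟩
    rw [Polynomial.eval_C]
    refine hf.apply_eq_apply_of_bounded ?_ z 0
    refine isBounded_iff_forall_norm_le.2 ⟨K, ?_⟩
    rintro _ ⟨z, rfl⟩
    simpa using hK z
  | succ L ih =>
    intro f hf K hK
    have hg : Differentiable ℂ (dslope f 0) :=
      differentiableOn_univ.1 ((Complex.differentiableOn_dslope univ_mem).2 hf.differentiableOn)
    obtain ⟨K', hK'⟩ := ((isCompact_closedBall (0 : ℂ) 1).image hg.continuous).isBounded.exists_norm_le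
    have hbound : ∀ z, ‖dslope f 0 z‖ ≤ (2 * (K + ‖f 0‖) + |K'|) * (1 + ‖z‖) ^ L := by
      intro z
      have hone : 1 ≤ (1 + ‖z‖) ^ L := one_le_pow₀ (by linarith [norm_nonneg z])
      have hK0 : 0 ≤ K := by
        have := (norm_nonneg _).trans (hK 0)
        simpa using this
      have hf0 := norm_nonneg (f 0)
      rcases le_or_gt ‖z‖ 1 with hz | hz
      · have h1 := hK' _ (mem_image_of_mem (dslope f 0) (mem_closedBall_zero_iff.2 hz))
        have h2 := le_abs_self K'
        nlinarith [abs_nonneg K']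
      · have hz0 : z ≠ 0 := norm_pos_iff.1 (one_pos.trans hz)
        rw [dslope_of_ne _ hz0, slope_def_field, sub_zero, norm_div, div_le_iff₀ (one_pos.trans hz)]
        have h1 : ‖f z - f 0‖ ≤ K * (1 + ‖z‖) ^ (L + 1) + ‖f 0‖ :=
          (norm_sub_le _ _).trans (add_le_add_left (hK z) _)
        refine h1.trans ?_
        rw [pow_succ]
        set P := (1 + ‖z‖) ^ L
        have h2 : K * (P * (1 + ‖z‖)) ≤ 2 * K * P * ‖z‖ := by nlinarith [mul_nonneg hK0 (zero_le_one.trans hone)]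
        have h3 : ‖f 0‖ ≤ ‖f 0‖ * P * ‖z‖ := by
          have : 1 ≤ P * ‖z‖ := one_le_mul_of_one_le_of_one_le hone hz.le
          nlinarith
        have h4 : 0 ≤ ‖f 0‖ * P * ‖z‖ := by positivity
        have h5 : 0 ≤ |K'| * P * ‖z‖ := by positivity
        nlinarith
    obtain ⟨p, hp⟩ := ih hg _ hbound
    refine ⟨Polynomial.C (f 0) + Polynomial.X * p, fun z => ?_⟩
    rw [Polynomial.eval_add, Polynomial.eval_C, Polynomial.eval_mul, Polynomial.eval_X, ← hp]
    have := sub_smul_dslope f 0 z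
    rw [sub_zero, smul_eq_mul] at this
    rw [this]
    ring

/-- A function of the upper half-plane that grows at most like a power at `∞`. -/
def HasPowerGrowth (h : ℂ → ℂ) : Prop :=
  ∃ n : ℕ, h =O[Bornology.cobounded ℂ ⊓ 𝓟 upperHalf] fun z => z ^ n

namespace HasPowerGrowth

theorem mul {h k : ℂ → ℂ} (hh : HasPowerGrowth h) (hk : HasPowerGrowth k) :
    HasPowerGrowth fun z => h z * k z := by
  obtain ⟨n, hn⟩ := hh
  obtain ⟨m, hm⟩ := hk
  refine ⟨n + m, ?_⟩
  simpa only [pow_add] using hn.mul hm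

theorem finset_prod {ι : Type*} (s : Finset ι) {h : ι → ℂ → ℂ} (hh : ∀ i ∈ s, HasPowerGrowth (h i)) :
    HasPowerGrowth fun z => ∏ i ∈ s, h i z := by
  classical
  induction s using Finset.induction_on with
  | empty =>
    refine ⟨0, ?_⟩
    simp only [Finset.prod_empty, pow_zero]
    exact Asymptotics.isBigO_refl _ _
  | insert a s ha ih =>
    simp only [Finset.prod_insert ha]
    exact (hh a (Finset.mem_insert_self a s)).mul (ih fun i hi => hh i (Finset.mem_insert_of_mem hi))

theorem cpow_sub (b : ℂ) (c : ℝ) : HasPowerGrowth fun z => (z - b) ^ (c : ℂ) := by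
  obtain ⟨n, hn⟩ := exists_nat_ge c
  refine ⟨n, Asymptotics.IsBigO.mono (g := fun z : ℂ => z ^ n) ?_ inf_le_left⟩
  have htop : Tendsto (fun z : ℂ => ‖z‖) (Bornology.cobounded ℂ) atTop := tendsto_norm_cobounded_atTop
  refine Asymptotics.IsBigO.of_bound (2 ^ n) ?_
  filter_upwards [htop.eventually_ge_atTop (‖b‖ + 1)] with z hz
  have h1 : 1 ≤ ‖z - b‖ := by
    have := norm_sub_norm_le z b
    linarith
  have h2 : ‖z - b‖ ≤ 2 * ‖z‖ := by
    have := norm_sub_le z b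
    linarith
  rw [Complex.norm_cpow_real, norm_pow, ← mul_pow]
  calc ‖z - b‖ ^ c ≤ ‖z - b‖ ^ (n : ℝ) := Real.rpow_le_rpow_of_exponent_le h1 hn
    _ = ‖z - b‖ ^ n := Real.rpow_natCast _ _
    _ ≤ (2 * ‖z‖) ^ n := pow_le_pow_left₀ (norm_nonneg _) h2 n

theorem pow_sub (b : ℂ) (n : ℕ) : HasPowerGrowth fun z => (z - b) ^ n := by
  simpa using cpow_sub b n

end HasPowerGrowth

/-- A meromorphic function in normal form that is bounded near a point is analytic there. -/
theorem MeromorphicNFAt.analyticAt_of_isBigO {Q : ℂ → ℂ} {w : ℂ} (hQ : MeromorphicNFAt Q w)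
    (hb : ∃ K : ℝ, ∀ᶠ z in 𝓝[≠] w, ‖Q z‖ ≤ K) : AnalyticAt ℂ Q w := by
  rw [← hQ.meromorphicOrderAt_nonneg_iff_analyticAt]
  by_contra hneg
  obtain ⟨K, hK⟩ := hb
  have h1 := tendsto_cobounded_of_meromorphicOrderAt_neg (not_le.1 hneg)
  have h2 := (tendsto_norm_cobounded_atTop.comp h1).eventually_gt_atTop K
  obtain ⟨z, h3, h4⟩ := (hK.and h2).exists
  exact absurd h3 (not_le.2 h4)

/-- The limits of a Kühnau quadratic differential at the regular boundary points. -/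
theorem exists_tendsto_of_boundary {Q : ℂ → ℂ} {S : Finset ℝ}
    (hS : ∀ I : Set ℝ, IsOpen I → I.OrdConnected → Disjoint I (S : Set ℝ) →
      ∃ θ ∈ Ico 0 Real.pi, IsBoundaryArc Q id θ I) {x : ℝ} (hx : x ∉ S) :
    ∃ θ : ℝ, ∀ᶠ y : ℝ in 𝓝 x, ∃ w, Tendsto Q (𝓝[upperHalf] (y : ℂ)) (𝓝 w) ∧ HasArgTwice θ w := by
  have h1 : ((S : Set ℝ)ᶜ) ∈ 𝓝 x := S.finite_toSet.isClosed.isOpen_compl.mem_nhds hx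
  obtain ⟨ε, hε, hball⟩ := Metric.mem_nhds_iff.1 h1
  rw [Real.ball_eq_Ioo] at hball
  obtain ⟨θ, -, harc⟩ := hS _ isOpen_Ioo ordConnected_Ioo
    (disjoint_left.2 fun y hy hyS => hball hy hyS)
  refine ⟨θ, ?_⟩
  filter_upwards [isOpen_Ioo.mem_nhds (show x ∈ Ioo (x - ε) (x + ε) by constructor <;> linarith)]
    with y hy using harc.exists_tendsto isOpen_Ioo hy

/-- On each side of any boundary point, corners included, the boundary values of a Kühnau quadratic
differential have a fixed argument. -/
theorem exists_tendsto_of_boundary_side {Q : ℂ → ℂ} {S : Finset ℝ}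
    (hS : ∀ I : Set ℝ, IsOpen I → I.OrdConnected → Disjoint I (S : Set ℝ) →
      ∃ θ ∈ Ico 0 Real.pi, IsBoundaryArc Q id θ I) (x : ℝ) :
    ∃ θl θr : ℝ, (∀ᶠ y : ℝ in 𝓝[<] x, ∃ w, Tendsto Q (𝓝[upperHalf] (y : ℂ)) (𝓝 w) ∧
        HasArgTwice θl w) ∧
      ∀ᶠ y : ℝ in 𝓝[>] x, ∃ w, Tendsto Q (𝓝[upperHalf] (y : ℂ)) (𝓝 w) ∧ HasArgTwice θr w := by
  have h1 : ((S.erase x : Set ℝ)ᶜ) ∈ 𝓝 x :=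
    (S.erase x).finite_toSet.isClosed.isOpen_compl.mem_nhds (by simp)
  obtain ⟨ε, hε, hball⟩ := Metric.mem_nhds_iff.1 h1
  rw [Real.ball_eq_Ioo] at hball
  have hdisj : ∀ y ∈ Ioo (x - ε) (x + ε), y ≠ x → y ∉ S := fun y hy hne hyS =>
    hball hy (Finset.mem_coe.2 (Finset.mem_erase.2 ⟨hne, hyS⟩))
  obtain ⟨θl, -, hl⟩ := hS (Ioo (x - ε) x) isOpen_Ioo ordConnected_Ioo
    (disjoint_left.2 fun y hy => hdisj y ⟨hy.1, by linarith [hy.2]⟩ hy.2.ne)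
  obtain ⟨θr, -, hr⟩ := hS (Ioo x (x + ε)) isOpen_Ioo ordConnected_Ioo
    (disjoint_left.2 fun y hy => hdisj y ⟨by linarith [hy.1], hy.2⟩ hy.1.ne')
  refine ⟨θl, θr, ?_, ?_⟩
  · filter_upwards [Ioo_mem_nhdsLT (show x - ε < x by linarith)] with y hy using
      hl.exists_tendsto isOpen_Ioo hy
  · filter_upwards [Ioo_mem_nhdsGT (show x < x + ε by linarith)] with y hy using
      hr.exists_tendsto isOpen_Ioo hy

/-- A Kühnau quadratic differential has only finitely many poles: they cannot accumulate at the
boundary, where it grows at most like a power. -/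
theorem IsKuhnau.finite_poles {Q : ℂ → ℂ} (hQ : IsKuhnau Q) :
    {w ∈ upperHalf | ¬ AnalyticAt ℂ Q w}.Finite := by
  obtain ⟨S, hS, hSO, L, hL⟩ := hQ.boundary
  have hana : ∀ w ∈ upperHalf, (∃ K : ℝ, ∀ᶠ z in 𝓝 w, ‖Q z‖ ≤ K) → AnalyticAt ℂ Q w :=
    fun w hw ⟨K, hK⟩ => (hQ.meromorphic hw).analyticAt_of_isBigO
      ⟨K, hK.filter_mono nhdsWithin_le_nhds⟩
  -- no poles near `∞`
  obtain ⟨ρ, hρ⟩ : ∃ ρ : ℝ, ∀ w ∈ upperHalf, ρ < ‖w‖ → AnalyticAt ℂ Q w := by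
    obtain ⟨K, hK⟩ := hL.bound
    rw [eventually_inf_principal, ← comap_norm_atTop, eventually_comap] at hK
    obtain ⟨ρ, hρ⟩ := eventually_atTop.1 hK
    refine ⟨ρ, fun w hw hwρ => hana w hw ⟨|K| * (‖w‖ + 1) ^ L, ?_⟩⟩
    have hc : ∀ᶠ z : ℂ in 𝓝 w, ρ < ‖z‖ := continuous_norm.continuousAt.eventually_const_lt hwρ
    have hc' : ∀ᶠ z : ℂ in 𝓝 w, ‖z‖ < ‖w‖ + 1 :=
      continuous_norm.continuousAt.eventually_lt_const (lt_add_one _)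
    filter_upwards [hc, hc', isOpen_upperHalf.mem_nhds hw] with z h1 h2 h3
    refine (hρ ‖z‖ h1.le z rfl h3).trans ?_
    rw [norm_pow]
    gcongr
    exact le_abs_self K
  by_contra hinf
  have hinf : {w ∈ upperHalf | ¬ AnalyticAt ℂ Q w}.Infinite := hinf
  -- an accumulation point `z` of poles is impossible: if it is on the axis, then `Q` is locally bounded
  -- at the points of the upper half-plane near `z`, and otherwise `Q` is meromorphic at `z`
  obtain ⟨z, -, hz⟩ := hinf.exists_accPt_of_subset_isCompact (isCompact_closedBall 0 ρ)
    (fun w hw => mem_closedBall_zero_iff.2 (not_lt.1 fun h => hw.2 (hρ w hw.1 h)))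
  rw [accPt_iff_frequently_nhdsNE] at hz
  apply hz
  have hev : ∀ K : ℝ, (∀ᶠ w in 𝓝[upperHalf] z, ∀ᶠ u in 𝓝 w, ‖Q u‖ ≤ K) →
      ∀ᶠ w in 𝓝[≠] z, ¬ (w ∈ {w ∈ upperHalf | ¬ AnalyticAt ℂ Q w}) := by
    intro K hK
    have := eventually_nhdsWithin_iff.1 hK
    filter_upwards [mem_nhdsWithin_of_mem_nhds this] with w h1 h2
    exact h2.2 (hana w h2.1 ⟨K, h1 h2.1⟩)
  have hev' : ∀ K : ℝ, (∀ᶠ w in 𝓝[upperHalf] z, ‖Q w‖ ≤ K) →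
      ∀ᶠ w in 𝓝[upperHalf] z, ∀ᶠ u in 𝓝 w, ‖Q u‖ ≤ K := by
    intro K hK
    have h1 := eventually_nhdsWithin_iff.1 hK
    rw [eventually_nhdsWithin_iff]
    filter_upwards [h1.eventually_nhds] with w h2 h3
    filter_upwards [h2, isOpen_upperHalf.mem_nhds h3] with u h4 h5 using h4 h5
  rcases lt_trichotomy z.im 0 with h | h | h
  · have h1 : ∀ᶠ w in 𝓝 z, w.im < 0 :=
      Complex.continuous_im.continuousAt.eventually_lt_const h
    filter_upwards [h1.filter_mono nhdsWithin_le_nhds] with w hw hw'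
    have : 0 < w.im := hw'.1
    linarith
  · have hz' : z = (z.re : ℂ) := Complex.ext (by simp) (by simp [h])
    by_cases hzS : z.re ∈ S
    · obtain ⟨m, hm⟩ := hSO _ hzS
      rw [← hz'] at hm
      obtain ⟨K, hK⟩ := hm.bound
      have h1 := eventually_nhdsWithin_iff.1 hK
      have h2 := h1.eventually_nhds
      filter_upwards [h2.filter_mono nhdsWithin_le_nhds] with w h3 h4
      refine h4.2 (hana w h4.1 ?_)
      have hwz : w - z ≠ 0 := fun h0 => by
        have h5 : 0 < w.im := h4.1
        rw [sub_eq_zero.1 h0] at h5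
        linarith
      have hcont : ContinuousAt (fun u => K * ‖((u - z) ^ m)⁻¹‖) w := by
        refine continuousAt_const.mul (ContinuousAt.norm (ContinuousAt.inv₀ ?_ (pow_ne_zero m hwz)))
        fun_prop
      refine ⟨K * ‖((w - z) ^ m)⁻¹‖ + 1, ?_⟩
      filter_upwards [h3, isOpen_upperHalf.mem_nhds h4.1,
        hcont.eventually_lt_const (lt_add_one _)] with u h5 h6 h7
      exact (h5 h6).trans h7.le
    · obtain ⟨θ, hθ⟩ := exists_tendsto_of_boundary hS hzS
      obtain ⟨w, hw, -⟩ := hθ.self_of_nhds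
      rw [← hz'] at hw
      exact hev (‖w‖ + 1) (hev' _ ((hw.norm.eventually_lt_const (lt_add_one _)).mono
        fun _ h => h.le))
  · have hmer := (hQ.meromorphic h).meromorphicAt
    filter_upwards [hmer.eventually_analyticAt] with w hw hw'
    exact hw'.2 hw

/-- Boundary values and boundary direction of a power. -/
theorem tendsto_cpow_sub {x s : ℝ} (hxs : x ≠ s) (c : ℝ) :
    ∃ w, Tendsto (fun z : ℂ => (z - s) ^ (c : ℂ)) (𝓝[upperHalf] (x : ℂ)) (𝓝 w) ∧
      HasArgTwice (if x < s then Real.pi * c / 2 else 0) w := by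
  have hsub : Tendsto (fun z : ℂ => z - s) (𝓝[upperHalf] (x : ℂ)) (𝓝[{z | 0 ≤ z.im}] (x - s)) := by
    apply tendsto_nhdsWithin_of_tendsto_nhds_of_eventually_within
    · have : Continuous fun z : ℂ => z - s := by fun_prop
      exact (this.tendsto (x : ℂ)).mono_left nhdsWithin_le_nhds
    · filter_upwards [self_mem_nhdsWithin] with z hz
      have hz : 0 < z.im := hz
      simpa using hz.le
  have hlim : Tendsto (fun z : ℂ => Complex.log (z - s)) (𝓝[upperHalf] (x : ℂ))
      (𝓝 (Complex.log (x - s))) := by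
    rcases lt_or_gt_of_ne hxs with h | h
    · exact (Complex.continuousWithinAt_log_of_re_neg_of_im_zero (z := (x : ℂ) - s) (by simpa using h)
        (by simp)).tendsto.comp hsub
    · exact ((continuousAt_clog (Or.inl (by simpa using h))).tendsto.mono_left
        nhdsWithin_le_nhds).comp hsub
  refine ⟨Complex.exp (Complex.log (x - s) * c), ?_, ?_⟩
  · refine (((Complex.continuous_exp.tendsto _).comp (hlim.mul_const _))).congr' ?_
    filter_upwards [self_mem_nhdsWithin] with z hz
    have hz : 0 < z.im := hz
    have h0 : z - (s : ℂ) ≠ 0 := fun h => by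
      rw [sub_eq_zero.1 h, Complex.ofReal_im] at hz
      exact hz.false
    rw [Complex.cpow_def_of_ne_zero h0]
    rfl
  · have hpos : 0 < |x - s| := abs_pos.2 (sub_ne_zero.2 hxs)
    refine ⟨|x - s| ^ c, Real.rpow_pos_of_pos hpos _, ?_⟩
    have harg : (x - s : ℂ).arg = if x < s then Real.pi else 0 := by
      rw [← Complex.ofReal_sub]
      split_ifs with h
      · exact Complex.arg_ofReal_of_neg (by linarith)
      · exact Complex.arg_ofReal_of_nonneg (by linarith [not_lt.1 h])
    rw [Real.rpow_def_of_pos hpos, Complex.log, harg, ← Complex.ofReal_sub, Complex.norm_real,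
      Real.norm_eq_abs, Complex.ofReal_exp, ← Complex.exp_add]
    congr 1
    split_ifs <;> push_cast <;> ring

theorem exists_near_notMem_finset (S : Finset ℝ) {p : ℝ → Prop} {x : ℝ} (h : ∀ᶠ y in 𝓝 x, p y) :
    ∃ y, y ∉ S ∧ p y := by
  have h1 : ((S.erase x : Set ℝ)ᶜ) ∈ 𝓝[≠] x := mem_nhdsWithin_of_mem_nhds
    ((S.erase x).finite_toSet.isClosed.isOpen_compl.mem_nhds (by simp))
  obtain ⟨y, ⟨hy, hyp⟩, hne⟩ := ((eventually_of_mem h1 (fun _ hy => hy)).and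
    (h.filter_mono nhdsWithin_le_nhds)).and self_mem_nhdsWithin |>.exists
  exact ⟨y, fun hyS => hy (Finset.mem_coe.2 (Finset.mem_erase.2 ⟨hne, hyS⟩)), hyp⟩

/-- The boundary directions of a Kühnau quadratic differential change at the corners only; powers
with suitable exponents at the corners make up for the jumps, so that the boundary values
become positive up to a constant factor. -/
theorem exists_boundary_pos {Q : ℂ → ℂ} {S : Finset ℝ}
    (hS : ∀ I : Set ℝ, IsOpen I → I.OrdConnected → Disjoint I (S : Set ℝ) →
      ∃ θ ∈ Ico 0 Real.pi, IsBoundaryArc Q id θ I) :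
    ∃ (β : ℝ → ℝ) (C : ℂ), C ≠ 0 ∧ ∀ x : ℝ, x ∉ S → ∃ r : ℝ, 0 < r ∧
      Tendsto (fun z => C * (Q z * ∏ s ∈ S, (z - s) ^ ((-β s : ℝ) : ℂ))) (𝓝[upperHalf] (x : ℂ))
        (𝓝 (r : ℂ)) := by
  have hpi := Real.pi_pos
  choose θl θr hθl hθr using exists_tendsto_of_boundary_side hS
  -- for `x < s` the power `(z - s)^(-β s)` has boundary direction `e^(-iπ β s)`, for `x > s` it is
  -- positive: this cancels the jump from `θl s` to `θr s`
  set β : ℝ → ℝ := fun s => 2 * (θl s - θr s) / Real.pi with hβ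
  set G : ℂ → ℂ := fun z => Q z * ∏ s ∈ S, (z - s) ^ ((-β s : ℝ) : ℂ) with hG
  set d : ℝ → ℝ → ℝ := fun y s => if y < s then Real.pi * (-β s) / 2 else 0 with hd
  have hGlim : ∀ y : ℝ, y ∉ S → ∀ θ : ℝ, (∃ w, Tendsto Q (𝓝[upperHalf] (y : ℂ)) (𝓝 w) ∧
      HasArgTwice θ w) → ∃ g, Tendsto G (𝓝[upperHalf] (y : ℂ)) (𝓝 g) ∧
        HasArgTwice (θ + ∑ s ∈ S, d y s) g := by
    rintro y hy θ ⟨w, hw, hθ⟩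
    choose! p hp hp' using fun s (hs : s ∈ S) =>
      tendsto_cpow_sub (x := y) (s := s) (fun h => hy (h ▸ hs)) (-β s)
    exact ⟨w * ∏ s ∈ S, p s, hw.mul (tendsto_finsetProd _ hp),
      hθ.mul (HasArgTwice.finset_prod S hp')⟩
  have hdconst : ∀ x : ℝ, ∀ᶠ y in 𝓝 x, ∀ s ∈ S, s ≠ x → d y s = d x s := by
    intro x
    rw [Finset.eventually_all]
    intro s _
    by_cases hsx : s = x
    · exact Eventually.of_forall fun y h => absurd hsx h
    · rcases lt_or_gt_of_ne hsx with h | h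
      · filter_upwards [lt_mem_nhds h] with y hy _
        simp only [hd, if_neg (not_lt.2 hy.le), if_neg (not_lt.2 h.le)]
      · filter_upwards [gt_mem_nhds h] with y hy _
        simp only [hd, if_pos hy, if_pos h]
  -- near each point, all regular boundary values have the same phase
  have hloc : ∀ x : ℝ, ∃ ψ : ℝ, ∀ᶠ y in 𝓝 x, y ∉ S →
      ∃ g, Tendsto G (𝓝[upperHalf] (y : ℂ)) (𝓝 g) ∧ HasArgTwice ψ g := by
    intro x
    by_cases hx : x ∈ S
    · refine ⟨θr x + ∑ s ∈ S.erase x, d x s, ?_⟩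
      have hsum : ∀ y, (∀ s ∈ S, s ≠ x → d y s = d x s) →
          ∑ s ∈ S, d y s = d y x + ∑ s ∈ S.erase x, d x s := by
        intro y hy
        rw [← Finset.add_sum_erase S _ hx]
        congr 1
        exact Finset.sum_congr rfl fun s hs => hy s (Finset.mem_of_mem_erase hs)
          (Finset.ne_of_mem_erase hs)
      have h1 : ∀ᶠ y in 𝓝[<] x, y ∉ S →
          ∃ g, Tendsto G (𝓝[upperHalf] (y : ℂ)) (𝓝 g) ∧
            HasArgTwice (θr x + ∑ s ∈ S.erase x, d x s) g := by
        filter_upwards [hθl x, (hdconst x).filter_mono nhdsWithin_le_nhds, self_mem_nhdsWithin]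
          with y h1 h2 h3 hyS
        have h3 : y < x := h3
        have := hGlim y hyS _ h1
        have h4 : d y x = θr x - θl x := by
          simp only [hd, if_pos h3, hβ]
          field_simp
          ring
        rwa [hsum y h2, h4, ← add_assoc, add_sub_cancel] at this
      have h2 : ∀ᶠ y in 𝓝[>] x, y ∉ S →
          ∃ g, Tendsto G (𝓝[upperHalf] (y : ℂ)) (𝓝 g) ∧
            HasArgTwice (θr x + ∑ s ∈ S.erase x, d x s) g := by
        filter_upwards [hθr x, (hdconst x).filter_mono nhdsWithin_le_nhds, self_mem_nhdsWithin]
          with y h1 h2 h3 hyS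
        have h3 : x < y := h3
        have := hGlim y hyS _ h1
        have h4 : d y x = 0 := by
          simp only [hd, if_neg (not_lt.2 h3.le)]
        rwa [hsum y h2, h4, zero_add] at this
      rw [eventually_nhdsWithin_iff] at h1 h2
      filter_upwards [h1, h2] with y h3 h4 hyS
      rcases lt_trichotomy y x with h | h | h
      · exact h3 h hyS
      · exact absurd (h ▸ hx) hyS
      · exact h4 h hyS
    · obtain ⟨θ, hθ⟩ := exists_tendsto_of_boundary hS hx
      refine ⟨θ + ∑ s ∈ S, d x s, ?_⟩
      filter_upwards [hθ, hdconst x] with y h1 h2 hyS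
      have := hGlim y hyS _ h1
      rwa [Finset.sum_congr rfl fun s hs => h2 s hs fun h => hx (h ▸ hs)] at this
  choose ψ hψ using hloc
  -- the common phase is locally constant, hence constant
  set u : ℝ → ℂ := fun x => Complex.exp (2 * (ψ x : ℂ) * Complex.I) with hu
  have hulc : IsLocallyConstant u := by
    rw [IsLocallyConstant.iff_eventually_eq]
    intro x
    filter_upwards [(hψ x).eventually_nhds] with y hy
    obtain ⟨t, htS, h1, h2⟩ := exists_near_notMem_finset S (hy.and (hψ y))
    obtain ⟨g, hg, hgx⟩ := h1 htS
    obtain ⟨g', hg', hgy⟩ := h2 htS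
    rw [tendsto_nhds_unique hg' hg] at hgy
    simp only [hu, hgx.exp_eq, hgy.exp_eq]
  have hconst : ∀ x, u x = u 0 := fun x => hulc.apply_eq_of_isPreconnected isPreconnected_univ
    (mem_univ x) (mem_univ 0)
  have hu0 : ∀ x, u x ≠ 0 := fun x => Complex.exp_ne_zero _
  refine ⟨β, (u 0)⁻¹, inv_ne_zero (hu0 0), fun x hx => ?_⟩
  obtain ⟨g, hg, r, hr, hgr⟩ := (hψ x).self_of_nhds hx
  refine ⟨r, hr, ?_⟩
  have h1 : (u 0)⁻¹ * g = r := by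
    rw [hgr, ← hconst x]
    have := hu0 x
    simp only [hu] at this ⊢
    field_simp
  rw [← h1]
  exact hg.const_mul _

/-! ### Products of powers -/

/-- The function `h` agrees in the upper half-plane, apart from a finite set, with a finite product
of powers `R ∏ (w - b)^(e b)`. -/
def IsPowerProduct (h : ℂ → ℂ) : Prop :=
  ∃ (e : ℂ →₀ ℝ) (R : ℂ), R ≠ 0 ∧ ∃ T : Finset ℂ, ∀ w ∈ upperHalf, w ∉ T →
    h w = R * e.prod fun b x => (w - b) ^ (x : ℂ)

namespace IsPowerProduct

theorem congr {h k : ℂ → ℂ} (hh : IsPowerProduct h) (T : Finset ℂ)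
    (hk : ∀ w ∈ upperHalf, w ∉ T → k w = h w) : IsPowerProduct k := by
  classical
  obtain ⟨e, R, hR, T', hT⟩ := hh
  refine ⟨e, R, hR, T ∪ T', fun w hw hwT => ?_⟩
  rw [Finset.notMem_union] at hwT
  rw [hk w hw hwT.1, hT w hw hwT.2]

theorem const {C : ℂ} (hC : C ≠ 0) : IsPowerProduct fun _ => C :=
  ⟨0, C, hC, ∅, by simp⟩

theorem cpow_sub (b : ℂ) (x : ℝ) : IsPowerProduct fun w => (w - b) ^ (x : ℂ) :=
  ⟨Finsupp.single b x, 1, one_ne_zero, ∅, fun w _ _ => by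
    rw [one_mul, Finsupp.prod_single_index]
    simp⟩

theorem mul {h k : ℂ → ℂ} (hh : IsPowerProduct h) (hk : IsPowerProduct k) :
    IsPowerProduct fun w => h w * k w := by
  classical
  obtain ⟨e, R, hR, T, hT⟩ := hh
  obtain ⟨e', R', hR', T', hT'⟩ := hk
  refine ⟨e + e', R * R', mul_ne_zero hR hR', (T ∪ T') ∪ (e.support ∪ e'.support),
    fun w hw hwT => ?_⟩
  simp only [Finset.notMem_union] at hwT
  show h w * k w = _
  rw [hT w hw hwT.1.1, hT' w hw hwT.1.2, Finsupp.prod_add_index]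
  · ring
  · simp
  · intro b hb x y
    have hwb : w - b ≠ 0 := by
      intro h0
      rw [sub_eq_zero.1 h0] at hwT
      rcases Finset.mem_union.1 hb with h | h
      · exact hwT.2.1 h
      · exact hwT.2.2 h
    push_cast
    exact Complex.cpow_add _ _ hwb

theorem finset_prod {ι : Type*} (s : Finset ι) {h : ι → ℂ → ℂ} (hh : ∀ i ∈ s, IsPowerProduct (h i)) :
    IsPowerProduct fun w => ∏ i ∈ s, h i w := by
  classical
  induction s using Finset.induction_on with
  | empty => simpa using const one_ne_zero
  | insert a s ha ih =>
    simp only [Finset.prod_insert ha]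
    exact (hh a (Finset.mem_insert_self a s)).mul (ih fun i hi => hh i (Finset.mem_insert_of_mem hi))

theorem pow_sub (b : ℂ) (n : ℕ) : IsPowerProduct fun w => (w - b) ^ n := by
  simpa using cpow_sub b n

theorem inv {h : ℂ → ℂ} (hh : IsPowerProduct h) : IsPowerProduct fun w => (h w)⁻¹ := by
  obtain ⟨e, R, hR, T, hT⟩ := hh
  refine ⟨-e, R⁻¹, inv_ne_zero hR, T, fun w hw hwT => ?_⟩
  show (h w)⁻¹ = _
  rw [hT w hw hwT, mul_inv, Finsupp.prod_neg_index (by simp)]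
  congr 1
  simp only [Finsupp.prod, ← Finset.prod_inv_distrib]
  refine Finset.prod_congr rfl fun b _ => ?_
  rw [Complex.ofReal_neg, Complex.cpow_neg]

theorem polynomial {p : Polynomial ℂ} (hp : p ≠ 0) : IsPowerProduct fun w => p.eval w := by
  classical
  have h1 : ∀ w, p.eval w = p.leadingCoeff * ∏ r ∈ p.roots.toFinset, (w - r) ^ p.roots.count r := by
    intro w
    conv_lhs => rw [(IsAlgClosed.splits p).eq_prod_roots]
    rw [Polynomial.eval_mul, Polynomial.eval_C, Polynomial.eval_multiset_prod, Multiset.map_map,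
      Finset.prod_multiset_map_count]
    simp
  simp only [h1]
  exact (const (Polynomial.leadingCoeff_ne_zero.2 hp)).mul
    (finset_prod _ fun r _ => pow_sub r _)

end IsPowerProduct

/-- A holomorphic function in the upper half-plane with real boundary values and power growth is a
polynomial, by reflection and Liouville's theorem. -/
theorem exists_polynomial_of_boundary_real {G : ℂ → ℂ} (hGd : DifferentiableOn ℂ G upperHalf)
    (hlim : ∀ x : ℝ, ∃ g, Tendsto G (𝓝[upperHalf] (x : ℂ)) (𝓝 g) ∧ g.im = 0)
    (hgrowth : HasPowerGrowth G) :
    ∃ p : Polynomial ℂ, ∀ z ∈ upperHalf, G z = p.eval z := by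
  have hmono : ∀ x : ℂ, 𝓝[upperHalf] x ≤ 𝓝 x := fun x => nhdsWithin_le_nhds
  set E := extendFrom upperHalf G with hE
  have hclos : ∀ x : ℝ, (x : ℂ) ∈ closure upperHalf := fun x => by
    rw [closure_upperHalf]
    simp
  have hEH : ∀ z ∈ upperHalf, E z = G z := extendFrom_extends hGd.continuousOn
  have hEr : ∀ (x : ℝ) (g : ℂ), Tendsto G (𝓝[upperHalf] (x : ℂ)) (𝓝 g) → E x = g := fun x g hg =>
    extendFrom_eq (hclos x) hg
  have hEc : ContinuousOn E {z | 0 ≤ z.im} := by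
    rw [← closure_upperHalf]
    refine continuousOn_extendFrom subset_rfl fun z hz => ?_
    rw [closure_upperHalf] at hz
    have hz : 0 ≤ z.im := hz
    rcases hz.eq_or_lt with h | h
    · have hz' : z = (z.re : ℂ) := Complex.ext (by simp) (by simp [← h])
      obtain ⟨g, hg, -⟩ := hlim z.re
      rw [← hz'] at hg
      exact ⟨g, hg⟩
    · exact ⟨G z, hGd.continuousOn z h⟩
  obtain ⟨F, hFd, hFE, hFl⟩ := exists_reflection_of_continuousOn (U := univ) (P := E) isOpen_univ
    (fun _ _ => mem_univ _) (by rwa [univ_inter])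
    (by rw [univ_inter]; exact hGd.congr hEH)
    (fun x _ => by
      obtain ⟨g, hg, hg'⟩ := hlim x
      rw [hEr x g hg, hg'])
  rw [differentiableOn_univ] at hFd
  have hFH : ∀ z ∈ upperHalf, F z = G z := fun z hz => by
    have hz0 : 0 < z.im := hz
    rw [hFE ⟨mem_univ z, hz0.le⟩, hEH z hz]
  obtain ⟨n, hn⟩ := hgrowth
  obtain ⟨K, hK⟩ := hn.bound
  obtain ⟨ρ, hρ⟩ : ∃ ρ : ℝ, ∀ z ∈ upperHalf, ρ < ‖z‖ → ‖F z‖ ≤ |K| * ‖z‖ ^ n := by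
    rw [eventually_inf_principal, ← comap_norm_atTop, eventually_comap] at hK
    obtain ⟨ρ, hρ⟩ := eventually_atTop.1 hK
    refine ⟨ρ, fun z hz hzρ => ?_⟩
    have := hρ ‖z‖ hzρ.le z rfl hz
    rw [norm_pow] at this
    rw [hFH z hz]
    exact this.trans (mul_le_mul_of_nonneg_right (le_abs_self K) (by positivity))
  have hρ' : ∀ z : ℂ, ρ < ‖z‖ → ‖F z‖ ≤ |K| * ‖z‖ ^ n := by
    have hup : ∀ z : ℂ, 0 ≤ z.im → ρ < ‖z‖ → ‖F z‖ ≤ |K| * ‖z‖ ^ n := by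
      intro z hz hzρ
      have hmem : z ∈ closure upperHalf := by rw [closure_upperHalf]; exact hz
      have := mem_closure_iff_nhdsWithin_neBot.1 hmem
      have h1 : Tendsto (fun u => ‖F u‖) (𝓝[upperHalf] z) (𝓝 ‖F z‖) :=
        (hFd.continuous.norm.tendsto z).mono_left (hmono z)
      have h2 : Tendsto (fun u : ℂ => |K| * ‖u‖ ^ n) (𝓝[upperHalf] z) (𝓝 (|K| * ‖z‖ ^ n)) := by
        have : Continuous fun u : ℂ => |K| * ‖u‖ ^ n := by fun_prop
        exact (this.tendsto z).mono_left (hmono z)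
      refine le_of_tendsto_of_tendsto h1 h2 ?_
      filter_upwards [self_mem_nhdsWithin, mem_nhdsWithin_of_mem_nhds
        (continuous_norm.continuousAt.eventually_const_lt hzρ)] with u h3 h4 using hρ u h3 h4
    intro z hzρ
    rcases le_or_gt 0 z.im with h | h
    · exact hup z h hzρ
    · rw [hFl z (mem_univ z) h, RCLike.norm_conj]
      have h1 : (0 : ℝ) ≤ ((starRingEnd ℂ) z).im := by rw [Complex.conj_im]; linarith
      rw [← hFE ⟨mem_univ _, h1⟩, ← RCLike.norm_conj z]
      exact hup _ h1 (by rwa [RCLike.norm_conj])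
  obtain ⟨K', hK'⟩ := ((isCompact_closedBall (0 : ℂ) ρ).image hFd.continuous).isBounded.exists_norm_le
  obtain ⟨p, hp⟩ := exists_polynomial_of_growth n hFd (|K| + |K'|) (fun z => by
    have hone : 1 ≤ (1 + ‖z‖) ^ n := one_le_pow₀ (by linarith [norm_nonneg z])
    have ha := abs_nonneg K
    have ha' := abs_nonneg K'
    rcases le_or_gt ‖z‖ ρ with h | h
    · have h1 := hK' _ (mem_image_of_mem F (mem_closedBall_zero_iff.2 h))
      have h2 := le_abs_self K'
      nlinarith
    · have h1 := hρ' z h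
      have h2 : ‖z‖ ^ n ≤ (1 + ‖z‖) ^ n :=
        pow_le_pow_left₀ (norm_nonneg z) (by linarith) n
      nlinarith [mul_le_mul_of_nonneg_left h2 ha])
  exact ⟨p, fun z hz => by rw [← hFH z hz, hp]⟩

/-- The product of a Kühnau quadratic differential with suitable powers at the corners and poles
extends to an entire function of polynomial growth, by reflection. -/
theorem IsKuhnau.isPowerProduct {Q : ℂ → ℂ} (hQ : IsKuhnau Q) : IsPowerProduct Q := by
  classical
  set P : Finset ℂ := hQ.finite_poles.toFinset with hP
  have hPmem : ∀ w, w ∈ P ↔ 0 < w.im ∧ ¬ AnalyticAt ℂ Q w := fun w => by simp [hP]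
  obtain ⟨S, hS, hSO, L, hL⟩ := hQ.boundary
  obtain ⟨β, C, hC, hpos⟩ := exists_boundary_pos hS
  choose! m hm using hSO
  -- an exponent that beats the growth at the corners and poles
  obtain ⟨M, hMS, hMP⟩ : ∃ M : ℕ, (∀ s ∈ S, (m s : ℝ) + β s < M) ∧
      ∀ p ∈ P, 0 < (M : ℤ) + (meromorphicOrderAt Q p).untop₀ := by
    obtain ⟨M₁, hM₁⟩ := (S.image fun s => (m s : ℝ) + β s).bddAbove
    obtain ⟨M₂, hM₂⟩ := (P.image fun p => -(meromorphicOrderAt Q p).untop₀).bddAbove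
    obtain ⟨n₁, hn₁⟩ := exists_nat_gt M₁
    refine ⟨n₁ + (M₂.toNat + 1), fun s hs => ?_, fun p hp => ?_⟩
    · have := hM₁ (Finset.mem_coe.2 (Finset.mem_image_of_mem (fun s => (m s : ℝ) + β s) hs))
      push_cast
      have h2 : (0 : ℝ) ≤ (M₂.toNat : ℝ) := Nat.cast_nonneg _
      linarith
    · have := hM₂ (Finset.mem_coe.2 (Finset.mem_image_of_mem
        (fun p => -(meromorphicOrderAt Q p).untop₀) hp))
      have h2 := Int.self_le_toNat M₂
      push_cast
      linarith
  set A : ℂ → ℂ := fun z => C * (Q z * ∏ s ∈ S, (z - s) ^ ((-β s : ℝ) : ℂ)) with hA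
  set B : ℂ → ℂ := fun z => ∏ s ∈ S, (z - (s : ℂ)) ^ M with hB
  set D : ℂ → ℂ := fun z => ∏ p ∈ P, ((z - p) * (z - (starRingEnd ℂ) p)) ^ M with hD
  set G : ℂ → ℂ := fun z => A z * (B z * D z) with hG
  have hBd : Differentiable ℂ B := by fun_prop
  have hDd : Differentiable ℂ D := by fun_prop
  have hsub0 : ∀ z ∈ upperHalf, ∀ s : ℝ, z - (s : ℂ) ≠ 0 := fun z hz s h0 => by
    have hz : 0 < z.im := hz
    rw [sub_eq_zero.1 h0, Complex.ofReal_im] at hz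
    exact hz.false
  have hslit : ∀ z ∈ upperHalf, ∀ s : ℝ, z - (s : ℂ) ∈ Complex.slitPlane := fun z hz s => by
    have hz : 0 < z.im := hz
    exact Or.inr (by simpa using hz.ne')
  have hprod : ∀ z ∈ upperHalf, AnalyticAt ℂ (fun z : ℂ => ∏ s ∈ S, (z - s) ^ ((-β s : ℝ) : ℂ)) z :=
    fun z hz => Finset.analyticAt_fun_prod _ fun s _ =>
      (analyticAt_id.sub analyticAt_const).cpow analyticAt_const (hslit z hz s)
  have hGreg : ∀ z ∈ upperHalf, z ∉ P → DifferentiableAt ℂ G z := by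
    intro z hz hzP
    have hQa : AnalyticAt ℂ Q z := by
      by_contra h
      exact hzP ((hPmem z).2 ⟨hz, h⟩)
    exact ((hQa.mul (hprod z hz)).differentiableAt.const_mul C).mul ((hBd z).mul (hDd z))
  have hGd : DifferentiableOn ℂ G upperHalf := by
    intro z hz
    by_cases hzP : z ∈ P
    · -- the pole is cancelled
      have hcont : ContinuousAt G z := by
        have hne : meromorphicOrderAt Q z ≠ ⊤ := by
          intro htop
          have h1 := (hQ.meromorphic hz).meromorphicOrderAt_nonneg_iff_analyticAt
          rw [htop] at h1
          exact ((hPmem z).1 hzP).2 (h1.1 le_top)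
        obtain ⟨g, hg, -, hgQ⟩ :=
          (meromorphicOrderAt_ne_top_iff (hQ.meromorphic hz).meromorphicAt).1 hne
        obtain ⟨k, hk⟩ := Int.eq_ofNat_of_zero_le (hMP z hzP).le
        have hk0 : k ≠ 0 := by
          rintro rfl
          have := hMP z hzP
          rw [hk] at this
          simp at this
        have hDz : ∀ u, D u = (u - z) ^ M * ((u - (starRingEnd ℂ) z) ^ M *
            ∏ p ∈ P.erase z, ((u - p) * (u - (starRingEnd ℂ) p)) ^ M) := by
          intro u
          rw [hD]
          simp only
          rw [← Finset.mul_prod_erase P _ hzP, mul_pow, mul_assoc]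
        have hGz : G z = 0 := by
          have hM0 : M ≠ 0 := by
            rintro rfl
            have h1 := hMP z hzP
            have h2 : ¬ (0 ≤ meromorphicOrderAt Q z) := fun h =>
              ((hPmem z).1 hzP).2
                ((hQ.meromorphic hz).meromorphicOrderAt_nonneg_iff_analyticAt.1 h)
            apply h2
            rw [← WithTop.coe_untop₀_of_ne_top hne]
            exact_mod_cast (by simpa using h1.le : (0 : ℤ) ≤ (meromorphicOrderAt Q z).untop₀)
          rw [hG]
          simp only
          rw [hDz, sub_self, zero_pow hM0]
          ring
        rw [continuousAt_iff_punctured_nhds, hGz]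
        set V : ℂ → ℂ := fun u => C * (g u * ∏ s ∈ S, (u - s) ^ ((-β s : ℝ) : ℂ)) * (B u *
          ((u - (starRingEnd ℂ) z) ^ M *
            ∏ p ∈ P.erase z, ((u - p) * (u - (starRingEnd ℂ) p)) ^ M)) with hV
        have hVc : ContinuousAt V z := by
          refine (continuousAt_const.mul (hg.continuousAt.mul (hprod z hz).continuousAt)).mul
            ((hBd z).continuousAt.mul ?_)
          fun_prop
        have h1 : Tendsto (fun u => (u - z) ^ k * V u) (𝓝[≠] z) (𝓝 0) := by
          have h2 : ContinuousAt (fun u => (u - z) ^ k * V u) z :=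
            ContinuousAt.mul (by fun_prop) hVc
          have h3 := h2.tendsto
          simp only [sub_self, zero_pow hk0, zero_mul] at h3
          exact h3.mono_left nhdsWithin_le_nhds
        refine h1.congr' ?_
        filter_upwards [hgQ, self_mem_nhdsWithin] with u h2 h3
        have h3 : u - z ≠ 0 := sub_ne_zero.2 h3
        have h4 : (u - z) ^ k = (u - z) ^ M * (u - z) ^ (meromorphicOrderAt Q z).untop₀ := by
          rw [← zpow_natCast, ← zpow_natCast, ← zpow_add₀ h3]
          congr 1
          exact hk.symm
        rw [hG]
        simp only [hA]
        rw [hDz, h2, h4, smul_eq_mul, hV]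
        ring
      refine (Complex.analyticAt_of_differentiable_on_punctured_nhds_of_continuousAt ?_
        hcont).differentiableAt.differentiableWithinAt
      have h1 : ((P.erase z : Set ℂ)ᶜ) ∈ 𝓝 z :=
        (P.erase z).finite_toSet.isClosed.isOpen_compl.mem_nhds (by simp)
      filter_upwards [mem_nhdsWithin_of_mem_nhds h1,
        mem_nhdsWithin_of_mem_nhds (isOpen_upperHalf.mem_nhds hz), self_mem_nhdsWithin]
        with u h2 h3 h4
      exact hGreg u h3 fun h5 => h2 (Finset.mem_coe.2 (Finset.mem_erase.2 ⟨h4, h5⟩))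
    · exact (hGreg z hz hzP).differentiableWithinAt
  -- boundary values
  have hDreal : ∀ x : ℝ, (D x).im = 0 := by
    intro x
    rw [← Complex.conj_eq_iff_im, hD]
    simp only [map_prod, map_pow, map_mul, map_sub, Complex.conj_ofReal, Complex.conj_conj]
    exact Finset.prod_congr rfl fun p _ => by rw [mul_comm]
  have hD0 : ∀ x : ℝ, D x ≠ 0 := by
    intro x
    refine Finset.prod_ne_zero_iff.2 fun p hp => pow_ne_zero _ (mul_ne_zero ?_ ?_) <;>
      refine sub_ne_zero.2 fun h => ?_
    · have := ((hPmem p).1 hp).1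
      rw [← h, Complex.ofReal_im] at this
      exact this.false
    · have h1 := ((hPmem p).1 hp).1
      have := congrArg Complex.im h
      rw [Complex.ofReal_im, Complex.conj_im] at this
      linarith
  have hBreal : ∀ x : ℝ, (B x).im = 0 := by
    intro x
    rw [← Complex.conj_eq_iff_im, hB]
    simp only [map_prod, map_pow, map_sub, Complex.conj_ofReal]
  have hmono : ∀ x : ℂ, 𝓝[upperHalf] x ≤ 𝓝 x := fun x => nhdsWithin_le_nhds
  have hlimreg : ∀ x : ℝ, x ∉ S → ∃ g, Tendsto G (𝓝[upperHalf] (x : ℂ)) (𝓝 g) ∧ g.im = 0 ∧ g ≠ 0 := by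
    intro x hx
    obtain ⟨r, hr, hlim⟩ := hpos x hx
    have h1 : Tendsto G (𝓝[upperHalf] (x : ℂ)) (𝓝 (r * (B x * D x))) :=
      hlim.mul (((hBd.continuous.tendsto _).mul (hDd.continuous.tendsto _)).mono_left (hmono _))
    refine ⟨_, h1, ?_, ?_⟩
    · rw [Complex.im_ofReal_mul, Complex.mul_im, hBreal, hDreal]
      ring
    · have hrc : (r : ℂ) ≠ 0 := by exact_mod_cast hr.ne'
      refine mul_ne_zero hrc (mul_ne_zero (Finset.prod_ne_zero_iff.2 fun s hs =>
        pow_ne_zero _ ?_) (hD0 x))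
      rw [← Complex.ofReal_sub]
      have hxs : x - s ≠ 0 := sub_ne_zero.2 fun h => hx (h ▸ hs)
      exact_mod_cast hxs
  have hlimS : ∀ s : ℝ, s ∈ S → Tendsto G (𝓝[upperHalf] (s : ℂ)) (𝓝 0) := by
    intro s hs
    choose! v hv hv' using fun t (ht : t ∈ S.erase s) =>
      tendsto_cpow_sub (x := s) (s := t) (Finset.ne_of_mem_erase ht).symm (-β t)
    have h1 : Tendsto (fun z : ℂ => C * (∏ t ∈ S.erase s, (z - t) ^ ((-β t : ℝ) : ℂ)) *
        ((∏ t ∈ S.erase s, (z - (t : ℂ)) ^ M) * D z)) (𝓝[upperHalf] (s : ℂ))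
        (𝓝 (C * (∏ t ∈ S.erase s, v t) * ((∏ t ∈ S.erase s, ((s : ℂ) - (t : ℂ)) ^ M) * D s))) := by
      refine ((tendsto_finsetProd _ hv).const_mul C).mul
        (Tendsto.mul ?_ ((hDd.continuous.tendsto _).mono_left (hmono _)))
      have : Continuous fun z : ℂ => ∏ t ∈ S.erase s, (z - (t : ℂ)) ^ M := by fun_prop
      exact (this.tendsto _).mono_left (hmono _)
    have h2 : Tendsto (fun z => Q z * (z - (s : ℂ)) ^ ((-β s : ℝ) : ℂ) * (z - (s : ℂ)) ^ M)
        (𝓝[upperHalf] (s : ℂ)) (𝓝 0) := by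
      obtain ⟨K, hK⟩ := (hm s hs).bound
      rw [tendsto_zero_iff_norm_tendsto_zero]
      have hexp : 0 < (M : ℝ) - (m s + β s) := by linarith [hMS s hs]
      have h3 : Tendsto (fun z : ℂ => K * ‖z - s‖ ^ ((M : ℝ) - (m s + β s)))
          (𝓝[upperHalf] (s : ℂ)) (𝓝 0) := by
        have h4 : ContinuousAt (fun z : ℂ => K * ‖z - s‖ ^ ((M : ℝ) - (m s + β s))) s :=
          continuousAt_const.mul (ContinuousAt.rpow_const (by fun_prop) (Or.inr hexp.le))
        have h5 := h4.tendsto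
        simp only [sub_self, norm_zero, Real.zero_rpow hexp.ne', mul_zero] at h5
        exact h5.mono_left (hmono _)
      refine squeeze_zero' (Eventually.of_forall fun z => norm_nonneg _) ?_ h3
      filter_upwards [hK, self_mem_nhdsWithin] with z h4 h5
      have h6 : 0 < ‖z - (s : ℂ)‖ := norm_pos_iff.2 (hsub0 z h5 s)
      rw [norm_mul, norm_mul, Complex.norm_cpow_real, norm_pow]
      rw [norm_inv, norm_pow] at h4
      calc ‖Q z‖ * ‖z - (s : ℂ)‖ ^ (-β s) * ‖z - (s : ℂ)‖ ^ M
          ≤ K * (‖z - (s : ℂ)‖ ^ m s)⁻¹ * ‖z - (s : ℂ)‖ ^ (-β s) * ‖z - (s : ℂ)‖ ^ M := by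
            gcongr
        _ = _ := by
            rw [← Real.rpow_natCast _ (m s), ← Real.rpow_natCast _ M, ← Real.rpow_neg h6.le,
              mul_assoc, mul_assoc, ← Real.rpow_add h6, ← Real.rpow_add h6]
            congr 2
            ring
    have h3 := h2.mul h1
    rw [zero_mul] at h3
    refine h3.congr fun z => ?_
    rw [hG]
    simp only [hA, hB]
    rw [← Finset.mul_prod_erase S _ hs, ← Finset.mul_prod_erase S (fun t : ℝ => (z - (t : ℂ)) ^ M) hs]
    ring
  have hlim : ∀ x : ℝ, ∃ g, Tendsto G (𝓝[upperHalf] (x : ℂ)) (𝓝 g) ∧ g.im = 0 := by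
    intro x
    by_cases hx : x ∈ S
    · exact ⟨0, hlimS x hx, rfl⟩
    · obtain ⟨g, h1, h2, -⟩ := hlimreg x hx
      exact ⟨g, h1, h2⟩
  -- growth
  have hgrowth : HasPowerGrowth G := by
    have hconst : HasPowerGrowth fun _ => C := by
      refine ⟨0, ?_⟩
      simp only [pow_zero]
      exact Asymptotics.isBigO_const_const C one_ne_zero _
    refine (hconst.mul (HasPowerGrowth.mul ⟨L, hL⟩ (HasPowerGrowth.finset_prod S fun s _ =>
      HasPowerGrowth.cpow_sub _ _))).mul ((HasPowerGrowth.finset_prod S fun s _ =>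
      HasPowerGrowth.pow_sub _ _).mul (HasPowerGrowth.finset_prod P fun p _ => ?_))
    simp only [mul_pow]
    exact (HasPowerGrowth.pow_sub _ _).mul (HasPowerGrowth.pow_sub _ _)
  obtain ⟨p, hp⟩ := exists_polynomial_of_boundary_real hGd hlim hgrowth
  have hp0 : p ≠ 0 := by
    rintro rfl
    obtain ⟨x, hx, -⟩ := exists_near_notMem_finset S (x := 0) (p := fun _ => True) (by simp)
    obtain ⟨g, hg, -, hg0⟩ := hlimreg x hx
    refine hg0 (tendsto_nhds_unique (hg.congr' ?_) tendsto_const_nhds)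
    filter_upwards [self_mem_nhdsWithin] with z hz
    rw [hp z hz, Polynomial.eval_zero]
  -- solve for `Q`
  refine IsPowerProduct.congr (h := fun w => p.eval w * (C * ∏ s ∈ S, (w - s) ^ ((-β s : ℝ) : ℂ))⁻¹ *
    (B w * D w)⁻¹) ?_ P ?_
  · refine ((IsPowerProduct.polynomial hp0).mul ((IsPowerProduct.const hC).mul
      (IsPowerProduct.finset_prod S fun s _ => IsPowerProduct.cpow_sub _ _)).inv).mul
      ((IsPowerProduct.finset_prod S fun s _ => IsPowerProduct.pow_sub _ _).mul
        (IsPowerProduct.finset_prod P fun q _ => ?_)).inv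
    simp only [mul_pow]
    exact (IsPowerProduct.pow_sub _ _).mul (IsPowerProduct.pow_sub _ _)
  · intro w hw hwP
    have h1 : ∏ s ∈ S, (w - (s : ℂ)) ^ ((-β s : ℝ) : ℂ) ≠ 0 := Finset.prod_ne_zero_iff.2 fun s _ => by
      rw [Complex.cpow_def_of_ne_zero (hsub0 w hw s)]
      exact Complex.exp_ne_zero _
    have h2 : B w ≠ 0 := Finset.prod_ne_zero_iff.2 fun s _ => pow_ne_zero _ (hsub0 w hw s)
    have h3 : D w ≠ 0 := Finset.prod_ne_zero_iff.2 fun q hq => pow_ne_zero _ (mul_ne_zero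
      (sub_ne_zero.2 fun h => hwP (h ▸ hq)) (sub_ne_zero.2 fun h => by
        have hw : 0 < w.im := hw
        have h4 := ((hPmem q).1 hq).1
        rw [h, Complex.conj_im] at hw
        linarith))
    rw [← hp w hw, hG]
    simp only [hA]
    field_simp

/-! ### The factorization of a Kühnau quadratic differential -/

section PowerProduct

variable {ι : Type*} {a : ι → ℂ} {α : ι → ℝ}

theorem analyticAt_prod_cpow {s : Finset ι} {w : ℂ} (hw : 0 < w.im) (hne : ∀ i ∈ s, w ≠ a i)
    (hint : ∀ i ∈ s, 0 < (a i).im → ∃ p : ℤ, α i = p) :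
    AnalyticAt ℂ (fun z => ∏ i ∈ s, (z - a i) ^ (α i : ℂ)) w := by
  refine Finset.analyticAt_fun_prod _ fun i hi => ?_
  by_cases h : 0 < (a i).im
  · obtain ⟨p, hp⟩ := hint i hi h
    simp only [hp, Complex.ofReal_intCast, Complex.cpow_intCast]
    exact (analyticAt_id.sub analyticAt_const).zpow (sub_ne_zero.2 (hne i hi))
  · refine (analyticAt_id.sub analyticAt_const).cpow analyticAt_const (Or.inr ?_)
    have h1 : 0 < (w - a i).im := by
      rw [Complex.sub_im]
      linarith [not_lt.1 h]
    exact h1.ne'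

theorem prod_cpow_ne_zero' {s : Finset ι} {w : ℂ} (hne : ∀ i ∈ s, w ≠ a i) :
    ∏ i ∈ s, (w - a i) ^ (α i : ℂ) ≠ 0 := by
  refine Finset.prod_ne_zero_iff.2 fun i hi => ?_
  rw [Complex.cpow_def_of_ne_zero (sub_ne_zero.2 (hne i hi))]
  exact Complex.exp_ne_zero _

/-- A product of powers, with the value `0` at the poles, is in normal form. -/
theorem meromorphicNFAt_prod_cpow [Fintype ι] {R w : ℂ} (hR : R ≠ 0) (hinj : Function.Injective a)
    (hw : 0 < w.im) (hint : ∀ i, 0 < (a i).im → ∃ p : ℤ, α i = p) :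
    MeromorphicNFAt (fun z => R * ∏ i, (z - a i) ^ (α i : ℂ)) w := by
  classical
  right
  by_cases hi : ∃ i, w = a i
  · obtain ⟨i, hi⟩ := hi
    have hne : ∀ k ∈ Finset.univ.erase i, w ≠ a k := fun k hk h =>
      (Finset.ne_of_mem_erase hk) (hinj (hi ▸ h)).symm
    obtain ⟨p, hp⟩ := hint i (hi ▸ hw)
    refine ⟨p, fun z => R * ∏ k ∈ Finset.univ.erase i, (z - a k) ^ (α k : ℂ),
      analyticAt_const.mul (analyticAt_prod_cpow hw hne fun k _ => hint k),
      mul_ne_zero hR (prod_cpow_ne_zero' hne), Eventually.of_forall fun z => ?_⟩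
    simp only [Pi.smul_apply', Pi.pow_apply, smul_eq_mul]
    rw [← Finset.mul_prod_erase _ _ (Finset.mem_univ i), hp, Complex.ofReal_intCast,
      Complex.cpow_intCast, ← hi]
    ring
  · have hne : ∀ k ∈ Finset.univ, w ≠ a k := fun k _ h => hi ⟨k, h⟩
    refine ⟨0, fun z => R * ∏ k, (z - a k) ^ (α k : ℂ),
      analyticAt_const.mul (analyticAt_prod_cpow hw hne fun k _ => hint k),
      mul_ne_zero hR (prod_cpow_ne_zero' hne), Eventually.of_forall fun z => ?_⟩
    simp

end PowerProduct

/-- The degree of a boundary point of the upper half-plane is the exponent there. -/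
theorem HasBoundaryDegree.eq_of_hasBoundaryExponent {Q : ℂ → ℂ} {c μ m : ℝ}
    (h : HasBoundaryDegree Q id c μ) (hQ : HasBoundaryExponent Q c m) : μ = m := by
  have h' := h
  obtain ⟨θ₁, hθ₁, θ₂, hθ₂, ⟨ε, hε, hl, hr⟩, hfin, -⟩ := h
  rcases le_or_gt m (-2) with hm | hm
  · exact absurd hfin (hQ.infinite_trajectoryEnds hm hε hr)
  · refine h'.unique (HasBoundaryExponent.hasBoundaryDegree differentiableOn_id (injOn_id _)
      (by simpa using hQ) hm ?_)
    have h1 : ∀ᶠ x in 𝓝 c, x ∈ Ioo (c - ε) (c + ε) := Ioo_mem_nhds (by linarith) (by linarith)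
    filter_upwards [h1.filter_mono nhdsWithin_le_nhds, self_mem_nhdsWithin] with x hx hne
    refine ⟨⟨id, analyticAt_id, EventuallyEq.rfl⟩, ?_⟩
    rcases lt_or_gt_of_ne hne with h2 | h2
    · obtain ⟨w, hw, -⟩ := hl.exists_tendsto isOpen_Ioo ⟨hx.1, h2⟩
      exact ⟨w, hw⟩
    · obtain ⟨w, hw, -⟩ := hr.exists_tendsto isOpen_Ioo ⟨h2, hx.2⟩
      exact ⟨w, hw⟩

/-- In a representation of `Q` as a product of powers, the exponent at `ξ₀` is the degree `N`, and
the identity extends to the exceptional points because both sides are in normal form. -/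
theorem IsKuhnau.exists_isFactorization {Q : ℂ → ℂ} (hQ : IsKuhnau Q) {ξ₀ : ℝ} {N : ℕ}
    (hN : HasBoundaryDegree Q id ξ₀ (N : ℝ)) :
    ∃ (n : ℕ) (a : Fin n → ℂ) (α : Fin n → ℝ) (R : ℂ), IsFactorization Q ξ₀ N n a α R := by
  classical
  obtain ⟨e, R, hR, T, hT⟩ := hQ.isPowerProduct
  set B : Finset ℂ := insert (ξ₀ : ℂ) e.support with hB
  have hprod : ∀ w, (e.prod fun b x => (w - b) ^ (x : ℂ)) = ∏ i : B, (w - i) ^ (e i : ℂ) := by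
    intro w
    rw [Finset.prod_coe_sort B (fun b => (w - b) ^ (e b : ℂ))]
    exact Finsupp.prod_of_support_subset _ (Finset.subset_insert _ _) _ (by simp)
  simp only [hprod] at hT
  have hinj : Function.Injective fun i : B => (i : ℂ) := Subtype.val_injective
  have hev : ∀ w ∈ upperHalf, ∀ᶠ z in 𝓝[≠] w, Q z = R * ∏ i : B, (z - i) ^ (e i : ℂ) := by
    intro w hw
    have h1 : ((T.erase w : Set ℂ)ᶜ) ∈ 𝓝 w :=
      (T.erase w).finite_toSet.isClosed.isOpen_compl.mem_nhds (by simp)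
    filter_upwards [mem_nhdsWithin_of_mem_nhds h1,
      mem_nhdsWithin_of_mem_nhds (isOpen_upperHalf.mem_nhds hw), self_mem_nhdsWithin] with z h2 h3 h4
    exact hT z h3 fun h5 => h2 (Finset.mem_coe.2 (Finset.mem_erase.2 ⟨h4, h5⟩))
  have hint : ∀ i : B, 0 < (i : ℂ).im → ∃ p : ℤ, e i = p := fun i hi =>
    exists_int_of_meromorphicAt (a := fun i : B => (i : ℂ)) (α := fun i : B => e i) hinj hR
      (hQ.meromorphic hi).meromorphicAt (hev i hi)
  have hfac : ∀ w ∈ upperHalf, Q w = R * ∏ i : B, (w - i) ^ (e i : ℂ) := fun w hw =>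
    (((hQ.meromorphic hw).eventuallyEq_nhdsNE_iff_eventuallyEq_nhds
      (meromorphicNFAt_prod_cpow hR hinj hw hint)).1 (hev w hw)).self_of_nhds
  have hξB : (ξ₀ : ℂ) ∈ B := Finset.mem_insert_self _ _
  have hsym := hQ.isReflectionSymmetric (a := fun i : B => (i : ℂ)) (α := fun i : B => e i) hinj
    (fun i hi => by
      rcases Finset.mem_insert.1 i.2 with h | h
      · exact absurd (by rw [h, Complex.ofReal_im]) hi
      · exact Finsupp.mem_support_iff.1 h) hR hfac
  have hexp : HasBoundaryExponent Q ξ₀ (e ξ₀) := by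
    have h1 := (HasBoundaryExponent.const (x := ξ₀) hR).mul (hsym.hasBoundaryExponent ξ₀)
    rw [zero_add, Finset.sum_eq_single_of_mem (⟨(ξ₀ : ℂ), hξB⟩ : B) (Finset.mem_univ _), if_pos rfl]
      at h1
    · exact h1.congr (by filter_upwards [self_mem_nhdsWithin] with w hw using (hfac w hw).symm)
    · intro i _ hi
      exact if_neg fun h => hi (Subtype.ext h)
  have heN : e ξ₀ = N := (hN.eq_of_hasBoundaryExponent hexp).symm
  set B' := e.support.erase (ξ₀ : ℂ) with hB'
  have hBB' : B.erase (ξ₀ : ℂ) = B' := Finset.erase_insert_eq_erase _ _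
  set eqv := B'.equivFin.symm with heqv
  refine ⟨B'.card, fun j => (eqv j : ℂ), fun j => e (eqv j), R, ?_, ?_, ?_, hR, ?_⟩
  · exact Subtype.val_injective.comp eqv.injective
  · exact fun j => (Finset.mem_erase.1 (eqv j).2).1
  · exact fun j => Finsupp.mem_support_iff.1 (Finset.mem_erase.1 (eqv j).2).2
  · intro w hw
    rw [hfac w hw, Finset.prod_coe_sort B (fun b => (w - b) ^ (e b : ℂ)),
      ← Finset.mul_prod_erase B _ hξB, hBB', heN, Complex.ofReal_natCast, Complex.cpow_natCast,
      mul_assoc]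
    congr 2
    rw [← Finset.prod_coe_sort B' (fun b => (w - b) ^ (e b : ℂ)),
      ← Equiv.prod_comp eqv (fun i : B' => (w - i) ^ (e i : ℂ))]

namespace IsFactorization

variable {Q : ℂ → ℂ} {ξ₀ : ℝ} {N n : ℕ} {a : Fin n → ℂ} {α : Fin n → ℝ} {R : ℂ}

/-- The factor `(w - ξ₀)^N` is treated as one more power, with index `none`. -/
theorem isReflectionSymmetric_option (h : IsFactorization Q ξ₀ N n a α R) (hQ : IsKuhnau Q) :
    IsReflectionSymmetric (fun i : Option (Fin n) => i.elim (ξ₀ : ℂ) a)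
      (fun i => i.elim (N : ℝ) α) := by
  obtain ⟨hinj, hne, hα, hR, hfac⟩ := h
  refine hQ.isReflectionSymmetric (R := R) ?_ ?_ hR ?_
  · rintro (_ | i) (_ | j) hij
    · rfl
    · exact absurd hij.symm (hne j)
    · exact absurd hij (hne i)
    · exact congrArg some (hinj hij)
  · rintro (_ | i) hi
    · exact absurd (Complex.ofReal_im ξ₀) hi
    · exact hα i
  · intro w hw
    rw [hfac w hw, Fintype.prod_option]
    simp only [Option.elim_none, Option.elim_some, Complex.ofReal_natCast, Complex.cpow_natCast]
    ring

theorem isReflectionSymmetric (h : IsFactorization Q ξ₀ N n a α R) (hQ : IsKuhnau Q) :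
    IsReflectionSymmetric a α := by
  have hs := h.isReflectionSymmetric_option hQ
  refine ⟨h.1, fun j => ?_, fun j hj => hs.exists_int (some j) hj⟩
  obtain ⟨k, hk, hk'⟩ := hs.exists_conj (some j)
  rcases k with _ | k
  · have : (ξ₀ : ℂ) = (starRingEnd ℂ) (a j) := hk
    refine absurd ?_ (h.2.1 j)
    rw [← Complex.conj_ofReal, this, Complex.conj_conj]
  · exact ⟨k, hk, hk'⟩

theorem hasBoundaryExponent (h : IsFactorization Q ξ₀ N n a α R) (hQ : IsKuhnau Q) (x : ℝ) :
    HasBoundaryExponent Q x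
      ((if x = ξ₀ then (N : ℝ) else 0) + ∑ j, if a j = x then α j else 0) := by
  have h1 := (HasBoundaryExponent.const (x := x) h.2.2.2.1).mul
    ((h.isReflectionSymmetric_option hQ).hasBoundaryExponent x)
  rw [zero_add, Fintype.sum_option] at h1
  simp only [Option.elim_none, Option.elim_some, Complex.ofReal_inj, eq_comm (a := ξ₀)] at h1
  refine h1.congr ?_
  filter_upwards [self_mem_nhdsWithin] with w hw
  rw [h.2.2.2.2 w hw, Fintype.prod_option]
  simp only [Option.elim_none, Option.elim_some, Complex.ofReal_natCast, Complex.cpow_natCast]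
  ring

end IsFactorization

/-! ### Boundary charts -/

theorem IsRealAnalyticAt.dslope {χ : ℂ → ℂ} {x : ℝ} (hχ : IsRealAnalyticAt χ x) (h0 : χ x = 0) :
    IsRealAnalyticAt (_root_.dslope χ x) x := by
  obtain ⟨p, hp⟩ := hχ.analytic
  refine ⟨hp.has_fpower_series_dslope_fslope.analyticAt, ?_⟩
  filter_upwards [hχ.real] with y hy
  by_cases hyx : (y : ℂ) = x
  · rw [hyx, dslope_same]
    exact hχ.deriv.im_eq_zero
  · rw [dslope_of_ne _ hyx, slope_def_field, h0, sub_zero, ← Complex.ofReal_sub,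
      Complex.div_ofReal_im, hy, zero_div]

namespace HasBoundaryExponent

/-- The power of a real coordinate. -/
theorem cpow_coordinate {χ : ℂ → ℂ} {x : ℝ} (hχ : IsRealAnalyticAt χ x) (h0 : χ x = 0)
    (hpos : 0 < (deriv χ x).re) (m : ℝ) :
    HasBoundaryExponent (fun z => (-Complex.I * χ z) ^ (m : ℂ)) x m := by
  have hk := hχ.dslope h0
  have hk0 : 0 < (dslope χ x x).re := by rwa [dslope_same]
  have hne : (dslope χ (x : ℂ) (x : ℂ)) ^ (m : ℂ) ≠ 0 := by
    rw [Complex.cpow_def_of_ne_zero (fun h => by rw [h] at hk0; simp at hk0)]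
    exact Complex.exp_ne_zero _
  refine ⟨1, one_ne_zero, fun z => dslope χ x z ^ (m : ℂ), hk.cpow hk0 m, hne, ?_⟩
  have hre : ∀ᶠ z in 𝓝 (x : ℂ), 0 < (dslope χ x z).re :=
    (Complex.continuous_re.continuousAt.comp hk.analytic.continuousAt).eventually_const_lt hk0
  filter_upwards [self_mem_nhdsWithin, mem_nhdsWithin_of_mem_nhds hre] with z hz h1
  have hz : 0 < z.im := hz
  have h2 := sub_smul_dslope χ x z
  rw [h0, sub_zero, smul_eq_mul] at h2
  rw [← h2, ← mul_assoc, mul_cpow_of_re_pos (by rw [re_neg_I_mul]; simpa using hz) h1, one_mul]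

/-- The exponent is invariant under composition with a real coordinate. -/
theorem comp_coordinate {q χ : ℂ → ℂ} {x y m : ℝ} (hq : HasBoundaryExponent q y m)
    (hχ : IsRealAnalyticAt χ x) (h0 : χ x = y) (hpos : 0 < (deriv χ x).re) :
    HasBoundaryExponent (fun z => q (χ z)) x m := by
  obtain ⟨C, hC, k, hk, hk0, hqk⟩ := hq
  have hsub : IsRealAnalyticAt (fun z => χ z - y) x := hχ.sub (IsRealAnalyticAt.const y)
  have hder : deriv (fun z => χ z - y) x = deriv χ x := by simp
  have h1 := cpow_coordinate hsub (by simp [h0]) (by rwa [hder]) m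
  have h2 := of_isRealAnalyticAt (hk.comp hχ h0) (by rwa [h0])
  have h3 := ((const (x := x) hC).mul h1).mul h2
  rw [zero_add, add_zero] at h3
  refine h3.congr ?_
  have hlim : Tendsto χ (𝓝[upperHalf] (x : ℂ)) (𝓝[upperHalf] (y : ℂ)) := by
    apply tendsto_nhdsWithin_of_tendsto_nhds_of_eventually_within
    · rw [← h0]
      exact hχ.analytic.continuousAt.tendsto.mono_left nhdsWithin_le_nhds
    · filter_upwards [self_mem_nhdsWithin,
        mem_nhdsWithin_of_mem_nhds (hχ.eventually_im_pos hpos)] with z h4 h5 using h5.1 h4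
  filter_upwards [hlim.eventually hqk] with z hz
  rw [hz, mul_assoc]

end HasBoundaryExponent

/-- A local description of the conformal map `f` near the boundary point `x₀`: `f = ψ ∘ χ` for a
map `ψ` of a half-disc into the image domain and a coordinate `χ` at `x₀` that is real on the real
axis. -/
structure IsBoundaryChart (f ψ χ : ℂ → ℂ) (x₀ : ℝ) : Prop where
  analytic : IsRealAnalyticAt χ x₀
  map_zero : χ x₀ = 0
  deriv_pos : 0 < (deriv χ x₀).re
  tendsto_inv : Tendsto (fun u => Function.invFunOn f upperHalf (ψ u)) (𝓝[upperHalf] 0)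
    (𝓝 (x₀ : ℂ))
  eq : ∀ᶠ z in 𝓝[upperHalf] (x₀ : ℂ), f z = ψ (χ z)

theorem IsBoundaryChart.tendsto {f ψ χ : ℂ → ℂ} {x₀ : ℝ} (h : IsBoundaryChart f ψ χ x₀) :
    Tendsto χ (𝓝[upperHalf] (x₀ : ℂ)) (𝓝[upperHalf] 0) := by
  apply tendsto_nhdsWithin_of_tendsto_nhds_of_eventually_within
  · rw [← h.map_zero]
    exact h.analytic.analytic.continuousAt.tendsto.mono_left nhdsWithin_le_nhds
  · filter_upwards [self_mem_nhdsWithin,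
      mem_nhdsWithin_of_mem_nhds (h.analytic.eventually_im_pos h.deriv_pos)] with z h4 h5
      using h5.1 h4

/-- Conformal maps that send only `∞` to `∞` have a boundary chart for each map `ψ` of a half-disc
into the image domain that sends the diameter to the boundary. -/
theorem exists_isBoundaryChart {f ψ : ℂ → ℂ} (hf : DifferentiableOn ℂ f upperHalf)
    (hinj : InjOn f upperHalf)
    (htop : Tendsto f (Bornology.cobounded ℂ ⊓ 𝓟 upperHalf) (Bornology.cobounded ℂ))
    (hψmaps : ∀ᶠ u in 𝓝[upperHalf] (0 : ℂ), DifferentiableAt ℂ ψ u ∧ ψ u ∈ f '' upperHalf)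
    (hψlim : ∀ᶠ x : ℝ in 𝓝 0, ∃ w ∉ f '' upperHalf,
      Tendsto ψ (𝓝[upperHalf] (x : ℂ)) (𝓝 w)) :
    ∃ (x₀ : ℝ) (χ : ℂ → ℂ), IsBoundaryChart f ψ χ x₀ := by
  obtain ⟨w₁, -, hw₁⟩ := hψlim.self_of_nhds
  rw [Complex.ofReal_zero] at hw₁
  obtain ⟨r₁, hr₁, hball₁⟩ := Metric.mem_nhdsWithin_iff.1
    (hψmaps.and (hw₁.norm.eventually_le_const (lt_add_one ‖w₁‖)))
  obtain ⟨r₂, hr₂, hball₂⟩ := Metric.eventually_nhds_iff_ball.1 hψlim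
  obtain ⟨r, hr, hrr₁, hrr₂⟩ : ∃ r : ℝ, 0 < r ∧ r ≤ r₁ ∧ r ≤ r₂ :=
    ⟨min r₁ r₂, lt_min hr₁ hr₂, min_le_left _ _, min_le_right _ _⟩
  have hsub : Metric.ball (0 : ℂ) r ∩ upperHalf ⊆ Metric.ball 0 r₁ ∩ upperHalf :=
    inter_subset_inter_left _ (Metric.ball_subset_ball hrr₁)
  set M := ‖w₁‖ + 1
  have hψ : DifferentiableOn ℂ ψ (Metric.ball 0 r ∩ upperHalf) := fun u hu =>
    (hball₁ (hsub hu)).1.1.differentiableWithinAt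
  have hmaps : MapsTo ψ (Metric.ball 0 r ∩ upperHalf) (f '' upperHalf) := fun u hu =>
    (hball₁ (hsub hu)).1.2
  have hM : ∀ u ∈ Metric.ball 0 r ∩ upperHalf, ‖ψ u‖ ≤ M := fun u hu => (hball₁ (hsub hu)).2
  have hlim : ∀ x : ℝ, |x| < r → ∃ w ∉ f '' upperHalf,
      Tendsto ψ (𝓝[upperHalf] (x : ℂ)) (𝓝 w) := fun x hx =>
    hball₂ x (by rw [mem_ball_zero_iff, Real.norm_eq_abs]; exact hx.trans_le hrr₂)
  set g := Function.invFunOn f upperHalf with hg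
  have hgf : ∀ z ∈ upperHalf, g (f z) = z := fun z hz => hinj.leftInvOn_invFunOn hz
  have hgH : ∀ w ∈ f '' upperHalf, g w ∈ upperHalf ∧ f (g w) = w := by
    rintro _ ⟨z, hz, rfl⟩
    rw [hgf z hz]
    exact ⟨hz, rfl⟩
  obtain ⟨M', hM'⟩ : ∃ M' : ℝ, ∀ z ∈ upperHalf, ‖f z‖ ≤ M → ‖z‖ ≤ M' := by
    have h1 := (tendsto_norm_cobounded_atTop.comp htop).eventually_gt_atTop M
    rw [eventually_inf_principal, ← comap_norm_atTop, eventually_comap] at h1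
    obtain ⟨M', hM'⟩ := eventually_atTop.1 h1
    refine ⟨M', fun z hz hzM => ?_⟩
    by_contra h
    exact (hM' ‖z‖ (not_le.1 h).le z rfl hz).not_ge hzM
  obtain ⟨x₀, χ, hχ, hχ0, hχd, hχt, hχe⟩ := exists_boundary_chart hr (G := fun u => g (ψ u))
    (fun u hu => by
      obtain ⟨z, hz, hzu⟩ := hmaps hu
      have h1 := (hasDerivAt_invFunOn isOpen_upperHalf hf hinj hz).differentiableAt
      rw [hzu] at h1
      exact h1.comp_differentiableWithinAt u (hψ u hu))
    (fun u hu => (hgH _ (hmaps hu)).1)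
    (M := M') (fun u hu => hM' _ (hgH _ (hmaps hu)).1 (by
      rw [(hgH _ (hmaps hu)).2]
      exact hM u hu))
    (fun x hx K hK hKc => by
      obtain ⟨w, hw, hwlim⟩ := hlim x hx
      have hfK : IsCompact (f '' K) := hKc.image_of_continuousOn (hf.continuousOn.mono hK)
      have hwK : w ∉ f '' K := fun h => hw (image_mono hK h)
      have hxm : (x : ℂ) ∈ Metric.ball (0 : ℂ) r := by simpa using hx
      filter_upwards [hwlim.eventually (hfK.isClosed.isOpen_compl.mem_nhds hwK),
        mem_nhdsWithin_of_mem_nhds (Metric.isOpen_ball.mem_nhds hxm), self_mem_nhdsWithin]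
        with u h1 h2 h3 h4
      exact h1 ⟨_, h4, (hgH _ (hmaps ⟨h2, h3⟩)).2⟩)
  refine ⟨x₀, χ, hχ, hχ0, hχd, hχt, ?_⟩
  filter_upwards [hχe] with z hz
  conv_lhs => rw [← hz.2]
  exact (hgH _ (hmaps hz.1)).2

/-! ### Trajectory coordinates and the slit -/

/-- A coordinate `Φ` at `w₀`, with inverse `Ψ`, in which the `φ`-trajectories of `Q(w)dw²` are
horizontal. -/
structure IsTrajectoryCoordinate (Q : ℂ → ℂ) (φ : ℝ) (w₀ : ℂ) (Φ Ψ : ℂ → ℂ) : Prop where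
  analytic : AnalyticAt ℂ Φ w₀
  map_zero : Φ w₀ = 0
  analytic_inv : AnalyticAt ℂ Ψ 0
  left_inv : ∀ᶠ w in 𝓝 w₀, Ψ (Φ w) = w
  right_inv : ∀ᶠ u in 𝓝 (0 : ℂ), Φ (Ψ u) = u
  eq : ∀ᶠ w in 𝓝 w₀, Q w = Complex.exp (2 * φ * Complex.I) * deriv Φ w ^ 2

namespace IsTrajectoryCoordinate

variable {Q Φ Ψ : ℂ → ℂ} {φ : ℝ} {w₀ : ℂ}

theorem inv_zero (h : IsTrajectoryCoordinate Q φ w₀ Φ Ψ) : Ψ 0 = w₀ := by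
  have := h.left_inv.self_of_nhds
  rwa [h.map_zero] at this

theorem tendsto (h : IsTrajectoryCoordinate Q φ w₀ Φ Ψ) : Tendsto Φ (𝓝 w₀) (𝓝 0) := by
  rw [← h.map_zero]
  exact h.analytic.continuousAt

theorem tendsto_inv (h : IsTrajectoryCoordinate Q φ w₀ Φ Ψ) : Tendsto Ψ (𝓝 0) (𝓝 w₀) := by
  rw [← h.inv_zero]
  exact h.analytic_inv.continuousAt

theorem neg (h : IsTrajectoryCoordinate Q φ w₀ Φ Ψ) :
    IsTrajectoryCoordinate Q φ w₀ (fun w => -Φ w) (fun u => Ψ (-u)) := by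
  have hneg : Tendsto (fun u : ℂ => -u) (𝓝 0) (𝓝 0) := by
    simpa using (continuous_neg (G := ℂ)).tendsto 0
  refine ⟨h.analytic.neg, by simp [h.map_zero], ?_, ?_, ?_, ?_⟩
  · have h1 : AnalyticAt ℂ Ψ (-(0 : ℂ)) := by simpa using h.analytic_inv
    exact h1.fun_comp (f := fun u : ℂ => -u) (analyticAt_id.neg)
  · simpa using h.left_inv
  · filter_upwards [hneg.eventually h.right_inv] with u hu
    rw [hu, neg_neg]
  · filter_upwards [h.eq] with w hw
    have : deriv (fun w => -Φ w) w = -deriv Φ w := deriv.fun_neg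
    rw [this, neg_sq, hw]

end IsTrajectoryCoordinate

/-- Trajectory coordinates exist at ordinary points: they are primitives of a square root of
`e^(-2iφ)Q`. -/
theorem exists_isTrajectoryCoordinate {Q : ℂ → ℂ} {w₀ : ℂ} (hQ : AnalyticAt ℂ Q w₀)
    (h0 : Q w₀ ≠ 0) (φ : ℝ) : ∃ Φ Ψ : ℂ → ℂ, IsTrajectoryCoordinate Q φ w₀ Φ Ψ := by
  have hE : Complex.exp (2 * φ * Complex.I) ≠ 0 := Complex.exp_ne_zero _
  obtain ⟨Φ, hΦ, hΦ0, hΦd, hΦq⟩ := exists_analyticAt_deriv_sq_eq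
    (q := fun w => (Complex.exp (2 * φ * Complex.I))⁻¹ * Q w) (analyticAt_const.mul hQ)
    (mul_ne_zero (inv_ne_zero hE) h0)
  have hs := hΦ.hasStrictDerivAt
  refine ⟨Φ, hs.localInverse _ _ _ hΦd, hΦ, hΦ0, ?_, ?_, ?_, ?_⟩
  · have := hΦ.analyticAt_localInverse hΦd
    rwa [hΦ0] at this
  · exact hs.eventually_left_inverse hΦd
  · have := hs.eventually_right_inverse hΦd
    rwa [hΦ0] at this
  · filter_upwards [hΦq] with w hw
    rw [hw]
    field_simp

/-- A slit: a simple curve in the upper half-plane that starts at the boundary point `ξ₀`. -/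
structure IsSlit (γ : ℝ → ℂ) (T ξ₀ : ℝ) : Prop where
  pos : 0 < T
  continuousOn : ContinuousOn γ (Icc 0 T)
  injOn : InjOn γ (Icc 0 T)
  map_zero : γ 0 = ξ₀
  im_pos : ∀ t ∈ Ioc 0 T, 0 < (γ t).im

namespace IsSlit

variable {γ : ℝ → ℂ} {T ξ₀ : ℝ}

/-- Points of the slit that are close to a point `γ(t₀)` have parameters close to `t₀`. -/
theorem eventually_mem_imp (h : IsSlit γ T ξ₀) {t₀ η : ℝ} (ht₀ : t₀ ∈ Icc 0 T) (hη : 0 < η) :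
    ∀ᶠ w in 𝓝 (γ t₀), ∀ t ∈ Icc 0 T, γ t = w → |t - t₀| < η := by
  set K := Icc 0 T \ Ioo (t₀ - η) (t₀ + η) with hK
  have hKc : IsCompact (γ '' K) := (isCompact_Icc.diff isOpen_Ioo).image_of_continuousOn
    (h.continuousOn.mono sdiff_subset)
  have hnot : γ t₀ ∉ γ '' K := by
    rintro ⟨t, ht, heq⟩
    rw [h.injOn ht.1 ht₀ heq] at ht
    exact ht.2 ⟨by linarith, by linarith⟩
  filter_upwards [hKc.isClosed.isOpen_compl.mem_nhds hnot] with w hw t ht htw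
  by_contra habs
  refine hw ⟨t, ⟨ht, fun hmem => habs ?_⟩, htw⟩
  rw [abs_lt]
  constructor <;> linarith [hmem.1, hmem.2]

theorem eventually_notMem (h : IsSlit γ T ξ₀) {w : ℂ} (hw : w ∉ γ '' Icc 0 T) :
    ∀ᶠ v in 𝓝 w, v ∉ γ '' Ioc 0 T := by
  have hc := (isCompact_Icc.image_of_continuousOn h.continuousOn).isClosed
  filter_upwards [hc.isOpen_compl.mem_nhds hw] with v hv hv'
  exact hv (image_mono Ioc_subset_Icc_self hv')

end IsSlit

/-- Along a `φ`-trajectory, a trajectory coordinate has a derivative whose square is positive. -/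
theorem IsTrajectoryArc.hasDerivAt_comp {Q Φ : ℂ → ℂ} {γ : ℝ → ℂ} {φ T t : ℝ}
    (h : IsTrajectoryArc upperHalf Q φ γ 0 T) (ht : t ∈ Ioo 0 T) (hΦ : AnalyticAt ℂ Φ (γ t))
    (heq : Q (γ t) = Complex.exp (2 * φ * Complex.I) * deriv Φ (γ t) ^ 2) :
    ∃ v : ℂ, HasDerivAt (fun t => Φ (γ t)) v t ∧ ∃ r : ℝ, 0 < r ∧ v ^ 2 = r := by
  obtain ⟨-, v, hv, r, hr, hQ⟩ := h t ht
  refine ⟨deriv Φ (γ t) * v, hΦ.differentiableAt.hasDerivAt.comp t hv, r, hr, ?_⟩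
  have hE : Complex.exp (2 * φ * Complex.I) ≠ 0 := Complex.exp_ne_zero _
  rw [heq] at hQ
  apply mul_left_cancel₀ hE
  linear_combination hQ

/-- In a trajectory coordinate at an inner point, the slit is the real axis. -/
theorem IsSlit.real_of_trajectoryCoordinate {Q Φ Ψ : ℂ → ℂ} {γ : ℝ → ℂ} {φ T ξ₀ t₀ : ℝ}
    (h : IsSlit γ T ξ₀) (harc : IsTrajectoryArc upperHalf Q φ γ 0 T) (ht₀ : t₀ ∈ Ioo 0 T)
    (hΦ : IsTrajectoryCoordinate Q φ (γ t₀) Φ Ψ) :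
    (∀ᶠ w in 𝓝 (γ t₀), w ∈ γ '' Ioc 0 T → (Φ w).im = 0) ∧
      ∀ᶠ x : ℝ in 𝓝 0, Ψ x ∈ γ '' Ioc 0 T := by
  have hcont : ContinuousAt γ t₀ := h.continuousOn.continuousAt (Icc_mem_nhds ht₀.1 ht₀.2)
  have hev := (hcont.eventually (hΦ.analytic.eventually_analyticAt.and
    (hΦ.eq.and hΦ.left_inv))).and (isOpen_Ioo.mem_nhds ht₀)
  obtain ⟨η, hη, hball⟩ := Metric.eventually_nhds_iff_ball.1 hev
  rw [Real.ball_eq_Ioo] at hball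
  choose! v hv hv2 using fun t (ht : t ∈ Ioo (t₀ - η) (t₀ + η)) =>
    harc.hasDerivAt_comp (hball t ht).2 (hball t ht).1.1 (hball t ht).1.2.1
  have hmid : t₀ ∈ Ioo (t₀ - η) (t₀ + η) := ⟨by linarith, by linarith⟩
  have him : ∀ t ∈ Ioo (t₀ - η) (t₀ + η), (Φ (γ t)).im = 0 := by
    intro t ht
    rw [im_eq_of_sq_pos hv hv2 ht hmid, hΦ.map_zero, Complex.zero_im]
  constructor
  · filter_upwards [h.eventually_mem_imp (Ioo_subset_Icc_self ht₀) hη] with w hw hmem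
    obtain ⟨t, ht, rfl⟩ := hmem
    have := abs_lt.1 (hw t (Ioc_subset_Icc_self ht) rfl)
    exact him t ⟨by linarith, by linarith⟩
  · have h1 : t₀ - η / 2 ∈ Ioo (t₀ - η) (t₀ + η) := ⟨by linarith, by linarith⟩
    have h2 : t₀ + η / 2 ∈ Ioo (t₀ - η) (t₀ + η) := ⟨by linarith, by linarith⟩
    have hsub : Icc (t₀ - η / 2) (t₀ + η / 2) ⊆ Ioo (t₀ - η) (t₀ + η) := fun t ht =>
      ⟨by linarith [ht.1], by linarith [ht.2]⟩
    have hc : ContinuousOn (fun t => (Φ (γ t)).re) (Icc (t₀ - η / 2) (t₀ + η / 2)) := fun t ht =>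
      (Complex.continuous_re.continuousAt.comp (hv t (hsub ht)).continuousAt).continuousWithinAt
    have h0 : (Φ (γ t₀)).re = 0 := by rw [hΦ.map_zero, Complex.zero_re]
    have hval : ∀ x : ℝ, x ∈ (fun t => (Φ (γ t)).re) '' Icc (t₀ - η / 2) (t₀ + η / 2) →
        Ψ x ∈ γ '' Ioc 0 T := by
      rintro x ⟨t, ht, rfl⟩
      refine ⟨t, Ioo_subset_Ioc_self (hball t (hsub ht)).2, ?_⟩
      rw [show (((Φ (γ t)).re : ℝ) : ℂ) = Φ (γ t) from
        Complex.ext (by simp) (by simp [him t (hsub ht)]), (hball t (hsub ht)).1.2.2]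
    rcases strictMonoOn_or_strictAntiOn_re_of_sq_pos hv hv2 with hm | hm
    · have h3 := hm h1 hmid (by linarith)
      have h4 := hm hmid h2 (by linarith)
      simp only [h0] at h3 h4
      filter_upwards [Icc_mem_nhds h3 h4] with x hx
      exact hval x (intermediate_value_Icc (by linarith) hc hx)
    · have h3 := hm h1 hmid (by linarith)
      have h4 := hm hmid h2 (by linarith)
      simp only [h0] at h3 h4
      filter_upwards [Icc_mem_nhds h4 h3] with x hx
      exact hval x (intermediate_value_Icc' (by linarith) hc hx)

/-- In a suitable trajectory coordinate at the tip, the slit is the half-line `[0, ∞)`. -/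
theorem IsSlit.exists_trajectoryCoordinate_tip {Q : ℂ → ℂ} {γ : ℝ → ℂ} {φ T ξ₀ : ℝ}
    (h : IsSlit γ T ξ₀) (harc : IsTrajectoryArc upperHalf Q φ γ 0 T)
    (hQ : AnalyticAt ℂ Q (γ T)) (hQ0 : Q (γ T) ≠ 0) :
    ∃ Φ Ψ : ℂ → ℂ, IsTrajectoryCoordinate Q φ (γ T) Φ Ψ ∧
      (∀ᶠ w in 𝓝 (γ T), w ∈ γ '' Ioc 0 T → (Φ w).im = 0 ∧ 0 ≤ (Φ w).re) ∧
      ∀ᶠ x : ℝ in 𝓝[≥] 0, Ψ x ∈ γ '' Ioc 0 T := by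
  have hTpos := h.pos
  have hTmem : T ∈ Icc 0 T := ⟨hTpos.le, le_rfl⟩
  -- a coordinate that decreases towards the tip will do
  have key : ∀ Φ Ψ : ℂ → ℂ, IsTrajectoryCoordinate Q φ (γ T) Φ Ψ → ∀ η : ℝ, 0 < η → η < T →
      (∀ t ∈ Ioo (T - η) T, AnalyticAt ℂ Φ (γ t) ∧ (Φ (γ t)).im = 0 ∧ Ψ (Φ (γ t)) = γ t) →
      StrictAntiOn (fun t => (Φ (γ t)).re) (Ioo (T - η) T) →
      (∀ᶠ w in 𝓝 (γ T), w ∈ γ '' Ioc 0 T → (Φ w).im = 0 ∧ 0 ≤ (Φ w).re) ∧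
        ∀ᶠ x : ℝ in 𝓝[≥] 0, Ψ x ∈ γ '' Ioc 0 T := by
    intro Φ Ψ hΦ η hη hηT hgood hanti
    have hlim : Tendsto (fun t => (Φ (γ t)).re) (𝓝[<] T) (𝓝 0) := by
      have h1 : Tendsto γ (𝓝[<] T) (𝓝 (γ T)) := by
        have h2 := h.continuousOn T hTmem
        refine h2.tendsto.mono_left ?_
        rw [← nhdsWithin_Ioo_eq_nhdsLT hTpos]
        exact nhdsWithin_mono _ Ioo_subset_Icc_self
      have := (Complex.continuous_re.tendsto _).comp (hΦ.tendsto.comp h1)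
      rwa [Complex.zero_re] at this
    have hpos : ∀ t ∈ Ioo (T - η) T, 0 < (Φ (γ t)).re := by
      intro t ht
      have hmid : (t + T) / 2 ∈ Ioo (T - η) T := ⟨by linarith [ht.1, ht.2], by linarith [ht.2]⟩
      have h1 := hanti ht hmid (by linarith [ht.2])
      have h2 : 0 ≤ (Φ (γ ((t + T) / 2))).re := by
        refine le_of_tendsto hlim ?_
        filter_upwards [Ioo_mem_nhdsLT hmid.2] with s hs
        exact (hanti hmid ⟨hmid.1.trans hs.1, hs.2⟩ hs.1).le
      exact h2.trans_lt h1
    constructor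
    · filter_upwards [h.eventually_mem_imp hTmem hη] with w hw hmem
      obtain ⟨t, ht, rfl⟩ := hmem
      have h1 := abs_lt.1 (hw t (Ioc_subset_Icc_self ht) rfl)
      rcases ht.2.eq_or_lt with rfl | hlt
      · simp [hΦ.map_zero]
      · have ht' : t ∈ Ioo (T - η) T := ⟨by linarith, hlt⟩
        exact ⟨(hgood t ht').2.1, (hpos t ht').le⟩
    · have ht1 : T - η / 2 ∈ Ioo (T - η) T := ⟨by linarith, by linarith⟩
      have hsub : ∀ t ∈ Icc (T - η / 2) T, t ≠ T → t ∈ Ioo (T - η) T := fun t ht hne =>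
        ⟨by linarith [ht.1], lt_of_le_of_ne ht.2 hne⟩
      have hc : ContinuousOn (fun t => (Φ (γ t)).re) (Icc (T - η / 2) T) := by
        intro t ht
        have hcγ : ContinuousWithinAt γ (Icc (T - η / 2) T) t :=
          (h.continuousOn t ⟨by linarith [ht.1], ht.2⟩).mono fun s hs =>
            ⟨by linarith [hs.1], hs.2⟩
        have hcΦ : ContinuousAt Φ (γ t) := by
          by_cases hne : t = T
          · rw [hne]
            exact hΦ.analytic.continuousAt
          · exact (hgood t (hsub t ht hne)).1.continuousAt
        exact Complex.continuous_re.continuousAt.comp_continuousWithinAt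
          (hcΦ.comp_continuousWithinAt hcγ)
      have h0 : (Φ (γ T)).re = 0 := by rw [hΦ.map_zero, Complex.zero_re]
      filter_upwards [Icc_mem_nhdsGE (hpos _ ht1)] with x hx
      rw [← h0] at hx
      obtain ⟨t, ht, rfl⟩ := intermediate_value_Icc' (by linarith) hc hx
      refine ⟨t, ⟨by linarith [ht.1], ht.2⟩, ?_⟩
      show γ t = Ψ (((Φ (γ t)).re : ℝ) : ℂ)
      by_cases hne : t = T
      · rw [hne, h0, Complex.ofReal_zero, hΦ.inv_zero]
      · obtain ⟨-, h2, h3⟩ := hgood t (hsub t ht hne)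
        rw [show (((Φ (γ t)).re : ℝ) : ℂ) = Φ (γ t) from
          Complex.ext (by simp) (by simp [h2]), h3]
  obtain ⟨Φ, Ψ, hΦ⟩ := exists_isTrajectoryCoordinate hQ hQ0 φ
  have hcont := h.continuousOn T hTmem
  have hev := hcont.eventually (hΦ.analytic.eventually_analyticAt.and (hΦ.eq.and hΦ.left_inv))
  obtain ⟨η₀, hη₀, hball⟩ := Metric.mem_nhdsWithin_iff.1 hev
  set η := min η₀ (T / 2) with hηdef
  have hη : 0 < η := lt_min hη₀ (by linarith)
  have hηT : η < T := (min_le_right _ _).trans_lt (by linarith)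
  have hgood : ∀ t ∈ Ioo (T - η) T, t ∈ Ioo 0 T ∧ AnalyticAt ℂ Φ (γ t) ∧
      Q (γ t) = Complex.exp (2 * φ * Complex.I) * deriv Φ (γ t) ^ 2 ∧ Ψ (Φ (γ t)) = γ t := by
    intro t ht
    have h1 : t ∈ Ioo 0 T := ⟨by linarith [ht.1], ht.2⟩
    refine ⟨h1, hball ⟨?_, Ioo_subset_Icc_self h1⟩⟩
    rw [Real.ball_eq_Ioo]
    constructor <;> linarith [ht.1, ht.2, min_le_left η₀ (T / 2)]
  choose! v hv hv2 using fun t (ht : t ∈ Ioo (T - η) T) =>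
    harc.hasDerivAt_comp (hgood t ht).1 (hgood t ht).2.1 (hgood t ht).2.2.1
  have him : ∀ t ∈ Ioo (T - η) T, (Φ (γ t)).im = 0 := by
    intro t ht
    have h1 : Tendsto (fun s => (Φ (γ s)).im) (𝓝[<] T) (𝓝 0) := by
      have h1 : Tendsto γ (𝓝[<] T) (𝓝 (γ T)) := by
        refine hcont.tendsto.mono_left ?_
        rw [← nhdsWithin_Ioo_eq_nhdsLT hTpos]
        exact nhdsWithin_mono _ Ioo_subset_Icc_self
      have := (Complex.continuous_im.tendsto _).comp (hΦ.tendsto.comp h1)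
      rwa [Complex.zero_im] at this
    refine tendsto_nhds_unique (tendsto_const_nhds.congr' ?_) h1
    filter_upwards [Ioo_mem_nhdsLT (show T - η < T by linarith)] with s hs using
      im_eq_of_sq_pos hv hv2 ht hs
  rcases strictMonoOn_or_strictAntiOn_re_of_sq_pos hv hv2 with hm | hm
  · refine ⟨_, _, hΦ.neg, key _ _ hΦ.neg η hη hηT (fun t ht => ?_) ?_⟩
    · refine ⟨(hgood t ht).2.1.neg, ?_, ?_⟩
      · rw [Complex.neg_im, him t ht, neg_zero]
      · rw [neg_neg]
        exact (hgood t ht).2.2.2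
    · simpa only [Complex.neg_re] using hm.neg
  · exact ⟨Φ, Ψ, hΦ, key Φ Ψ hΦ η hη hηT
      (fun t ht => ⟨(hgood t ht).2.1, him t ht, (hgood t ht).2.2.2⟩) hm⟩

/-! ### Charts of a slit half-plane -/

namespace IsBoundaryChart

variable {f ψ χ : ℂ → ℂ} {x₀ : ℝ}

theorem tendsto_map {w : ℂ} (h : IsBoundaryChart f ψ χ x₀) (hψ : Tendsto ψ (𝓝[upperHalf] 0) (𝓝 w)) :
    Tendsto f (𝓝[upperHalf] (x₀ : ℂ)) (𝓝 w) :=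
  (hψ.comp h.tendsto).congr' (h.eq.mono fun _ hz => hz.symm)

theorem exists_analyticAt (h : IsBoundaryChart f ψ χ x₀) (hψ : AnalyticAt ℂ ψ 0) :
    ∃ F : ℂ → ℂ, AnalyticAt ℂ F x₀ ∧ f =ᶠ[𝓝[upperHalf] (x₀ : ℂ)] F := by
  rw [← h.map_zero] at hψ
  exact ⟨_, hψ.fun_comp h.analytic.analytic, h.eq⟩

/-- The exponent of a quadratic differential can be computed in a boundary chart. -/
theorem hasBoundaryExponent {Q q : ℂ → ℂ} {m : ℝ} (h : IsBoundaryChart f ψ χ x₀)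
    (hψ : ∀ᶠ u in 𝓝[upperHalf] (0 : ℂ), DifferentiableAt ℂ ψ u ∧ Q (ψ u) * deriv ψ u ^ 2 = q u)
    (hq : HasBoundaryExponent q 0 m) :
    HasBoundaryExponent (fun z => Q (f z) * deriv f z ^ 2) x₀ m := by
  have h1 := hq.comp_coordinate h.analytic (by rw [h.map_zero]; simp) h.deriv_pos
  have hd0 : deriv χ x₀ ≠ 0 := fun h0 => by simpa [h0] using h.deriv_pos
  have h2 := h1.mul (HasBoundaryExponent.of_isRealAnalyticAt (h.analytic.deriv.pow 2)
    (pow_ne_zero 2 hd0))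
  rw [add_zero] at h2
  refine h2.congr ?_
  filter_upwards [self_mem_nhdsWithin, h.tendsto.eventually hψ,
    mem_nhdsWithin_of_mem_nhds h.analytic.analytic.eventually_analyticAt,
    eventually_eventually_nhdsWithin.2 h.eq] with z hz hzψ hzχ hzf
  rw [isOpen_upperHalf.nhdsWithin_eq hz] at hzf
  have hder : deriv f z = deriv ψ (χ z) * deriv χ z := by
    rw [EventuallyEq.deriv_eq (f := fun z => ψ (χ z)) hzf]
    exact (hzψ.1.hasDerivAt.comp z hzχ.differentiableAt.hasDerivAt).deriv
  rw [hder, hzf.self_of_nhds, ← hzψ.2]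
  ring

/-- Points of the image domain with a coordinate in the half-plane have preimages near the
boundary point. -/
theorem tendsto_invFunOn {κ : ℂ → ℂ} {L : Filter ℂ} (h : IsBoundaryChart f ψ χ x₀)
    (hκ : Tendsto κ L (𝓝[upperHalf] 0)) (heq : ∀ᶠ w in L, ψ (κ w) = w) :
    Tendsto (Function.invFunOn f upperHalf) L (𝓝 (x₀ : ℂ)) :=
  (h.tendsto_inv.comp hκ).congr' (heq.mono fun w hw => by simp only [Function.comp_apply, hw])

end IsBoundaryChart

theorem Filter.Tendsto.sup_of_principal {α β : Type*} {g : α → β} {L : Filter α} {A : Set α}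
    {F G : Filter β} (h₁ : Tendsto g (L ⊓ 𝓟 A) F) (h₂ : Tendsto g (L ⊓ 𝓟 Aᶜ) G) :
    Tendsto g L (F ⊔ G) := by
  have : L = (L ⊓ 𝓟 A) ⊔ (L ⊓ 𝓟 Aᶜ) := by
    rw [← inf_sup_left, sup_principal, union_compl_self, principal_univ, inf_top_eq]
  rw [this]
  exact h₁.sup_sup h₂

/-- A conformal map `f` of the upper half-plane onto the half-plane without the slit `γ(0, T]`,
with `f(∞) = ∞`. -/
structure IsSlitMap (f : ℂ → ℂ) (γ : ℝ → ℂ) (T ξ₀ : ℝ) : Prop where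
  slit : IsSlit γ T ξ₀
  differentiableOn : DifferentiableOn ℂ f upperHalf
  injOn : InjOn f upperHalf
  image_eq : f '' upperHalf = upperHalf \ γ '' Ioc 0 T
  tendsto_cobounded : Tendsto f (Bornology.cobounded ℂ ⊓ 𝓟 upperHalf) (Bornology.cobounded ℂ)

namespace IsSlitMap

variable {f : ℂ → ℂ} {γ : ℝ → ℂ} {T ξ₀ : ℝ}

theorem notMem_image_of_im_eq_zero (h : IsSlitMap f γ T ξ₀) {w : ℂ} (hw : w.im = 0) :
    w ∉ f '' upperHalf := by
  rw [h.image_eq]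
  rintro ⟨h1, -⟩
  exact (ne_of_gt h1) hw

theorem notMem_image_of_mem_slit (h : IsSlitMap f γ T ξ₀) {w : ℂ} (hw : w ∈ γ '' Ioc 0 T) :
    w ∉ f '' upperHalf := by
  rw [h.image_eq]
  exact fun h1 => h1.2 hw

/-- The chart at a real point off the slit is a translation. -/
theorem exists_isBoundaryChart_real (h : IsSlitMap f γ T ξ₀) {y : ℝ} (hy : y ≠ ξ₀) :
    ∃ (x₀ : ℝ) (χ : ℂ → ℂ), IsBoundaryChart f (fun u => y + u) χ x₀ ∧
      Tendsto (Function.invFunOn f upperHalf) (𝓝[f '' upperHalf] (y : ℂ)) (𝓝 (x₀ : ℂ)) := by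
  have hslit : (y : ℂ) ∉ γ '' Icc 0 T := by
    rintro ⟨t, ht, heq⟩
    rcases ht.1.eq_or_lt with rfl | hlt
    · rw [h.slit.map_zero] at heq
      exact hy (Complex.ofReal_injective heq).symm
    · have := h.slit.im_pos t ⟨hlt, ht.2⟩
      rw [heq, Complex.ofReal_im] at this
      exact this.false
  have hadd : ∀ x : ℂ, Tendsto (fun u : ℂ => (y : ℂ) + u) (𝓝 x) (𝓝 (y + x)) := fun x =>
    (continuous_const.add continuous_id).tendsto x
  have hadd0 := hadd 0
  rw [add_zero] at hadd0
  obtain ⟨x₀, χ, hχ⟩ := exists_isBoundaryChart (ψ := fun u => (y : ℂ) + u) h.differentiableOn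
    h.injOn h.tendsto_cobounded (by
      filter_upwards [self_mem_nhdsWithin, mem_nhdsWithin_of_mem_nhds
        (hadd0.eventually (h.slit.eventually_notMem hslit))] with u hu hus
      have hu : 0 < u.im := hu
      refine ⟨by fun_prop, ?_⟩
      rw [h.image_eq]
      exact ⟨by simpa using hu, hus⟩)
    (Eventually.of_forall fun x => ⟨y + x, h.notMem_image_of_im_eq_zero (by simp),
      (hadd x).mono_left nhdsWithin_le_nhds⟩)
  refine ⟨x₀, χ, hχ, hχ.tendsto_invFunOn (κ := fun w => w - y) ?_
    (Eventually.of_forall fun w => by ring)⟩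
  apply tendsto_nhdsWithin_of_tendsto_nhds_of_eventually_within
  · have : Tendsto (fun w : ℂ => w - y) (𝓝 (y : ℂ)) (𝓝 (y - y)) :=
      (continuous_id.sub continuous_const).tendsto _
    rw [sub_self] at this
    exact this.mono_left nhdsWithin_le_nhds
  · filter_upwards [self_mem_nhdsWithin] with w hw
    rw [h.image_eq] at hw
    have : 0 < w.im := hw.1
    simpa using this

/-- At an inner point of the slit. -/
theorem exists_isBoundaryChart_inner {Q : ℂ → ℂ} {φ t₀ : ℝ} (h : IsSlitMap f γ T ξ₀)
    (harc : IsTrajectoryArc upperHalf Q φ γ 0 T) (ht₀ : t₀ ∈ Ioo 0 T)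
    (hQ : AnalyticAt ℂ Q (γ t₀)) (hQ0 : Q (γ t₀) ≠ 0) :
    ∃ (x₁ x₂ : ℝ) (χ₁ χ₂ Φ Ψ : ℂ → ℂ), IsTrajectoryCoordinate Q φ (γ t₀) Φ Ψ ∧
      IsBoundaryChart f Ψ χ₁ x₁ ∧ IsBoundaryChart f (fun u => Ψ (-u)) χ₂ x₂ ∧
      Tendsto (Function.invFunOn f upperHalf) (𝓝[f '' upperHalf] (γ t₀))
        (𝓝 (x₁ : ℂ) ⊔ 𝓝 (x₂ : ℂ)) := by
  have key : ∀ Φ Ψ : ℂ → ℂ, IsTrajectoryCoordinate Q φ (γ t₀) Φ Ψ → ∃ (x : ℝ) (χ : ℂ → ℂ),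
      IsBoundaryChart f Ψ χ x := by
    intro Φ Ψ hΦ
    obtain ⟨h1, h2⟩ := h.slit.real_of_trajectoryCoordinate harc ht₀ hΦ
    refine exists_isBoundaryChart h.differentiableOn h.injOn h.tendsto_cobounded ?_ ?_
    · filter_upwards [self_mem_nhdsWithin, mem_nhdsWithin_of_mem_nhds
        (hΦ.analytic_inv.eventually_analyticAt.and (hΦ.right_inv.and (hΦ.tendsto_inv.eventually
          (h1.and (isOpen_upperHalf.mem_nhds (h.slit.im_pos t₀ (Ioo_subset_Ioc_self ht₀)))))))]
        with u hu h3
      obtain ⟨h3, h4, h5, h6⟩ := h3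
      have hu : 0 < u.im := hu
      refine ⟨h3.differentiableAt, ?_⟩
      rw [h.image_eq]
      refine ⟨h6, fun h7 => hu.ne' ?_⟩
      rw [← h4]
      exact h5 h7
    · filter_upwards [h2, (tendsto_ofReal_nhds 0).eventually (by
        rw [Complex.ofReal_zero]; exact hΦ.analytic_inv.eventually_analyticAt)] with x h3 h4
      exact ⟨Ψ x, h.notMem_image_of_mem_slit h3, h4.continuousAt.tendsto.mono_left
        nhdsWithin_le_nhds⟩
  obtain ⟨Φ, Ψ, hΦ⟩ := exists_isTrajectoryCoordinate hQ hQ0 φ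
  obtain ⟨x₁, χ₁, hχ₁⟩ := key Φ Ψ hΦ
  obtain ⟨x₂, χ₂, hχ₂⟩ := key _ _ hΦ.neg
  obtain ⟨-, h2⟩ := h.slit.real_of_trajectoryCoordinate harc ht₀ hΦ
  refine ⟨x₁, x₂, χ₁, χ₂, Φ, Ψ, hΦ, hχ₁, hχ₂, ?_⟩
  have hle : 𝓝[f '' upperHalf] (γ t₀) ≤ 𝓝 (γ t₀) := nhdsWithin_le_nhds
  have hne : ∀ᶠ w in 𝓝[f '' upperHalf] (γ t₀), (Φ w).im ≠ 0 := by
    have hre : Tendsto (fun w => (Φ w).re) (𝓝 (γ t₀)) (𝓝 0) := by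
      have := (Complex.continuous_re.tendsto _).comp hΦ.tendsto
      rwa [Complex.zero_re] at this
    filter_upwards [self_mem_nhdsWithin, hle (hre.eventually h2), hle hΦ.left_inv]
      with w hw h3 h4 h5
    rw [show (((Φ w).re : ℝ) : ℂ) = Φ w from Complex.ext (by simp) (by simp [h5]), h4] at h3
    exact h.notMem_image_of_mem_slit h3 hw
  refine Tendsto.sup_of_principal (A := {w | 0 < (Φ w).im})
    (hχ₁.tendsto_invFunOn (κ := Φ) ?_ (hΦ.left_inv.filter_mono (inf_le_left.trans hle)))
    (hχ₂.tendsto_invFunOn (κ := fun w => -Φ w) ?_ ?_)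
  · exact tendsto_nhdsWithin_of_tendsto_nhds_of_eventually_within _
      (hΦ.tendsto.mono_left (inf_le_left.trans hle)) (mem_inf_of_right (mem_principal_self _))
  · have hneg := hΦ.tendsto.neg
    rw [neg_zero] at hneg
    refine tendsto_nhdsWithin_of_tendsto_nhds_of_eventually_within _
      (hneg.mono_left (inf_le_left.trans hle)) ?_
    rw [eventually_inf_principal]
    filter_upwards [hne] with w h3 h4
    simpa using lt_of_le_of_ne (not_lt.1 (show ¬ 0 < (Φ w).im from h4)) h3
  · filter_upwards [hΦ.left_inv.filter_mono (inf_le_left.trans hle)] with w hw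
    rwa [neg_neg]

/-- At the tip of the slit, whose coordinate is a square. -/
theorem exists_isBoundaryChart_tip {Q : ℂ → ℂ} {φ : ℝ} (h : IsSlitMap f γ T ξ₀)
    (harc : IsTrajectoryArc upperHalf Q φ γ 0 T) (hQ : AnalyticAt ℂ Q (γ T)) (hQ0 : Q (γ T) ≠ 0) :
    ∃ (x₀ : ℝ) (χ Φ Ψ : ℂ → ℂ), IsTrajectoryCoordinate Q φ (γ T) Φ Ψ ∧
      IsBoundaryChart f (fun u => Ψ (u ^ 2)) χ x₀ ∧
      Tendsto (Function.invFunOn f upperHalf) (𝓝[f '' upperHalf] (γ T)) (𝓝 (x₀ : ℂ)) := by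
  obtain ⟨Φ, Ψ, hΦ, h1, h2⟩ := h.slit.exists_trajectoryCoordinate_tip harc hQ hQ0
  have hsq : Tendsto (fun u : ℂ => u ^ 2) (𝓝 0) (𝓝 0) := by
    simpa using (continuous_pow 2).tendsto (0 : ℂ)
  obtain ⟨δ, hδ, h2⟩ := Metric.mem_nhdsWithin_iff.1 h2
  have hT := h.slit.im_pos T ⟨h.slit.pos, le_rfl⟩
  obtain ⟨x₀, χ, hχ⟩ : ∃ (x₀ : ℝ) (χ : ℂ → ℂ), IsBoundaryChart f (fun u => Ψ (u ^ 2)) χ x₀ := by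
    refine exists_isBoundaryChart h.differentiableOn h.injOn h.tendsto_cobounded ?_ ?_
    · filter_upwards [self_mem_nhdsWithin, mem_nhdsWithin_of_mem_nhds (hsq.eventually
        (hΦ.analytic_inv.eventually_analyticAt.and (hΦ.right_inv.and (hΦ.tendsto_inv.eventually
          (h1.and (isOpen_upperHalf.mem_nhds hT))))))] with u hu h3
      obtain ⟨h3, h4, h5, h6⟩ := h3
      have hu : 0 < u.im := hu
      refine ⟨h3.differentiableAt.comp u (differentiableAt_pow 2), ?_⟩
      rw [h.image_eq]
      refine ⟨h6, fun h7 => ?_⟩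
      have h8 := h5 h7
      rw [h4, sq, Complex.mul_im, Complex.mul_re] at h8
      have h9 : u.re = 0 := by
        have : u.re * u.im = 0 := by linarith [h8.1]
        exact (mul_eq_zero.1 this).resolve_right hu.ne'
      rw [h9] at h8
      nlinarith [h8.2]
    · have hsqr : Tendsto (fun x : ℝ => x ^ 2) (𝓝 0) (𝓝 0) := by
        simpa using (continuous_pow 2).tendsto (0 : ℝ)
      filter_upwards [hsqr.eventually (Metric.ball_mem_nhds 0 hδ),
        (tendsto_ofReal_nhds 0).eventually (by
          rw [Complex.ofReal_zero]
          exact hsq.eventually hΦ.analytic_inv.eventually_analyticAt)] with x h3 h4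
      refine ⟨Ψ ((x : ℂ) ^ 2), ?_, ?_⟩
      · apply h.notMem_image_of_mem_slit
        have h5 := h2 ⟨h3, sq_nonneg x⟩
        simpa using h5
      · exact (h4.continuousAt.comp (f := fun u : ℂ => u ^ 2)
          (continuous_pow 2).continuousAt).tendsto.mono_left nhdsWithin_le_nhds
  have hle : 𝓝[f '' upperHalf] (γ T) ≤ 𝓝 (γ T) := nhdsWithin_le_nhds
  have hne : ∀ᶠ w in 𝓝[f '' upperHalf] (γ T), -Φ w ∈ Complex.slitPlane := by
    have hre : Tendsto (fun w => (Φ w).re) (𝓝 (γ T)) (𝓝 0) := by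
      have := (Complex.continuous_re.tendsto _).comp hΦ.tendsto
      rwa [Complex.zero_re] at this
    filter_upwards [self_mem_nhdsWithin, hle (hre.eventually (Metric.ball_mem_nhds 0 hδ)),
      hle hΦ.left_inv] with w hw h3 h4
    by_contra h5
    rw [Complex.mem_slitPlane_iff] at h5
    push Not at h5
    simp only [Complex.neg_re, Complex.neg_im, neg_eq_zero] at h5
    have h6 := h2 ⟨h3, show 0 ≤ (Φ w).re by linarith [h5.1]⟩
    simp only [mem_ofPred_eq] at h6
    rw [show (((Φ w).re : ℝ) : ℂ) = Φ w from Complex.ext (by simp) (by simp [h5.2]), h4] at h6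
    exact h.notMem_image_of_mem_slit h6 hw
  have hroot : ∀ v : ℂ, (v ^ (1 / 2 : ℂ)) ^ 2 = v := fun v => by
    rw [← Complex.cpow_nat_mul]
    norm_num
  refine ⟨x₀, χ, Φ, Ψ, hΦ, hχ, hχ.tendsto_invFunOn
    (κ := fun w => Complex.I * (-Φ w) ^ (1 / 2 : ℂ)) ?_ ?_⟩
  · apply tendsto_nhdsWithin_of_tendsto_nhds_of_eventually_within
    · have h3 : Tendsto (fun w => Real.sqrt ‖Φ w‖) (𝓝 (γ T)) (𝓝 0) := by
        have := (Real.continuous_sqrt.tendsto _).comp hΦ.tendsto.norm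
        simpa [Function.comp_def] using this
      rw [tendsto_zero_iff_norm_tendsto_zero]
      refine (h3.mono_left hle).congr fun w => ?_
      rw [norm_mul, Complex.norm_I, one_mul, Real.sqrt_eq_iff_eq_sq (norm_nonneg _)
        (norm_nonneg _), ← norm_pow, hroot, norm_neg]
    · filter_upwards [hne] with w hw
      show 0 < (Complex.I * (-Φ w) ^ (1 / 2 : ℂ)).im
      rw [Complex.I_mul_im, Complex.cpow_def_of_ne_zero (Complex.slitPlane_ne_zero hw),
        Complex.exp_re]
      apply mul_pos (Real.exp_pos _)
      have him : (Complex.log (-Φ w) * (1 / 2)).im = (-Φ w).arg / 2 := by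
        rw [show (1 / 2 : ℂ) = ((1 / 2 : ℝ) : ℂ) by norm_num, Complex.im_mul_ofReal, Complex.log_im]
        ring
      rw [him]
      have h4 := Complex.neg_pi_lt_arg (-Φ w)
      have h5 : (-Φ w).arg < Real.pi := lt_of_le_of_ne (Complex.arg_le_pi _)
        (Complex.slitPlane_arg_ne_pi hw)
      exact Real.cos_pos_of_mem_Ioo ⟨by linarith, by linarith⟩
  · filter_upwards [hle hΦ.left_inv] with w hw
    rw [mul_pow, hroot, Complex.I_sq, neg_one_mul, neg_neg, hw]

end IsSlitMap

/-! ### Sectors -/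

/-- The map of the upper half-plane onto the sector with bisector `arg w = κ` and opening `bπ`. -/
noncomputable def sectorMap (κ b : ℝ) (u : ℂ) : ℂ :=
  Complex.exp (κ * Complex.I) * (-Complex.I * u) ^ (b : ℂ)

theorem cpow_ofReal_eq (v : ℂ) (b : ℝ) :
    v ^ (b : ℂ) = (‖v‖ ^ b : ℝ) * Complex.exp ((v.arg * b : ℝ) * Complex.I) := by
  rw [Complex.cpow_ofReal, Complex.exp_mul_I, Complex.ofReal_cos, Complex.ofReal_sin]

theorem arg_ofReal_mul_exp {s θ : ℝ} (hs : 0 < s) (hθ : θ ∈ Ioc (-Real.pi) Real.pi) :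
    ((s : ℂ) * Complex.exp (θ * Complex.I)).arg = θ := by
  rw [Complex.exp_mul_I]
  exact Complex.arg_mul_cos_add_sin_mul_I hs hθ

theorem im_ofReal_mul_exp (s θ : ℝ) :
    ((s : ℂ) * Complex.exp (θ * Complex.I)).im = s * Real.sin θ := by
  rw [Complex.im_ofReal_mul, Complex.exp_ofReal_mul_I_im]

theorem exp_pi_div_two_ofReal_mul_I : Complex.exp ((Real.pi / 2 : ℝ) * Complex.I) = Complex.I := by
  push_cast
  exact Complex.exp_pi_div_two_mul_I

namespace sectorMap

variable {κ b : ℝ}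

theorem eq_of_upperHalf (hb : 0 < b) {u : ℂ} (hu : u ∈ upperHalf) :
    ∃ s : ℝ, 0 < s ∧ ∃ θ ∈ Ioo (κ - b * (Real.pi / 2)) (κ + b * (Real.pi / 2)),
      sectorMap κ b u = s * Complex.exp (θ * Complex.I) := by
  have hre : 0 < (-Complex.I * u).re := by rw [re_neg_I_mul]; exact hu
  have hne : -Complex.I * u ≠ 0 := fun h => by rw [h] at hre; simp at hre
  have harg := abs_lt.1 (Complex.abs_arg_lt_pi_div_two_iff.2 (Or.inl hre))
  refine ⟨‖-Complex.I * u‖ ^ b, Real.rpow_pos_of_pos (norm_pos_iff.2 hne) b,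
    κ + (-Complex.I * u).arg * b, ⟨by nlinarith [harg.1], by nlinarith [harg.2]⟩, ?_⟩
  rw [sectorMap, cpow_ofReal_eq, mul_left_comm, ← Complex.exp_add]
  push_cast
  ring_nf

theorem apply_zero (hb : 0 < b) : sectorMap κ b 0 = 0 := by
  rw [sectorMap, mul_zero, Complex.zero_cpow (by exact_mod_cast hb.ne'), mul_zero]

theorem apply_pos {x : ℝ} (hx : 0 < x) : sectorMap κ b x =
    (x ^ b : ℝ) * Complex.exp ((κ - b * (Real.pi / 2) : ℝ) * Complex.I) := by
  have h1 : -Complex.I * x = (x : ℂ) * Complex.exp ((-(Real.pi / 2) : ℝ) * Complex.I) := by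
    rw [Complex.ofReal_neg (Real.pi / 2), neg_mul ((Real.pi / 2 : ℝ) : ℂ), Complex.exp_neg,
      exp_pi_div_two_ofReal_mul_I, Complex.inv_I]
    ring
  have h2 := arg_ofReal_mul_exp hx (θ := -(Real.pi / 2))
    ⟨by linarith [Real.pi_pos], by linarith [Real.pi_pos]⟩
  rw [sectorMap, cpow_ofReal_eq, h1, h2, mul_left_comm, ← Complex.exp_add, norm_mul,
    Complex.norm_exp_ofReal_mul_I, mul_one, Complex.norm_real, Real.norm_of_nonneg hx.le]
  push_cast
  ring_nf

theorem apply_neg {x : ℝ} (hx : x < 0) : sectorMap κ b x =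
    ((-x) ^ b : ℝ) * Complex.exp ((κ + b * (Real.pi / 2) : ℝ) * Complex.I) := by
  have h1 : -Complex.I * x = ((-x : ℝ) : ℂ) * Complex.exp ((Real.pi / 2 : ℝ) * Complex.I) := by
    rw [exp_pi_div_two_ofReal_mul_I, Complex.ofReal_neg]
    ring
  have h2 := arg_ofReal_mul_exp (neg_pos.2 hx) (θ := Real.pi / 2)
    ⟨by linarith [Real.pi_pos], by linarith [Real.pi_pos]⟩
  rw [sectorMap, cpow_ofReal_eq, h1, h2, mul_left_comm, ← Complex.exp_add, norm_mul,
    Complex.norm_exp_ofReal_mul_I, mul_one, Complex.norm_real,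
    Real.norm_of_nonneg (neg_pos.2 hx).le]
  push_cast
  ring_nf

theorem continuousAt_ofReal (hb : 0 < b) (x : ℝ) : ContinuousAt (sectorMap κ b) x := by
  have h1 : ContinuousAt (fun v : ℂ => v ^ (b : ℂ)) (-Complex.I * x) :=
    Complex.continuousAt_cpow_const_of_re_pos (by simp) (by simpa using hb)
  exact continuousAt_const.mul (h1.comp (f := fun u : ℂ => -Complex.I * u)
    (continuousAt_const.mul continuousAt_id))

theorem tendsto_zero (hb : 0 < b) : Tendsto (sectorMap κ b) (𝓝 0) (𝓝 0) := by
  have := (continuousAt_ofReal (κ := κ) hb 0).tendsto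
  rwa [Complex.ofReal_zero, apply_zero hb] at this

theorem hasDerivAt {u : ℂ} (hu : u ∈ upperHalf) : HasDerivAt (sectorMap κ b)
    (Complex.exp (κ * Complex.I) * (b * (-Complex.I * u) ^ (((b - 1 : ℝ)) : ℂ) * -Complex.I)) u := by
  have hre : 0 < (-Complex.I * u).re := by rw [re_neg_I_mul]; exact hu
  have h1 : HasDerivAt (fun u : ℂ => -Complex.I * u) (-Complex.I) u := by
    simpa using (hasDerivAt_id u).const_mul (-Complex.I)
  have h2 := (h1.cpow_const (c := (b : ℂ)) (Or.inl hre)).const_mul (Complex.exp (κ * Complex.I))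
  rw [Complex.ofReal_sub, Complex.ofReal_one]
  exact h2

/-- On the sector, the sector map is inverted by a power; the condition `b ≤ 1` keeps the argument
principal. -/
theorem inverse (hb : 0 < b) (hb1 : b ≤ 1) {s θ : ℝ} (hs : 0 < s)
    (hθ : θ ∈ Ioo (κ - b * (Real.pi / 2)) (κ + b * (Real.pi / 2))) {v : ℂ}
    (hv : v = s * Complex.exp (θ * Complex.I)) :
    Complex.I * (Complex.exp (-(κ * Complex.I)) * v) ^ ((b⁻¹ : ℝ) : ℂ) ∈ upperHalf ∧
      sectorMap κ b (Complex.I * (Complex.exp (-(κ * Complex.I)) * v) ^ ((b⁻¹ : ℝ) : ℂ)) = v := by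
  have hpi := Real.pi_pos
  have h1 : Complex.exp (-(κ * Complex.I)) * v = s * Complex.exp ((θ - κ : ℝ) * Complex.I) := by
    rw [hv, mul_left_comm, ← Complex.exp_add]
    push_cast
    ring_nf
  have hη : θ - κ ∈ Ioo (-(b * (Real.pi / 2))) (b * (Real.pi / 2)) :=
    ⟨by linarith [hθ.1], by linarith [hθ.2]⟩
  have harg : (Complex.exp (-(κ * Complex.I)) * v).arg = θ - κ := by
    rw [h1]
    exact arg_ofReal_mul_exp hs ⟨by nlinarith [hη.1], by nlinarith [hη.2]⟩
  have hdiv : (θ - κ) * b⁻¹ ∈ Ioo (-(Real.pi / 2)) (Real.pi / 2) := by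
    rw [← div_eq_mul_inv]
    constructor
    · rw [lt_div_iff₀ hb]
      linarith [hη.1]
    · rw [div_lt_iff₀ hb]
      linarith [hη.2]
  have hne : Complex.exp (-(κ * Complex.I)) * v ≠ 0 := by
    rw [h1]
    exact mul_ne_zero (by exact_mod_cast hs.ne') (Complex.exp_ne_zero _)
  constructor
  · show 0 < (Complex.I * (Complex.exp (-(κ * Complex.I)) * v) ^ ((b⁻¹ : ℝ) : ℂ)).im
    rw [Complex.I_mul_im, cpow_ofReal_eq, harg, Complex.re_ofReal_mul,
      Complex.exp_ofReal_mul_I_re]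
    exact mul_pos (Real.rpow_pos_of_pos (norm_pos_iff.2 hne) _) (Real.cos_pos_of_mem_Ioo hdiv)
  · have him : (Complex.log (Complex.exp (-(κ * Complex.I)) * v) * ((b⁻¹ : ℝ) : ℂ)).im =
        (θ - κ) * b⁻¹ := by
      rw [Complex.im_mul_ofReal, Complex.log_im, harg]
    rw [sectorMap, ← mul_assoc, neg_mul, Complex.I_mul_I, neg_neg, one_mul, ← Complex.cpow_mul,
      ← Complex.ofReal_mul, inv_mul_cancel₀ hb.ne', Complex.ofReal_one, Complex.cpow_one,
      ← mul_assoc, ← Complex.exp_add, add_neg_cancel, Complex.exp_zero, one_mul]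
    · rw [him]; linarith [hdiv.1]
    · rw [him]; linarith [hdiv.2]

theorem tendsto_inverse (hb : 0 < b) (κ : ℝ) :
    Tendsto (fun v => Complex.I * (Complex.exp (-(κ * Complex.I)) * v) ^ ((b⁻¹ : ℝ) : ℂ))
      (𝓝 0) (𝓝 0) := by
  have h1 : ContinuousAt (fun v : ℂ => v ^ ((b⁻¹ : ℝ) : ℂ)) (Complex.exp (-(κ * Complex.I)) * 0) :=
    Complex.continuousAt_cpow_const_of_re_pos (by simp) (by simpa using hb)
  have h2 := (h1.comp (f := fun v : ℂ => Complex.exp (-(κ * Complex.I)) * v)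
    (continuousAt_const.mul continuousAt_id)).tendsto.const_mul Complex.I
  simpa [Function.comp_def, Complex.zero_cpow, hb.ne'] using h2

/-- The sector map multiplies the order `N + 2` by `b`. -/
theorem hasBoundaryExponent {q Ψ : ℂ → ℂ} {C : ℂ} {N : ℕ} (hC : C ≠ 0) (hb : 0 < b)
    (hmaps : ∀ u ∈ upperHalf, sectorMap κ b u ∈ upperHalf)
    (hΨ : ∀ᶠ v in 𝓝[upperHalf] (0 : ℂ), DifferentiableAt ℂ Ψ v ∧
      q (Ψ v) * deriv Ψ v ^ 2 = C * (-Complex.I * v) ^ N) :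
    ∃ p : ℂ → ℂ, HasBoundaryExponent p 0 (b * (N + 2) - 2) ∧
      ∀ᶠ u in 𝓝[upperHalf] (0 : ℂ), DifferentiableAt ℂ (fun u => Ψ (sectorMap κ b u)) u ∧
        q (Ψ (sectorMap κ b u)) * deriv (fun u => Ψ (sectorMap κ b u)) u ^ 2 = p u := by
  set C' : ℂ := C * (-Complex.I * Complex.exp (κ * Complex.I)) ^ N *
    (Complex.exp (κ * Complex.I) * b * -Complex.I) ^ 2 with hC'
  have hC0 : C' ≠ 0 := by
    have hb' : (b : ℂ) ≠ 0 := by exact_mod_cast hb.ne'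
    simp [hC', hC, hb', Complex.exp_ne_zero]
  have h1 := HasBoundaryExponent.cpow_coordinate (IsRealAnalyticAt.id (x := 0)) (by simp)
    (by simp) (b * (N + 2) - 2)
  have h2 := (HasBoundaryExponent.const hC0).mul h1
  rw [zero_add] at h2
  refine ⟨_, h2, ?_⟩
  have hlim : Tendsto (sectorMap κ b) (𝓝[upperHalf] 0) (𝓝[upperHalf] 0) :=
    tendsto_nhdsWithin_of_tendsto_nhds_of_eventually_within _
      ((tendsto_zero hb).mono_left nhdsWithin_le_nhds)
      (eventually_mem_nhdsWithin.mono fun u hu => hmaps u hu)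
  filter_upwards [hlim.eventually hΨ, self_mem_nhdsWithin] with u h3 hu
  have hre : 0 < (-Complex.I * u).re := by rw [re_neg_I_mul]; exact hu
  have hne : -Complex.I * u ≠ 0 := fun h => by rw [h] at hre; simp at hre
  have h4 : HasDerivAt (fun u => Ψ (sectorMap κ b u)) _ u :=
    h3.1.hasDerivAt.comp u (hasDerivAt (κ := κ) (b := b) hu)
  refine ⟨h4.differentiableAt, ?_⟩
  rw [h4.deriv]
  have h5 : (-Complex.I * u) ^ ((b * (N + 2) - 2 : ℝ) : ℂ) =
      ((-Complex.I * u) ^ (b : ℂ)) ^ N * ((-Complex.I * u) ^ ((b - 1 : ℝ) : ℂ)) ^ 2 := by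
    rw [← Complex.cpow_mul_nat, ← Complex.cpow_mul_nat, ← Complex.cpow_add _ _ hne]
    congr 1
    push_cast
    ring
  rw [h5, mul_pow, ← mul_assoc, h3.2, hC', sectorMap]
  ring

end sectorMap

namespace IsSlitMap

variable {f : ℂ → ℂ} {γ : ℝ → ℂ} {T ξ₀ : ℝ}

/-- A sector between boundary arcs that end at the image of `0` provides a boundary chart. -/
theorem exists_isBoundaryChart_sector {Ψ : ℂ → ℂ} {κ b : ℝ} (h : IsSlitMap f γ T ξ₀) (hb : 0 < b)
    (hΨ : AnalyticAt ℂ Ψ 0) (h0 : Ψ 0 ∉ f '' upperHalf)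
    (hin : ∀ᶠ v in 𝓝 (0 : ℂ), ∀ s : ℝ, 0 < s →
      ∀ θ ∈ Ioo (κ - b * (Real.pi / 2)) (κ + b * (Real.pi / 2)),
      v = s * Complex.exp (θ * Complex.I) → Ψ v ∈ f '' upperHalf)
    (h₁ : ∀ᶠ s : ℝ in 𝓝[>] 0,
      Ψ (s * Complex.exp ((κ - b * (Real.pi / 2) : ℝ) * Complex.I)) ∉ f '' upperHalf)
    (h₂ : ∀ᶠ s : ℝ in 𝓝[>] 0,
      Ψ (s * Complex.exp ((κ + b * (Real.pi / 2) : ℝ) * Complex.I)) ∉ f '' upperHalf) :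
    ∃ (x₀ : ℝ) (χ : ℂ → ℂ), IsBoundaryChart f (fun u => Ψ (sectorMap κ b u)) χ x₀ := by
  have hlim : Tendsto (sectorMap κ b) (𝓝 0) (𝓝 0) := sectorMap.tendsto_zero hb
  refine exists_isBoundaryChart h.differentiableOn h.injOn h.tendsto_cobounded ?_ ?_
  · filter_upwards [self_mem_nhdsWithin, mem_nhdsWithin_of_mem_nhds
      (hlim.eventually (hΨ.eventually_analyticAt.and hin))] with u hu h3
    refine ⟨h3.1.differentiableAt.comp u (sectorMap.hasDerivAt hu).differentiableAt, ?_⟩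
    obtain ⟨s, hs, θ, hθ, heq⟩ := sectorMap.eq_of_upperHalf (κ := κ) hb hu
    exact h3.2 s hs θ hθ heq
  · obtain ⟨δ, hδ, hball⟩ := Metric.mem_nhdsWithin_iff.1 (h₁.and h₂)
    have hrp : Tendsto (fun x : ℝ => |x| ^ b) (𝓝 0) (𝓝 0) := by
      have := ((Real.continuousAt_rpow_const |0| b (Or.inr hb.le)).comp
        (f := fun x : ℝ => |x|) (continuous_abs.continuousAt)).tendsto
      simpa [Function.comp_def, Real.zero_rpow hb.ne'] using this
    filter_upwards [hrp.eventually (Metric.ball_mem_nhds 0 hδ), (tendsto_ofReal_nhds 0).eventually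
      (by rw [Complex.ofReal_zero]; exact hlim.eventually hΨ.eventually_analyticAt)] with x h3 h4
    refine ⟨Ψ (sectorMap κ b x), ?_, (h4.continuousAt.comp
      (sectorMap.continuousAt_ofReal hb x)).tendsto.mono_left nhdsWithin_le_nhds⟩
    rcases lt_trichotomy x 0 with hx | rfl | hx
    · rw [abs_of_neg hx] at h3
      rw [sectorMap.apply_neg hx]
      exact (hball ⟨h3, Real.rpow_pos_of_pos (neg_pos.2 hx) b⟩).2
    · rwa [Complex.ofReal_zero, sectorMap.apply_zero hb]
    · rw [abs_of_pos hx] at h3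
      rw [sectorMap.apply_pos hx]
      exact (hball ⟨h3, Real.rpow_pos_of_pos hx b⟩).1

end IsSlitMap

/-- Near its starting point, the slit is a ray in a model coordinate of a differential of order
greater than `-2`. -/
theorem IsSlit.exists_angle {Q ω Ψ : ℂ → ℂ} {γ : ℝ → ℂ} {φ T ξ₀ m ρ ψ : ℝ} (h : IsSlit γ T ξ₀)
    (harc : IsTrajectoryArc upperHalf Q φ γ 0 T) (hω : IsModelCoordinate Q ω ξ₀ m ρ ψ)
    (hm : -2 < m) (hΨ : ∀ᶠ w in 𝓝 (ξ₀ : ℂ), Ψ (ω w) = w) :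
    ∃ l ∈ Ioo 0 Real.pi,
      (∀ᶠ w in 𝓝 (ξ₀ : ℂ), w ∈ γ '' Ioc 0 T →
        ∃ s : ℝ, 0 < s ∧ ω w = s * Complex.exp (l * Complex.I)) ∧
      ∀ᶠ s : ℝ in 𝓝[>] 0, Ψ (s * Complex.exp (l * Complex.I)) ∈ γ '' Ioc 0 T := by
  have hlimγ : Tendsto γ (𝓝[>] 0) (𝓝 (ξ₀ : ℂ)) := by
    have h1 := (h.continuousOn 0 ⟨le_rfl, h.pos.le⟩).tendsto
    rw [h.map_zero] at h1
    refine h1.mono_left ?_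
    rw [← nhdsWithin_Ioo_eq_nhdsGT h.pos]
    exact nhdsWithin_mono _ Ioo_subset_Icc_self
  obtain ⟨n, hn, hray⟩ := hω.exists_ray_of_trajectory hm h.pos harc hlimγ
  have hβ : 0 < (m + 2) / 2 := by linarith
  set τ := (φ - ψ + n * Real.pi) / ((m + 2) / 2) with hτ
  have hτ2 : |τ| < Real.pi / 2 := by
    rw [hτ, abs_div, abs_of_pos hβ, div_lt_iff₀ hβ]
    exact hn
  have hexp : ∀ s : ℝ, Complex.I * (s * Complex.exp (τ * Complex.I)) =
      s * Complex.exp ((Real.pi / 2 + τ : ℝ) * Complex.I) := by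
    intro s
    rw [Complex.ofReal_add, add_mul, Complex.exp_add, exp_pi_div_two_ofReal_mul_I]
    ring
  simp only [hexp] at hray
  refine ⟨Real.pi / 2 + τ, ⟨by linarith [(abs_lt.1 hτ2).1], by linarith [(abs_lt.1 hτ2).2]⟩,
    ?_, ?_⟩
  · obtain ⟨δ, hδ, hball⟩ := Metric.mem_nhdsWithin_iff.1 hray
    have h2 := h.eventually_mem_imp (t₀ := 0) ⟨le_rfl, h.pos.le⟩ hδ
    rw [h.map_zero] at h2
    filter_upwards [h2] with w hw hmem
    obtain ⟨t, ht, rfl⟩ := hmem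
    have h3 := hw t (Ioc_subset_Icc_self ht) rfl
    obtain ⟨h4, h5⟩ := hball ⟨by rwa [Metric.mem_ball, Real.dist_eq], ht.1⟩
    exact ⟨_, norm_pos_iff.2 fun h0 => by rw [h0] at h4; simp at h4, h5⟩
  · have hωa : ∀ᶠ t in 𝓝[>] (0 : ℝ), AnalyticAt ℂ ω (γ t) ∧ t < T :=
      (hlimγ.eventually hω.analytic.analytic.eventually_analyticAt).and
        (eventually_nhdsWithin_of_eventually_nhds (eventually_lt_nhds h.pos))
    obtain ⟨ε, hε, hball⟩ := Metric.mem_nhdsWithin_iff.1 (hωa.and hray)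
    have hball' : ∀ t ∈ Ioo 0 ε, (AnalyticAt ℂ ω (γ t) ∧ t < T) ∧ 0 < (ω (γ t)).im := by
      intro t ht
      have h4 := hball ⟨by rw [Real.ball_eq_Ioo]; exact ⟨by linarith [ht.1, ht.2], by linarith [ht.2]⟩,
        ht.1⟩
      exact ⟨h4.1, h4.2.1⟩
    have hmap := map_nhdsGT_zero_eq (ρ := fun t => ‖ω (γ t)‖) hε
      (fun t ht => by
        obtain ⟨-, v, hv, -⟩ := harc t ⟨ht.1, (hball' t ht).1.2⟩
        exact ((hball' t ht).1.1.continuousAt.comp hv.continuousAt).norm.continuousWithinAt)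
      (fun t ht => norm_pos_iff.2 fun h0 => by
        have := (hball' t ht).2
        rw [h0] at this
        simp at this)
      (by simpa using (hω.tendsto_zero.comp hlimγ).norm)
    rw [← hmap, eventually_map]
    filter_upwards [hray, hlimγ.eventually hΨ, hωa, self_mem_nhdsWithin] with t h4 h5 h6 h7
    rw [← h4.2, h5]
    exact ⟨t, ⟨h7, h6.2.le⟩, rfl⟩

/-! ### The starting point of the slit and the point at infinity -/

theorem neg_inv_mem_upperHalf {u : ℂ} (hu : u ∈ upperHalf) : -u⁻¹ ∈ upperHalf := by
  have hu : 0 < u.im := hu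
  have hne : u ≠ 0 := fun h0 => by rw [h0] at hu; simp at hu
  show 0 < (-u⁻¹).im
  rw [Complex.neg_im, Complex.inv_im, neg_div, neg_neg]
  exact div_pos hu (Complex.normSq_pos.2 hne)

/-- The inversion `u ↦ -1/u` maps the upper half-plane near `0` to the upper half-plane
near `∞`. -/
theorem tendsto_neg_inv_upperHalf :
    Tendsto (fun u : ℂ => -u⁻¹) (𝓝[upperHalf] 0) (Bornology.cobounded ℂ ⊓ 𝓟 upperHalf) := by
  refine tendsto_inf.2 ⟨?_, tendsto_principal.2 ?_⟩
  · refine tendsto_neg_cobounded.comp (tendsto_inv₀_nhdsNE_zero.mono_left ?_)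
    refine nhdsWithin_mono _ fun u hu => ?_
    rintro rfl
    exact lt_irrefl _ (show (0 : ℝ) < (0 : ℂ).im from hu)
  · filter_upwards [self_mem_nhdsWithin] with u hu using neg_inv_mem_upperHalf hu

theorem tendsto_neg_inv_cobounded :
    Tendsto (fun w : ℂ => -w⁻¹) (Bornology.cobounded ℂ ⊓ 𝓟 upperHalf) (𝓝[upperHalf] 0) := by
  apply tendsto_nhdsWithin_of_tendsto_nhds_of_eventually_within
  · have := (tendsto_inv₀_cobounded (α := ℂ)).neg
    rw [neg_zero] at this
    exact this.mono_left inf_le_left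
  · rw [eventually_inf_principal]
    exact Eventually.of_forall fun u hu => neg_inv_mem_upperHalf hu

instance neBot_cobounded_inf_upperHalf :
    (Bornology.cobounded ℂ ⊓ 𝓟 upperHalf).NeBot := by
  have : (𝓝[upperHalf] (0 : ℂ)).NeBot := by
    simpa using neBot_nhdsWithin_upperHalf 0
  exact tendsto_neg_inv_upperHalf.neBot

namespace IsSlitMap

variable {f : ℂ → ℂ} {γ : ℝ → ℂ} {T ξ₀ : ℝ}

/-- At the starting point of the slit: the two sectors on the sides of the slit. -/
theorem exists_preimages_foot {Q : ℂ → ℂ} {φ : ℝ} {N : ℕ} (h : IsSlitMap f γ T ξ₀)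
    (harc : IsTrajectoryArc upperHalf Q φ γ 0 T) (hq : HasBoundaryExponent Q ξ₀ N) :
    ∃ x₁ x₂ μ₁ μ₂ : ℝ, x₁ ≠ x₂ ∧
      (-2 < μ₁ ∧ Tendsto f (𝓝[upperHalf] (x₁ : ℂ)) (𝓝 ξ₀) ∧
        HasBoundaryExponent (fun z => Q (f z) * deriv f z ^ 2) x₁ μ₁) ∧
      (-2 < μ₂ ∧ Tendsto f (𝓝[upperHalf] (x₂ : ℂ)) (𝓝 ξ₀) ∧
        HasBoundaryExponent (fun z => Q (f z) * deriv f z ^ 2) x₂ μ₂) ∧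
      Tendsto (Function.invFunOn f upperHalf) (𝓝[f '' upperHalf] (ξ₀ : ℂ))
        (𝓝 (x₁ : ℂ) ⊔ 𝓝 (x₂ : ℂ)) := by
  have hpi := Real.pi_pos
  have hN : (-2 : ℝ) < N := by
    have : (0 : ℝ) ≤ N := Nat.cast_nonneg N
    linarith
  obtain ⟨ω, ρ, ψ, hω⟩ := hq.exists_isModelCoordinate hN
  obtain ⟨Ψ, hΨ, hΨ0, hΨd, hωΨ, hΨω, hΨq⟩ := hω.exists_inverse
  obtain ⟨l, hl, hl1, hl2⟩ := h.slit.exists_angle harc hω hN hΨω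
  have hΨlim : Tendsto Ψ (𝓝 0) (𝓝 (ξ₀ : ℂ)) := by
    rw [← hΨ0]
    have := hΨ.analytic.continuousAt.tendsto
    rwa [Complex.ofReal_zero] at this
  have h0 : Ψ 0 ∉ f '' upperHalf := h.notMem_image_of_im_eq_zero (by rw [hΨ0]; simp)
  -- the rays on the real axis and on the slit
  have hnot : ∀ a : ℝ, a = 0 ∨ a = l ∨ a = Real.pi → ∀ᶠ s : ℝ in 𝓝[>] 0,
      Ψ (s * Complex.exp (a * Complex.I)) ∉ f '' upperHalf := by
    have hneg : Tendsto (fun s : ℝ => -s) (𝓝 0) (𝓝 0) := by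
      simpa using (continuous_neg (G := ℝ)).tendsto 0
    rintro a (rfl | rfl | rfl)
    · filter_upwards [nhdsWithin_le_nhds hΨ.real] with s hs
      apply h.notMem_image_of_im_eq_zero
      simpa using hs
    · filter_upwards [hl2] with s hs using h.notMem_image_of_mem_slit hs
    · filter_upwards [nhdsWithin_le_nhds (hneg.eventually hΨ.real)] with s hs
      apply h.notMem_image_of_im_eq_zero
      rw [Complex.exp_pi_mul_I, mul_neg_one, ← Complex.ofReal_neg]
      exact hs
  have key : ∀ a b : ℝ, 0 ≤ a → a < b → b ≤ Real.pi → l ∉ Ioo a b →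
      (a = 0 ∨ a = l ∨ a = Real.pi) → (b = 0 ∨ b = l ∨ b = Real.pi) → ∃ x μ : ℝ,
        (-2 < μ ∧ Tendsto f (𝓝[upperHalf] (x : ℂ)) (𝓝 ξ₀) ∧
          HasBoundaryExponent (fun z => Q (f z) * deriv f z ^ 2) x μ) ∧
        (∀ᶠ z in 𝓝[upperHalf] (x : ℂ), (ω (f z)).arg ∈ Ioo a b) ∧
        ∀ L ≤ 𝓝 (ξ₀ : ℂ), (∀ᶠ w in L, (ω w).arg ∈ Ioo a b ∧ ω w ≠ 0) →
          Tendsto (Function.invFunOn f upperHalf) L (𝓝 (x : ℂ)) := by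
    intro a b ha hab hb hlab ha' hb'
    obtain ⟨κ, c, hc, hc1, h1, h2⟩ : ∃ κ c : ℝ, 0 < c ∧ c ≤ 1 ∧ κ - c * (Real.pi / 2) = a ∧
        κ + c * (Real.pi / 2) = b := by
      refine ⟨(a + b) / 2, (b - a) / Real.pi, div_pos (by linarith) hpi, ?_, ?_, ?_⟩
      · rw [div_le_one hpi]
        linarith
      · field_simp
        ring
      · field_simp
        ring
    have hin : ∀ᶠ v in 𝓝 (0 : ℂ), ∀ s : ℝ, 0 < s →
        ∀ θ ∈ Ioo (κ - c * (Real.pi / 2)) (κ + c * (Real.pi / 2)),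
        v = s * Complex.exp (θ * Complex.I) → Ψ v ∈ f '' upperHalf := by
      have h3 := hΨq
      rw [eventually_nhdsWithin_iff] at h3
      filter_upwards [h3, hωΨ, hΨlim.eventually hl1] with v h3 h4 h5 s hs θ hθ hv
      rw [h1, h2] at hθ
      have hθ' : θ ∈ Ioc (-Real.pi) Real.pi := ⟨by linarith [hθ.1], by linarith [hθ.2]⟩
      have hvH : v ∈ upperHalf := by
        show 0 < v.im
        rw [hv, im_ofReal_mul_exp]
        exact mul_pos hs (Real.sin_pos_of_pos_of_lt_pi (by linarith [hθ.1]) (by linarith [hθ.2]))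
      rw [h.image_eq]
      refine ⟨(h3 hvH).1, fun h6 => ?_⟩
      obtain ⟨s', hs', heq⟩ := h5 h6
      rw [h4] at heq
      have h7 : v.arg = θ := by rw [hv, arg_ofReal_mul_exp hs hθ']
      have h8 : v.arg = l := by
        rw [heq, arg_ofReal_mul_exp hs' ⟨by linarith [hl.1], hl.2.le⟩]
      exact hlab (by rwa [← h8, h7])
    obtain ⟨x, χ, hχ⟩ := h.exists_isBoundaryChart_sector hc (by simpa using hΨ.analytic) h0 hin
      (by rw [h1]; exact hnot a ha') (by rw [h2]; exact hnot b hb')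
    have hsec : ∀ u ∈ upperHalf, (sectorMap κ c u).arg ∈ Ioo a b ∧ sectorMap κ c u ∈ upperHalf := by
      intro u hu
      obtain ⟨s, hs, θ, hθ, heq⟩ := sectorMap.eq_of_upperHalf (κ := κ) hc hu
      rw [h1, h2] at hθ
      rw [heq, arg_ofReal_mul_exp hs ⟨by linarith [hθ.1], by linarith [hθ.2]⟩]
      refine ⟨hθ, ?_⟩
      show 0 < ((s : ℂ) * Complex.exp (θ * Complex.I)).im
      rw [im_ofReal_mul_exp]
      exact mul_pos hs (Real.sin_pos_of_pos_of_lt_pi (by linarith [hθ.1]) (by linarith [hθ.2]))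
    have hC : -(ρ * Complex.exp (2 * ψ * Complex.I)) ≠ 0 :=
      neg_ne_zero.2 (mul_ne_zero (by exact_mod_cast hω.pos.ne') (Complex.exp_ne_zero _))
    obtain ⟨p, hp, hpq⟩ := sectorMap.hasBoundaryExponent (q := Q) (Ψ := Ψ) (N := N) hC hc
      (fun u hu => (hsec u hu).2) (by
        filter_upwards [hΨq] with u hu
        refine ⟨hu.2.1, ?_⟩
        rw [hu.2.2]
        simp)
    have hlim0 : Tendsto (fun u => Ψ (sectorMap κ c u)) (𝓝[upperHalf] 0) (𝓝 (ξ₀ : ℂ)) :=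
      hΨlim.comp ((sectorMap.tendsto_zero hc).mono_left nhdsWithin_le_nhds)
    refine ⟨x, c * (N + 2) - 2, ⟨?_, hχ.tendsto_map hlim0, hχ.hasBoundaryExponent hpq hp⟩, ?_, ?_⟩
    · have : 0 < c * ((N : ℝ) + 2) := by positivity
      linarith
    · filter_upwards [hχ.eq, hχ.tendsto.eventually (eventually_mem_nhdsWithin.and
        (((sectorMap.tendsto_zero hc).mono_left nhdsWithin_le_nhds).eventually hωΨ))]
        with z hz hz2
      rw [hz, hz2.2]
      exact (hsec _ hz2.1).1
    · intro L hL hLω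
      have hpolar : ∀ v : ℂ, v.arg ∈ Ioo a b → v ≠ 0 → 0 < ‖v‖ ∧
          v.arg ∈ Ioo (κ - c * (Real.pi / 2)) (κ + c * (Real.pi / 2)) ∧
          v = ‖v‖ * Complex.exp (v.arg * Complex.I) := by
        intro v hv hv0
        rw [h1, h2]
        exact ⟨norm_pos_iff.2 hv0, hv, (Complex.norm_mul_exp_arg_mul_I v).symm⟩
      refine hχ.tendsto_invFunOn (κ := fun w => Complex.I *
        (Complex.exp (-(κ * Complex.I)) * ω w) ^ ((c⁻¹ : ℝ) : ℂ)) ?_ ?_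
      · refine tendsto_nhdsWithin_of_tendsto_nhds_of_eventually_within _
          ((sectorMap.tendsto_inverse hc κ).comp (hω.tendsto_zero.mono_left hL)) ?_
        filter_upwards [hLω] with w hw
        obtain ⟨h3, h4, h5⟩ := hpolar _ hw.1 hw.2
        exact (sectorMap.inverse hc hc1 h3 h4 h5).1
      · filter_upwards [hLω, hL hΨω] with w hw hw2
        obtain ⟨h3, h4, h5⟩ := hpolar _ hw.1 hw.2
        rw [(sectorMap.inverse hc hc1 h3 h4 h5).2, hw2]
  obtain ⟨x₁, μ₁, h1, h2, h3⟩ := key 0 l le_rfl hl.1 hl.2.le (by simp) (by simp) (by simp)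
  obtain ⟨x₂, μ₂, h4, h5, h6⟩ := key l Real.pi hl.1.le hl.2 le_rfl (by simp) (by simp) (by simp)
  refine ⟨x₁, x₂, μ₁, μ₂, ?_, h1, h4, ?_⟩
  · rintro rfl
    obtain ⟨z, hz⟩ := (h2.and h5).exists
    exact (hz.1.2.trans hz.2.1).false
  · have hle : 𝓝[f '' upperHalf] (ξ₀ : ℂ) ≤ 𝓝 (ξ₀ : ℂ) := nhdsWithin_le_nhds
    have hsub : f '' upperHalf ⊆ upperHalf := by rw [h.image_eq]; exact sdiff_subset
    have hne : ∀ᶠ w in 𝓝[f '' upperHalf] (ξ₀ : ℂ), ω w ≠ 0 ∧ (ω w).arg ∈ Ioo 0 Real.pi ∧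
        (ω w).arg ≠ l := by
      have hnorm : Tendsto (fun w => ‖ω w‖) (𝓝 (ξ₀ : ℂ)) (𝓝 0) := by
        simpa using hω.tendsto_zero.norm
      have h7 := hl2
      rw [eventually_nhdsWithin_iff] at h7
      filter_upwards [self_mem_nhdsWithin, nhdsWithin_mono _ hsub hω.eventually_im_pos,
        hle (hnorm.eventually h7), hle hΨω] with w hw h8 h9 h10
      have hne0 : ω w ≠ 0 := fun h0 => by rw [h0] at h8; simp at h8
      have harg : 0 ≤ (ω w).arg := Complex.arg_nonneg_iff.2 h8.le
      refine ⟨hne0, ⟨lt_of_le_of_ne harg fun h11 => ?_, lt_of_le_of_ne (Complex.arg_le_pi _)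
        fun h11 => ?_⟩, fun h11 => ?_⟩
      · rw [eq_comm, Complex.arg_eq_zero_iff] at h11
        exact h8.ne' h11.2
      · rw [Complex.arg_eq_pi_iff] at h11
        exact h8.ne' h11.2
      · have h12 := h9 (norm_pos_iff.2 hne0)
        rw [← h11, Complex.norm_mul_exp_arg_mul_I, h10] at h12
        exact h.notMem_image_of_mem_slit h12 hw
    refine Tendsto.sup_of_principal (A := {w | (ω w).arg < l})
      (h3 _ (inf_le_left.trans hle) ?_) (h6 _ (inf_le_left.trans hle) ?_)
    · rw [eventually_inf_principal]
      filter_upwards [hne] with w h7 h8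
      exact ⟨⟨h7.2.1.1, h8⟩, h7.1⟩
    · rw [eventually_inf_principal]
      filter_upwards [hne] with w h7 h8
      exact ⟨⟨lt_of_le_of_ne (not_lt.1 (show ¬ (ω w).arg < l from h8)) (Ne.symm h7.2.2),
        h7.2.1.2⟩, h7.1⟩

theorem invFunOn_apply (h : IsSlitMap f γ T ξ₀) {z : ℂ} (hz : z ∈ upperHalf) :
    Function.invFunOn f upperHalf (f z) = z := h.injOn.leftInvOn_invFunOn hz

theorem invFunOn_mem (h : IsSlitMap f γ T ξ₀) {w : ℂ} (hw : w ∈ f '' upperHalf) :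
    Function.invFunOn f upperHalf w ∈ upperHalf ∧ f (Function.invFunOn f upperHalf w) = w := by
  obtain ⟨z, hz, rfl⟩ := hw
  rw [h.invFunOn_apply hz]
  exact ⟨hz, rfl⟩

theorem eventually_mem_image (h : IsSlitMap f γ T ξ₀) :
    ∀ᶠ w in Bornology.cobounded ℂ ⊓ 𝓟 upperHalf, w ∈ f '' upperHalf := by
  rw [h.image_eq, eventually_inf_principal]
  have hb : Bornology.IsBounded (γ '' Ioc 0 T) :=
    (isCompact_Icc.image_of_continuousOn h.slit.continuousOn).isBounded.subset
      (image_mono Ioc_subset_Icc_self)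
  filter_upwards [Bornology.isBounded_def.1 hb] with w hw hwH using ⟨hwH, hw⟩

/-- The conformal map near `∞`, in the coordinate `-1/(z - x₁)`: the point `x₁` is a centre of a
chart at a finite boundary point, so that `1/(z - x₁)` remains bounded where `f` is large. -/
theorem exists_chart_infty (h : IsSlitMap f γ T ξ₀) :
    ∃ (x₁ : ℝ) (χ : ℂ → ℂ), IsRealAnalyticAt χ 0 ∧ χ 0 = 0 ∧ 0 < (deriv χ 0).re ∧
      (∀ᶠ v in 𝓝[upperHalf] (0 : ℂ), f (x₁ - v⁻¹) = -(χ v)⁻¹) ∧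
      Tendsto (Function.invFunOn f upperHalf) (Bornology.cobounded ℂ ⊓ 𝓟 (f '' upperHalf))
        (Bornology.cobounded ℂ) := by
  set g := Function.invFunOn f upperHalf with hg
  obtain ⟨x₁, χ₁, hχ₁, -⟩ := h.exists_isBoundaryChart_real (y := ξ₀ + 1) (by simp)
  have hf1 := hχ₁.tendsto_map (w := (ξ₀ + 1 : ℝ)) (by
    have : Tendsto (fun u : ℂ => ((ξ₀ + 1 : ℝ) : ℂ) + u) (𝓝 0) (𝓝 (((ξ₀ + 1 : ℝ) : ℂ) + 0)) :=
      (continuous_const.add continuous_id).tendsto _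
    rw [add_zero] at this
    exact this.mono_left nhdsWithin_le_nhds)
  obtain ⟨c, hc, hball⟩ := Metric.mem_nhdsWithin_iff.1
    (hf1.norm.eventually_le_const (lt_add_one _))
  set M := ‖((ξ₀ + 1 : ℝ) : ℂ)‖ + 1
  have hfar : ∀ w ∈ f '' upperHalf, M < ‖w‖ → c ≤ ‖g w - x₁‖ := by
    intro w hw hwM
    by_contra hlt
    have h2 : ‖f (g w)‖ ≤ M := hball ⟨by rw [Metric.mem_ball, dist_eq_norm]; exact not_le.1 hlt,
      (h.invFunOn_mem hw).1⟩
    rw [(h.invFunOn_mem hw).2] at h2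
    exact h2.not_gt hwM
  have hev : ∀ᶠ u in 𝓝[upperHalf] (0 : ℂ), -u⁻¹ ∈ f '' upperHalf ∧ M < ‖-u⁻¹‖ :=
    tendsto_neg_inv_upperHalf.eventually (h.eventually_mem_image.and
      ((tendsto_norm_cobounded_atTop.eventually_gt_atTop M).filter_mono inf_le_left))
  obtain ⟨r, hr, hrball⟩ := Metric.mem_nhdsWithin_iff.1 hev
  have hsubH : ∀ w ∈ f '' upperHalf, g w - x₁ ∈ upperHalf := fun w hw => by
    have : 0 < (g w).im := (h.invFunOn_mem hw).1
    simpa using this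
  obtain ⟨x₀, χ, hχ, hχ0, hχd, hχt, hχe⟩ := exists_boundary_chart hr
    (G := fun u => -(g (-u⁻¹) - x₁)⁻¹)
    (fun u hu => by
      obtain ⟨z, hz, hzu⟩ := (hrball hu).1
      have h1 := (hasDerivAt_invFunOn isOpen_upperHalf h.differentiableOn h.injOn hz).differentiableAt
      rw [hzu] at h1
      have hu0 : u ≠ 0 := fun h0 => by
        have := hu.2
        rw [h0] at this
        exact lt_irrefl _ (show (0 : ℝ) < (0 : ℂ).im from this)
      have h2 : DifferentiableAt ℂ (fun u => g (-u⁻¹)) u :=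
        h1.comp u (differentiableAt_inv hu0).neg
      have h3 : g (-u⁻¹) - x₁ ≠ 0 := fun h0 => by
        have := hsubH _ (hrball hu).1
        rw [h0] at this
        exact lt_irrefl _ (show (0 : ℝ) < (0 : ℂ).im from this)
      exact ((h2.sub_const _).inv h3).neg.differentiableWithinAt)
    (fun u hu => neg_inv_mem_upperHalf (hsubH _ (hrball hu).1))
    (M := c⁻¹) (fun u hu => by
      rw [norm_neg, norm_inv]
      exact inv_anti₀ hc (hfar _ (hrball hu).1 (hrball hu).2))
    (fun x hx K hK hKc => by
      have hK0 : ∀ k ∈ K, k ≠ 0 := fun k hk h0 => by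
        have := hK hk
        rw [h0] at this
        exact lt_irrefl _ (show (0 : ℝ) < (0 : ℂ).im from this)
      have hK' : (fun k : ℂ => x₁ - k⁻¹) '' K ⊆ upperHalf := by
        rintro _ ⟨k, hk, rfl⟩
        have : 0 < (-k⁻¹).im := neg_inv_mem_upperHalf (hK hk)
        show 0 < ((x₁ : ℂ) - k⁻¹).im
        simpa using this
      have hfK : IsCompact (f '' ((fun k : ℂ => x₁ - k⁻¹) '' K)) :=
        (hKc.image_of_continuousOn (continuousOn_const.sub
          (continuousOn_id.inv₀ hK0))).image_of_continuousOn (h.differentiableOn.continuousOn.mono hK')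
      have hout : ∀ᶠ u in 𝓝[upperHalf] (x : ℂ), -u⁻¹ ∉ f '' ((fun k : ℂ => x₁ - k⁻¹) '' K) := by
        by_cases hx0 : x = 0
        · subst hx0
          rw [Complex.ofReal_zero]
          exact tendsto_neg_inv_upperHalf.eventually
            (Filter.Eventually.filter_mono inf_le_left (Bornology.isBounded_def.1 hfK.isBounded))
        · have h1 : Tendsto (fun u : ℂ => -u⁻¹) (𝓝[upperHalf] (x : ℂ)) (𝓝 (-(x : ℂ)⁻¹)) :=
            ((continuousAt_inv₀ (by exact_mod_cast hx0)).neg.tendsto).mono_left nhdsWithin_le_nhds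
          refine h1.eventually (hfK.isClosed.isOpen_compl.mem_nhds fun h2 => ?_)
          refine h.notMem_image_of_im_eq_zero ?_ (image_mono hK' h2)
          rw [← Complex.ofReal_inv, Complex.neg_im, Complex.ofReal_im, neg_zero]
      have hxm : (x : ℂ) ∈ Metric.ball (0 : ℂ) r := by simpa using hx
      filter_upwards [hout, mem_nhdsWithin_of_mem_nhds (Metric.isOpen_ball.mem_nhds hxm),
        self_mem_nhdsWithin] with u h1 h2 h3 h4
      refine h1 ⟨g (-u⁻¹), ⟨_, h4, ?_⟩, (h.invFunOn_mem (hrball ⟨h2, h3⟩).1).2⟩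
      simp)
  -- along the image of the upper half-plane near `∞` the limit of the chart is `0`
  have hx₀ : x₀ = 0 := by
    have htop : Tendsto f (Bornology.cobounded ℂ ⊓ 𝓟 upperHalf)
        (Bornology.cobounded ℂ ⊓ 𝓟 upperHalf) := by
      refine tendsto_inf.2 ⟨h.tendsto_cobounded, tendsto_principal.2 ?_⟩
      rw [eventually_inf_principal]
      refine Eventually.of_forall fun z hz => ?_
      have := mem_image_of_mem f hz
      rw [h.image_eq] at this
      exact this.1
    have h1 := hχt.comp (tendsto_neg_inv_cobounded.comp htop)
    have h2 : Tendsto (fun z : ℂ => -(z - x₁)⁻¹) (Bornology.cobounded ℂ ⊓ 𝓟 upperHalf) (𝓝 0) := by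
      have := ((tendsto_inv₀_cobounded (α := ℂ)).comp (tendsto_sub_const_cobounded (x₁ : ℂ))).neg
      rw [neg_zero] at this
      exact this.mono_left inf_le_left
    have h3 := tendsto_nhds_unique (h2.congr' ?_) h1
    · exact_mod_cast h3.symm
    · rw [EventuallyEq, eventually_inf_principal]
      refine Eventually.of_forall fun z hz => ?_
      simp only [Function.comp_apply, inv_neg, inv_inv, neg_neg]
      rw [hg, h.invFunOn_apply hz]
  subst hx₀
  simp only [Complex.ofReal_zero] at *
  refine ⟨x₁, χ, hχ, hχ0, hχd, ?_, ?_⟩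
  · filter_upwards [hχe] with v hv
    have h1 := (h.invFunOn_mem (hrball hv.1).1).2
    rw [← hv.2, inv_neg, inv_inv, sub_neg_eq_add, add_sub_cancel]
    rw [← hg] at h1
    rw [h1, hv.2]
  · have hsub : f '' upperHalf ⊆ upperHalf := by rw [h.image_eq]; exact sdiff_subset
    have hmono : Bornology.cobounded ℂ ⊓ 𝓟 (f '' upperHalf) ≤ Bornology.cobounded ℂ ⊓ 𝓟 upperHalf :=
      inf_le_inf_left _ (principal_mono.2 hsub)
    have h1 := (hχt.comp (tendsto_neg_inv_cobounded.mono_left hmono)).neg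
    rw [neg_zero] at h1
    have h2 : Tendsto (fun w => (g w - x₁)⁻¹) (Bornology.cobounded ℂ ⊓ 𝓟 (f '' upperHalf))
        (𝓝[≠] 0) := by
      apply tendsto_nhdsWithin_of_tendsto_nhds_of_eventually_within
      · refine h1.congr fun w => ?_
        simp
      · rw [eventually_inf_principal]
        refine Eventually.of_forall fun w hw => inv_ne_zero fun h0 => ?_
        have := hsubH w hw
        rw [h0] at this
        exact lt_irrefl _ (show (0 : ℝ) < (0 : ℂ).im from this)
    have h3 := (tendsto_add_const_cobounded (x₁ : ℂ)).comp (tendsto_inv₀_nhdsNE_zero.comp h2)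
    refine h3.congr fun w => ?_
    simp

/-- A boundary point is determined by the limits of the inverse map. -/
theorem eq_or_eq_of_tendsto (h : IsSlitMap f γ T ξ₀) {x x₁ x₂ w : ℂ} {L : Filter ℂ} [L.NeBot]
    (hL : L ≤ 𝓝[upperHalf] x) (hf : Tendsto f L (𝓝 w))
    (hg : Tendsto (Function.invFunOn f upperHalf) (𝓝[f '' upperHalf] w) (𝓝 x₁ ⊔ 𝓝 x₂)) :
    x = x₁ ∨ x = x₂ := by
  by_contra! hne
  have hLH : ∀ᶠ z in L, z ∈ upperHalf := hL self_mem_nhdsWithin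
  have h1 : Tendsto f L (𝓝[f '' upperHalf] w) :=
    tendsto_nhdsWithin_of_tendsto_nhds_of_eventually_within _ hf
      (hLH.mono fun z hz => mem_image_of_mem f hz)
  have h2 : Tendsto (fun z => z) L (𝓝 x₁ ⊔ 𝓝 x₂) :=
    (hg.comp h1).congr' (hLH.mono fun z hz => h.invFunOn_apply hz)
  have h3 : L ≤ 𝓝 x₁ ⊔ 𝓝 x₂ := by simpa [Tendsto] using h2
  have h4 : Disjoint (𝓝 x) (𝓝 x₁ ⊔ 𝓝 x₂) :=
    (disjoint_nhds_nhds.2 hne.1).sup_right (disjoint_nhds_nhds.2 hne.2)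
  exact NeBot.ne inferInstance (le_bot_iff.1
    (disjoint_iff_inf_le.1 h4 |>.trans' (le_inf (hL.trans nhdsWithin_le_nhds) h3)))

/-- Every point of the real axis has a boundary value along a finer filter. -/
theorem exists_boundary_value (h : IsSlitMap f γ T ξ₀) (x : ℝ) :
    ∃ (L : Filter ℂ) (w : ℂ), L.NeBot ∧ L ≤ 𝓝[upperHalf] (x : ℂ) ∧ Tendsto f L (𝓝 w) ∧
      ((∃ y : ℝ, w = y) ∨ w ∈ γ '' Ioc 0 T) := by
  obtain ⟨x₁, χ, -, -, -, -, htop⟩ := h.exists_chart_infty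
  obtain ⟨M, hM⟩ : ∃ M : ℝ, ∀ᶠ z in 𝓝[upperHalf] (x : ℂ), ‖f z‖ ≤ M := by
    have h1 := (tendsto_norm_cobounded_atTop.comp htop).eventually_gt_atTop (‖(x : ℂ)‖ + 1)
    rw [eventually_inf_principal, ← comap_norm_atTop, eventually_comap] at h1
    obtain ⟨M, hM⟩ := eventually_atTop.1 h1
    refine ⟨M, ?_⟩
    filter_upwards [self_mem_nhdsWithin, nhdsWithin_le_nhds
      ((continuous_norm.tendsto (x : ℂ)).eventually_le_const (lt_add_one _))] with z hz hzx
    by_contra hlt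
    have h2 := hM ‖f z‖ (not_le.1 hlt).le (f z) rfl (mem_image_of_mem f hz)
    simp only [Function.comp_apply] at h2
    rw [h.invFunOn_apply hz] at h2
    exact hzx.not_gt h2
  have hcpt := isCompact_closedBall (0 : ℂ) M
  obtain ⟨w, -, hw⟩ := hcpt (f := map f (𝓝[upperHalf] (x : ℂ))) (by
    rw [le_principal_iff, mem_map]
    filter_upwards [hM] with z hz
    simpa using hz)
  have hL : (𝓝[upperHalf] (x : ℂ) ⊓ comap f (𝓝 w)).NeBot := by
    rw [neBot_inf_comap_iff_map, inf_comm]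
    exact hw
  have hfL : Tendsto f (𝓝[upperHalf] (x : ℂ) ⊓ comap f (𝓝 w)) (𝓝 w) :=
    tendsto_comap.mono_left inf_le_right
  refine ⟨_, w, hL, inf_le_left, hfL, ?_⟩
  have hLH : ∀ᶠ z in 𝓝[upperHalf] (x : ℂ) ⊓ comap f (𝓝 w), z ∈ upperHalf :=
    inf_le_left (a := 𝓝[upperHalf] (x : ℂ)) self_mem_nhdsWithin
  have hnot : w ∉ f '' upperHalf := by
    intro hmem
    obtain ⟨z₀, hz₀, rfl⟩ := hmem
    have hc := (hasDerivAt_invFunOn isOpen_upperHalf h.differentiableOn h.injOn hz₀).continuousAt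
    have h2 := (hc.tendsto.comp hfL).congr' (hLH.mono fun z hz => h.invFunOn_apply hz)
    rw [h.invFunOn_apply hz₀] at h2
    have h3 := tendsto_nhds_unique h2 (inf_le_left.trans nhdsWithin_le_nhds)
    rw [h3] at hz₀
    exact lt_irrefl _ (show (0 : ℝ) < (x : ℂ).im from hz₀)
  have him : 0 ≤ w.im := by
    refine ge_of_tendsto ((Complex.continuous_im.tendsto w).comp hfL) ?_
    filter_upwards [hLH] with z hz
    have := mem_image_of_mem f (show z ∈ upperHalf from hz)
    rw [h.image_eq] at this
    exact (show 0 < (f z).im from this.1).le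
  rcases him.eq_or_lt with h1 | h1
  · exact Or.inl ⟨w.re, Complex.ext (by simp) (by simp [← h1])⟩
  · right
    by_contra h2
    rw [h.image_eq] at hnot
    exact hnot ⟨h1, h2⟩

end IsSlitMap

/-! ### Exponents and preimages -/

/-- In a trajectory coordinate the quadratic differential is constant. -/
theorem IsTrajectoryCoordinate.eventually_eq_const {Q Φ Ψ : ℂ → ℂ} {φ : ℝ} {w₀ : ℂ}
    (h : IsTrajectoryCoordinate Q φ w₀ Φ Ψ) : ∀ᶠ u in 𝓝 (0 : ℂ), DifferentiableAt ℂ Ψ u ∧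
      Q (Ψ u) * deriv Ψ u ^ 2 = Complex.exp (2 * φ * Complex.I) := by
  filter_upwards [h.analytic_inv.eventually_analyticAt, eventually_eventually_nhds.2 h.right_inv,
    h.tendsto_inv.eventually (h.analytic.eventually_analyticAt.and h.eq)] with u h1 h2 h3
  refine ⟨h1.differentiableAt, ?_⟩
  have h4 : deriv Φ (Ψ u) * deriv Ψ u = 1 := by
    have h5 := (h3.1.differentiableAt.hasDerivAt.comp u h1.differentiableAt.hasDerivAt)
    exact h5.unique ((hasDerivAt_id u).congr_of_eventuallyEq h2)
  rw [h3.2, mul_assoc, ← mul_pow, h4, one_pow, mul_one]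

/-- A meromorphic function in normal form is analytic where its value is not zero. -/
theorem MeromorphicNFAt.analyticAt_of_ne_zero {Q : ℂ → ℂ} {w : ℂ} (hQ : MeromorphicNFAt Q w)
    (h0 : Q w ≠ 0) : AnalyticAt ℂ Q w :=
  hQ.meromorphicOrderAt_nonneg_iff_analyticAt.1 (hQ.meromorphicOrderAt_eq_zero_iff.2 h0).ge

namespace IsSlitMap

variable {f : ℂ → ℂ} {γ : ℝ → ℂ} {T ξ₀ : ℝ} {Q : ℂ → ℂ} {φ : ℝ}

theorem image_subset (h : IsSlitMap f γ T ξ₀) : f '' upperHalf ⊆ upperHalf := by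
  rw [h.image_eq]
  exact sdiff_subset

/-- A real point off the slit is the boundary value of `f` at a point `x`, and the exponent of `Q`
carries over to `x`. -/
theorem exists_preimage_real {y : ℝ} (h : IsSlitMap f γ T ξ₀) (hy : y ≠ ξ₀) :
    ∃ x : ℝ, Tendsto f (𝓝[upperHalf] (x : ℂ)) (𝓝 (y : ℂ)) ∧
      Tendsto (Function.invFunOn f upperHalf) (𝓝[f '' upperHalf] (y : ℂ)) (𝓝 (x : ℂ)) ∧
      (∃ F : ℂ → ℂ, AnalyticAt ℂ F x ∧ f =ᶠ[𝓝[upperHalf] (x : ℂ)] F) ∧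
      ∀ m : ℝ, HasBoundaryExponent Q y m →
        HasBoundaryExponent (fun z => Q (f z) * deriv f z ^ 2) x m := by
  obtain ⟨x, χ, hχ, hg⟩ := h.exists_isBoundaryChart_real hy
  have ha : IsRealAnalyticAt (fun u => (y : ℂ) + u) 0 :=
    (IsRealAnalyticAt.const y).add IsRealAnalyticAt.id
  have hd : ∀ u : ℂ, HasDerivAt (fun u => (y : ℂ) + u) 1 u := fun u => (hasDerivAt_id u).const_add _
  refine ⟨x, hχ.tendsto_map ?_, hg, hχ.exists_analyticAt (by simpa using ha.analytic), ?_⟩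
  · have := (hd 0).continuousAt.tendsto
    rw [add_zero] at this
    exact this.mono_left nhdsWithin_le_nhds
  · intro m hm
    refine hχ.hasBoundaryExponent (q := fun u => Q (y + u)) (Eventually.of_forall fun u => ?_)
      (hm.comp_coordinate ha (by simp) (by rw [(hd _).deriv]; simp))
    exact ⟨(hd u).differentiableAt, by rw [(hd u).deriv, one_pow, mul_one]⟩

/-- An inner point of the slit is the boundary value of `f` on either side; the exponent is `0`, as
`Q` is constant in a trajectory coordinate. -/
theorem exists_preimages_inner {t₀ : ℝ} (h : IsSlitMap f γ T ξ₀)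
    (harc : IsTrajectoryArc upperHalf Q φ γ 0 T) (ht₀ : t₀ ∈ Ioo 0 T)
    (hQ : AnalyticAt ℂ Q (γ t₀)) (hQ0 : Q (γ t₀) ≠ 0) :
    ∃ x₁ x₂ : ℝ, (∀ x : ℝ, x = x₁ ∨ x = x₂ → Tendsto f (𝓝[upperHalf] (x : ℂ)) (𝓝 (γ t₀)) ∧
      (∃ F : ℂ → ℂ, AnalyticAt ℂ F x ∧ f =ᶠ[𝓝[upperHalf] (x : ℂ)] F) ∧
      HasBoundaryExponent (fun z => Q (f z) * deriv f z ^ 2) x 0) ∧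
      Tendsto (Function.invFunOn f upperHalf) (𝓝[f '' upperHalf] (γ t₀))
        (𝓝 (x₁ : ℂ) ⊔ 𝓝 (x₂ : ℂ)) := by
  obtain ⟨x₁, x₂, χ₁, χ₂, Φ, Ψ, hΦ, h1, h2, hg⟩ := h.exists_isBoundaryChart_inner harc ht₀ hQ hQ0
  have key : ∀ (x : ℝ) (χ Φ Ψ : ℂ → ℂ), IsTrajectoryCoordinate Q φ (γ t₀) Φ Ψ →
      IsBoundaryChart f Ψ χ x → Tendsto f (𝓝[upperHalf] (x : ℂ)) (𝓝 (γ t₀)) ∧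
      (∃ F : ℂ → ℂ, AnalyticAt ℂ F x ∧ f =ᶠ[𝓝[upperHalf] (x : ℂ)] F) ∧
      HasBoundaryExponent (fun z => Q (f z) * deriv f z ^ 2) x 0 := by
    intro x χ Φ Ψ hΦ hχ
    refine ⟨hχ.tendsto_map (hΦ.tendsto_inv.mono_left nhdsWithin_le_nhds),
      hχ.exists_analyticAt hΦ.analytic_inv, ?_⟩
    exact hχ.hasBoundaryExponent (q := fun _ => Complex.exp (2 * φ * Complex.I))
      (hΦ.eventually_eq_const.filter_mono nhdsWithin_le_nhds)
      (HasBoundaryExponent.const (Complex.exp_ne_zero _))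
  refine ⟨x₁, x₂, ?_, hg⟩
  rintro x (rfl | rfl)
  · exact key x χ₁ Φ Ψ hΦ h1
  · exact key x χ₂ _ _ hΦ.neg h2

/-- At the tip, `f` is the inverse of a trajectory coordinate after squaring, and `(u²)'² = 4u²`
gives the exponent `2`. -/
theorem exists_preimage_tip (h : IsSlitMap f γ T ξ₀)
    (harc : IsTrajectoryArc upperHalf Q φ γ 0 T) (hQ : AnalyticAt ℂ Q (γ T)) (hQ0 : Q (γ T) ≠ 0) :
    ∃ x : ℝ, Tendsto f (𝓝[upperHalf] (x : ℂ)) (𝓝 (γ T)) ∧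
      Tendsto (Function.invFunOn f upperHalf) (𝓝[f '' upperHalf] (γ T)) (𝓝 (x : ℂ)) ∧
      (∃ F : ℂ → ℂ, AnalyticAt ℂ F x ∧ f =ᶠ[𝓝[upperHalf] (x : ℂ)] F) ∧
      HasBoundaryExponent (fun z => Q (f z) * deriv f z ^ 2) x 2 := by
  obtain ⟨x, χ, Φ, Ψ, hΦ, hχ, hg⟩ := h.exists_isBoundaryChart_tip harc hQ hQ0
  have hsq : Tendsto (fun u : ℂ => u ^ 2) (𝓝 0) (𝓝 0) := by
    simpa using (continuous_pow 2).tendsto (0 : ℂ)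
  have ha : AnalyticAt ℂ (fun u => Ψ (u ^ 2)) 0 := by
    have h1 : AnalyticAt ℂ Ψ ((0 : ℂ) ^ 2) := by simpa using hΦ.analytic_inv
    exact h1.fun_comp (f := fun u : ℂ => u ^ 2) (analyticAt_id.pow 2)
  refine ⟨x, hχ.tendsto_map ((hΦ.tendsto_inv.comp hsq).mono_left nhdsWithin_le_nhds), hg,
    hχ.exists_analyticAt ha, ?_⟩
  have h2 := (HasBoundaryExponent.const (x := 0) (C := -4 * Complex.exp (2 * φ * Complex.I))
    (mul_ne_zero (by norm_num) (Complex.exp_ne_zero _))).mul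
    (HasBoundaryExponent.cpow_coordinate (IsRealAnalyticAt.id (x := 0)) (by simp) (by simp) 2)
  rw [zero_add] at h2
  refine hχ.hasBoundaryExponent ?_ h2
  filter_upwards [nhdsWithin_le_nhds (hsq.eventually hΦ.eventually_eq_const)] with u hu
  have h3 : HasDerivAt (fun u => Ψ (u ^ 2)) (deriv Ψ (u ^ 2) * (2 * u)) u := by
    have := hu.1.hasDerivAt.comp u (hasDerivAt_pow 2 u)
    simpa [Function.comp_def] using this
  refine ⟨h3.differentiableAt, ?_⟩
  rw [h3.deriv, mul_pow, ← mul_assoc, hu.2, Complex.ofReal_ofNat,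
    show (2 : ℂ) = ((2 : ℕ) : ℂ) by norm_num, Complex.cpow_natCast, mul_pow, mul_pow, neg_sq,
    Complex.I_sq]
  push_cast
  ring

/-- The preimages of a boundary point are the limits of the inverse map; `x₁ = x₂` is allowed. -/
theorem isPreimage_eq_pair (h : IsSlitMap f γ T ξ₀) {w : ℂ} {x₁ x₂ : ℝ} (hw : w ∉ f '' upperHalf)
    (hw' : 0 ≤ w.im) (h₁ : Tendsto f (𝓝[upperHalf] (x₁ : ℂ)) (𝓝 w))
    (h₂ : Tendsto f (𝓝[upperHalf] (x₂ : ℂ)) (𝓝 w))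
    (hg : Tendsto (Function.invFunOn f upperHalf) (𝓝[f '' upperHalf] w)
      (𝓝 (x₁ : ℂ) ⊔ 𝓝 (x₂ : ℂ))) :
    {z | IsPreimage f z w} = {(x₁ : ℂ), (x₂ : ℂ)} := by
  ext z
  simp only [mem_ofPred_eq, mem_insert_iff, mem_singleton_iff]
  constructor
  · rintro (⟨hz, hfz⟩ | ⟨hz, hfz⟩ | ⟨hz, hfz⟩)
    · exact absurd ⟨z, hz, hfz⟩ hw
    · have hzr : z = (z.re : ℂ) := Complex.ext (by simp) (by simp [hz])
      have : (𝓝[upperHalf] z).NeBot := by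
        rw [hzr]
        infer_instance
      exact h.eq_or_eq_of_tendsto le_rfl hfz hg
    · have h3 : f (starRingEnd ℂ z) ∈ upperHalf :=
        h.image_subset (mem_image_of_mem f (show 0 < (starRingEnd ℂ z).im by simpa using hz))
      rw [hfz] at h3
      have h3 : 0 < (starRingEnd ℂ w).im := h3
      rw [Complex.conj_im] at h3
      linarith
  · rintro (rfl | rfl)
    · exact Or.inr (Or.inl ⟨Complex.ofReal_im _, h₁⟩)
    · exact Or.inr (Or.inl ⟨Complex.ofReal_im _, h₂⟩)

/-- A boundary value of `f` is not in the image of `f`, nor in the lower half-plane. -/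
theorem notMem_of_tendsto (h : IsSlitMap f γ T ξ₀) {x : ℝ} {w : ℂ}
    (hf : Tendsto f (𝓝[upperHalf] (x : ℂ)) (𝓝 w)) : w ∉ f '' upperHalf ∧ 0 ≤ w.im := by
  constructor
  · rintro ⟨z₀, hz₀, rfl⟩
    have hc := (hasDerivAt_invFunOn isOpen_upperHalf h.differentiableOn h.injOn hz₀).continuousAt
    have h2 := (hc.tendsto.comp hf).congr'
      (eventually_mem_nhdsWithin.mono fun z hz => h.invFunOn_apply hz)
    rw [h.invFunOn_apply hz₀] at h2
    have h3 := tendsto_nhds_unique h2 nhdsWithin_le_nhds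
    rw [h3] at hz₀
    exact lt_irrefl _ (show (0 : ℝ) < (x : ℂ).im from hz₀)
  · refine ge_of_tendsto ((Complex.continuous_im.tendsto w).comp hf) ?_
    filter_upwards [self_mem_nhdsWithin] with z hz
    exact (show 0 < (f z).im from h.image_subset (mem_image_of_mem f hz)).le

theorem isPreimage_eq_singleton (h : IsSlitMap f γ T ξ₀) {A : ℂ} (hA : A ∈ upperHalf) :
    {z | IsPreimage f z (f A)} = {A} := by
  ext z
  simp only [mem_ofPred_eq, mem_singleton_iff]
  constructor
  · rintro (⟨hz, hfz⟩ | ⟨hz, hfz⟩ | ⟨hz, hfz⟩)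
    · exact h.injOn hz hA hfz
    · have hzr : z = (z.re : ℂ) := Complex.ext (by simp) (by simp [hz])
      rw [hzr] at hfz
      exact absurd (mem_image_of_mem f hA) (h.notMem_of_tendsto hfz).1
    · have h3 : 0 < (f (starRingEnd ℂ z)).im :=
        h.image_subset (mem_image_of_mem f (show 0 < (starRingEnd ℂ z).im by simpa using hz))
      have h4 : 0 < (f A).im := h.image_subset (mem_image_of_mem f hA)
      rw [hfz, Complex.conj_im] at h3
      linarith
  · rintro rfl
    exact Or.inl ⟨hA, rfl⟩

theorem isPreimage_conj_eq_singleton (h : IsSlitMap f γ T ξ₀) {A : ℂ} (hA : A ∈ upperHalf) :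
    {z | IsPreimage f z (starRingEnd ℂ (f A))} = {starRingEnd ℂ A} := by
  have h4 : 0 < (f A).im := h.image_subset (mem_image_of_mem f hA)
  ext z
  simp only [mem_ofPred_eq, mem_singleton_iff]
  constructor
  · rintro (⟨hz, hfz⟩ | ⟨hz, hfz⟩ | ⟨hz, hfz⟩)
    · have h3 : 0 < (f z).im := h.image_subset (mem_image_of_mem f hz)
      rw [hfz, Complex.conj_im] at h3
      linarith
    · have hzr : z = (z.re : ℂ) := Complex.ext (by simp) (by simp [hz])
      rw [hzr] at hfz
      have h3 := (h.notMem_of_tendsto hfz).2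
      rw [Complex.conj_im] at h3
      linarith
    · rw [Complex.conj_conj] at hfz
      have := h.injOn (show 0 < (starRingEnd ℂ z).im by simpa using hz) hA hfz
      rw [← this, Complex.conj_conj]
  · rintro rfl
    have hA : 0 < A.im := hA
    exact Or.inr (Or.inr ⟨by simpa using hA, by rw [Complex.conj_conj, Complex.conj_conj]⟩)

end IsSlitMap

theorem IsPreimage.unique {f : ℂ → ℂ} {z w w' : ℂ} (hw : IsPreimage f z w)
    (hw' : IsPreimage f z w') : w = w' := by
  rcases hw with ⟨hz, h1⟩ | ⟨hz, h1⟩ | ⟨hz, h1⟩ <;> rcases hw' with ⟨hz', h2⟩ | ⟨hz', h2⟩ | ⟨hz', h2⟩ <;>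
    try linarith
  · exact h1.symm.trans h2
  · have hzr : z = (z.re : ℂ) := Complex.ext (by simp) (by simp [hz])
    rw [hzr] at h1 h2
    exact tendsto_nhds_unique h1 h2
  · exact (starRingEnd ℂ).injective (h1.symm.trans h2)

/-! ### The boundary correspondence -/

namespace IsSlitMap

variable {f : ℂ → ℂ} {γ : ℝ → ℂ} {T ξ₀ : ℝ} {Q : ℂ → ℂ} {φ : ℝ}

/-- The boundary correspondence: the real axis consists of the preimage `ξ` of the tip, the two
preimages of the starting point, and of points that `f` maps analytically to the real axis or to
inner points of the slit. The exponents of `Q(f(z))f'(z)²` are given at all these points. -/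
theorem exists_boundary_correspondence {N : ℕ} {e : ℝ → ℝ} (h : IsSlitMap f γ T ξ₀)
    (harc : IsTrajectoryArc upperHalf Q φ γ 0 T)
    (hQs : ∀ t ∈ Ioc 0 T, AnalyticAt ℂ Q (γ t) ∧ Q (γ t) ≠ 0)
    (hN : HasBoundaryExponent Q ξ₀ N) (he : ∀ y : ℝ, y ≠ ξ₀ → HasBoundaryExponent Q y (e y)) :
    ∃ ξ cm cp μm μp : ℝ, cm < cp ∧ {z | IsPreimage f z ξ₀} = {(cm : ℂ), (cp : ℂ)} ∧
      {z | IsPreimage f z (γ T)} = {(ξ : ℂ)} ∧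
      (-2 < μm ∧ HasBoundaryExponent (fun z => Q (f z) * deriv f z ^ 2) cm μm) ∧
      (-2 < μp ∧ HasBoundaryExponent (fun z => Q (f z) * deriv f z ^ 2) cp μp) ∧
      HasBoundaryExponent (fun z => Q (f z) * deriv f z ^ 2) ξ 2 ∧
      ∀ x : ℝ, x ≠ ξ → x ≠ cm → x ≠ cp →
        (∃ F : ℂ → ℂ, AnalyticAt ℂ F x ∧ f =ᶠ[𝓝[upperHalf] (x : ℂ)] F) ∧
        ((∃ y : ℝ, y ≠ ξ₀ ∧ Tendsto f (𝓝[upperHalf] (x : ℂ)) (𝓝 (y : ℂ)) ∧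
          HasBoundaryExponent (fun z => Q (f z) * deriv f z ^ 2) x (e y)) ∨
        ∃ t ∈ Ioo 0 T, Tendsto f (𝓝[upperHalf] (x : ℂ)) (𝓝 (γ t)) ∧
          HasBoundaryExponent (fun z => Q (f z) * deriv f z ^ 2) x 0) := by
  have hT : T ∈ Ioc 0 T := ⟨h.slit.pos, le_rfl⟩
  obtain ⟨ξ, hξ, hξg, -, hξe⟩ := h.exists_preimage_tip harc (hQs T hT).1 (hQs T hT).2
  obtain ⟨cm, cp, μm, μp, hlt, ⟨hm, hmf, hme⟩, ⟨hp, hpf, hpe⟩, hg⟩ : ∃ cm cp μm μp : ℝ, cm < cp ∧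
      (-2 < μm ∧ Tendsto f (𝓝[upperHalf] (cm : ℂ)) (𝓝 ξ₀) ∧
        HasBoundaryExponent (fun z => Q (f z) * deriv f z ^ 2) cm μm) ∧
      (-2 < μp ∧ Tendsto f (𝓝[upperHalf] (cp : ℂ)) (𝓝 ξ₀) ∧
        HasBoundaryExponent (fun z => Q (f z) * deriv f z ^ 2) cp μp) ∧
      Tendsto (Function.invFunOn f upperHalf) (𝓝[f '' upperHalf] (ξ₀ : ℂ))
        (𝓝 (cm : ℂ) ⊔ 𝓝 (cp : ℂ)) := by
    obtain ⟨x₁, x₂, μ₁, μ₂, hne, h1, h2, h3⟩ := h.exists_preimages_foot harc hN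
    rcases lt_or_gt_of_ne hne with hlt | hlt
    · exact ⟨x₁, x₂, μ₁, μ₂, hlt, h1, h2, h3⟩
    · exact ⟨x₂, x₁, μ₂, μ₁, hlt, h2, h1, by rwa [sup_comm]⟩
  refine ⟨ξ, cm, cp, μm, μp, hlt, ?_, ?_, ⟨hm, hme⟩, ⟨hp, hpe⟩, hξe, ?_⟩
  · exact h.isPreimage_eq_pair (h.notMem_image_of_im_eq_zero (by simp)) (by simp) hmf hpf hg
  · rw [h.isPreimage_eq_pair (h.notMem_image_of_mem_slit ⟨T, hT, rfl⟩) (h.slit.im_pos T hT).le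
      hξ hξ (by rwa [sup_idem]), pair_eq_singleton]
  · intro x hxξ hxm hxp
    obtain ⟨L, w, hL, hLx, hfL, hw⟩ := h.exists_boundary_value x
    rcases hw with ⟨y, rfl⟩ | ⟨t, ht, rfl⟩
    · by_cases hy : y = ξ₀
      · subst hy
        rcases h.eq_or_eq_of_tendsto hLx hfL hg with h1 | h1
        · exact absurd (Complex.ofReal_injective h1) hxm
        · exact absurd (Complex.ofReal_injective h1) hxp
      · obtain ⟨x', h1, h2, h3, h4⟩ := h.exists_preimage_real (Q := Q) hy
        have h5 : x = x' := by
          have := h.eq_or_eq_of_tendsto (x₁ := x') (x₂ := x') hLx hfL (by rwa [sup_idem])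
          rw [or_self] at this
          exact_mod_cast this
        subst h5
        exact ⟨h3, Or.inl ⟨y, hy, h1, h4 _ (he y hy)⟩⟩
    · rcases ht.2.eq_or_lt with rfl | hlt'
      · have := h.eq_or_eq_of_tendsto (x₁ := ξ) (x₂ := ξ) hLx hfL (by rwa [sup_idem])
        rw [or_self] at this
        exact absurd (Complex.ofReal_injective this) hxξ
      · have ht' : t ∈ Ioo 0 T := ⟨ht.1, hlt'⟩
        obtain ⟨x₁, x₂, h1, h2⟩ := h.exists_preimages_inner harc ht' (hQs t ht).1 (hQs t ht).2
        have h3 : x = x₁ ∨ x = x₂ :=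
          (h.eq_or_eq_of_tendsto hLx hfL h2).imp (fun h => Complex.ofReal_injective h)
            (fun h => Complex.ofReal_injective h)
        obtain ⟨h4, h5, h6⟩ := h1 x h3
        exact ⟨h5, Or.inr ⟨t, ht', h4, h6⟩⟩

/-- The exponent at a point of the real axis is the degree of the corresponding prime end. -/
theorem hasBoundaryDegree {E : Set ℝ} {c μ : ℝ} (h : IsSlitMap f γ T ξ₀) (hQ : IsKuhnau Q)
    (hQs : ∀ t ∈ Ioc 0 T, AnalyticAt ℂ Q (γ t)) (hE : E.Finite)
    (hreg : ∀ x : ℝ, x ∉ E →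
      (∃ F : ℂ → ℂ, AnalyticAt ℂ F x ∧ f =ᶠ[𝓝[upperHalf] (x : ℂ)] F) ∧
        ((∃ y : ℝ, y ≠ ξ₀ ∧ Tendsto f (𝓝[upperHalf] (x : ℂ)) (𝓝 (y : ℂ))) ∨
        ∃ t ∈ Ioo 0 T, Tendsto f (𝓝[upperHalf] (x : ℂ)) (𝓝 (γ t))))
    (hμ : -2 < μ) (hc : HasBoundaryExponent (fun z => Q (f z) * deriv f z ^ 2) c μ) :
    HasBoundaryDegree Q f c μ := by
  obtain ⟨S, hS, -, -⟩ := hQ.boundary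
  refine hc.hasBoundaryDegree h.differentiableOn h.injOn hμ ?_
  choose! x hx using fun (y : ℝ) (hy : y ≠ ξ₀) => h.exists_preimage_real (Q := Q) hy
  have hfin : (E ∪ x '' (S : Set ℝ)).Finite := hE.union (S.finite_toSet.image x)
  filter_upwards [nhdsNE_le_cofinite _ hfin.eventually_cofinite_notMem] with u hu
  obtain ⟨h1, h2⟩ := hreg u fun h => hu (Or.inl h)
  refine ⟨h1, ?_⟩
  rcases h2 with ⟨y, hy, hfy⟩ | ⟨t, ht, hft⟩
  · have hyS : y ∉ S := by
      intro hyS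
      refine hu (Or.inr ⟨y, hyS, ?_⟩)
      have := h.eq_or_eq_of_tendsto (x₁ := x y) (x₂ := x y) le_rfl hfy
        (by rw [sup_idem]; exact (hx y hy).2.1)
      rw [or_self] at this
      exact_mod_cast this.symm
    obtain ⟨θ, hθ⟩ := exists_tendsto_of_boundary hS hyS
    obtain ⟨w, hw, -⟩ := hθ.self_of_nhds
    refine ⟨w, hw.comp (tendsto_nhdsWithin_of_tendsto_nhds_of_eventually_within _ hfy ?_)⟩
    exact eventually_mem_nhdsWithin.mono fun z hz => h.image_subset (mem_image_of_mem f hz)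
  · exact ⟨_, (hQs t (Ioo_subset_Ioc_self ht)).continuousAt.tendsto.comp hft⟩

/-- Each point off the slit and its mirror image has exactly one preimage; the preimages inherit
the symmetry with respect to the real axis. -/
theorem exists_preimages {ι : Type*} {a : ι → ℂ} {α : ι → ℝ} (h : IsSlitMap f γ T ξ₀)
    (ha : IsReflectionSymmetric a α) (hne : ∀ j, a j ≠ ξ₀) (hslit : ∀ j, a j ∉ γ '' Ioc 0 T) :
    ∃ A : ι → ℂ, (∀ j, {z | IsPreimage f z (a j)} = {A j}) ∧ IsReflectionSymmetric A α ∧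
      (∀ j, 0 < (a j).im → 0 < (A j).im ∧ f (A j) = a j) ∧ ∀ j, (a j).im ≤ 0 → (A j).im ≤ 0 := by
  have hex : ∀ j, ∃ A : ℂ, {z | IsPreimage f z (a j)} = {A} := by
    intro j
    have himage : ∀ i, 0 < (a i).im → ∃ A ∈ upperHalf, f A = a i := by
      intro i hi
      have : a i ∈ f '' upperHalf := by
        rw [h.image_eq]
        exact ⟨hi, hslit i⟩
      exact this
    rcases lt_trichotomy 0 (a j).im with hj | hj | hj
    · obtain ⟨A, hA, hAf⟩ := himage j hj
      exact ⟨A, by rw [← hAf]; exact h.isPreimage_eq_singleton hA⟩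
    · have hreal : a j = ((a j).re : ℂ) := Complex.ext (by simp) (by simp [← hj])
      have hy : (a j).re ≠ ξ₀ := fun h0 => hne j (by rw [hreal, h0])
      obtain ⟨x, h1, h2, -⟩ := h.exists_preimage_real (Q := fun _ => 0) hy
      rw [← hreal] at h1 h2
      refine ⟨x, ?_⟩
      rw [h.isPreimage_eq_pair (h.notMem_image_of_im_eq_zero hj.symm) hj.le h1 h1
        (by rwa [sup_idem]), pair_eq_singleton]
    · obtain ⟨i, hi, -⟩ := ha.exists_conj j
      obtain ⟨A, hA, hAf⟩ := himage i (by rw [hi, Complex.conj_im]; linarith)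
      refine ⟨starRingEnd ℂ A, ?_⟩
      rw [← h.isPreimage_conj_eq_singleton hA, hAf, hi, Complex.conj_conj]
  choose A hA using hex
  have hpre : ∀ j, IsPreimage f (A j) (a j) := fun j => by
    have : A j ∈ {z | IsPreimage f z (a j)} := by rw [hA j]; rfl
    exact this
  have huniq : ∀ j z, IsPreimage f z (a j) → z = A j := fun j z hz => by
    have : z ∈ {z | IsPreimage f z (a j)} := hz
    rw [hA j] at this
    exact this
  have him_pos : ∀ j, 0 < (A j).im → 0 < (a j).im := by
    intro j hj
    rcases hpre j with ⟨-, h2⟩ | ⟨h1, -⟩ | ⟨h1, -⟩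
    · rw [← h2]
      exact h.image_subset (mem_image_of_mem f hj)
    · linarith
    · linarith
  have him_zero : ∀ j, (A j).im = 0 → 0 ≤ (a j).im ∧ a j ∉ f '' upperHalf := by
    intro j hj
    rcases hpre j with ⟨h1, -⟩ | ⟨h1, h2⟩ | ⟨h1, -⟩
    · linarith
    · have hr : A j = ((A j).re : ℂ) := Complex.ext (by simp) (by simp [h1])
      rw [hr] at h2
      exact (h.notMem_of_tendsto h2).symm
    · linarith
  have him_neg : ∀ j, (A j).im < 0 → (a j).im < 0 := by
    intro j hj
    rcases hpre j with ⟨h1, -⟩ | ⟨h1, -⟩ | ⟨-, h2⟩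
    · linarith
    · linarith
    · have : 0 < (f (starRingEnd ℂ (A j))).im := h.image_subset
        (mem_image_of_mem f (show 0 < (starRingEnd ℂ (A j)).im by simpa using hj))
      rw [h2, Complex.conj_im] at this
      linarith
  have hreal : ∀ j, (A j).im = 0 → (a j).im = 0 := by
    intro j hj
    obtain ⟨h1, h2⟩ := him_zero j hj
    refine le_antisymm (not_lt.1 fun h3 => h2 ?_) h1
    rw [h.image_eq]
    exact ⟨h3, hslit j⟩
  have hup : ∀ j, 0 < (a j).im → 0 < (A j).im := by
    intro j hj
    rcases lt_trichotomy 0 (A j).im with h1 | h1 | h1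
    · exact h1
    · exact absurd (hreal j h1.symm) hj.ne'
    · linarith [him_neg j h1]
  refine ⟨A, hA, ⟨?_, ?_, ?_⟩, fun j hj => ⟨hup j hj, ?_⟩, fun j hj => ?_⟩
  · intro j k hjk
    have h1 := hpre k
    rw [← hjk] at h1
    exact ha.injective ((hpre j).unique h1)
  · intro j
    obtain ⟨k, hk, hkα⟩ := ha.exists_conj j
    refine ⟨k, (huniq k _ ?_).symm, hkα⟩
    rw [hk]
    rcases hpre j with ⟨h1, h2⟩ | ⟨h1, h2⟩ | ⟨h1, h2⟩
    · exact Or.inr (Or.inr ⟨by rw [Complex.conj_im]; linarith, by rw [Complex.conj_conj,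
        Complex.conj_conj, h2]⟩)
    · refine Or.inr (Or.inl ⟨by rw [Complex.conj_im, h1, neg_zero], ?_⟩)
      rw [Complex.conj_eq_iff_im.2 h1, Complex.conj_eq_iff_im.2 (hreal j h1)]
      exact h2
    · exact Or.inl ⟨by rw [Complex.conj_im]; linarith, h2⟩
  · intro j hj
    exact ha.exists_int j fun h0 => hj (by
      rcases lt_trichotomy 0 (A j).im with h1 | h1 | h1
      · exact absurd h0 (him_pos j h1).ne'
      · exact h1.symm
      · exact absurd h0 (him_neg j h1).ne)
  · rcases hpre j with ⟨-, h2⟩ | ⟨h1, -⟩ | ⟨h1, -⟩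
    · exact h2
    · exact absurd h1 (hup j hj).ne'
    · exact absurd h1 (hup j hj).le.not_gt
  · exact not_lt.1 fun h1 => (him_pos j h1).not_ge hj

end IsSlitMap

/-! ### Zero-free functions with vanishing logarithmic derivative at infinity -/

/-- Neighbourhoods of `∞` in the upper half-plane are open. -/
theorem eventually_eventually_cobounded_upperHalf {p : ℂ → Prop}
    (hp : ∀ᶠ z in Bornology.cobounded ℂ ⊓ 𝓟 upperHalf, p z) :
    ∀ᶠ z in Bornology.cobounded ℂ ⊓ 𝓟 upperHalf, ∀ᶠ w in 𝓝 z, p w := by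
  rw [eventually_inf_principal, ← comap_norm_atTop, eventually_comap] at hp
  obtain ⟨M, hM⟩ := eventually_atTop.1 hp
  rw [eventually_inf_principal]
  filter_upwards [tendsto_norm_cobounded_atTop.eventually_gt_atTop M] with z hz hzH
  filter_upwards [continuous_norm.continuousAt.eventually_const_lt hz,
    isOpen_upperHalf.mem_nhds hzH] with w h1 h2 using hM ‖w‖ h1.le w rfl h2

/-- Along the conformal map of a slit half-plane with `f(∞) = ∞`, the derivative has a limit at
`∞`. -/
theorem IsSlitMap.tendsto_deriv_infty {f : ℂ → ℂ} {γ : ℝ → ℂ} {T ξ₀ : ℝ} (h : IsSlitMap f γ T ξ₀) :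
    ∃ d : ℂ, d ≠ 0 ∧ Tendsto (deriv f) (Bornology.cobounded ℂ ⊓ 𝓟 upperHalf) (𝓝 d) ∧
      Tendsto (deriv (deriv f)) (Bornology.cobounded ℂ ⊓ 𝓟 upperHalf) (𝓝 0) := by
  obtain ⟨x₁, χ, hχ, hχ0, hχd, hf, -⟩ := h.exists_chart_infty
  have hd0 : deriv χ 0 ≠ 0 := fun h0 => by simp [h0] at hχd
  have ha : AnalyticAt ℂ χ 0 := by simpa using hχ.analytic
  have hk : AnalyticAt ℂ (dslope χ 0) 0 := by
    obtain ⟨p, hp⟩ := ha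
    exact hp.has_fpower_series_dslope_fslope.analyticAt
  have hk0 : dslope χ 0 0 ≠ 0 := by rwa [dslope_same]
  have hh : AnalyticAt ℂ (fun v => deriv χ v / dslope χ 0 v ^ 2) 0 :=
    ha.deriv.div (hk.pow 2) (pow_ne_zero 2 hk0)
  set g : ℂ → ℂ := fun v => deriv χ v / dslope χ 0 v ^ 2 with hg
  set C := Bornology.cobounded ℂ ⊓ 𝓟 upperHalf with hC
  set v : ℂ → ℂ := fun z => -(z - x₁)⁻¹ with hv
  have hshift : Tendsto (fun z : ℂ => z - x₁) C C := by
    refine tendsto_inf.2 ⟨(tendsto_sub_const_cobounded _).mono_left inf_le_left,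
      tendsto_principal.2 ?_⟩
    rw [hC, eventually_inf_principal]
    refine Eventually.of_forall fun z hz => ?_
    have hz : 0 < z.im := hz
    show 0 < (z - x₁).im
    simpa using hz
  have hvlim : Tendsto v C (𝓝[upperHalf] 0) := tendsto_neg_inv_cobounded.comp hshift
  have hvlim0 : Tendsto v C (𝓝 0) := hvlim.mono_right nhdsWithin_le_nhds
  have hv' : ∀ z ∈ upperHalf, HasDerivAt v (v z ^ 2) z := by
    intro z hz
    have hz : 0 < z.im := hz
    have hne : z - x₁ ≠ 0 := fun h0 => by
      have := congrArg Complex.im h0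
      rw [Complex.sub_im, Complex.ofReal_im, Complex.zero_im] at this
      linarith
    have h1 : HasDerivAt v (-(-1 / (z - x₁) ^ 2)) z :=
      (((hasDerivAt_id z).sub_const (x₁ : ℂ)).inv hne).neg
    rwa [show -(-1 / (z - (x₁ : ℂ)) ^ 2) = v z ^ 2 by
      show _ = (-(z - (x₁ : ℂ))⁻¹) ^ 2
      field_simp] at h1
  have hCH : ∀ᶠ z in C, z ∈ upperHalf := mem_inf_of_right (mem_principal_self _)
  have hfv : ∀ᶠ z in C, f z = -(χ (v z))⁻¹ := by
    filter_upwards [hvlim.eventually hf] with z hz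
    rw [← hz]
    simp [hv]
  have hder : ∀ᶠ z in C, deriv f z = g (v z) := by
    filter_upwards [eventually_eventually_cobounded_upperHalf hfv, hCH,
      hvlim0.eventually (ha.eventually_analyticAt.and (hk.continuousAt.eventually_ne hk0)),
      hvlim.eventually self_mem_nhdsWithin] with z h1 h2 h3 h4
    have hv0 : v z ≠ 0 := fun h0 => by
      rw [h0] at h4
      exact lt_irrefl _ (show (0 : ℝ) < (0 : ℂ).im from h4)
    have h5 : χ (v z) = v z * dslope χ 0 (v z) := by
      have := sub_smul_dslope χ 0 (v z)
      rw [hχ0, sub_zero, sub_zero, smul_eq_mul] at this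
      exact this.symm
    have hχ0' : χ (v z) ≠ 0 := by
      rw [h5]
      exact mul_ne_zero hv0 h3.2
    have h6 := (((h3.1.differentiableAt.hasDerivAt.comp z (hv' z h2)).inv hχ0').neg)
    have h7 : deriv f z = _ := (h6.congr_of_eventuallyEq h1).deriv
    have h8 := h3.2
    rw [h7, hg]
    simp only [Function.comp_apply, h5]
    field_simp
  refine ⟨g 0, div_ne_zero hd0 (pow_ne_zero 2 hk0),
    (hh.continuousAt.tendsto.comp hvlim0).congr' (hder.mono fun z hz => hz.symm), ?_⟩
  have h1 : Tendsto (fun z => deriv g (v z) * v z ^ 2) C (𝓝 0) := by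
    have := (hh.deriv.continuousAt.tendsto.comp hvlim0).mul (hvlim0.pow 2)
    simpa using this
  refine h1.congr' ?_
  filter_upwards [eventually_eventually_cobounded_upperHalf hder, hCH,
    hvlim0.eventually hh.eventually_analyticAt] with z h2 h3 h4
  exact (((h4.differentiableAt.hasDerivAt.comp z (hv' z h3)).congr_of_eventuallyEq h2).deriv).symm

/-- A zero-free holomorphic function in the upper half-plane whose logarithmic derivative vanishes
at `∞`. -/
structure IsTameUnit (F : ℂ → ℂ) : Prop where
  differentiableAt : ∀ z ∈ upperHalf, DifferentiableAt ℂ F z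
  ne_zero : ∀ z ∈ upperHalf, F z ≠ 0
  tendsto : Tendsto (logDeriv F) (Bornology.cobounded ℂ ⊓ 𝓟 upperHalf) (𝓝 0)

namespace IsTameUnit

variable {F G : ℂ → ℂ}

theorem eventually_mem_upperHalf :
    ∀ᶠ z in Bornology.cobounded ℂ ⊓ 𝓟 upperHalf, z ∈ upperHalf :=
  mem_inf_of_right (mem_principal_self _)

theorem const {c : ℂ} (hc : c ≠ 0) : IsTameUnit fun _ => c := by
  refine ⟨fun _ _ => differentiableAt_const c, fun _ _ => hc, ?_⟩
  rw [logDeriv_const]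
  exact tendsto_const_nhds

theorem mul (hF : IsTameUnit F) (hG : IsTameUnit G) : IsTameUnit fun z => F z * G z := by
  refine ⟨fun z hz => (hF.differentiableAt z hz).mul (hG.differentiableAt z hz),
    fun z hz => mul_ne_zero (hF.ne_zero z hz) (hG.ne_zero z hz), ?_⟩
  have h := hF.tendsto.add hG.tendsto
  rw [add_zero] at h
  refine h.congr' ?_
  filter_upwards [eventually_mem_upperHalf] with z hz
  exact (logDeriv_mul z (hF.ne_zero z hz) (hG.ne_zero z hz) (hF.differentiableAt z hz)
    (hG.differentiableAt z hz)).symm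

theorem inv (hF : IsTameUnit F) : IsTameUnit fun z => (F z)⁻¹ := by
  refine ⟨fun z hz => (hF.differentiableAt z hz).inv (hF.ne_zero z hz),
    fun z hz => inv_ne_zero (hF.ne_zero z hz), ?_⟩
  have h := hF.tendsto.neg
  rw [neg_zero] at h
  refine h.congr' ?_
  filter_upwards [eventually_mem_upperHalf] with z hz
  simpa using (logDeriv_fun_zpow (hF.differentiableAt z hz) (-1)).symm

theorem div (hF : IsTameUnit F) (hG : IsTameUnit G) : IsTameUnit fun z => F z / G z := by
  simp only [div_eq_mul_inv]
  exact hF.mul hG.inv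

theorem pow (hF : IsTameUnit F) (n : ℕ) : IsTameUnit fun z => F z ^ n := by
  induction n with
  | zero => simpa using const one_ne_zero
  | succ n ih => simpa only [pow_succ] using ih.mul hF

theorem zpow (hF : IsTameUnit F) (p : ℤ) : IsTameUnit fun z => F z ^ p := by
  cases p with
  | ofNat n => simpa using hF.pow n
  | negSucc n => simpa only [zpow_negSucc] using (hF.pow (n + 1)).inv

theorem finset_prod {ι : Type*} (s : Finset ι) {F : ι → ℂ → ℂ} (hF : ∀ i ∈ s, IsTameUnit (F i)) :
    IsTameUnit fun z => ∏ i ∈ s, F i z := by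
  classical
  induction s using Finset.induction_on with
  | empty => simpa using const one_ne_zero
  | insert i s hi ih =>
    simp only [Finset.prod_insert hi]
    exact (hF i (Finset.mem_insert_self i s)).mul
      (ih fun j hj => hF j (Finset.mem_insert_of_mem hj))

theorem cpow (hF : IsTameUnit F) (hslit : ∀ z ∈ upperHalf, F z ∈ Complex.slitPlane) (c : ℂ) :
    IsTameUnit fun z => F z ^ c := by
  refine ⟨fun z hz => (hF.differentiableAt z hz).cpow_const (hslit z hz), fun z hz => ?_, ?_⟩
  · rw [Complex.cpow_def_of_ne_zero (hF.ne_zero z hz)]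
    exact Complex.exp_ne_zero _
  · have h := hF.tendsto.const_mul c
    rw [mul_zero] at h
    refine h.congr' ?_
    filter_upwards [eventually_mem_upperHalf] with z hz
    have h1 := (hF.differentiableAt z hz).hasDerivAt.cpow_const (c := c) (hslit z hz)
    have h0 := hF.ne_zero z hz
    have h2 : F z ^ c ≠ 0 := by
      rw [Complex.cpow_def_of_ne_zero h0]
      exact Complex.exp_ne_zero _
    rw [logDeriv_apply, logDeriv_apply, h1.deriv, Complex.cpow_sub _ _ h0, Complex.cpow_one]
    field_simp

theorem sub_const {b : ℂ} (hb : b.im ≤ 0) : IsTameUnit fun z => z - b := by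
  refine ⟨fun z _ => differentiableAt_id.sub_const b, fun z hz h0 => ?_, ?_⟩
  · have hz : 0 < z.im := hz
    rw [sub_eq_zero.1 h0] at hz
    linarith
  · have h := ((tendsto_inv₀_cobounded (α := ℂ)).comp (tendsto_sub_const_cobounded b)).mono_left
      (inf_le_left (b := 𝓟 upperHalf))
    refine h.congr fun z => ?_
    rw [logDeriv_apply, deriv_sub_const_fun, deriv_id'']
    simp

end IsTameUnit

theorem sub_mem_slitPlane {w b : ℂ} (hw : w ∈ upperHalf) (hb : b.im ≤ 0) :
    w - b ∈ Complex.slitPlane := by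
  have hw : 0 < w.im := hw
  right
  rw [Complex.sub_im]
  linarith

namespace IsSlitMap

variable {f : ℂ → ℂ} {γ : ℝ → ℂ} {T ξ₀ : ℝ}

theorem isTameUnit_deriv (h : IsSlitMap f γ T ξ₀) : IsTameUnit (deriv f) := by
  obtain ⟨d, hd, h1, h2⟩ := h.tendsto_deriv_infty
  refine ⟨fun z hz => ((h.differentiableOn.deriv isOpen_upperHalf) z hz).differentiableAt
    (isOpen_upperHalf.mem_nhds hz), fun z hz =>
    deriv_ne_zero_of_injOn isOpen_upperHalf h.differentiableOn h.injOn hz, ?_⟩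
  have h3 := h2.div h1 hd
  rw [zero_div] at h3
  exact h3

theorem tendsto_logDeriv_sub_const (h : IsSlitMap f γ T ξ₀) (b : ℂ) :
    Tendsto (logDeriv fun z => f z - b) (Bornology.cobounded ℂ ⊓ 𝓟 upperHalf) (𝓝 0) := by
  obtain ⟨d, -, h1, -⟩ := h.tendsto_deriv_infty
  have h2 := h1.mul ((tendsto_inv₀_cobounded (α := ℂ)).comp
    ((tendsto_sub_const_cobounded b).comp h.tendsto_cobounded))
  rw [mul_zero] at h2
  refine h2.congr fun z => ?_
  rw [logDeriv_apply, deriv_sub_const_fun]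
  rfl

theorem isTameUnit_sub_const (h : IsSlitMap f γ T ξ₀) {b : ℂ} (hb : b.im ≤ 0) :
    IsTameUnit fun z => f z - b := by
  refine ⟨fun z hz => ((h.differentiableOn z hz).differentiableAt
    (isOpen_upperHalf.mem_nhds hz)).sub_const b, fun z hz h0 => ?_, h.tendsto_logDeriv_sub_const b⟩
  have h1 : 0 < (f z).im := h.image_subset (mem_image_of_mem f hz)
  rw [sub_eq_zero.1 h0] at h1
  linarith

/-- The difference quotient of a univalent function has no zeros. -/
theorem isTameUnit_dslope (h : IsSlitMap f γ T ξ₀) {A : ℂ} (hA : A ∈ upperHalf) :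
    IsTameUnit (dslope f A) := by
  have hnhds := isOpen_upperHalf.mem_nhds hA
  refine ⟨fun z hz => ((Complex.differentiableOn_dslope hnhds).2 h.differentiableOn z
    hz).differentiableAt (isOpen_upperHalf.mem_nhds hz), fun z hz => ?_, ?_⟩
  · by_cases hzA : z = A
    · rw [hzA, dslope_same]
      exact deriv_ne_zero_of_injOn isOpen_upperHalf h.differentiableOn h.injOn hA
    · rw [dslope_of_ne _ hzA, slope_def_field]
      exact div_ne_zero (sub_ne_zero.2 fun h0 => hzA (h.injOn hz hA h0)) (sub_ne_zero.2 hzA)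
  · have h1 : Tendsto (logDeriv fun z : ℂ => z - A) (Bornology.cobounded ℂ ⊓ 𝓟 upperHalf)
        (𝓝 0) := by
      have h2 := ((tendsto_inv₀_cobounded (α := ℂ)).comp (tendsto_sub_const_cobounded A)).mono_left
        (inf_le_left (b := 𝓟 upperHalf))
      refine h2.congr fun z => ?_
      rw [logDeriv_apply, deriv_sub_const_fun, deriv_id'']
      simp
    have h2 := (h.tendsto_logDeriv_sub_const (f A)).sub h1
    rw [sub_zero] at h2
    refine h2.congr' ?_
    have hfar : ∀ᶠ z in Bornology.cobounded ℂ ⊓ 𝓟 upperHalf, z ≠ A := by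
      filter_upwards [(tendsto_norm_cobounded_atTop.eventually_gt_atTop ‖A‖).filter_mono
        inf_le_left] with z hz hzA
      rw [hzA] at hz
      exact hz.false
    filter_upwards [hfar, IsTameUnit.eventually_mem_upperHalf] with z hzA hz
    have h3 : EventuallyEq (𝓝 z) (dslope f A) fun z => (f z - f A) / (z - A) := by
      filter_upwards [isOpen_ne.mem_nhds hzA] with w hw
      rw [dslope_of_ne _ hw, slope_def_field]
    rw [(logDeriv_congr_nhds h3).eq_of_nhds]
    exact (logDeriv_div (f := fun z => f z - f A) (g := fun z => z - A) z
      (sub_ne_zero.2 fun h0 => hzA (h.injOn hz hA h0)) (sub_ne_zero.2 hzA)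
      (((h.differentiableOn z hz).differentiableAt (isOpen_upperHalf.mem_nhds hz)).sub_const _)
      (differentiableAt_id.sub_const A)).symm

end IsSlitMap

/-- The exponent `0` at every point of the real axis leaves only constants. -/
theorem IsTameUnit.eq_const {F : ℂ → ℂ} (hF : IsTameUnit F)
    (hb : ∀ x : ℝ, HasBoundaryExponent F x 0) :
    ∃ c : ℂ, c ≠ 0 ∧ ∀ z ∈ upperHalf, F z = c := by
  have hd : DifferentiableOn ℂ F upperHalf := fun z hz =>
    (hF.differentiableAt z hz).differentiableWithinAt
  obtain ⟨p, hp⟩ := exists_polynomial_of_boundary_real (G := logDeriv F)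
    (fun z hz => ((hd.deriv isOpen_upperHalf) z hz).div (hd z hz) (hF.ne_zero z hz))
    (fun x => by
      obtain ⟨C, hC, k, hk, hk0, hFk⟩ := hb x
      have h1 : ContinuousAt (logDeriv k) x :=
        (hk.analytic.deriv.div hk.analytic hk0).continuousAt
      refine ⟨logDeriv k x, (h1.tendsto.mono_left nhdsWithin_le_nhds).congr' ?_,
        (hk.deriv.div hk hk0).im_eq_zero⟩
      filter_upwards [self_mem_nhdsWithin, eventually_eventually_nhdsWithin.2 hFk] with z hz h2
      rw [isOpen_upperHalf.nhdsWithin_eq hz] at h2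
      have h3 : EventuallyEq (𝓝 z) F fun z => C * k z := h2.mono fun w hw => by
        rw [hw, Complex.ofReal_zero, Complex.cpow_zero, one_mul]
      rw [(logDeriv_congr_nhds h3).eq_of_nhds, logDeriv_const_mul z C hC])
    ⟨0, by simpa using hF.tendsto.isBigO_one ℂ⟩
  have hp0 : Tendsto (fun z => p.eval z) (Bornology.cobounded ℂ ⊓ 𝓟 upperHalf) (𝓝 0) :=
    hF.tendsto.congr' (eventually_mem_upperHalf.mono fun z hz => hp z hz)
  have hp1 : p = 0 := by
    rcases lt_or_ge 0 p.degree with hdeg | hdeg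
    · have h1 := Polynomial.tendsto_norm_atTop p hdeg (z := fun z : ℂ => z)
        (l := Bornology.cobounded ℂ ⊓ 𝓟 upperHalf)
        (tendsto_norm_cobounded_atTop.mono_left inf_le_left)
      exact absurd hp0.norm (not_tendsto_nhds_of_tendsto_atTop h1 _)
    · rw [Polynomial.eq_C_of_degree_le_zero hdeg] at hp0 ⊢
      simp only [Polynomial.eval_C] at hp0
      rw [tendsto_nhds_unique tendsto_const_nhds hp0, Polynomial.C_0]
  have hder : ∀ z ∈ upperHalf, deriv F z = 0 := fun z hz => by
    have := hp z hz
    rw [hp1, Polynomial.eval_zero, logDeriv_apply, div_eq_zero_iff] at this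
    exact this.resolve_right (hF.ne_zero z hz)
  have hI : Complex.I ∈ upperHalf := by
    show 0 < Complex.I.im
    simp
  refine ⟨F Complex.I, hF.ne_zero _ hI, fun z hz => ?_⟩
  exact isOpen_upperHalf.is_const_of_deriv_eq_zero convex_upperHalf.isPreconnected hd
    (fun w hw => hder w hw) hz hI

/-! ### The quadratic differential in the half-plane -/

namespace IsSlitMap

variable {f : ℂ → ℂ} {γ : ℝ → ℂ} {T ξ₀ : ℝ}

/-- Two products of powers with the same exponents at the points of the real axis and with zeros
and poles at the same points of the upper half-plane are proportional. -/
theorem exists_eq_const_mul {ι : Type*} [Fintype ι] {a A : ι → ℂ} {α : ι → ℝ} {R : ℂ} {N : ℕ}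
    {q : ℂ → ℂ} {ξ cm cp μm μp : ℝ} (h : IsSlitMap f γ T ξ₀) (hα : ∀ j, α j ≠ 0)
    (hA : IsReflectionSymmetric A α)
    (hup : ∀ j, 0 < (a j).im → 0 < (A j).im ∧ f (A j) = a j)
    (hlow : ∀ j, (a j).im ≤ 0 → (A j).im ≤ 0) (hR : R ≠ 0)
    (hq : ∀ z ∈ upperHalf,
      q z = R * (f z - ξ₀) ^ N * (∏ j, (f z - a j) ^ (α j : ℂ)) * deriv f z ^ 2)
    (hexp : ∀ x : ℝ, HasBoundaryExponent q x ((if (ξ : ℂ) = x then 2 else 0) +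
      ((if (cm : ℂ) = x then μm else 0) + (if (cp : ℂ) = x then μp else 0)) +
      ∑ j, if A j = x then α j else 0)) :
    ∃ c : ℂ, c ≠ 0 ∧ ∀ z ∈ upperHalf, q z = c * (z - (ξ : ℂ)) ^ 2 *
      ((z - (cm : ℂ)) ^ (μm : ℂ) * (z - (cp : ℂ)) ^ (μp : ℂ)) * ∏ j, (z - A j) ^ (α j : ℂ) := by
  classical
  have hint : ∀ j, ∃ p : ℤ, 0 < (a j).im → α j = p := by
    intro j
    by_cases hj : 0 < (a j).im
    · obtain ⟨p, hp⟩ := hA.exists_int j (hup j hj).1.ne'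
      exact ⟨p, fun _ => hp⟩
    · exact ⟨0, fun h => absurd h hj⟩
  choose p hp using hint
  -- the quotient of corresponding factors, with the common zero in the upper half-plane removed
  set E : ι → ℂ → ℂ := fun j z => if 0 < (a j).im then dslope f (A j) z ^ p j else
    (f z - a j) ^ (α j : ℂ) / (z - A j) ^ (α j : ℂ) with hE
  have hEtame : ∀ j, IsTameUnit (E j) := by
    intro j
    by_cases hj : 0 < (a j).im
    · simp only [hE, hj, if_true]
      exact (h.isTameUnit_dslope (hup j hj).1).zpow _
    · simp only [hE, hj, if_false]
      have h1 := not_lt.1 hj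
      exact ((h.isTameUnit_sub_const h1).cpow (fun z hz =>
        sub_mem_slitPlane (h.image_subset (mem_image_of_mem f hz)) h1) _).div
        ((IsTameUnit.sub_const (hlow j h1)).cpow (fun z hz => sub_mem_slitPlane hz (hlow j h1)) _)
  have hEeq : ∀ j, ∀ z ∈ upperHalf, z ≠ A j →
      E j z = (f z - a j) ^ (α j : ℂ) / (z - A j) ^ (α j : ℂ) := by
    intro j z hz hzA
    by_cases hj : 0 < (a j).im
    · simp only [hE, hj, if_true]
      rw [dslope_of_ne _ hzA, slope_def_field, (hup j hj).2, hp j hj, Complex.ofReal_intCast,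
        Complex.cpow_intCast, Complex.cpow_intCast, div_zpow]
    · simp only [hE, hj, if_false]
  have hcpow : ∀ c μ : ℝ, IsTameUnit fun z => (z - (c : ℂ)) ^ (μ : ℂ) := fun c μ =>
    (IsTameUnit.sub_const (by simp)).cpow (fun z hz => sub_mem_slitPlane hz (by simp)) _
  set P : ℂ → ℂ := fun z => (z - (ξ : ℂ)) ^ 2 *
    ((z - (cm : ℂ)) ^ (μm : ℂ) * (z - (cp : ℂ)) ^ (μp : ℂ)) with hP
  have hPtame : IsTameUnit P := ((IsTameUnit.sub_const (by simp)).pow 2).mul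
    ((hcpow cm μm).mul (hcpow cp μp))
  have hF : IsTameUnit fun z => R * (f z - ξ₀) ^ N * (∏ j, E j z) * deriv f z ^ 2 / P z :=
    ((((IsTameUnit.const hR).mul ((h.isTameUnit_sub_const (by simp)).pow N)).mul
      (IsTameUnit.finset_prod _ fun j _ => hEtame j)).mul (h.isTameUnit_deriv.pow 2)).div hPtame
  have hFq : ∀ z ∈ upperHalf, (∀ j, z ≠ A j) →
      R * (f z - ξ₀) ^ N * (∏ j, E j z) * deriv f z ^ 2 / P z =
        q z / (P z * ∏ j, (z - A j) ^ (α j : ℂ)) := by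
    intro z hz hzA
    rw [hq z hz, Finset.prod_congr rfl fun j _ => hEeq j z hz (hzA j), Finset.prod_div_distrib]
    have h1 : ∏ j, (z - A j) ^ (α j : ℂ) ≠ 0 := prod_cpow_ne_zero hzA
    have h2 := hPtame.ne_zero z hz
    field_simp
  have hPexp : ∀ x : ℝ, HasBoundaryExponent P x ((if (ξ : ℂ) = x then 2 else 0) +
      ((if (cm : ℂ) = x then μm else 0) + (if (cp : ℂ) = x then μp else 0))) := by
    intro x
    have h1 := hasBoundaryExponent_cpow_sub (x := x) (b := ξ) (α := 2)
    simp only [Complex.ofReal_ofNat] at h1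
    refine (h1.mul (hasBoundaryExponent_cpow_sub.mul hasBoundaryExponent_cpow_sub)).congr
      (Eventually.of_forall fun z => ?_)
    simp only [hP, ← Complex.cpow_ofNat]
  have hFexp : ∀ x : ℝ, HasBoundaryExponent
      (fun z => R * (f z - ξ₀) ^ N * (∏ j, E j z) * deriv f z ^ 2 / P z) x 0 := by
    intro x
    have h1 := (hexp x).div ((hPexp x).mul (hA.hasBoundaryExponent x))
    rw [sub_self] at h1
    refine h1.congr ?_
    have hsub : upperHalf ⊆ ({(x : ℂ)} : Set ℂ)ᶜ := by
      rintro z hz rfl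
      exact lt_irrefl _ (show (0 : ℝ) < (x : ℂ).im from hz)
    have h2 := (eventually_ne_of_finite A (x : ℂ)).filter_mono (nhdsWithin_mono _ hsub)
    filter_upwards [self_mem_nhdsWithin, h2] with z hz h3
    exact (hFq z hz h3).symm
  obtain ⟨c, hc, hFc⟩ := hF.eq_const hFexp
  refine ⟨c, hc, fun z hz => ?_⟩
  by_cases hzA : ∀ j, z ≠ A j
  · have h1 := hFq z hz hzA
    rw [hFc z hz, eq_div_iff (mul_ne_zero (hPtame.ne_zero z hz) (prod_cpow_ne_zero hzA))] at h1
    rw [← h1]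
    simp only [hP]
    ring
  · push Not at hzA
    obtain ⟨j, rfl⟩ := hzA
    -- at the common zeros and poles both sides have the value `0`
    have hj : 0 < (a j).im := by
      by_contra h1
      exact (hlow j (not_lt.1 h1)).not_gt hz
    have h0 : ((α j : ℝ) : ℂ) ≠ 0 := by exact_mod_cast hα j
    rw [hq _ hz, Finset.prod_eq_zero (Finset.mem_univ j), Finset.prod_eq_zero (Finset.mem_univ j)]
    · ring
    · rw [sub_self, Complex.zero_cpow h0]
    · rw [(hup j hj).2, sub_self, Complex.zero_cpow h0]

end IsSlitMap

theorem mainTheorem4 (Q : ℂ → ℂ) (hQ : IsKuhnau Q) (ξ₀ : ℝ) (N : ℕ)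
    (hN : HasBoundaryDegree Q id ξ₀ (N : ℝ)) :
    (∃ (n : ℕ) (a : Fin n → ℂ) (α : Fin n → ℝ) (R : ℂ), IsFactorization Q ξ₀ N n a α R) ∧
    ∀ (n : ℕ) (a : Fin n → ℂ) (α : Fin n → ℝ) (R : ℂ), IsFactorization Q ξ₀ N n a α R →
    ∀ (φ : ℝ), φ ∈ Ico 0 Real.pi →
    ∀ (T : ℝ), 0 < T →
    ∀ (γ : ℝ → ℂ), ContinuousOn γ (Icc 0 T) → InjOn γ (Icc 0 T) → γ 0 = (ξ₀ : ℂ) →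
      IsTrajectoryArc upperHalf Q φ γ 0 T →
      γ T ∈ upperHalf → meromorphicOrderAt Q (γ T) = 0 →
    ∀ (f : ℂ → ℂ), DifferentiableOn ℂ f upperHalf → InjOn f upperHalf →
      f '' upperHalf = upperHalf \ γ '' Ioc 0 T →
      Tendsto f (Bornology.cobounded ℂ ⊓ 𝓟 upperHalf) (Bornology.cobounded ℂ) →
    ∃ (R' : ℂ) (ξ cm cp μm μp : ℝ) (A : Fin n → ℂ),
      R' ≠ 0 ∧ cm < cp ∧
      {z : ℂ | IsPreimage f z (ξ₀ : ℂ)} = {(cm : ℂ), (cp : ℂ)} ∧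
      {z : ℂ | IsPreimage f z (γ T)} = {(ξ : ℂ)} ∧
      (∀ j, {z : ℂ | IsPreimage f z (a j)} = {A j}) ∧
      HasBoundaryDegree Q f cm μm ∧ HasBoundaryDegree Q f cp μp ∧
      ∀ z ∈ upperHalf, Q (f z) * (deriv f z) ^ 2 =
        R' * (z - (ξ : ℂ)) ^ 2 * ((z - (cm : ℂ)) ^ (μm : ℂ) * (z - (cp : ℂ)) ^ (μp : ℂ)) *
          ∏ j, (z - A j) ^ (α j : ℂ) := by
  refine ⟨hQ.exists_isFactorization hN, ?_⟩
  intro n a α R hfac φ _ T hT γ hγ hγinj hγ0 harc hγT hord f hf hinj himage htop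
  have him : ∀ t ∈ Ioc 0 T, 0 < (γ t).im := fun t ht => by
    rcases ht.2.eq_or_lt with rfl | hlt
    · exact hγT
    · exact (harc t ⟨ht.1, hlt⟩).1
  have h : IsSlitMap f γ T ξ₀ := ⟨⟨hT, hγ, hγinj, hγ0, him⟩, hf, hinj, himage, htop⟩
  have hQs : ∀ t ∈ Ioc 0 T, AnalyticAt ℂ Q (γ t) ∧ Q (γ t) ≠ 0 := by
    intro t ht
    have hne : Q (γ t) ≠ 0 := by
      rcases ht.2.eq_or_lt with rfl | hlt
      · exact (hQ.meromorphic hγT).meromorphicOrderAt_eq_zero_iff.1 hord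
      · obtain ⟨-, v, -, r, hr, hv⟩ := harc t ⟨ht.1, hlt⟩
        intro h0
        rw [h0, zero_mul, eq_comm] at hv
        exact mul_ne_zero (by exact_mod_cast hr.ne') (Complex.exp_ne_zero _) hv
    exact ⟨(hQ.meromorphic (him t ht)).analyticAt_of_ne_zero hne, hne⟩
  have hsym := hfac.isReflectionSymmetric hQ
  obtain ⟨-, hne, hα, hR, hprod⟩ := id hfac
  have hslit : ∀ j, ∀ t ∈ Ioc 0 T, a j ≠ γ t := by
    intro j t ht heq
    have h0 : ((α j : ℝ) : ℂ) ≠ 0 := by exact_mod_cast hα j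
    apply (hQs t ht).2
    rw [hprod _ (him t ht), Finset.prod_eq_zero (Finset.mem_univ j), mul_zero]
    rw [← heq, sub_self, Complex.zero_cpow h0]
  obtain ⟨A, hA, hAsym, hup, hlow⟩ := h.exists_preimages hsym hne fun j ⟨t, ht, heq⟩ =>
    hslit j t ht heq.symm
  have hexp0 : HasBoundaryExponent Q ξ₀ N := by
    have h1 := hfac.hasBoundaryExponent hQ ξ₀
    rwa [if_pos rfl, Finset.sum_eq_zero fun j _ => if_neg (hne j), add_zero] at h1
  obtain ⟨ξ, cm, cp, μm, μp, hlt, hc, hξ, ⟨hμm, hem⟩, ⟨hμp, hep⟩, heξ, hrest⟩ :=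
    h.exists_boundary_correspondence (e := fun y => ∑ j, if a j = y then α j else 0) harc hQs hexp0
      fun y hy => by
        have h1 := hfac.hasBoundaryExponent hQ y
        rwa [if_neg hy, zero_add] at h1
  have hpm : IsPreimage f cm ξ₀ := by
    have : (cm : ℂ) ∈ {z | IsPreimage f z ξ₀} := by rw [hc]; simp
    exact this
  have hpp : IsPreimage f cp ξ₀ := by
    have : (cp : ℂ) ∈ {z | IsPreimage f z ξ₀} := by rw [hc]; simp
    exact this
  have hpξ : IsPreimage f ξ (γ T) := by
    have : (ξ : ℂ) ∈ {z | IsPreimage f z (γ T)} := by rw [hξ]; rfl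
    exact this
  have hpA : ∀ j, IsPreimage f (A j) (a j) := fun j => by
    have : A j ∈ {z | IsPreimage f z (a j)} := by rw [hA j]; rfl
    exact this
  have hTne : γ T ≠ ξ₀ := fun h0 => by
    have := him T ⟨hT, le_rfl⟩
    rw [h0, Complex.ofReal_im] at this
    exact this.false
  have hξm : ξ ≠ cm := fun h0 => hTne (hpξ.unique (by rw [h0]; exact hpm))
  have hξp : ξ ≠ cp := fun h0 => hTne (hpξ.unique (by rw [h0]; exact hpp))
  have hAξ : ∀ j, A j ≠ ξ := fun j h0 =>
    hslit j T ⟨hT, le_rfl⟩ ((hpA j).unique (by rw [h0]; exact hpξ))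
  have hAm : ∀ j, A j ≠ cm := fun j h0 => hne j ((hpA j).unique (by rw [h0]; exact hpm))
  have hAp : ∀ j, A j ≠ cp := fun j h0 => hne j ((hpA j).unique (by rw [h0]; exact hpp))
  have hdeg : ∀ c μ : ℝ, -2 < μ →
      HasBoundaryExponent (fun z => Q (f z) * deriv f z ^ 2) c μ → HasBoundaryDegree Q f c μ := by
    intro c μ hμ he
    refine h.hasBoundaryDegree (E := {ξ, cm, cp}) hQ (fun t ht => (hQs t ht).1) (by simp) ?_ hμ he
    intro x hx
    simp only [mem_insert_iff, mem_singleton_iff, not_or] at hx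
    obtain ⟨h1, h2⟩ := hrest x hx.1 hx.2.1 hx.2.2
    exact ⟨h1, h2.imp (fun ⟨y, hy, hfy, _⟩ => ⟨y, hy, hfy⟩) fun ⟨t, ht, hft, _⟩ => ⟨t, ht, hft⟩⟩
  obtain ⟨R', hR', hmain⟩ := h.exists_eq_const_mul (q := fun z => Q (f z) * deriv f z ^ 2)
    (ξ := ξ) (cm := cm) (cp := cp) (μm := μm) (μp := μp) hα hAsym hup hlow hR
    (fun z hz => by rw [hprod _ (h.image_subset (mem_image_of_mem f hz))]) (by
      intro x
      simp only [Complex.ofReal_inj]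
      -- `ξ`, `c⁻`, `c⁺` and the points `A j` are distinct, since their images are, so that at most one
      -- of the terms differs from `0`
      by_cases hxξ : x = ξ
      · subst hxξ
        rw [if_pos rfl, if_neg hξm.symm, if_neg hξp.symm,
          Finset.sum_eq_zero fun j _ => if_neg (hAξ j)]
        simpa using heξ
      by_cases hxm : x = cm
      · subst hxm
        rw [if_neg hξm, if_pos rfl, if_neg hlt.ne', Finset.sum_eq_zero fun j _ => if_neg (hAm j)]
        simpa using hem
      by_cases hxp : x = cp
      · subst hxp
        rw [if_neg hξp, if_pos rfl, if_neg hlt.ne, Finset.sum_eq_zero fun j _ => if_neg (hAp j)]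
        simpa using hep
      rw [if_neg (Ne.symm hxξ), if_neg (Ne.symm hxm), if_neg (Ne.symm hxp)]
      simp only [add_zero, zero_add]
      rcases (hrest x hxξ hxm hxp).2 with ⟨y, -, hfy, he⟩ | ⟨t, ht, hft, he⟩
      · have hpx : IsPreimage f x y := Or.inr (Or.inl ⟨by simp, hfy⟩)
        have h1 : ∀ j, A j = x ↔ a j = y := fun j => by
          constructor
          · intro h0
            exact (hpA j).unique (by rw [h0]; exact hpx)
          · intro h0
            have : (x : ℂ) ∈ {z | IsPreimage f z (a j)} := by rw [h0]; exact hpx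
            rw [hA j] at this
            exact this.symm
        simpa only [h1] using he
      · have hpx : IsPreimage f x (γ t) := Or.inr (Or.inl ⟨by simp, hft⟩)
        rw [Finset.sum_eq_zero fun j _ => if_neg fun h0 => hslit j t (Ioo_subset_Ioc_self ht)
          ((hpA j).unique (by rw [h0]; exact hpx))]
        exact he)
  exact ⟨R', ξ, cm, cp, μm, μp, A, hR', hlt, hc, hξ, hA, hdeg cm μm hμm hem, hdeg cp μp hμp hep,
    hmain⟩
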